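/- **Setting.** Let $d,r\in\mathbb N$, let $\Lambda$ be an $r$-dimensional lattice in $\mathbb R^r$ generated by independent vectors, with points identified with their integer coordinate vectors $j=(j_1,\dots,j_r)$, and let $\Lambda_+\subset\Lambda$ have *product structure*: if $j,j'\in\Lambda_+$ and $\min(j_p,j_p')\le j''_p\le\max(j_p,j'_p)$ for all $p$, then $j''\in\Lambda_+$. Let $\mathfrak A$ be a finite set and $\mathfrak K:=\mathbb Z^d\times\Lambda_+\times\mathfrak A$. For $k=(i,\mathfrak a)=(l,j,\mathfrak a)$ put $|k|=|i|=\max(|l|_\infty,|j|_\infty)$ and $\langle i\rangle=\max(1,|i|)$; put $\mathrm{dist}(k,k')=1$ if $i=i'$, $\mathfrak a\neq\mathfrak a'$, and $\mathrm{dist}(k,k')=|i-i'|$ otherwise. Let $d_j\in\mathbb N$ $(j\in\Lambda_+)$ be multiplicities and $w_k$ weights with $c_w|k|\le w_k\le C_w\max(1,|k|)$, $0<c_w\le C_w$; let $\langle w_k\rangle=\max(c_w,1,w_k)$. For $s\ge0$, $$H^s=H^s(\mathfrak K)=\Big\{u=(u_k)_{k\in\mathfrak K}:\ u_k\in\mathbb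 C^{d_j},\ \|u\|_s^2=\sum_k\langle w_k\rangle^{2s}\|u_k\|_0^2<\infty\Big\},$$ $\|\cdot\|_0$ being the Euclidean norm. A matrix is $M=(M_k^{k'})_{k,k'\in\mathfrak K}$ with $M_k^{k'}\in\mathrm{Mat}(d_j\times d_{j'},\mathbb C)$; for $i=(l,j)$, $i'=(l',j')$ in $\mathbb Z^d\times\Lambda_+$ let $M_{\{i\}}^{\{i'\}}=(M_{i,\mathfrak a}^{i',\mathfrak a'})_{\mathfrak a,\mathfrak a'\in\mathfrak A}$, with $L^2$ operator norm $\|\cdot\|_0$. Its $s$-decay norm is $$|M|_s^2=K_1\sum_{i\in\mathbb Z^d\times\Lambda}[M(i)]^2\langle i\rangle^{2s},\qquad [M(i)]=\sup_{h-h'=i}\|M_{\{h\}}^{\{h'\}}\|_0$$ (the supremum over $h,h'\in\mathbb Z^d\times\Lambda_+$, and $0$ if there is no such pair), where $s_0>(d+r)/2$ is fixed and $K_1>4\sum_i\langle i\rangle^{-2s_0}$. Let $\nu\ge0$, $\nu_0>0$, $\tau_0>0$, $\mathtt s\in\mathbb R$, $S'\in(s_0,+\infty]$, and let $\mathcal I\subset[1/2,+\infty)$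 be an interval with non-empty interior. Consider $$F(\varepsilon,\lambda,u)=D(\lambda)u+\varepsilon f(u),\qquad D(\lambda)=\mathrm{diag}(D_k(\lambda)\mathbf 1_{d_j})_{k\in\mathfrak K},$$ with $D_k\in C^1(\mathcal I,\mathbb C)$ and, for all $s\ge0$ and $\lambda\in\mathcal I$, $\|D(\lambda)h\|_s,\ \|\partial_\lambda D(\lambda)h\|_s\le C(s)\|h\|_{s+\nu}$. Let $B=\{u\in H^{s_0}:\|u\|_{s_0}<1\}$ and $f\in C^2(B,H^{s_0})$. For $u\in B$, let $df(u)$ be represented by a complex matrix $T(u)$ (so $df(u)$ is $\mathbb C$-linear). For all $s_0\le s<S'$ assume $f(0)\in H^s$ and, for $u\in B\cap H^s$ and $h,v\in H^s$, - (f1) $\|df(u)[h]\|_s\le C(s)(\|u\|_s\|h\|_{s_0}+\|h\|_s)$, - (f2) $\|d^2f(u)[h,v]\|_s\le C(s)(\|u\|_s\|h\|_{s_0}\|v\|_{s_0}+\|h\|_s\|v\|_{s_0}+\|h\|_{s_0}\|v\|_s)$. **Hypothesis 1.** There are $\bar\omega\in\mathbb R^d$ and $\gamma_0>0$ with $|\bar\omega\cdot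 l|\ge2\gamma_0|l|^{-d}$ for all $l\in\mathbb Z^d\setminus\{0\}$, and a function $\mathfrak D:\Lambda_+\times\mathfrak A\times\mathbb R\to\mathbb C$, such that: (covariance) $D_{(l,j,\mathfrak a)}(\lambda)=\mathfrak D_{j,\mathfrak a}(\lambda\bar\omega\cdot l)$ for $\lambda\in\mathcal I$; (Töplitz in time) for $u\in B$ the block $T(u)_{(l,j,\mathfrak a)}^{(l',j',\mathfrak a')}$ depends on $l,l'$ only through $l-l'$; and for all $s_0+\nu_0<s<S'$ and $u,u'\in B\cap H^s$, (off-diagonal decay) $|T(u)|_{s-\nu_0}\le C(s)(1+\|u\|_s)$ and (Lipschitz) $|T(u)-T(u')|_{s-\nu_0}\le C(s)(\|u-u'\|_s+(\|u\|_s+\|u'\|_s)\|u-u'\|_{s_0})$. For $\theta\in\mathbb R$ let $D_k(\lambda,\theta)=\mathfrak D_{j,\mathfrak a}(\lambda\bar\omega\cdot l+\theta)$, $D(\lambda,\theta)=\mathrm{diag}(D_k(\lambda,\theta)\mathbf 1_{d_j})$, $L(\varepsilon,\lambda,\theta,u)=D(\lambda,\theta)+\varepsilon T(u)$. **Hypothesis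 2 (initialisation).** There is $\mathfrak n\in\mathbb N$ such that for all $\tau>1$, integers $N>1$, $\lambda\in\mathcal I$ and $k\in\mathfrak K$, the set $\{\theta\in\mathbb R:|D_k(\lambda,\theta)|\le N^{-\tau}\}$ is covered by $\mathfrak n$ intervals of length at most $N^{-\tau}$. **Hypothesis 3 (separation of singular sites, with exponent $\mathtt s$).** For every integer $N_0\ge2$ there is a set $\tilde{\mathcal I}(N_0)$ such that for all $\lambda\in\tilde{\mathcal I}(N_0)$, $\theta\in\mathbb R$ and real $K>1$, $\Gamma\ge2$ with $K\Gamma\ge N_0$ the following holds. Let $\Sigma\subset\mathfrak K$ consist of singular sites ($|D_k(\lambda,\theta)|<1$ for $k\in\Sigma$), with at most $K$ elements $(l,\tilde\jmath,\mathfrak a)$ for each $\tilde\jmath\in\Lambda_+$. Then every $\Gamma$-chain in $\Sigma$, i.e. every sequence of distinct $k_0,\dots,k_\ell\in\Sigma$ with $\mathrm{dist}(k_{q+1},k_q)\le\Gamma$ for all $q<\ell$, has length $\ell\le(\Gamma K)^{\mathtt s}$. **Truncations.** $L_{N,j_0}$ is the finite submatrix of $L$ with row and column indices $\{k=(i,\mathfrak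 a)\in\mathfrak K:|i-(0,j_0)|\le N\}$, and $L_N:=L_{N,0}$. We put $\|A^{-1}\|_0=\infty$ if $A$ is not invertible. **Theorem.** Let $\mathfrak e>d+r+1$. There are $\tau_1>1$, $s_0+\nu_0<s_1<S$ and a threshold $S'_{\min}>S+\nu_0$, depending only on $\mathfrak e$, $\mathfrak K$, the multiplicities, weights and constants $s_0,\nu,\nu_0,\tau_0,\mathtt s,K_1$, such that whenever all the above holds with some $S'\ge S'_{\min}$ (so $S\in(s_0+\nu_0,S'-\nu_0)$), there are $\bar N_0\in\mathbb N$ and $c(S)>0$ with the following property. For every integer $N_0\ge\bar N_0$ there is a family $u_\varepsilon$, defined for all $\varepsilon\ge0$ with $\varepsilon N_0^S<c(S)$, such that $u_0(\lambda)=0$ and, for each such $\varepsilon$: $u_\varepsilon\in C^1(\mathcal I,H^{s_1+\nu})$, $\|u_\varepsilon(\lambda)\|_{s_0}<1$ for $\lambda\in\mathcal I$, and $$F(\varepsilon,\lambda,u_\varepsilon(\lambda))=0\qquad\text{for all }\lambda\in\mathcal C_\varepsilon:=\bigcap_{n\ge0}\Big(\bar{\mathcal G}^0_{N_0^{2^n}}\cap\bar{\mathfrak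 G}_{N_0^{2^n}}\Big)\cap\tilde{\mathcal I}(N_0)\cap\bar{\mathcal I},$$ where $$\bar{\mathcal I}=\{\lambda\in\mathcal I:\ |D_k(\lambda)|\ge N_0^{-\tau_0}\ \text{ for all }k\in\mathfrak K\text{ with }|k|\le N_0\},$$ $$\bar{\mathfrak G}_N=\{\lambda\in\mathcal I:\ \|L_N^{-1}(\varepsilon,\lambda,0,u_\varepsilon(\lambda))\|_0\le N^{\tau_1}/2\},$$ and $\bar{\mathcal G}^0_N$ is the set of $\lambda\in\mathcal I$ such that for every $j_0\in\Lambda_+$ the set $$\{\theta\in\mathbb R:\ \|L_{N,j_0}^{-1}(\varepsilon,\lambda,\theta,u_\varepsilon(\lambda))\|_0>N^{\tau_1}/2\}$$ is covered by at most $N^{\mathfrak e}$ intervals of length at most $N^{-\tau_1}$. Finally, if $f(0)\in\bigcap_sH^s$ and (f1), (f2), the off-diagonal decay and the Lipschitz estimates hold up to $S'=+\infty$, then moreover $u_\varepsilon(\lambda)\in\bigcap_{s\ge0}H^s$ for all $\lambda\in\mathcal I$. -/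

import Mathlib

open scoped ENNReal

noncomputable section

namespace SeqScale

/-- The index data: `𝔎 = ℤ^d × Λ₊ × 𝔄`, where `Λ₊` is a subset with product structure of the
`r`-dimensional lattice (a lattice point is given by its vector of integer coordinates with respect
to the generators), `𝔄` is a finite set, together with multiplicities `d_j` and weights `w_k`. -/
structure IndexData where
  d : ℕ
  r : ℕ
  Lam : Set (Fin r → ℤ)
  product_structure : ∀ j ∈ Lam, ∀ j' ∈ Lam, ∀ j'' : Fin r → ℤ,
    (∀ p, min (j p) (j' p) ≤ j'' p ∧ j'' p ≤ max (j p) (j' p)) → j'' ∈ Lam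
  A : Type
  [fintypeA : Fintype A]
  mult : Lam → ℕ
  w : (Fin d → ℤ) × Lam × A → ℝ
  cw : ℝ
  Cw : ℝ
  cw_pos : 0 < cw
  cw_le : cw ≤ Cw
  w_lower : ∀ k, cw * max ‖k.1‖ ‖k.2.1.1‖ ≤ w k
  w_upper : ∀ k, w k ≤ Cw * max 1 (max ‖k.1‖ ‖k.2.1.1‖)

attribute [instance] IndexData.fintypeA

variable (K : IndexData)

/-- The index set `𝔎`; elements are `k = (l, j, a)`. -/
abbrev Idx : Type := (Fin K.d → ℤ) × K.Lam × K.A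

/-- The lattice `ℤ^d × Λ`; its norm is `|(l, j)| = max (|l|_∞, |j|_∞)`. -/
abbrev Site : Type := (Fin K.d → ℤ) × (Fin K.r → ℤ)

variable {K}

/-- The site `i = (l, j)` of the index `k = (l, j, a)`. -/
def site (k : Idx K) : Site K := (k.1, k.2.1.1)

/-- `dist (k, k')`: equal to `1` if `i = i'` and `a ≠ a'`, and `|i - i'|` otherwise. -/
def idxDist (k k' : Idx K) : ℝ :=
  open Classical in
  if site k = site k' ∧ k.2.2 ≠ k'.2.2 then 1 else ‖site k - site k'‖

/-- The dimension `d_j` of the component with index `k = (l, j, a)`. -/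
abbrev dim (k : Idx K) : ℕ := K.mult k.2.1

/-- `⟨w_k⟩ = max (c, 1, w_k)`. -/
def bracket (k : Idx K) : ℝ := max K.cw (max 1 (K.w k))

theorem bracket_pos (k : Idx K) : 0 < bracket k := lt_max_of_lt_left K.cw_pos

variable (K)

/-- Families `u = (u_k)` with `u_k ∈ ℂ^{d_j}`. -/
abbrev Seq : Type := ∀ k : Idx K, EuclideanSpace ℂ (Fin (dim k))

variable {K}

/-- `u` has finite `s`-norm. -/
def MemHs (s : ℝ) (u : Seq K) : Prop :=
  Summable fun k => bracket k ^ (2 * s) * ‖u k‖ ^ 2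

/-- The norm `‖u‖_s = (∑ₖ ⟨w_k⟩^{2s} ‖u_k‖²)^{1/2}` (meaningful when `MemHs s u`). -/
def snorm (s : ℝ) (u : Seq K) : ℝ :=
  Real.sqrt (∑' k, bracket k ^ (2 * s) * ‖u k‖ ^ 2)

theorem weighted_norm_sq (s : ℝ) (u : Seq K) (k : Idx K) :
    ‖(bracket k ^ s) • u k‖ ^ 2 = bracket k ^ (2 * s) * ‖u k‖ ^ 2 := by
  have h : 0 ≤ bracket k ^ s := Real.rpow_nonneg (bracket_pos k).le s
  rw [norm_smul, mul_pow, Real.norm_of_nonneg h, mul_comm 2 s, Real.rpow_mul (bracket_pos k).le]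
  norm_num

theorem memHs_iff (s : ℝ) (u : Seq K) :
    MemHs s u ↔ Memℓp (fun k => (bracket k ^ s) • u k) 2 := by
  rw [memℓp_gen_iff (by norm_num)]
  simp only [ENNReal.toReal_ofNat, Real.rpow_ofNat, weighted_norm_sq]
  rfl

variable (K)

/-- The subspace of families with finite `s`-norm. -/
def hsSubmodule (s : ℝ) : Submodule ℂ (Seq K) where
  carrier := {u | MemHs s u}
  zero_mem' := by
    simp only [Set.mem_ofPred_eq, memHs_iff]
    convert (zero_memℓp : Memℓp (0 : Seq K) 2) using 1
    ext k : 1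
    simp
  add_mem' := by
    intro u v hu hv
    simp only [Set.mem_ofPred_eq, memHs_iff] at hu hv ⊢
    convert hu.add hv using 1
    ext k : 1
    simp
  smul_mem' := by
    intro c u hu
    simp only [Set.mem_ofPred_eq, memHs_iff] at hu ⊢
    convert hu.const_smul c using 1
    ext k : 1
    exact smul_comm (bracket k ^ s) c (u k)

/-- The Hilbert sequence space `H^s(𝔎)`. -/
def Hs (s : ℝ) : Type := hsSubmodule K s

variable {K}

namespace Hs

variable {s : ℝ}

instance : AddCommGroup (Hs K s) := inferInstanceAs (AddCommGroup (hsSubmodule K s))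

instance : Module ℂ (Hs K s) := inferInstanceAs (Module ℂ (hsSubmodule K s))

/-- The underlying family of an element of `H^s`. -/
def val (u : Hs K s) : Seq K := Subtype.val u

theorem val_mem (u : Hs K s) : MemHs s u.val := Subtype.property u

/-- An element of `H^s` from a family with finite `s`-norm. -/
def mk (u : Seq K) (hu : MemHs s u) : Hs K s := ⟨u, hu⟩

theorem val_injective : Function.Injective (val : Hs K s → Seq K) := Subtype.val_injective

theorem val_add (u v : Hs K s) : (u + v).val = u.val + v.val := rfl

theorem val_smul (c : ℂ) (u : Hs K s) : (c • u).val = c • u.val := rfl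

/-- The map `u ↦ (⟨w_k⟩^s u_k)` into `ℓ²`; the norm of `H^s` is the one it induces. -/
def toLp : Hs K s →ₗ[ℂ] lp (fun k : Idx K => EuclideanSpace ℂ (Fin (dim k))) 2 where
  toFun u := ⟨fun k => (bracket k ^ s) • u.val k, (memHs_iff s u.val).1 u.val_mem⟩
  map_add' u v := by
    apply Subtype.ext
    funext k
    exact smul_add _ _ _
  map_smul' c u := by
    apply Subtype.ext
    funext k
    exact smul_comm (bracket k ^ s) c (u.val k)

theorem toLp_injective : Function.Injective (toLp : Hs K s →ₗ[ℂ] _) := by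
  intro u v h
  apply val_injective
  funext k
  have h1 : (bracket k ^ s) • u.val k = (bracket k ^ s) • v.val k :=
    congrFun (congrArg Subtype.val h) k
  exact smul_right_injective _ (Real.rpow_pos_of_pos (bracket_pos k) s).ne' h1

instance : NormedAddCommGroup (Hs K s) :=
  NormedAddCommGroup.induced (Hs K s) _ toLp toLp_injective

instance : NormedSpace ℂ (Hs K s) := NormedSpace.induced ℂ (Hs K s) _ toLp

theorem norm_eq (u : Hs K s) : ‖u‖ = snorm s u.val := by
  have h1 : ‖u‖ = ‖toLp u‖ := rfl
  have h2 := lp.norm_rpow_eq_tsum (p := 2) (by norm_num) (toLp u)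
  simp only [ENNReal.toReal_ofNat, Real.rpow_ofNat] at h2
  rw [h1, snorm, ← Real.sqrt_sq (norm_nonneg (toLp u)), h2]
  congr 1
  exact tsum_congr fun k => weighted_norm_sq s u.val k

end Hs

open Classical in
theorem memHs_single (s : ℝ) (k : Idx K) (x : EuclideanSpace ℂ (Fin (dim k))) :
    MemHs s (Pi.single k x : Seq K) := by
  apply summable_of_ne_finset_zero (s := {k})
  intro b hb
  simp only [Finset.mem_singleton] at hb
  simp [Pi.single_eq_of_ne hb]

open Classical in
/-- The element of `H^s` whose only nonzero component is `x`, at the index `k`. -/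
def Hs.single (s : ℝ) (k : Idx K) (x : EuclideanSpace ℂ (Fin (dim k))) : Hs K s :=
  Hs.mk (Pi.single k x) (memHs_single s k x)

variable (K)

/-- Matrices `(M_k^{k'})` with `k, k' ∈ 𝔎` and `M_k^{k'} ∈ Mat (d_j × d_{j'}, ℂ)`. -/
abbrev BlockMatrix : Type := ∀ k k' : Idx K, Matrix (Fin (dim k)) (Fin (dim k')) ℂ

variable {K}

/-- The `L²` operator norm of a finite matrix. -/
def opNorm {m n : Type} [Fintype m] [Fintype n] (M : Matrix m n ℂ) : ℝ :=
  open Classical in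
  ‖LinearMap.toContinuousLinearMap (Matrix.toEuclideanLin M)‖

/-- The block `M_{i}^{i'}` with `i = (l, j)` and `i' = (l', j')`, which collects the matrices
`M_{i,a}^{i',a'}` for `a, a' ∈ 𝔄`. -/
def siteBlock (M : BlockMatrix K) (i i' : (Fin K.d → ℤ) × K.Lam) :
    Matrix (K.A × Fin (K.mult i.2)) (K.A × Fin (K.mult i'.2)) ℂ :=
  Matrix.of fun x y => M (i.1, i.2, x.1) (i'.1, i'.2, y.1) x.2 y.2

/-- `[M(i)]`, the supremum of `‖M_{h}^{h'}‖₀` over `h - h' = i` (zero if there is no such pair). -/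
def diagSup (M : BlockMatrix K) (i : Site K) : ℝ≥0∞ :=
  ⨆ (h : (Fin K.d → ℤ) × K.Lam) (h' : (Fin K.d → ℤ) × K.Lam)
    (_ : ((h.1, h.2.1) : Site K) - (h'.1, h'.2.1) = i), ENNReal.ofReal (opNorm (siteBlock M h h'))

/-- The `s`-decay norm `(K₁ ∑ᵢ [M(i)]² ⟨i⟩^{2s})^{1/2}`, possibly infinite. -/
def decayNorm (K₁ s : ℝ) (M : BlockMatrix K) : ℝ≥0∞ :=
  (ENNReal.ofReal K₁ *
    ∑' i : Site K, diagSup M i ^ 2 * ENNReal.ofReal (max 1 ‖i‖ ^ (2 * s))) ^ (1 / 2 : ℝ)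

/-- The action of the diagonal operator `diag (m_k 1_{d_j})`. -/
def diagAct (m : Idx K → ℂ) (u : Seq K) : Seq K := fun k => m k • u k

/-- The matrix of `diag (m_k 1_{d_j})`. -/
def diagMatrix (m : Idx K → ℂ) : BlockMatrix K := fun k k' =>
  Matrix.of fun x y => open Classical in if k = k' ∧ (x : ℕ) = (y : ℕ) then m k else 0

/-- The family of diagonal operators `diag (m_k(λ))`, `λ ∈ I`, maps `H^{s+ν}` to `H^s` for all
`s ≥ 0`, with bounds uniform in `λ`. -/
def DiagBound (ν : ℝ) (I : Set ℝ) (m : ℝ → Idx K → ℂ) : Prop :=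
  ∀ s, 0 ≤ s → ∃ C : ℝ, ∀ lam ∈ I, ∀ h : Seq K, MemHs (s + ν) h →
    MemHs s (diagAct (m lam) h) ∧ snorm s (diagAct (m lam) h) ≤ C * snorm (s + ν) h

/-- The matrix `T(u)` of the differential `df(u)`. -/
def jacobian {s₀ : ℝ} (f : Hs K s₀ → Hs K s₀) (u : Hs K s₀) : BlockMatrix K := fun k k' =>
  Matrix.of fun x y => (fderiv ℝ f u (Hs.single s₀ k' (EuclideanSpace.single y 1))).val k x

/-- The tame estimates for `f` (for `s₀ ≤ s < S'`), together with the off-diagonal decay and the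
Lipschitz estimates for `T = df` (for `s₀ + ν₀ < s < S'`), on the open unit ball of `H^{s₀}`. -/
structure TameUpTo (K₁ s₀ ν₀ : ℝ) (f : Hs K s₀ → Hs K s₀) (S' : EReal) : Prop where
  zero_mem : ∀ s : ℝ, s₀ ≤ s → (s : EReal) < S' → MemHs s (f 0).val
  f1 : ∀ s : ℝ, s₀ ≤ s → (s : EReal) < S' → ∃ C : ℝ, ∀ u h : Hs K s₀, ‖u‖ < 1 →
    MemHs s u.val → MemHs s h.val →
      MemHs s (fderiv ℝ f u h).val ∧
      snorm s (fderiv ℝ f u h).val ≤ C * (snorm s u.val * ‖h‖ + snorm s h.val)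
  f2 : ∀ s : ℝ, s₀ ≤ s → (s : EReal) < S' → ∃ C : ℝ, ∀ u h v : Hs K s₀, ‖u‖ < 1 →
    MemHs s u.val → MemHs s h.val → MemHs s v.val →
      MemHs s (fderiv ℝ (fderiv ℝ f) u h v).val ∧
      snorm s (fderiv ℝ (fderiv ℝ f) u h v).val ≤
        C * (snorm s u.val * ‖h‖ * ‖v‖ + snorm s h.val * ‖v‖ + ‖h‖ * snorm s v.val)
  decay : ∀ s : ℝ, s₀ + ν₀ < s → (s : EReal) < S' → ∃ C : ℝ, ∀ u : Hs K s₀, ‖u‖ < 1 →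
    MemHs s u.val →
      decayNorm K₁ (s - ν₀) (jacobian f u) ≤ ENNReal.ofReal (C * (1 + snorm s u.val))
  lipschitz : ∀ s : ℝ, s₀ + ν₀ < s → (s : EReal) < S' → ∃ C : ℝ, ∀ u u' : Hs K s₀,
    ‖u‖ < 1 → ‖u'‖ < 1 → MemHs s u.val → MemHs s u'.val →
      decayNorm K₁ (s - ν₀) (jacobian f u - jacobian f u') ≤
        ENNReal.ofReal
          (C * (snorm s (u - u').val + (snorm s u.val + snorm s u'.val) * ‖u - u'‖))

/-- The Diophantine condition `|ω̄ · l| ≥ 2 γ₀ |l|^{-d}` for some `γ₀ > 0`. -/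
def Diophantine {d : ℕ} (om : Fin d → ℝ) : Prop :=
  ∃ γ₀ : ℝ, 0 < γ₀ ∧ ∀ l : Fin d → ℤ, l ≠ 0 → 2 * γ₀ * ‖l‖ ^ (-(d : ℝ)) ≤ |∑ p, om p * l p|

/-- `D_k(λ, θ) = 𝔇_{j,a}(λ ω̄ · l + θ)` for `k = (l, j, a)`. -/
def Dtheta (om : Fin K.d → ℝ) (DD : K.Lam → K.A → ℝ → ℂ) (lam θ : ℝ) (k : Idx K) : ℂ :=
  DD k.2.1 k.2.2 (lam * (∑ p, om p * k.1 p) + θ)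

/-- The matrix `M` is Töplitz in time: `M_{(l,j,a)}^{(l',j',a')}` depends on `l, l'` only through
`l - l'`. -/
def ToeplitzInTime (M : BlockMatrix K) : Prop :=
  ∀ (m l l' : Fin K.d → ℤ) (j j' : K.Lam) (a a' : K.A),
    M (l + m, j, a) (l' + m, j', a') = M (l, j, a) (l', j', a')

/-- `B` is covered by at most `M` intervals of length at most `δ`. -/
def CoveredBy (B : Set ℝ) (M δ : ℝ) : Prop :=
  ∃ n : ℕ, (n : ℝ) ≤ M ∧ ∃ J : Fin n → Set ℝ,
    (∀ q, (J q).OrdConnected ∧ MeasureTheory.volume (J q) ≤ ENNReal.ofReal δ) ∧ B ⊆ ⋃ q, J q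

/-- The initialisation hypothesis. -/
def Initialisation (om : Fin K.d → ℝ) (DD : K.Lam → K.A → ℝ → ℂ) (I : Set ℝ) : Prop :=
  ∃ n : ℕ, ∀ τ : ℝ, 1 < τ → ∀ N : ℕ, 1 < N → ∀ lam ∈ I, ∀ k : Idx K,
    CoveredBy {θ : ℝ | ‖Dtheta om DD lam θ k‖ ≤ (N : ℝ) ^ (-τ)} n ((N : ℝ) ^ (-τ))

/-- `k 0, …, k ℓ` is a `Γ`-chain of length `ℓ`. -/
def IsChainOfLength (Γ : ℝ) (ℓ : ℕ) (k : Fin (ℓ + 1) → Idx K) : Prop :=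
  Function.Injective k ∧ ∀ q : Fin ℓ, idxDist (k q.succ) (k q.castSucc) ≤ Γ

/-- `Σ_κ`: a set of singular sites of `diag (m_k)` whose section at each `j` has cardinality at
most `κ`. -/
def IsSingularSet (m : Idx K → ℂ) (κ : ℝ) (Sig : Set (Idx K)) : Prop :=
  (∀ k ∈ Sig, ‖m k‖ < 1) ∧
    ∀ j : K.Lam, {k ∈ Sig | k.2.1 = j}.Finite ∧ (({k ∈ Sig | k.2.1 = j}.ncard : ℕ) : ℝ) ≤ κ

/-- The hypothesis on the separation of singular sites, with exponent `e` and sets `Ĩ(N₀)`. -/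
def SeparatedChains (om : Fin K.d → ℝ) (DD : K.Lam → K.A → ℝ → ℂ) (e : ℝ)
    (Itilde : ℕ → Set ℝ) : Prop :=
  ∀ N₀ : ℕ, 2 ≤ N₀ → ∀ lam ∈ Itilde N₀, ∀ θ κ Γ : ℝ, 1 < κ → 2 ≤ Γ → (N₀ : ℝ) ≤ κ * Γ →
    ∀ Sig : Set (Idx K), IsSingularSet (Dtheta om DD lam θ) κ Sig →
      ∀ (ℓ : ℕ) (k : Fin (ℓ + 1) → Idx K), (∀ q, k q ∈ Sig) → IsChainOfLength Γ ℓ k →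
        (ℓ : ℝ) ≤ (Γ * κ) ^ e

/-- The indices `k' = (i', a')` with `|i' - i| ≤ N`. For `N ≥ 1` these are the indices at `idxDist`
at most `N` from `(i, a)`, whatever `a` is. -/
def box (N : ℕ) (i : Site K) : Set (Idx K) := {k | ‖site k - i‖ ≤ N}

theorem box_finite (N : ℕ) (i : Site K) : (box N i).Finite := by
  have h1 : (Metric.closedBall i (N : ℝ)).Finite :=
    (isCompact_closedBall i (N : ℝ)).finite_of_discrete
  have h2 : (Metric.closedBall i (N : ℝ) ×ˢ (Set.univ : Set K.A)).Finite :=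
    h1.prod Set.finite_univ
  refine Set.Finite.of_finite_image (f := fun k : Idx K => (site k, k.2.2)) (h2.subset ?_) ?_
  · rintro _ ⟨k, hk, rfl⟩
    exact ⟨by simpa [box, dist_eq_norm] using hk, trivial⟩
  · rintro ⟨l, j, a⟩ _ ⟨l', j', a'⟩ _ h
    simp only [site, Prod.mk.injEq] at h
    obtain ⟨⟨rfl, h2⟩, rfl⟩ := h
    have : j = j' := Subtype.ext h2
    subst this
    rfl

instance (N : ℕ) (i : Site K) : Fintype (box N i) := (box_finite N i).fintype

/-- The truncation `M_{N,i}`: the finite submatrix of `M` with rows and columns in the box of radius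
`N` around `i`. -/
def trunc (M : BlockMatrix K) (N : ℕ) (i : Site K) :
    Matrix (Σ k : box N i, Fin (dim k.1)) (Σ k : box N i, Fin (dim k.1)) ℂ :=
  Matrix.of fun x y => M x.1.1 y.1.1 x.2 y.2

/-- The square matrix `M` is invertible and `‖M⁻¹‖₀ ≤ b`. Its negation is `‖M⁻¹‖₀ > b`, with the
usual convention `‖M⁻¹‖₀ = ∞` for a matrix that is not invertible. -/
def InvBound {n : Type} [Fintype n] (M : Matrix n n ℂ) (b : ℝ) : Prop :=
  open Classical in
  ∃ R : Matrix n n ℂ, M * R = 1 ∧ R * M = 1 ∧ opNorm R ≤ b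

/-- The matrix `L(ε, λ, θ, u) = D(λ, θ) + ε T(u)`. -/
def Lmat {s₀ : ℝ} (om : Fin K.d → ℝ) (DD : K.Lam → K.A → ℝ → ℂ) (f : Hs K s₀ → Hs K s₀)
    (ε lam θ : ℝ) (u : Hs K s₀) : BlockMatrix K :=
  diagMatrix (Dtheta om DD lam θ) + (ε : ℂ) • jacobian f u

/-- `|D_k(λ)| ≥ N₀^{-τ₀}` for all `k = (i, a)` with `|i| ≤ N₀`: membership in `Ī(N₀, τ₀)`. -/
def InIbar (D : Idx K → ℝ → ℂ) (N₀ : ℕ) (τ₀ lam : ℝ) : Prop :=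
  ∀ k : Idx K, ‖site k‖ ≤ N₀ → (N₀ : ℝ) ^ (-τ₀) ≤ ‖D k lam‖

/-- Membership of `λ` in the set of parameters for which the truncation `L_N` at `u` has an inverse
bounded by `N^{τ₁} / 2` in `L²`. -/
def InGoodL2 {s₀ : ℝ} (om : Fin K.d → ℝ) (DD : K.Lam → K.A → ℝ → ℂ) (f : Hs K s₀ → Hs K s₀)
    (τ₁ ε lam : ℝ) (u : Hs K s₀) (N : ℕ) : Prop :=
  InvBound (trunc (Lmat om DD f ε lam 0 u) N 0) ((N : ℝ) ^ τ₁ / 2)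

/-- Membership of `λ` in the set of parameters for which, for every `j₀ ∈ Λ₊`, the set of `θ` with
`‖L_{N,j₀}(ε, λ, θ, u)⁻¹‖₀ > N^{τ₁} / 2` is covered by at most `N^𝔢` intervals of length at most
`N^{-τ₁}`. -/
def InGoodEig {s₀ : ℝ} (om : Fin K.d → ℝ) (DD : K.Lam → K.A → ℝ → ℂ) (f : Hs K s₀ → Hs K s₀)
    (ee τ₁ ε lam : ℝ) (u : Hs K s₀) (N : ℕ) : Prop :=
  ∀ j₀ : K.Lam, CoveredBy
    {θ : ℝ | ¬ InvBound (trunc (Lmat om DD f ε lam θ u) N ((0, j₀.1) : Site K))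
      ((N : ℝ) ^ τ₁ / 2)}
    ((N : ℝ) ^ ee) ((N : ℝ) ^ (-τ₁))

/-- The Cantor set `𝒞_ε` determined by a function `u` of the parameter. -/
def cantorSet {s₀ : ℝ} (om : Fin K.d → ℝ) (DD : K.Lam → K.A → ℝ → ℂ) (D : Idx K → ℝ → ℂ)
    (f : Hs K s₀ → Hs K s₀) (I : Set ℝ) (Itilde : ℕ → Set ℝ) (ee τ₀ τ₁ : ℝ) (N₀ : ℕ) (ε : ℝ)
    (u : ℝ → Hs K s₀) : Set ℝ :=
  {lam ∈ I | lam ∈ Itilde N₀ ∧ InIbar D N₀ τ₀ lam ∧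
    ∀ n : ℕ, InGoodEig om DD f ee τ₁ ε lam (u lam) (N₀ ^ 2 ^ n) ∧
      InGoodL2 om DD f τ₁ ε lam (u lam) (N₀ ^ 2 ^ n)}

/-- The family `F(ε, λ, u) = D(λ) u + ε f(u)`. -/
def Fop {s₀ : ℝ} (D : Idx K → ℝ → ℂ) (f : Hs K s₀ → Hs K s₀) (ε lam : ℝ) (u : Hs K s₀) : Seq K :=
  diagAct (fun k => D k lam) u.val + (ε : ℂ) • (f u).val

/-- The function `u` on `I` takes values in `H^s` and is `C¹` as a map into `H^s`. -/
def IsC1Into {s₀ : ℝ} (s : ℝ) (I : Set ℝ) (u : ℝ → Hs K s₀) : Prop :=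
  ∃ v : ℝ → Hs K s, ContDiffOn ℝ 1 v I ∧ ∀ lam ∈ I, (v lam).val = (u lam).val

end SeqScale

end

noncomputable section

namespace SeqScale

variable {K : IndexData}

/-! ### Geometry of the index set -/

/-! The solution is the limit of a Nash–Moser iteration along the scales `N = N₀ ^ 2 ^ n`. The hard
input is a tame bound for the inverse of the truncated linearised operator `D + ε T`, for parameters
at which that inverse is only known to be bounded in ℓ² by a power of `N`.

Inverse. The multiscale analysis (`multiscale_step`, `multiscale`) passes from boxes of radius `N`
to boxes of radius `N ^ χ`. A site of the large box is regular, or lies well inside a small box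
whose inverse is bounded and hence, by induction, has decaying columns, or is bad. Covariance, the
Töplitz property, the covering by few intervals of angles and the Diophantine condition bound the
number of bad sites over each `j` (`ncard_section_le`). The separation hypothesis then groups bad
sites into clusters of diameter at most `N ^ C` that are more than `N²` apart (`exists_cluster`).
Instead of resolvent identities, a column `u` of the inverse is controlled through the maximum of
`‖u k‖ ⟨k - k₀⟩^s γ(k)^p`, where `γ` is a truncated distance to the bad set: at each of the three
kinds of sites the equation bounds the weighted value by half the maximum plus an error
(`weighted_le_of_regular`, `weighted_le_of_box`, `weighted_le_of_bad`, `colDec_of_goodSites`). By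
`pow_add_le_of_quasi` the coefficient of the maximum is independent of `s`, so the thresholds on
`N₀` and on the perturbation in this analysis do not depend on the regularity; this is what makes
the smooth case accessible. A decay of order `s` costs `N ^ (C s)`, which is the power `C s / χ ≤ s
/ 16` of the new scale: only one sixteenth of the derivatives is lost (`exists_level`).

Newton scheme. Inverses exist only on a set `A` of good parameters. They are sampled near a grid of
mesh `N ^ (-3 g)`, replaced by zero away from `A` and interpolated smoothly (`gridQ`), so every
correction is `C¹` on the whole interval. Two Newton steps are made per scale (`exists_scale_step`):
the first improves the residual, the second its derivative in the parameter. Passing to the scale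
`N²` adds a truncation error, which is small because the high norms grow like a power of `N` that is
smaller than the gain of regularity (`residual_le_of_scale_change`, `grow_gap`, `exists_step`).

Limit. The sets defining `𝒞_ε` refer to the limit, not to the approximations. The approximation at
scale `N` is within `N ^ (-closeExp)` of the limit, and the factor `1/2` in the bounds that define
these sets absorbs the difference (`exists_good_of_cantor`). Hence a parameter of `𝒞_ε` is never
discarded, and its residuals tend to zero (`Run.eq_zero`). For the smooth conclusion the level of
regularity that drives the scheme increases slowly with `n`, at a pace at which its constants are
absorbed by the current scale (`exists_schedule_tendsto`, `Run.memHs`). -/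

theorem pow_add_le_of_quasi (s : ℕ) {x y j : ℝ} (hx : 0 ≤ x) (hy : 0 ≤ y) (hj : 0 ≤ j)
    (h : x ≤ y + j) : x ^ s ≤ 3 * y ^ s + (1 + s) ^ s * j ^ s := by
  rcases Nat.eq_zero_or_pos s with rfl | hs
  · norm_num
  have hs' : (0 : ℝ) < s := by exact_mod_cast hs
  -- If `j ≤ y / s`, then `x ≤ y (1 + 1/s)` and `(1 + 1/s)^s ≤ e < 3`; otherwise `x ≤ (1 + s) j`.
  -- The coefficient of `y ^ s` stays bounded in `s`, unlike the `2 ^ s` of the crude inequality.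
  by_cases hc : s * j ≤ y
  · have h1 : x ≤ y * (1 + 1 / s) := by
      have : j ≤ y / s := by rw [le_div_iff₀ hs']; linarith
      calc x ≤ y + j := h
        _ ≤ y + y / s := by linarith
        _ = y * (1 + 1 / s) := by ring
    have h2 : (1 + 1 / (s : ℝ)) ^ s ≤ 3 := by
      have h3 : (1 + 1 / (s : ℝ)) ^ s ≤ Real.exp (1 / s) ^ s := by
        apply pow_le_pow_left₀ (by positivity)
        have := Real.add_one_le_exp (1 / (s : ℝ)); linarith
      rw [← Real.exp_nat_mul, mul_one_div_cancel hs'.ne'] at h3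
      linarith [Real.exp_one_lt_d9]
    calc x ^ s ≤ (y * (1 + 1 / s)) ^ s := pow_le_pow_left₀ hx h1 s
      _ = (1 + 1 / (s : ℝ)) ^ s * y ^ s := by rw [mul_pow]; ring
      _ ≤ 3 * y ^ s := by gcongr
      _ ≤ _ := le_add_of_nonneg_right (by positivity)
  · push Not at hc
    calc x ^ s ≤ ((1 + s) * j) ^ s := pow_le_pow_left₀ hx (by nlinarith) s
      _ = (1 + s) ^ s * j ^ s := mul_pow ..
      _ ≤ _ := le_add_of_nonneg_left (by positivity)


/-- `⟨i - i'⟩` for the sites `i`, `i'` of `k`, `k'`. -/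
def jb (k k' : Idx K) : ℝ := max 1 ‖site k - site k'‖

theorem one_le_jb (k k' : Idx K) : 1 ≤ jb k k' := le_max_left _ _

theorem jb_pos (k k' : Idx K) : 0 < jb k k' := zero_lt_one.trans_le (one_le_jb k k')

theorem norm_le_jb (k k' : Idx K) : ‖site k - site k'‖ ≤ jb k k' := le_max_right _ _

theorem jb_self (k : Idx K) : jb k k = 1 := by simp [jb]

theorem jb_le_one_add (k k' : Idx K) : jb k k' ≤ 1 + ‖site k - site k'‖ :=
  max_le (by linarith [norm_nonneg (site k - site k')]) (by linarith)

theorem jb_triangle (k k' k'' : Idx K) : jb k k'' ≤ jb k k' + jb k' k'' := by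
  have h := norm_sub_le_norm_sub_add_norm_sub (site k) (site k') (site k'')
  apply max_le
  · linarith [one_le_jb k k', one_le_jb k' k'']
  · linarith [norm_le_jb k k', norm_le_jb k' k'']

theorem jb_pow_quasi (s : ℕ) (k k' k'' : Idx K) :
    jb k k'' ^ s ≤ 3 * jb k' k'' ^ s + (1 + s) ^ s * jb k k' ^ s :=
  pow_add_le_of_quasi s (jb_pos _ _).le (jb_pos _ _).le (jb_pos _ _).le
    (by linarith [jb_triangle k k' k''])

theorem jb_pow_le_two (s : ℕ) (k k' k'' : Idx K) :
    jb k k'' ^ s ≤ 2 ^ s * (jb k k' ^ s + jb k' k'' ^ s) := by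
  have h := jb_triangle k k' k''
  have h1 := jb_pos k k'
  have h2 := jb_pos k' k''
  rcases le_total (jb k k') (jb k' k'') with hc | hc
  · calc jb k k'' ^ s ≤ (2 * jb k' k'') ^ s :=
        pow_le_pow_left₀ (jb_pos _ _).le (by linarith) s
      _ = 2 ^ s * jb k' k'' ^ s := mul_pow ..
      _ ≤ _ := by gcongr; linarith [pow_pos h1 s]
  · calc jb k k'' ^ s ≤ (2 * jb k k') ^ s :=
        pow_le_pow_left₀ (jb_pos _ _).le (by linarith) s
      _ = 2 ^ s * jb k k' ^ s := mul_pow ..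
      _ ≤ _ := by gcongr; linarith [pow_pos h2 s]

theorem jb_pow_mono {s t : ℕ} (h : s ≤ t) (k k' : Idx K) : jb k k' ^ s ≤ jb k k' ^ t :=
  pow_le_pow_right₀ (one_le_jb _ _) h

/-- The box of radius `N` around the site `i`, as a finite set. -/
def bx (N : ℕ) (i : Site K) : Finset (Idx K) := (box_finite N i).toFinset

theorem mem_bx {N : ℕ} {i : Site K} {k : Idx K} : k ∈ bx N i ↔ ‖site k - i‖ ≤ N := by
  simp [bx, box]

theorem mem_bx_zero {N : ℕ} {k : Idx K} : k ∈ bx N (0 : Site K) ↔ ‖site k‖ ≤ N := by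
  simp [mem_bx]

theorem bx_subset {N M : ℕ} (h : N ≤ M) (i : Site K) : bx N i ⊆ bx M i := fun k hk => by
  rw [mem_bx] at hk ⊢
  exact hk.trans (by exact_mod_cast h)

theorem jb_le_of_mem_bx {N : ℕ} {i : Site K} {k k' : Idx K} (hk : k ∈ bx N i) (hk' : k' ∈ bx N i) :
    jb k k' ≤ 1 + 2 * N := by
  rw [mem_bx] at hk hk'
  have : ‖site k - site k'‖ ≤ ‖site k - i‖ + ‖site k' - i‖ := by
    have := norm_sub_le (site k - i) (site k' - i)
    simpa using this
  linarith [jb_le_one_add k k']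

variable (K) in
/-- The dimension `d + r` of the lattice of sites. -/
def rd : ℕ := K.d + K.r

theorem site_prod_injective :
    Function.Injective fun k : Idx K => (site k, k.2.2) := by
  rintro ⟨l, j, a⟩ ⟨l', j', a'⟩ h
  simp only [site, Prod.mk.injEq] at h
  obtain ⟨⟨rfl, h2⟩, rfl⟩ := h
  rw [Subtype.ext h2]

theorem card_bx_le (N : ℕ) (i : Site K) :
    (bx N i).card ≤ Fintype.card K.A * (2 * N + 1) ^ rd K := by
  classical
  let B : Finset (Site K) :=
    (Fintype.piFinset fun p => Finset.Icc (i.1 p - N) (i.1 p + N)) ×ˢ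
      (Fintype.piFinset fun p => Finset.Icc (i.2 p - N) (i.2 p + N))
  have h1 : (bx N i).card ≤ (B ×ˢ (Finset.univ : Finset K.A)).card := by
    refine Finset.card_le_card_of_injOn (fun k : Idx K => (site k, k.2.2)) ?_
      site_prod_injective.injOn
    intro k hk
    have hk := mem_bx.1 (Finset.mem_coe.1 hk)
    rw [Prod.norm_def] at hk
    have h1 := (pi_norm_le_iff_of_nonneg (Nat.cast_nonneg N)).1 ((le_max_left _ _).trans hk)
    have h2 := (pi_norm_le_iff_of_nonneg (Nat.cast_nonneg N)).1 ((le_max_right _ _).trans hk)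
    simp only [B, Finset.coe_product, Set.mem_prod, Finset.mem_coe, Fintype.mem_piFinset,
      Finset.mem_Icc, Finset.mem_univ, and_true]
    constructor
    · intro p
      have := h1 p
      rw [Int.norm_eq_abs, abs_le] at this
      have h3 : (-(N : ℤ) : ℤ) ≤ (site k).1 p - i.1 p := by exact_mod_cast this.1
      have h4 : (site k).1 p - i.1 p ≤ N := by exact_mod_cast this.2
      omega
    · intro p
      have := h2 p
      rw [Int.norm_eq_abs, abs_le] at this
      have h3 : (-(N : ℤ) : ℤ) ≤ (site k).2 p - i.2 p := by exact_mod_cast this.1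
      have h4 : (site k).2 p - i.2 p ≤ N := by exact_mod_cast this.2
      omega
  refine h1.trans (le_of_eq ?_)
  have h2 : ∀ x : ℤ, (x + N + 1 - (x - N)).toNat = 2 * N + 1 := by intro x; omega
  simp only [B, Finset.card_product, Fintype.card_piFinset, Int.card_Icc, h2, Finset.prod_const,
    Finset.card_univ, Fintype.card_fin, rd, pow_add]
  ring

theorem summable_int_bracket : Summable fun x : ℤ => ((max 1 |(x : ℝ)|) ^ 2)⁻¹ := by
  have h1 : Summable fun x : ℤ => 1 / (x : ℝ) ^ 2 := Real.summable_one_div_int_pow.2 (by norm_num)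
  have h2 : Summable fun x : ℤ => if x = 0 then (1 : ℝ) else 0 :=
    summable_of_ne_finset_zero (s := {0}) (by intro b hb; simpa using hb)
  refine Summable.of_nonneg_of_le (fun x => by positivity) (fun x => ?_) (h1.add h2)
  by_cases hx : x = 0
  · subst hx; simp
  · have h3 : (0 : ℝ) < (x : ℝ) ^ 2 := by positivity
    simp only [hx, if_false, add_zero, one_div]
    apply inv_anti₀ h3
    rw [← sq_abs]
    gcongr
    exact le_max_right _ _

/-- Enlarging `B` to the product of its coordinate projections turns the sum of products into a
product of one-dimensional sums. -/
theorem sum_pi_bracket_le (n : ℕ) (B : Finset (Fin n → ℤ)) :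
    ∑ x ∈ B, ∏ p, ((max 1 |(x p : ℝ)|) ^ 2)⁻¹ ≤
      (∑' x : ℤ, ((max 1 |(x : ℝ)|) ^ 2)⁻¹) ^ n := by
  classical
  let S : Fin n → Finset ℤ := fun p => B.image fun x => x p
  have h1 : B ⊆ Fintype.piFinset S := by
    intro x hx
    simp only [S, Fintype.mem_piFinset, Finset.mem_image]
    exact fun p => ⟨x, hx, rfl⟩
  calc ∑ x ∈ B, ∏ p, ((max 1 |(x p : ℝ)|) ^ 2)⁻¹
      ≤ ∑ x ∈ Fintype.piFinset S,
          ∏ p, ((max 1 |(x p : ℝ)|) ^ 2)⁻¹ :=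
        Finset.sum_le_sum_of_subset_of_nonneg h1 fun x _ _ =>
          Finset.prod_nonneg fun p _ => by positivity
    _ = ∏ p, ∑ y ∈ S p, ((max 1 |(y : ℝ)|) ^ 2)⁻¹ := by
        rw [Finset.prod_univ_sum]
    _ ≤ ∏ _p : Fin n, ∑' x : ℤ, ((max 1 |(x : ℝ)|) ^ 2)⁻¹ := by
        refine Finset.prod_le_prod (fun p _ => Finset.sum_nonneg fun y _ => by positivity)
          fun p _ => ?_
        exact summable_int_bracket.sum_le_tsum _ fun y _ => by positivity
    _ = _ := by simp

/-- The bracket `jb` dominates every coordinate of the difference of sites, so its power `-2 (d +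
r)` is at most a product of summable functions of the single coordinates. The bound is uniform in
`k` and in the finite set. -/
theorem exists_sum_jb_le :
    ∃ C : ℝ, 1 ≤ C ∧ ∀ (k : Idx K) (B : Finset (Idx K)),
      ∑ k' ∈ B, (jb k k' ^ (2 * rd K))⁻¹ ≤ C := by
  classical
  set c := ∑' x : ℤ, ((max 1 |(x : ℝ)|) ^ 2)⁻¹ with hc
  have hc0 : 0 ≤ c := tsum_nonneg fun x => by positivity
  refine ⟨1 + Fintype.card K.A * (c ^ K.d * c ^ K.r), le_add_of_nonneg_right (by positivity), ?_⟩
  intro k B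
  let φ : (Fin K.d → ℤ) → ℝ := fun x => ∏ p, ((max 1 |(x p : ℝ)|) ^ 2)⁻¹
  let ψ : (Fin K.r → ℤ) → ℝ := fun x => ∏ p, ((max 1 |(x p : ℝ)|) ^ 2)⁻¹
  have hφ : ∀ x, 0 ≤ φ x := fun x => Finset.prod_nonneg fun p _ => by positivity
  have hψ : ∀ x, 0 ≤ ψ x := fun x => Finset.prod_nonneg fun p _ => by positivity
  have key : ∀ k' : Idx K, (jb k k' ^ (2 * rd K))⁻¹ ≤
      φ (site k - site k').1 * ψ (site k - site k').2 := by
    intro k'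
    have e1 : ∀ (n : ℕ) (x : Fin n → ℤ) (j : ℝ), 1 ≤ j → ‖x‖ ≤ j →
        (j ^ (2 * n))⁻¹ ≤ ∏ p, ((max 1 |(x p : ℝ)|) ^ 2)⁻¹ := by
      intro n x j hj hx
      rw [Finset.prod_inv_distrib]
      apply inv_anti₀ (Finset.prod_pos fun p _ => by positivity)
      calc ∏ p, (max 1 |(x p : ℝ)|) ^ 2 ≤ ∏ _p : Fin n, j ^ 2 := by
            refine Finset.prod_le_prod (fun p _ => by positivity) fun p _ => ?_
            gcongr
            refine max_le hj (le_trans ?_ hx)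
            have := norm_le_pi_norm x p
            rwa [Int.norm_eq_abs] at this
        _ = j ^ (2 * n) := by simp [pow_mul]
    have h1 := e1 K.d (site k - site k').1 (jb k k') (one_le_jb _ _)
      ((le_max_left _ _).trans (norm_le_jb k k'))
    have h2 := e1 K.r (site k - site k').2 (jb k k') (one_le_jb _ _)
      ((le_max_right _ _).trans (norm_le_jb k k'))
    calc (jb k k' ^ (2 * rd K))⁻¹ = (jb k k' ^ (2 * K.d))⁻¹ * (jb k k' ^ (2 * K.r))⁻¹ := by
          rw [rd, mul_add, pow_add, mul_inv]
      _ ≤ _ := mul_le_mul h1 h2 (by have := jb_pos k k'; positivity) (hφ _)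
  let f : Idx K → ((Fin K.d → ℤ) × (Fin K.r → ℤ)) × K.A := fun k' => (site k - site k', k'.2.2)
  have hf : Function.Injective f := by
    intro x y h
    apply site_prod_injective
    simp only [f, Prod.mk.injEq, sub_right_inj] at h
    exact Prod.ext h.1 h.2
  let B1 := B.image fun k' => (site k - site k').1
  let B2 := B.image fun k' => (site k - site k').2
  have hsub : B.image f ⊆ (B1 ×ˢ B2) ×ˢ Finset.univ := by
    intro y hy
    obtain ⟨k', hk', rfl⟩ := Finset.mem_image.1 hy
    simp only [Finset.mem_product, Finset.mem_univ, and_true]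
    exact ⟨Finset.mem_image_of_mem _ hk', Finset.mem_image_of_mem _ hk'⟩
  have : ∑ k' ∈ B, (jb k k' ^ (2 * rd K))⁻¹ ≤ Fintype.card K.A * (c ^ K.d * c ^ K.r) := by
    calc ∑ k' ∈ B, (jb k k' ^ (2 * rd K))⁻¹
        ≤ ∑ k' ∈ B, φ (f k').1.1 * ψ (f k').1.2 := Finset.sum_le_sum fun k' _ => key k'
      _ = ∑ y ∈ B.image f, φ y.1.1 * ψ y.1.2 := by
          rw [Finset.sum_image hf.injOn]
      _ ≤ ∑ y ∈ (B1 ×ˢ B2) ×ˢ (Finset.univ : Finset K.A), φ y.1.1 * ψ y.1.2 :=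
          Finset.sum_le_sum_of_subset_of_nonneg hsub fun y _ _ => mul_nonneg (hφ _) (hψ _)
      _ = Fintype.card K.A * ((∑ x ∈ B1, φ x) * ∑ x ∈ B2, ψ x) := by
          rw [Finset.sum_product_right]
          simp only [Finset.sum_const, Finset.card_univ, nsmul_eq_mul]
          rw [Finset.sum_product, Finset.sum_mul_sum]
      _ ≤ _ := by
          refine mul_le_mul_of_nonneg_left ?_ (Nat.cast_nonneg _)
          refine mul_le_mul ?_ ?_ (Finset.sum_nonneg fun x _ => hψ x) (pow_nonneg hc0 _)
          · exact sum_pi_bracket_le _ _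
          · exact sum_pi_bracket_le _ _
  linarith

/-- A consequence of the two-sided bounds on the weights; it lets Sobolev weights be exchanged for
distances to the origin. -/
theorem exists_bracket_bounds :
    ∃ C : ℝ, 1 ≤ C ∧ ∀ k : Idx K, bracket k ≤ C * max 1 ‖site k‖ ∧ max 1 ‖site k‖ ≤ C * bracket k := by
  have hc := K.cw_pos
  have hC : 0 < K.Cw := hc.trans_le K.cw_le
  refine ⟨max (max 1 K.Cw) (1 / K.cw), (le_max_left _ _).trans (le_max_left _ _), fun k => ?_⟩
  have e : ‖site k‖ = max ‖k.1‖ ‖k.2.1.1‖ := rfl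
  have h1 := K.w_upper k
  have h2 := K.w_lower k
  rw [← e] at h1 h2
  set X := max 1 ‖site k‖ with hX
  have hX1 : 1 ≤ X := le_max_left _ _
  set C := max (max 1 K.Cw) (1 / K.cw)
  have c1 : 1 ≤ C := (le_max_left _ _).trans (le_max_left _ _)
  have c2 : K.Cw ≤ C := (le_max_right _ _).trans (le_max_left _ _)
  have c3 : 1 / K.cw ≤ C := le_max_right _ _
  have b1 : 1 ≤ bracket k := (le_max_left _ _).trans (le_max_right _ _)
  have b2 : K.w k ≤ bracket k := (le_max_right _ _).trans (le_max_right _ _)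
  constructor
  · refine max_le ?_ (max_le ?_ ?_)
    · nlinarith [K.cw_le]
    · nlinarith
    · exact h1.trans (by gcongr)
  · refine max_le (by nlinarith) ?_
    have : ‖site k‖ ≤ 1 / K.cw * K.w k := by
      rw [one_div, ← div_eq_inv_mul, le_div_iff₀ hc]; linarith
    calc ‖site k‖ ≤ 1 / K.cw * K.w k := this
      _ ≤ 1 / K.cw * bracket k := by gcongr
      _ ≤ C * bracket k := by gcongr

theorem one_le_bracket (k : Idx K) : 1 ≤ bracket k := (le_max_left _ _).trans (le_max_right _ _)

/-! ### Operators with diagonal part and decaying remainder on finite sets of indices -/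

variable (K) in
/-- Kernels of operators: families of linear maps between the components. -/
abbrev Ker : Type :=
  ∀ k k' : Idx K, EuclideanSpace ℂ (Fin (dim k')) →L[ℂ] EuclideanSpace ℂ (Fin (dim k))

/-- The operator `u ↦ (m_k u_k + ∑_{k' ∈ E} T_k^{k'} u_{k'})_k`. -/
def app (m : Idx K → ℂ) (T : Ker K) (E : Finset (Idx K)) : Seq K →ₗ[ℂ] Seq K where
  toFun u k := m k • u k + ∑ k' ∈ E, T k k' (u k')
  map_add' u v := by
    funext k
    simp only [Pi.add_apply, smul_add, map_add, Finset.sum_add_distrib]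
    abel
  map_smul' c u := by
    funext k
    simp only [Pi.smul_apply, map_smul, RingHom.id_apply, smul_add, Finset.smul_sum,
      smul_comm (m k) c]

theorem app_apply (m : Idx K → ℂ) (T : Ker K) (E : Finset (Idx K)) (u : Seq K) (k : Idx K) :
    app m T E u k = m k • u k + ∑ k' ∈ E, T k k' (u k') := rfl

/-- `u` vanishes outside `E`. -/
def SuppIn (E : Finset (Idx K)) (u : Seq K) : Prop := ∀ k, k ∉ E → u k = 0

/-- The `ℓ²` norm of the restriction of `u` to `E`. -/
def l2 (E : Finset (Idx K)) (u : Seq K) : ℝ := Real.sqrt (∑ k ∈ E, ‖u k‖ ^ 2)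

theorem l2_nonneg (E : Finset (Idx K)) (u : Seq K) : 0 ≤ l2 E u := Real.sqrt_nonneg _

theorem l2_eq_norm (E : Finset (Idx K)) (u : Seq K) :
    l2 E u = ‖(WithLp.toLp 2 fun k : E => u k.1 : PiLp 2 fun k : E =>
      EuclideanSpace ℂ (Fin (dim k.1)))‖ := by
  rw [PiLp.norm_eq_of_L2, l2]
  congr 1
  exact (Finset.sum_coe_sort E fun k => ‖u k‖ ^ 2).symm

theorem l2_add_le (E : Finset (Idx K)) (u v : Seq K) : l2 E (u + v) ≤ l2 E u + l2 E v := by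
  simp only [l2_eq_norm]
  exact norm_add_le (WithLp.toLp 2 fun k : E => u k.1 : PiLp 2 fun k : E =>
      EuclideanSpace ℂ (Fin (dim k.1))) (WithLp.toLp 2 fun k : E => v k.1)

theorem norm_le_l2 {E : Finset (Idx K)} {k : Idx K} (hk : k ∈ E) (u : Seq K) : ‖u k‖ ≤ l2 E u := by
  apply Real.le_sqrt_of_sq_le
  exact Finset.single_le_sum (f := fun k => ‖u k‖ ^ 2) (fun k _ => by positivity) hk

theorem l2_le_sum (E : Finset (Idx K)) (u : Seq K) : l2 E u ≤ ∑ k ∈ E, ‖u k‖ := by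
  apply Real.sqrt_le_iff.2
  exact ⟨Finset.sum_nonneg fun k _ => norm_nonneg _,
    Finset.sum_sq_le_sq_sum_of_nonneg fun k _ => norm_nonneg _⟩

theorem l2_congr {E : Finset (Idx K)} {u v : Seq K} (h : ∀ k ∈ E, u k = v k) : l2 E u = l2 E v := by
  rw [l2, l2, Finset.sum_congr rfl fun k hk => by rw [h k hk]]

/-- The truncation of the operator to `E` is invertible in `ℓ²` with inverse bounded by `b`. -/
def Coer (m : Idx K → ℂ) (T : Ker K) (E : Finset (Idx K)) (b : ℝ) : Prop :=
  ∀ u, SuppIn E u → l2 E u ≤ b * l2 E (app m T E u)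

/-- The columns of the inverse of the truncation to `E` decay like `z ⟨k - k₀⟩^{-s}`. -/
def ColDec (m : Idx K → ℂ) (T : Ker K) (E : Finset (Idx K)) (s : ℕ) (z : ℝ) : Prop :=
  ∀ k₀ ∈ E, ∀ u, SuppIn E u → (∀ k ∈ E, k ≠ k₀ → app m T E u k = 0) →
    ∀ k ∈ E, ‖u k‖ * jb k k₀ ^ s ≤ z * ‖app m T E u k₀‖

/-- The entries of `T` decay like `t ⟨k - k'⟩^{-s}`. -/
def TB (T : Ker K) (s : ℕ) (t : ℝ) : Prop := ∀ k k', ‖T k k'‖ * jb k k' ^ s ≤ t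

theorem TB.mono {T : Ker K} {s s' : ℕ} {t : ℝ} (h : TB T s t) (hs : s' ≤ s) : TB T s' t :=
  fun k k' => (mul_le_mul_of_nonneg_left (jb_pow_mono hs k k') (norm_nonneg _)).trans (h k k')

theorem TB.norm_le {T : Ker K} {s : ℕ} {t : ℝ} (h : TB T s t) (k k' : Idx K) : ‖T k k'‖ ≤ t := by
  simpa using h.mono (Nat.zero_le s) k k'

theorem ColDec.mono {m : Idx K → ℂ} {T : Ker K} {E : Finset (Idx K)} {s : ℕ} {z z' : ℝ}
    (h : ColDec m T E s z) (hz : z ≤ z') : ColDec m T E s z' := fun k₀ hk₀ u hu h0 k hk =>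
  (h k₀ hk₀ u hu h0 k hk).trans (by gcongr)

/-- Coercivity gives injectivity, and in finite dimension injectivity gives solvability. Inverses
are thus handled through solutions of equations, without ever writing an inverse matrix. -/
theorem exists_app_eq {m : Idx K → ℂ} {T : Ker K} {E : Finset (Idx K)} {b : ℝ}
    (hC : Coer m T E b) (h : Seq K) : ∃ u, SuppIn E u ∧ ∀ k ∈ E, app m T E u k = h k := by
  classical
  let ext : (∀ k : E, EuclideanSpace ℂ (Fin (dim k.1))) →ₗ[ℂ] Seq K :=
    { toFun := fun x k => if hk : k ∈ E then x ⟨k, hk⟩ else 0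
      map_add' := fun x y => by
        funext k
        by_cases hk : k ∈ E <;> simp [hk]
      map_smul' := fun c x => by
        funext k
        by_cases hk : k ∈ E <;> simp [hk] }
  let res : Seq K →ₗ[ℂ] (∀ k : E, EuclideanSpace ℂ (Fin (dim k.1))) :=
    { toFun := fun x k => x k.1
      map_add' := fun x y => rfl
      map_smul' := fun c x => rfl }
  have hext : ∀ x, SuppIn E (ext x) := fun x k hk => by simp [ext, hk]
  let Φ := res ∘ₗ app m T E ∘ₗ ext
  have hinj : Function.Injective Φ := by
    rw [← LinearMap.ker_eq_bot, LinearMap.ker_eq_bot']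
    intro x hx
    have h1 := hC (ext x) (hext x)
    have h2 : l2 E (app m T E (ext x)) = 0 := by
      rw [l2, Finset.sum_eq_zero, Real.sqrt_zero]
      intro k hk
      have : app m T E (ext x) k = 0 := congrFun hx ⟨k, hk⟩
      simp [this]
    rw [h2, mul_zero] at h1
    funext k
    have h3 := (norm_le_l2 k.2 (ext x)).trans h1
    have h4 : ext x k.1 = 0 := norm_le_zero_iff.1 h3
    simpa [ext] using h4
  obtain ⟨x, hx⟩ := LinearMap.injective_iff_surjective.1 hinj (res h)
  exact ⟨ext x, hext x, fun k hk => congrFun hx ⟨k, hk⟩⟩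

theorem SuppIn.sum {ι : Type*} {E : Finset (Idx K)} {B : Finset ι} {f : ι → Seq K}
    (h : ∀ i ∈ B, SuppIn E (f i)) : SuppIn E (∑ i ∈ B, f i) := fun k hk => by
  rw [Finset.sum_apply]
  exact Finset.sum_eq_zero fun i hi => h i hi k hk

theorem SuppIn.sub {E : Finset (Idx K)} {u v : Seq K} (hu : SuppIn E u) (hv : SuppIn E v) :
    SuppIn E (u - v) := fun k hk => by simp [hu k hk, hv k hk]

theorem Coer.eq_zero {m : Idx K → ℂ} {T : Ker K} {E : Finset (Idx K)} {b : ℝ}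
    (hC : Coer m T E b) {u : Seq K} (hu : SuppIn E u) (h : ∀ k ∈ E, app m T E u k = 0) :
    u = 0 := by
  have h1 := hC u hu
  rw [l2_congr (v := 0) h] at h1
  have h2 : l2 E (0 : Seq K) = 0 := by simp [l2]
  rw [h2, mul_zero] at h1
  funext k
  by_cases hk : k ∈ E
  · exact norm_le_zero_iff.1 ((norm_le_l2 hk u).trans h1)
  · exact hu k hk

/-- Superposition of columns of the inverse. -/
theorem norm_le_sum_of_columns {m : Idx K → ℂ} {T : Ker K} {E : Finset (Idx K)} {b : ℝ}
    (hC : Coer m T E b) {Z : Idx K → Idx K → ℝ}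
    (hZ : ∀ k₀ ∈ E, ∀ u, SuppIn E u → (∀ k ∈ E, k ≠ k₀ → app m T E u k = 0) →
      ∀ k ∈ E, ‖u k‖ ≤ Z k k₀ * ‖app m T E u k₀‖) {u : Seq K} (hu : SuppIn E u)
    {k : Idx K} (hk : k ∈ E) : ‖u k‖ ≤ ∑ k₁ ∈ E, Z k k₁ * ‖app m T E u k₁‖ := by
  classical
  -- `v k₁` has as its source the component at `k₁` of the source of `u`; by uniqueness these
  -- columns add up to `u`.
  have h1 : ∀ k₁ : Idx K, ∃ v, SuppIn E v ∧
      ∀ k ∈ E, app m T E v k = (Pi.single k₁ (app m T E u k₁) : Seq K) k :=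
    fun k₁ => exists_app_eq hC _
  choose v hv1 hv2 using h1
  have h2 : u - ∑ k₁ ∈ E, v k₁ = 0 := by
    refine hC.eq_zero (hu.sub (SuppIn.sum fun i _ => hv1 i)) fun k hk => ?_
    rw [map_sub, map_sum, Pi.sub_apply, Finset.sum_apply,
      Finset.sum_congr rfl fun k₁ _ => hv2 k₁ k hk, Finset.sum_eq_single_of_mem k hk, Pi.single_eq_same,
      sub_self]
    intro b _ hb
    exact Pi.single_eq_of_ne hb.symm _
  have h3 : u k = ∑ k₁ ∈ E, v k₁ k := by
    have := congrFun h2 k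
    rw [Pi.sub_apply, Finset.sum_apply] at this
    exact sub_eq_zero.1 this
  rw [h3]
  refine (norm_sum_le _ _).trans (Finset.sum_le_sum fun k₁ hk₁ => ?_)
  have h4 := hZ k₁ hk₁ (v k₁) (hv1 k₁) (fun k hk hne => by
    rw [hv2 k₁ k hk, Pi.single_eq_of_ne hne]) k hk
  rwa [hv2 k₁ k₁ hk₁, Pi.single_eq_same] at h4

/-- The implication is applied to the maximum itself, which exists because the set is finite; so no
prior bound on `φ` is needed. -/
theorem le_of_half {ι : Type*} (E : Finset ι) (φ : ι → ℝ) {B : ℝ} (hφ : ∀ k, 0 ≤ φ k)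
    (h : ∀ M, 0 ≤ M → (∀ k ∈ E, φ k ≤ M) → ∀ k ∈ E, φ k ≤ M / 2 + B) : ∀ k ∈ E, φ k ≤ 2 * B := by
  intro k hk
  obtain ⟨k₁, hk₁, hmax⟩ := E.exists_max_image φ ⟨k, hk⟩
  have h1 := h (φ k₁) (hφ k₁) hmax k₁ hk₁
  linarith [hmax k hk]

/-! ### Weighted maximum estimates at regular, good and bad sites -/

/-- The constant in the quasi-triangle inequality for the power `s`. -/
def cq (s : ℕ) : ℝ := (1 + s) ^ s

theorem cq_pos (s : ℕ) : 0 < cq s := by unfold cq; positivity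

/-- Multiply two quasi-triangle inequalities, for the power `s` of the distance to `k₀` and for the
weight `g`. One part of the product is controlled by the weighted maximum `M`, with a coefficient
free of `s` and only the decay `p` of `R`. In the other part the decay `s + p` of `R` carries the
whole weight, and only the unweighted bound `A₀` of `a` is used. -/
theorem weighted_sum_le {E : Finset (Idx K)} {R : Idx K → ℝ} {a g : Idx K → ℝ} {k k₀ : Idx K}
    {s p : ℕ} {G M A₀ Y₁ Y₂ : ℝ} (hR : ∀ k' ∈ E, 0 ≤ R k') (ha : ∀ k', 0 ≤ a k')
    (hg1 : ∀ k', 1 ≤ g k') (hgG : ∀ k', g k' ≤ G)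
    (hg : ∀ k', g k ≤ 3 * g k' + cq p * jb k k' ^ p)
    (hM : ∀ k' ∈ E, a k' * jb k' k₀ ^ s * g k' ≤ M) (hM0 : 0 ≤ M)
    (hA : ∀ k' ∈ E, a k' ≤ A₀) (hA0 : 0 ≤ A₀)
    (h1 : ∑ k' ∈ E, R k' * jb k k' ^ p ≤ Y₁) (h2 : ∑ k' ∈ E, R k' * jb k k' ^ (s + p) ≤ Y₂) :
    (∑ k' ∈ E, R k' * a k') * (jb k k₀ ^ s * g k) ≤
      (9 + 3 * cq p) * Y₁ * M + cq s * (3 + cq p) * G * Y₂ * A₀ := by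
  have cs := cq_pos s
  have cp := cq_pos p
  have hG : 0 ≤ G := (zero_le_one.trans (hg1 k)).trans (hgG k)
  have key : ∀ k' ∈ E, R k' * a k' * (jb k k₀ ^ s * g k) ≤
      (9 + 3 * cq p) * M * (R k' * jb k k' ^ p) +
        cq s * (3 + cq p) * G * A₀ * (R k' * jb k k' ^ (s + p)) := by
    intro k' hk'
    have q1 : jb k k₀ ^ s ≤ 3 * jb k' k₀ ^ s + cq s * jb k k' ^ s := jb_pow_quasi s k k' k₀
    have q2 := hg k'
    set x := jb k' k₀ ^ s
    set y := jb k k' ^ s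
    set w := jb k k' ^ p
    have hx : 0 ≤ x := (pow_pos (jb_pos _ _) s).le
    have hy : 0 ≤ y := (pow_pos (jb_pos _ _) s).le
    have hw : 1 ≤ w := one_le_pow₀ (one_le_jb _ _)
    have g1 := hg1 k'
    have g2 : g k ≤ (3 + cq p) * w * g k' := by
      have e1 : g k' ≤ w * g k' := le_mul_of_one_le_left (by linarith) hw
      have e2 : cq p * w ≤ cq p * w * g k' := le_mul_of_one_le_right (by positivity) g1
      nlinarith
    have r1 : jb k k₀ ^ s * g k ≤ (9 + 3 * cq p) * w * (x * g k') + cq s * (3 + cq p) * (y * w) * G := by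
      calc jb k k₀ ^ s * g k ≤ (3 * x + cq s * y) * ((3 + cq p) * w * g k') := by
            apply mul_le_mul q1 g2 (by linarith [hg1 k]) (by positivity)
        _ = (9 + 3 * cq p) * w * (x * g k') + cq s * (3 + cq p) * (y * w) * g k' := by ring
        _ ≤ _ := by gcongr; exact hgG k'
    have hRa : 0 ≤ R k' * a k' := mul_nonneg (hR k' hk') (ha k')
    have hm := hM k' hk'
    have hA' := hA k' hk'
    have hR' := hR k' hk'
    calc R k' * a k' * (jb k k₀ ^ s * g k)
        ≤ R k' * a k' * ((9 + 3 * cq p) * w * (x * g k') + cq s * (3 + cq p) * (y * w) * G) := by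
          gcongr
      _ = (9 + 3 * cq p) * (R k' * w) * (a k' * x * g k') +
            cq s * (3 + cq p) * G * (R k' * (y * w)) * a k' := by ring
      _ ≤ (9 + 3 * cq p) * (R k' * w) * M + cq s * (3 + cq p) * G * (R k' * (y * w)) * A₀ := by
          gcongr
      _ = _ := by rw [pow_add]; ring
  calc (∑ k' ∈ E, R k' * a k') * (jb k k₀ ^ s * g k)
      = ∑ k' ∈ E, R k' * a k' * (jb k k₀ ^ s * g k) := Finset.sum_mul ..
    _ ≤ _ := Finset.sum_le_sum key
    _ = (9 + 3 * cq p) * M * (∑ k' ∈ E, R k' * jb k k' ^ p) +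
        cq s * (3 + cq p) * G * A₀ * (∑ k' ∈ E, R k' * jb k k' ^ (s + p)) := by
        rw [Finset.sum_add_distrib, ← Finset.mul_sum, ← Finset.mul_sum]
    _ ≤ (9 + 3 * cq p) * M * Y₁ + cq s * (3 + cq p) * G * A₀ * Y₂ := by gcongr
    _ = _ := by ring

theorem norm_le_of_regular {m : Idx K → ℂ} {T : Ker K} {E : Finset (Idx K)} {k : Idx K} {μ : ℝ}
    (hμ : 0 < μ) (hk : μ ≤ ‖m k‖) (u : Seq K) :
    ‖u k‖ ≤ μ⁻¹ * (‖app m T E u k‖ + ∑ k' ∈ E, ‖T k k'‖ * ‖u k'‖) := by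
  have h1 : m k • u k = app m T E u k - ∑ k' ∈ E, T k k' (u k') := by
    rw [app_apply]; abel
  have h2 : ‖m k‖ * ‖u k‖ ≤ ‖app m T E u k‖ + ∑ k' ∈ E, ‖T k k'‖ * ‖u k'‖ := by
    rw [← norm_smul, h1]
    refine (norm_sub_le _ _).trans (add_le_add le_rfl ?_)
    exact (norm_sum_le _ _).trans (Finset.sum_le_sum fun k' _ => (T k k').le_opNorm _)
  rw [← div_eq_inv_mul, le_div_iff₀ hμ]
  nlinarith [norm_nonneg (u k)]

/-- The restriction of `u` to `E`. -/
def restr (E : Finset (Idx K)) (u : Seq K) : Seq K := fun k =>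
  open Classical in if k ∈ E then u k else 0

theorem restr_suppIn (E : Finset (Idx K)) (u : Seq K) : SuppIn E (restr E u) := fun k hk => by
  simp [restr, hk]

theorem restr_apply {E : Finset (Idx K)} {k : Idx K} (hk : k ∈ E) (u : Seq K) :
    restr E u k = u k := by simp [restr, hk]

-- The restriction of `u` to `F` solves the equation on `F`, with the original source corrected by
-- the couplings from `E \ F`. Superposing the columns of the inverse on `F`, bounded by `Z`, gives
-- the estimate.
open Classical in
theorem norm_le_of_box {m : Idx K → ℂ} {T : Ker K} {E F : Finset (Idx K)} (hF : F ⊆ E) {b : ℝ}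
    (hC : Coer m T F b) {Z : Idx K → Idx K → ℝ} (hZ0 : ∀ k k', 0 ≤ Z k k')
    (hZ : ∀ k₀ ∈ F, ∀ u, SuppIn F u → (∀ k ∈ F, k ≠ k₀ → app m T F u k = 0) →
      ∀ k ∈ F, ‖u k‖ ≤ Z k k₀ * ‖app m T F u k₀‖) {k : Idx K} (hk : k ∈ F) (u : Seq K) :
    ‖u k‖ ≤ ∑ k₁ ∈ F, Z k k₁ * ‖app m T E u k₁‖ +
      ∑ k' ∈ E \ F, (∑ k₁ ∈ F, Z k k₁ * ‖T k₁ k'‖) * ‖u k'‖ := by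
  have h1 := norm_le_sum_of_columns hC hZ (restr_suppIn F u) hk
  rw [restr_apply hk] at h1
  refine h1.trans ?_
  have h2 : ∀ k₁ ∈ F, ‖app m T F (restr F u) k₁‖ ≤
      ‖app m T E u k₁‖ + ∑ k' ∈ E \ F, ‖T k₁ k'‖ * ‖u k'‖ := by
    intro k₁ hk₁
    have : app m T F (restr F u) k₁ = app m T E u k₁ - ∑ k' ∈ E \ F, T k₁ k' (u k') := by
      rw [app_apply, app_apply, restr_apply hk₁, ← Finset.sum_sdiff hF,
        Finset.sum_congr rfl fun k' hk' => by rw [restr_apply hk' u]]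
      abel
    rw [this]
    refine (norm_sub_le _ _).trans (add_le_add le_rfl ?_)
    exact (norm_sum_le _ _).trans (Finset.sum_le_sum fun k' _ => (T k₁ k').le_opNorm _)
  calc ∑ k₁ ∈ F, Z k k₁ * ‖app m T F (restr F u) k₁‖
      ≤ ∑ k₁ ∈ F, Z k k₁ * (‖app m T E u k₁‖ + ∑ k' ∈ E \ F, ‖T k₁ k'‖ * ‖u k'‖) :=
        Finset.sum_le_sum fun k₁ hk₁ => mul_le_mul_of_nonneg_left (h2 k₁ hk₁) (hZ0 _ _)
    _ = _ := by
        simp only [mul_add, Finset.sum_add_distrib, Finset.sum_mul, Finset.mul_sum]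
        rw [Finset.sum_comm (s := E \ F)]
        simp only [mul_assoc]

-- The ℓ² bound on all of `E` is applied to the cut-off of `u` to `U`. The commutator of `T` with
-- the cut-off only involves pairs with exactly one index in `U`.
open Classical in
theorem norm_le_of_cutoff {m : Idx K → ℂ} {T : Ker K} {E U : Finset (Idx K)} (hU : U ⊆ E) {b : ℝ}
    (hb : 0 ≤ b) (hC : Coer m T E b) {k : Idx K} (hk : k ∈ U) (u : Seq K) :
    ‖u k‖ ≤ b * (∑ k₁ ∈ U, ‖app m T E u k₁‖ +
      ∑ k₁ ∈ E, ∑ k' ∈ E with ¬ (k₁ ∈ U ↔ k' ∈ U), ‖T k₁ k'‖ * ‖u k'‖) := by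
  have hs : SuppIn E (restr U u) := fun k hk => restr_suppIn U u k fun h => hk (hU h)
  have h1 := (norm_le_l2 (hU hk) _).trans ((hC _ hs).trans
    (mul_le_mul_of_nonneg_left (l2_le_sum _ _) hb))
  rw [restr_apply hk] at h1
  refine h1.trans (mul_le_mul_of_nonneg_left ?_ hb)
  have e0 : ∑ k₁ ∈ U, ‖app m T E u k₁‖ = ∑ k₁ ∈ E, if k₁ ∈ U then ‖app m T E u k₁‖ else 0 := by
    rw [Finset.sum_ite_mem, Finset.inter_eq_right.2 hU]
  rw [e0, ← Finset.sum_add_distrib]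
  refine Finset.sum_le_sum fun k₁ hk₁ => ?_
  have e1 : app m T E (restr U u) k₁ = (if k₁ ∈ U then app m T E u k₁ else 0) +
      ∑ k' ∈ E, T k₁ k' (restr U u k' - if k₁ ∈ U then u k' else 0) := by
    simp only [map_sub, Finset.sum_sub_distrib, app_apply]
    by_cases h : k₁ ∈ U
    · simp only [h, if_true, restr_apply h]; abel
    · have : restr U u k₁ = 0 := restr_suppIn U u k₁ h
      simp [h, this]
  rw [e1]
  refine (norm_add_le _ _).trans (add_le_add ?_ ?_)
  · split_ifs <;> simp
  · refine (norm_sum_le _ _).trans ?_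
    rw [Finset.sum_filter]
    refine Finset.sum_le_sum fun k' _ => ?_
    by_cases h : k₁ ∈ U <;> by_cases h' : k' ∈ U
    · simp [h, h', restr_apply h']
    · have : restr U u k' = 0 := restr_suppIn U u k' h'
      simpa [h, h', this] using (T k₁ k').le_opNorm (u k')
    · simpa [h, h', restr_apply h'] using (T k₁ k').le_opNorm (u k')
    · have : restr U u k' = 0 := restr_suppIn U u k' h'
      simp [h, h', this]

theorem sum_le_card_mul {ι : Type*} {E : Finset ι} {f : ι → ℝ} {c : ℝ} (h : ∀ i ∈ E, f i ≤ c) :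
    ∑ i ∈ E, f i ≤ E.card * c := by
  simpa using Finset.sum_le_card_nsmul E f c h

/-- The kernel `∑_{k₁ ∈ F} Z_k^{k₁} ‖T_{k₁}^{k'}‖` decays. -/
theorem box_kernel_decay {T : Ker K} {F : Finset (Idx K)} {Z : Idx K → Idx K → ℝ} {s : ℕ}
    {z b t t' cF : ℝ} {k k' : Idx K} (hZ0 : ∀ k', 0 ≤ Z k k') (hZb : ∀ k', Z k k' ≤ b)
    (hZz : ∀ k' ∈ F, Z k k' * jb k k' ^ s ≤ z) (ht : ∀ k k', ‖T k k'‖ ≤ t) (hts : TB T s t')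
    (hc : (F.card : ℝ) ≤ cF) (hb : 0 ≤ b) (hz : 0 ≤ z) (ht0 : 0 ≤ t) (ht'0 : 0 ≤ t') :
    (∑ k₁ ∈ F, Z k k₁ * ‖T k₁ k'‖) * jb k k' ^ s ≤ cF * (2 ^ s * (z * t + b * t')) := by
  rw [Finset.sum_mul]
  refine (sum_le_card_mul (c := 2 ^ s * (z * t + b * t')) fun k₁ hk₁ => ?_).trans
    (mul_le_mul_of_nonneg_right hc (by positivity))
  have h1 := jb_pow_le_two s k k₁ k'
  have h2 := hZz k₁ hk₁
  have h3 := hts k₁ k'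
  have h4 := hZ0 k₁
  calc Z k k₁ * ‖T k₁ k'‖ * jb k k' ^ s
      ≤ Z k k₁ * ‖T k₁ k'‖ * (2 ^ s * (jb k k₁ ^ s + jb k₁ k' ^ s)) := by gcongr
    _ = 2 ^ s * ((Z k k₁ * jb k k₁ ^ s) * ‖T k₁ k'‖ + Z k k₁ * (‖T k₁ k'‖ * jb k₁ k' ^ s)) := by ring
    _ ≤ 2 ^ s * (z * t + b * t') := by
        have h5 := hZb k₁
        have h6 := ht k₁ k'
        have h7 := jb_pos k₁ k'
        gcongr

/-- The distance-type function whose power serves as weight in the multiscale estimate. -/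
def gam (Bad : Set (Idx K)) (N : ℝ) (k : Idx K) : ℝ :=
  1 + min (Metric.infDist (site k) (site '' Bad)) (N ^ 2)

theorem one_le_gam (Bad : Set (Idx K)) (N : ℝ) (k : Idx K) : 1 ≤ gam Bad N k :=
  le_add_of_nonneg_right (le_min Metric.infDist_nonneg (sq_nonneg N))

theorem gam_le (Bad : Set (Idx K)) (N : ℝ) (k : Idx K) : gam Bad N k ≤ 1 + N ^ 2 :=
  add_le_add le_rfl (min_le_right _ _)

theorem gam_le_add (Bad : Set (Idx K)) (N : ℝ) (k k' : Idx K) :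
    gam Bad N k ≤ gam Bad N k' + jb k k' := by
  have h1 : Metric.infDist (site k) (site '' Bad) ≤
      Metric.infDist (site k') (site '' Bad) + dist (site k) (site k') :=
    Metric.infDist_le_infDist_add_dist
  rw [dist_eq_norm] at h1
  have h2 := norm_le_jb k k'
  have h3 := jb_pos k k'
  unfold gam
  rcases le_total (Metric.infDist (site k') (site '' Bad)) (N ^ 2) with h | h
  · rw [min_eq_left h]
    linarith [min_le_left (Metric.infDist (site k) (site '' Bad)) (N ^ 2)]
  · rw [min_eq_right h]
    linarith [min_le_right (Metric.infDist (site k) (site '' Bad)) (N ^ 2)]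

theorem gam_eq_one {Bad : Set (Idx K)} {N : ℝ} {k : Idx K} (hk : k ∈ Bad) : gam Bad N k = 1 := by
  rw [gam, Metric.infDist_zero_of_mem (Set.mem_image_of_mem _ hk), min_eq_left (sq_nonneg N), add_zero]

theorem exists_near_of_gam_lt {Bad : Set (Idx K)} {N : ℝ} {k : Idx K} {x : ℝ} (hne : Bad.Nonempty)
    (hx : x ≤ N ^ 2) (h : gam Bad N k < 1 + x) : ∃ o ∈ Bad, ‖site k - site o‖ < x := by
  have h1 : Metric.infDist (site k) (site '' Bad) < x := by
    unfold gam at h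
    rcases min_lt_iff.1 (lt_of_add_lt_add_left h) with h | h
    · exact h
    · linarith
  obtain ⟨_, ⟨o, ho, rfl⟩, h2⟩ := (Metric.infDist_lt_iff (hne.image _)).1 h1
  exact ⟨o, ho, by rwa [dist_eq_norm] at h2⟩

/-- A site is good if it is regular, or if it lies well inside a set `F ⊆ E` such that the
truncation to `F` has an inverse with off-diagonal decay. -/
def GoodSite (m : Idx K → ℂ) (T : Ker K) (E : Finset (Idx K)) (N b z cF : ℝ) (sd : ℕ) (k : Idx K) :
    Prop :=
  1 ≤ ‖m k‖ ∨ ∃ F ⊆ E, k ∈ F ∧ (∀ k' ∈ E, k' ∉ F → N ≤ jb k k') ∧ (∀ k' ∈ F, jb k k' ≤ 3 * N) ∧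
    Coer m T F b ∧ ColDec m T F sd z ∧ (F.card : ℝ) ≤ cF

/-- The diagonal entry is at least `1`, so the equation at `k` can be solved for `u k`; the
smallness of `t` makes the coefficient of the maximum at most one half. The source sits at `k₀`,
where the distance weight equals `1`. -/
theorem weighted_le_of_regular {m : Idx K → ℂ} {T : Ker K} {E : Finset (Idx K)} {u : Seq K}
    {g : Idx K → ℝ} {k k₀ : Idx K} {s p : ℕ} {G M A₀ H t t' Cσ : ℝ}
    (hk : k ∈ E) (hreg : 1 ≤ ‖m k‖) (hg1 : ∀ k', 1 ≤ g k') (hgG : ∀ k', g k' ≤ G)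
    (hg : ∀ k', g k ≤ 3 * g k' + cq p * jb k k' ^ p)
    (h0 : ∀ k ∈ E, k ≠ k₀ → app m T E u k = 0) (hH : ‖app m T E u k₀‖ ≤ H)
    (hM : ∀ k' ∈ E, ‖u k'‖ * jb k' k₀ ^ s * g k' ≤ M) (hM0 : 0 ≤ M)
    (hA : ∀ k' ∈ E, ‖u k'‖ ≤ A₀) (hA0 : 0 ≤ A₀)
    (hσ : ∑ k' ∈ E, (jb k k' ^ (2 * rd K))⁻¹ ≤ Cσ)
    (ht : TB T (p + 2 * rd K) t) (ht0 : 0 ≤ t) (ht' : TB T (s + p) t')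
    (hsmall : (9 + 3 * cq p) * (t * Cσ) ≤ 1 / 2) :
    ‖u k‖ * jb k k₀ ^ s * g k ≤
      M / 2 + (G * H + cq s * (3 + cq p) * G * (E.card * t') * A₀) := by
  have h1 := norm_le_of_regular (m := m) (T := T) (E := E) one_pos hreg u
  rw [inv_one, one_mul] at h1
  have hw : 0 ≤ jb k k₀ ^ s * g k :=
    mul_nonneg (pow_pos (jb_pos _ _) s).le (zero_le_one.trans (hg1 k))
  have h2 : ‖app m T E u k‖ * (jb k k₀ ^ s * g k) ≤ G * H := by
    by_cases hkk : k = k₀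
    · subst hkk
      rw [jb_self, one_pow, one_mul, mul_comm]
      have := hg1 k
      exact mul_le_mul (hgG k) hH (norm_nonneg _) (by linarith [hgG k])
    · rw [h0 k hk hkk, norm_zero, zero_mul]
      exact mul_nonneg (zero_le_one.trans ((hg1 k).trans (hgG k))) ((norm_nonneg _).trans hH)
  have h3 := weighted_sum_le (E := E) (R := fun k' => ‖T k k'‖) (a := fun k' => ‖u k'‖) (g := g)
    (k := k) (k₀ := k₀) (s := s) (p := p) (Y₁ := t * Cσ) (Y₂ := E.card * t')
    (fun _ _ => norm_nonneg _) (fun _ => norm_nonneg _) hg1 hgG hg hM hM0 hA hA0 ?_ ?_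
  · have : (9 + 3 * cq p) * (t * Cσ) * M ≤ 1 / 2 * M := by gcongr
    calc ‖u k‖ * jb k k₀ ^ s * g k = ‖u k‖ * (jb k k₀ ^ s * g k) := by ring
      _ ≤ (‖app m T E u k‖ + ∑ k' ∈ E, ‖T k k'‖ * ‖u k'‖) * (jb k k₀ ^ s * g k) := by gcongr
      _ = ‖app m T E u k‖ * (jb k k₀ ^ s * g k) +
          (∑ k' ∈ E, ‖T k k'‖ * ‖u k'‖) * (jb k k₀ ^ s * g k) := by ring
      _ ≤ _ := by linarith
  · calc ∑ k' ∈ E, ‖T k k'‖ * jb k k' ^ p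
        ≤ ∑ k' ∈ E, t * (jb k k' ^ (2 * rd K))⁻¹ := by
          refine Finset.sum_le_sum fun k' _ => ?_
          have := ht k k'
          rw [pow_add, ← mul_assoc] at this
          rwa [← div_eq_mul_inv, le_div_iff₀ (pow_pos (jb_pos _ _) _)]
      _ = t * ∑ k' ∈ E, (jb k k' ^ (2 * rd K))⁻¹ := by rw [Finset.mul_sum]
      _ ≤ t * Cσ := by gcongr
  · exact sum_le_card_mul fun k' _ => ht' k k'

-- Sources inside `F` cost only the diameter of the box. Couplings to `E \ F` span a distance of at
-- least `N`; the resulting kernel decays with exponent `sd`, of which the weight `g` uses `p`, and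
-- the remaining `N ^ (sd - p)` absorbs the maximum.
set_option maxHeartbeats 1000000 in
theorem weighted_le_of_box {m : Idx K → ℂ} {T : Ker K} {E F : Finset (Idx K)} {u : Seq K}
    {g : Idx K → ℝ} {k k₀ : Idx K} {s p sd : ℕ} {N G M A₀ H t t' b z cF : ℝ} (hN : 1 ≤ N)
    (hF : F ⊆ E) (hk : k ∈ F) (hfar : ∀ k' ∈ E, k' ∉ F → N ≤ jb k k')
    (hdiam : ∀ k' ∈ F, jb k k' ≤ 3 * N) (hC : Coer m T F b) (hcol : ColDec m T F sd z)
    (hcF : (F.card : ℝ) ≤ cF) (hb : 0 ≤ b) (hz : 0 ≤ z) (hpsd : p ≤ sd)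
    (hg1 : ∀ k', 1 ≤ g k') (hgG : ∀ k', g k' ≤ G)
    (hg : ∀ k', g k ≤ 3 * g k' + cq p * jb k k' ^ p)
    (h0 : ∀ k ∈ E, k ≠ k₀ → app m T E u k = 0) (hH : ‖app m T E u k₀‖ ≤ H)
    (hM : ∀ k' ∈ E, ‖u k'‖ * jb k' k₀ ^ s * g k' ≤ M) (hM0 : 0 ≤ M)
    (hA : ∀ k' ∈ E, ‖u k'‖ ≤ A₀) (hA0 : 0 ≤ A₀)
    (ht : TB T sd t) (ht0 : 0 ≤ t) (ht' : TB T (s + p) t') (ht'0 : 0 ≤ t')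
    (hsmall : (9 + 3 * cq p) * (E.card * (cF * (2 ^ sd * (z * t + b * t)))) ≤
      1 / 2 * N ^ (sd - p)) :
    ‖u k‖ * jb k k₀ ^ s * g k ≤
      M / 2 + (b * (3 * N) ^ s * G * H + cq s * (3 + cq p) * G *
        (E.card * (cF * (2 ^ (s + p) * (b * (3 * N) ^ (s + p) * t + b * t')))) * A₀) := by
  classical
  have hcF0 : 0 ≤ cF := (Nat.cast_nonneg _).trans hcF
  have hG : 1 ≤ G := (hg1 k).trans (hgG k)
  have hH0 : 0 ≤ H := (norm_nonneg _).trans hH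
  -- Both bounds on the columns are kept: the decay is used for the power `sd`, while for the power
  -- `s + p` the ℓ² bound `b` together with the diameter `3 N` of the box suffices.
  let Z : Idx K → Idx K → ℝ := fun k k' => min b (z / jb k k' ^ sd)
  have hj : ∀ (k k' : Idx K) (n : ℕ), 0 < jb k k' ^ n := fun k k' n => pow_pos (jb_pos _ _) n
  have hZ0 : ∀ k k', 0 ≤ Z k k' := fun k k' => le_min hb (div_nonneg hz (hj _ _ _).le)
  have hZb : ∀ k k', Z k k' ≤ b := fun k k' => min_le_left _ _
  have hZz : ∀ k k', Z k k' * jb k k' ^ sd ≤ z := fun k k' =>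
    (mul_le_mul_of_nonneg_right (min_le_right _ _) (hj _ _ _).le).trans
      (div_mul_cancel₀ _ (hj _ _ _).ne').le
  have hZ : ∀ k₀ ∈ F, ∀ u, SuppIn F u → (∀ k ∈ F, k ≠ k₀ → app m T F u k = 0) →
      ∀ k ∈ F, ‖u k‖ ≤ Z k k₀ * ‖app m T F u k₀‖ := by
    intro k₀ hk₀ u hu h0 k hk
    rw [min_mul_of_nonneg _ _ (norm_nonneg _)]
    apply le_min
    · refine (norm_le_l2 hk u).trans ((hC u hu).trans (mul_le_mul_of_nonneg_left ?_ hb))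
      refine (l2_le_sum _ _).trans (le_of_eq ?_)
      exact Finset.sum_eq_single_of_mem k₀ hk₀ fun k hk hne => by rw [h0 k hk hne, norm_zero]
    · rw [div_mul_eq_mul_div, le_div_iff₀ (hj _ _ _)]
      exact hcol k₀ hk₀ u hu h0 k hk
  have h1 := norm_le_of_box hF hC hZ0 hZ hk u
  have hw : 0 ≤ jb k k₀ ^ s * g k := mul_nonneg (hj _ _ _).le (zero_le_one.trans (hg1 k))
  have h2 : (∑ k₁ ∈ F, Z k k₁ * ‖app m T E u k₁‖) * (jb k k₀ ^ s * g k) ≤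
      b * (3 * N) ^ s * G * H := by
    by_cases hk₀ : k₀ ∈ F
    · rw [Finset.sum_eq_single_of_mem k₀ hk₀ fun k hk hne => by
        rw [h0 k (hF hk) hne, norm_zero, mul_zero]]
      calc Z k k₀ * ‖app m T E u k₀‖ * (jb k k₀ ^ s * g k)
          ≤ b * H * ((3 * N) ^ s * G) := by
            have e1 := hdiam k₀ hk₀
            have e2 := jb_pos k k₀
            have e3 := hgG k
            have e4 := hg1 k
            have e5 := hZb k k₀
            gcongr
        _ = _ := by ring
    · rw [Finset.sum_eq_zero fun k₁ hk₁ => by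
        rw [h0 k₁ (hF hk₁) (fun h => hk₀ (h ▸ hk₁)), norm_zero, mul_zero], zero_mul]
      positivity
  obtain ⟨R, hR⟩ : ∃ R : Idx K → ℝ, ∀ k', R k' = ∑ k₁ ∈ F, Z k k₁ * ‖T k₁ k'‖ := ⟨_, fun _ => rfl⟩
  have hR0 : ∀ k', 0 ≤ R k' := fun k' => hR k' ▸
    Finset.sum_nonneg fun k₁ _ => mul_nonneg (hZ0 _ _) (norm_nonneg _)
  have hcard : (((E \ F).card : ℕ) : ℝ) ≤ E.card := by
    exact_mod_cast Finset.card_le_card Finset.sdiff_subset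
  set Y := E.card * (cF * (2 ^ sd * (z * t + b * t))) with hY
  have h3 := weighted_sum_le (E := E \ F) (R := R) (a := fun k' => ‖u k'‖) (g := g)
    (k := k) (k₀ := k₀) (s := s) (p := p) (Y₁ := Y / N ^ (sd - p))
    (Y₂ := E.card * (cF * (2 ^ (s + p) * (b * (3 * N) ^ (s + p) * t + b * t'))))
    (fun _ _ => hR0 _) (fun _ => norm_nonneg _) hg1 hgG hg
    (fun k' hk' => hM k' (Finset.sdiff_subset hk')) hM0
    (fun k' hk' => hA k' (Finset.sdiff_subset hk')) hA0 ?_ ?_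
  · have e1 : (9 + 3 * cq p) * (Y / N ^ (sd - p)) * M ≤ 1 / 2 * M := by
      refine mul_le_mul_of_nonneg_right ?_ hM0
      rw [← mul_div_assoc, div_le_iff₀ (by positivity)]
      exact hsmall
    calc ‖u k‖ * jb k k₀ ^ s * g k = ‖u k‖ * (jb k k₀ ^ s * g k) := by ring
      _ ≤ (∑ k₁ ∈ F, Z k k₁ * ‖app m T E u k₁‖ + ∑ k' ∈ E \ F, R k' * ‖u k'‖) *
          (jb k k₀ ^ s * g k) := by
          simp only [← hR] at h1
          exact mul_le_mul_of_nonneg_right h1 hw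
      _ = (∑ k₁ ∈ F, Z k k₁ * ‖app m T E u k₁‖) * (jb k k₀ ^ s * g k) +
          (∑ k' ∈ E \ F, R k' * ‖u k'‖) * (jb k k₀ ^ s * g k) := by ring
      _ ≤ _ := by linarith
  · rw [le_div_iff₀ (by positivity), Finset.sum_mul]
    refine (sum_le_card_mul (c := cF * (2 ^ sd * (z * t + b * t))) fun k' hk' => ?_).trans
      (mul_le_mul_of_nonneg_right hcard (by positivity))
    have hk2 := Finset.mem_sdiff.1 hk'
    have e1 := box_kernel_decay (T := T) (F := F) (Z := Z) (s := sd) (k := k) (k' := k')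
      (hZ0 k) (hZb k) (fun k' _ => hZz k k') ht.norm_le ht hcF hb hz ht0 ht0
    rw [← hR] at e1
    refine le_trans ?_ e1
    have e2 : N ^ (sd - p) ≤ jb k k' ^ (sd - p) :=
      pow_le_pow_left₀ (by linarith) (hfar k' hk2.1 hk2.2) _
    calc R k' * jb k k' ^ p * N ^ (sd - p) ≤ R k' * jb k k' ^ p * jb k k' ^ (sd - p) := by
          exact mul_le_mul_of_nonneg_left e2 (mul_nonneg (hR0 k') (hj k k' p).le)
      _ = R k' * jb k k' ^ sd := by
          have e3 : jb k k' ^ sd = jb k k' ^ p * jb k k' ^ (sd - p) := by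
            rw [← pow_add, Nat.add_sub_of_le hpsd]
          rw [e3, mul_assoc]
  · refine (sum_le_card_mul (c := cF * (2 ^ (s + p) * (b * (3 * N) ^ (s + p) * t + b * t')))
      fun k' hk' => ?_).trans (mul_le_mul_of_nonneg_right hcard (by positivity))
    rw [hR]
    refine box_kernel_decay (T := T) (F := F) (Z := Z) (s := s + p) (k := k) (k' := k')
      (hZ0 k) (hZb k) (fun k' hk' => ?_) ht.norm_le ht' hcF hb (by positivity) ht0 ht'0
    exact mul_le_mul (hZb _ _) (pow_le_pow_left₀ (jb_pos _ _).le (hdiam k' hk') _)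
      (hj _ _ _).le hb

-- Nothing local is known about the inverse near a cluster, so `u` is cut off to a neighbourhood of
-- the cluster and the ℓ² bound on `E` is used. The gain comes from the commutator: an entry across
-- the boundary either joins sites at distance of order `N²`, or ends far from all bad sites, where
-- the weight `gam ^ p` is of order `N ^ (2 p)`. Either way a factor `N ^ (-2 p)` beats `b`.
set_option maxHeartbeats 1000000 in
open Classical in
theorem weighted_le_of_bad {m : Idx K → ℂ} {T : Ker K} {E : Finset (Idx K)} {u : Seq K}
    {Bad Om : Set (Idx K)} {k k₀ : Idx K} {s p : ℕ} {N M A₀ H t t' b X : ℝ} (hN : 1 ≤ N)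
    (hb : 0 ≤ b) (hC : Coer m T E b) (hOm : Om ⊆ Bad) (hBE : ∀ o ∈ Bad, o ∈ E) (hk : k ∈ Om)
    (hX1 : 1 ≤ X)
    (hdiam : ∀ o ∈ Om, ∀ k' : Idx K, 4 * ‖site k' - site o‖ ≤ N ^ 2 → jb k k' ≤ X)
    (hsep : ∀ o ∈ Om, ∀ o' ∈ Bad, o' ∉ Om → N ^ 2 < ‖site o' - site o‖)
    (h0 : ∀ k ∈ E, k ≠ k₀ → app m T E u k = 0) (hH : ‖app m T E u k₀‖ ≤ H)
    (hM : ∀ k' ∈ E, ‖u k'‖ * jb k' k₀ ^ s * gam Bad N k' ^ p ≤ M) (hM0 : 0 ≤ M)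
    (hA : ∀ k' ∈ E, ‖u k'‖ ≤ A₀) (hA0 : 0 ≤ A₀)
    (ht : TB T p t) (ht0 : 0 ≤ t) (ht' : TB T s t') (ht'0 : 0 ≤ t')
    (hsmall : 3 * b * E.card ^ 2 * t * 8 ^ p ≤ 1 / 2 * N ^ (2 * p)) :
    ‖u k‖ * jb k k₀ ^ s * gam Bad N k ^ p ≤
      M / 2 + (b * X ^ s * H + b * E.card ^ 2 * (cq s * (2 * X) ^ s * t' * A₀)) := by
  have hH0 : 0 ≤ H := (norm_nonneg _).trans hH
  have hj : ∀ (k k' : Idx K) (n : ℕ), 0 < jb k k' ^ n := fun k k' n => pow_pos (jb_pos _ _) n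
  have hkB := hOm hk
  -- The radius `N²/4` leaves room on both sides: balls of radius `N²/8` around sites of `Om` stay
  -- inside `U` (within `E`), those around the other bad sites stay outside, and in both cases the
  -- boundary of `U` is at least `N²/8` away.
  let U : Finset (Idx K) := E.filter fun k' => ∃ o ∈ Om, 4 * ‖site k' - site o‖ ≤ N ^ 2
  have hUE : U ⊆ E := Finset.filter_subset _ _
  have hmemU : ∀ k', k' ∈ U ↔ k' ∈ E ∧ ∃ o ∈ Om, 4 * ‖site k' - site o‖ ≤ N ^ 2 := fun k' =>
    Finset.mem_filter
  have hkU : k ∈ U := (hmemU k).2 ⟨hBE k hkB, k, hk, by simp; positivity⟩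
  have hUX : ∀ k' ∈ U, jb k k' ≤ X := fun k' hk' => by
    obtain ⟨_, o, ho, h⟩ := (hmemU k').1 hk'
    exact hdiam o ho k' h
  have h1 := norm_le_of_cutoff hUE hb hC hkU u
  have hw := hj k k₀ s
  rw [gam_eq_one hkB, one_pow, mul_one]
  have h2 : (∑ k₁ ∈ U, ‖app m T E u k₁‖) * jb k k₀ ^ s ≤ X ^ s * H := by
    by_cases hk₀ : k₀ ∈ U
    · rw [Finset.sum_eq_single_of_mem k₀ hk₀ fun k hk hne => by
        rw [h0 k (hUE hk) hne, norm_zero], mul_comm]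
      exact mul_le_mul (pow_le_pow_left₀ (jb_pos _ _).le (hUX k₀ hk₀) _) hH (norm_nonneg _)
        (by positivity)
    · rw [Finset.sum_eq_zero fun k₁ hk₁ => by
        rw [h0 k₁ (hUE hk₁) (fun h => hk₀ (h ▸ hk₁)), norm_zero], zero_mul]
      positivity
  have hN2 : 0 < N ^ (2 * p) := by positivity
  set Y := 3 * (t * 8 ^ p / N ^ (2 * p) * M) + cq s * (2 * X) ^ s * t' * A₀ with hY
  have hY0 : 0 ≤ Y := by have := cq_pos s; positivity
  have h3 : ∀ k₁ ∈ E, ∀ k' ∈ E, ¬ (k₁ ∈ U ↔ k' ∈ U) → ‖T k₁ k'‖ * ‖u k'‖ * jb k k₀ ^ s ≤ Y := by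
    intro k₁ hk₁ k' hk' hne
    set y := jb k₁ k' with hy
    have hy1 : 1 ≤ y := one_le_jb _ _
    have hjk : jb k k' ≤ 2 * X * y := by
      by_cases hU1 : k₁ ∈ U
      · have := jb_triangle k k₁ k'
        have := hUX k₁ hU1
        nlinarith
      · have hU2 : k' ∈ U := by tauto
        have := hUX k' hU2
        nlinarith
    have q1 : jb k k₀ ^ s ≤ 3 * jb k' k₀ ^ s + cq s * ((2 * X) ^ s * y ^ s) := by
      have e1 : jb k k₀ ^ s ≤ 3 * jb k' k₀ ^ s + cq s * jb k k' ^ s := jb_pow_quasi s k k' k₀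
      have e2 : jb k k' ^ s ≤ (2 * X) ^ s * y ^ s := by
        rw [← mul_pow]; exact pow_le_pow_left₀ (jb_pos _ _).le hjk s
      have := cq_pos s
      nlinarith
    have hγ := one_le_gam Bad N k'
    have q2 : ‖T k₁ k'‖ ≤ t * 8 ^ p / N ^ (2 * p) * gam Bad N k' ^ p := by
      rw [div_mul_eq_mul_div, le_div_iff₀ hN2]
      have e8 : t * 8 ^ p * gam Bad N k' ^ p = t * (8 * gam Bad N k') ^ p := by rw [mul_pow]; ring
      rw [e8, pow_mul]
      -- Either the weight at `k'` supplies the factor `N ^ (2 p)`, or `k'` is within `N²/8` of a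
      -- bad site `o`, and then the choice of `U` forces `8 jb k₁ k' ≥ N²`, so that the decay of `T`
      -- supplies it.
      by_cases hfar : N ^ 2 ≤ 8 * gam Bad N k'
      · exact mul_le_mul (ht.norm_le _ _) (pow_le_pow_left₀ (by positivity) hfar p)
          (by positivity) ht0
      · have hlt : gam Bad N k' < 1 + N ^ 2 / 8 := by linarith
        obtain ⟨o, ho, hok⟩ := exists_near_of_gam_lt ⟨k, hkB⟩ (by nlinarith) hlt
        have hy8 : N ^ 2 ≤ 8 * y := by
          have hny := norm_le_jb k₁ k'
          by_cases hoO : o ∈ Om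
          · have hk'U : k' ∈ U := (hmemU k').2 ⟨hk', o, hoO, by nlinarith⟩
            have hk₁U : k₁ ∉ U := by tauto
            have e3 : ¬ 4 * ‖site k₁ - site o‖ ≤ N ^ 2 := fun h =>
              hk₁U ((hmemU k₁).2 ⟨hk₁, o, hoO, h⟩)
            have := norm_sub_le_norm_sub_add_norm_sub (site k₁) (site k') (site o)
            linarith
          · have hk'U : k' ∉ U := by
              intro h
              obtain ⟨_, o', ho', h'⟩ := (hmemU k').1 h
              have e4 := hsep o' ho' o ho hoO
              have := norm_sub_le_norm_sub_add_norm_sub (site o) (site k') (site o')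
              rw [norm_sub_rev (site o) (site k')] at this
              nlinarith
            have hk₁U : k₁ ∈ U := by tauto
            obtain ⟨_, o', ho', h'⟩ := (hmemU k₁).1 hk₁U
            have e4 := hsep o' ho' o ho hoO
            have e5 := norm_sub_le_norm_sub_add_norm_sub (site o) (site k') (site o')
            have e6 := norm_sub_le_norm_sub_add_norm_sub (site k') (site k₁) (site o')
            rw [norm_sub_rev (site o) (site k')] at e5
            rw [norm_sub_rev (site k') (site k₁)] at e6
            nlinarith
        calc ‖T k₁ k'‖ * (N ^ 2) ^ p ≤ ‖T k₁ k'‖ * (8 * y) ^ p := by gcongr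
          _ = (‖T k₁ k'‖ * y ^ p) * 8 ^ p := by rw [mul_pow]; ring
          _ ≤ t * 8 ^ p := by gcongr; exact ht k₁ k'
          _ ≤ t * (8 * gam Bad N k') ^ p := by gcongr; linarith
    have hx := hj k' k₀ s
    calc ‖T k₁ k'‖ * ‖u k'‖ * jb k k₀ ^ s
        ≤ ‖T k₁ k'‖ * ‖u k'‖ * (3 * jb k' k₀ ^ s + cq s * ((2 * X) ^ s * y ^ s)) := by gcongr
      _ = 3 * (‖T k₁ k'‖ * (‖u k'‖ * jb k' k₀ ^ s)) +
          cq s * (2 * X) ^ s * (‖T k₁ k'‖ * y ^ s) * ‖u k'‖ := by ring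
      _ ≤ 3 * (t * 8 ^ p / N ^ (2 * p) * gam Bad N k' ^ p * (‖u k'‖ * jb k' k₀ ^ s)) +
          cq s * (2 * X) ^ s * t' * A₀ := by
          have := cq_pos s
          have e7 := ht' k₁ k'
          have e8 := hA k' hk'
          gcongr
      _ = 3 * (t * 8 ^ p / N ^ (2 * p) * (‖u k'‖ * jb k' k₀ ^ s * gam Bad N k' ^ p)) +
          cq s * (2 * X) ^ s * t' * A₀ := by ring
      _ ≤ Y := by
          have := hM k' hk'
          rw [hY]
          gcongr
  have h4 : (∑ k₁ ∈ E, ∑ k' ∈ E with ¬ (k₁ ∈ U ↔ k' ∈ U), ‖T k₁ k'‖ * ‖u k'‖) * jb k k₀ ^ s ≤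
      E.card ^ 2 * Y := by
    rw [Finset.sum_mul, sq, mul_assoc]
    refine sum_le_card_mul fun k₁ hk₁ => ?_
    rw [Finset.sum_mul]
    refine (sum_le_card_mul (c := Y) fun k' hk' => ?_).trans
      (mul_le_mul_of_nonneg_right ?_ hY0)
    · have := Finset.mem_filter.1 hk'
      exact h3 k₁ hk₁ k' this.1 this.2
    · exact_mod_cast Finset.card_le_card (Finset.filter_subset _ _)
  have h5 : b * (E.card ^ 2 * (3 * (t * 8 ^ p / N ^ (2 * p) * M))) ≤ M / 2 := by
    have e1 : 3 * b * E.card ^ 2 * t * 8 ^ p / N ^ (2 * p) ≤ 1 / 2 := by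
      rw [div_le_iff₀ hN2]; exact hsmall
    calc b * (E.card ^ 2 * (3 * (t * 8 ^ p / N ^ (2 * p) * M)))
        = 3 * b * E.card ^ 2 * t * 8 ^ p / N ^ (2 * p) * M := by ring
      _ ≤ 1 / 2 * M := mul_le_mul_of_nonneg_right e1 hM0
      _ = M / 2 := by ring
  calc ‖u k‖ * jb k k₀ ^ s
      ≤ b * (∑ k₁ ∈ U, ‖app m T E u k₁‖ +
        ∑ k₁ ∈ E, ∑ k' ∈ E with ¬ (k₁ ∈ U ↔ k' ∈ U), ‖T k₁ k'‖ * ‖u k'‖) * jb k k₀ ^ s := by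
        gcongr
    _ = b * ((∑ k₁ ∈ U, ‖app m T E u k₁‖) * jb k k₀ ^ s +
        (∑ k₁ ∈ E, ∑ k' ∈ E with ¬ (k₁ ∈ U ↔ k' ∈ U), ‖T k₁ k'‖ * ‖u k'‖) * jb k k₀ ^ s) := by ring
    _ ≤ b * (X ^ s * H + E.card ^ 2 * Y) := by gcongr
    _ = b * (E.card ^ 2 * (3 * (t * 8 ^ p / N ^ (2 * p) * M))) +
        (b * X ^ s * H + b * E.card ^ 2 * (cq s * (2 * X) ^ s * t' * A₀)) := by rw [hY]; ring
    _ ≤ _ := by linarith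

/-! ### Truncated matrices as operators -/

/-- The kernel of a block matrix. -/
def blk (M : BlockMatrix K) : Ker K := fun k k' =>
  LinearMap.toContinuousLinearMap (Matrix.toEuclideanLin (M k k'))

theorem blk_apply (M : BlockMatrix K) (k k' : Idx K) (x : EuclideanSpace ℂ (Fin (dim k')))
    (c : Fin (dim k)) : blk M k k' x c = ∑ c', M k k' c c' * x c' := by
  simp [blk, Matrix.toEuclideanLin, Matrix.mulVec, dotProduct]

theorem opNorm_nonneg {m n : Type} [Fintype m] [Fintype n] (M : Matrix m n ℂ) : 0 ≤ opNorm M :=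
  norm_nonneg _

theorem norm_toEuclideanLin_le {m n : Type} [Fintype m] [Fintype n] [DecidableEq n]
    (M : Matrix m n ℂ) (x : EuclideanSpace ℂ n) :
    ‖Matrix.toEuclideanLin M x‖ ≤ opNorm M * ‖x‖ := by
  have e : opNorm M = ‖LinearMap.toContinuousLinearMap (Matrix.toEuclideanLin M)‖ := by
    unfold opNorm; congr!
  rw [e]
  exact (LinearMap.toContinuousLinearMap (Matrix.toEuclideanLin M)).le_opNorm x

/-- The block is a compression of the site block: extend a vector by zero to the other elements of
`𝔄`, and keep one component of the image. -/
theorem norm_blk_le (M : BlockMatrix K) (k k' : Idx K) :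
    ‖blk M k k'‖ ≤ opNorm (siteBlock M (k.1, k.2.1) (k'.1, k'.2.1)) := by
  classical
  refine ContinuousLinearMap.opNorm_le_bound _ (opNorm_nonneg _) fun x => ?_
  let X : EuclideanSpace ℂ (K.A × Fin (K.mult k'.2.1)) :=
    WithLp.toLp 2 fun y => if y.1 = k'.2.2 then x y.2 else 0
  have hX : ‖X‖ = ‖x‖ := by
    rw [EuclideanSpace.norm_eq, EuclideanSpace.norm_eq, Fintype.sum_prod_type]
    congr 1
    rw [Finset.sum_eq_single k'.2.2]
    · simp [X]
    · intro a _ ha; simp [X, ha]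
    · simp
  have h1 := norm_toEuclideanLin_le (siteBlock M (k.1, k.2.1) (k'.1, k'.2.1)) X
  rw [hX] at h1
  refine le_trans ?_ h1
  rw [EuclideanSpace.norm_eq, EuclideanSpace.norm_eq, Fintype.sum_prod_type]
  apply Real.sqrt_le_sqrt
  have h2 : ∀ c, (Matrix.toEuclideanLin (siteBlock M (k.1, k.2.1) (k'.1, k'.2.1)) X) (k.2.2, c) =
      blk M k k' x c := by
    intro c
    rw [blk_apply]
    simp only [Matrix.toEuclideanLin, Matrix.toLpLin_apply,
      Matrix.mulVec, dotProduct, Fintype.sum_prod_type]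
    rw [Finset.sum_eq_single k'.2.2]
    · simp [X, siteBlock]
    · intro a _ ha; simp [X, ha]
    · simp
  simp only [← h2]
  exact Finset.single_le_sum (f := fun a => ∑ c, ‖(Matrix.toEuclideanLin
    (siteBlock M (k.1, k.2.1) (k'.1, k'.2.1)) X) (a, c)‖ ^ 2)
    (fun a _ => Finset.sum_nonneg fun c _ => by positivity) (Finset.mem_univ k.2.2)

/-- Keeping a single term of the sum, and a single pair in the supremum, turns the decay norm into
pointwise decay of the blocks. -/
theorem norm_blk_mul_jb_le {K₁ : ℝ} (hK : 0 < K₁) {M : BlockMatrix K} {s : ℕ} {c : ℝ} (hc : 0 ≤ c)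
    (h : decayNorm K₁ s M ≤ ENNReal.ofReal c) (k k' : Idx K) :
    ‖blk M k k'‖ * jb k k' ^ s ≤ c / Real.sqrt K₁ := by
  have h1 : ENNReal.ofReal ‖blk M k k'‖ ≤ diagSup M (site k - site k') := by
    refine (ENNReal.ofReal_le_ofReal (norm_blk_le M k k')).trans ?_
    unfold diagSup
    refine le_iSup_of_le (k.1, k.2.1) (le_iSup_of_le (k'.1, k'.2.1) (le_iSup_of_le rfl le_rfl))
  have h2 : ENNReal.ofReal K₁ * (ENNReal.ofReal ‖blk M k k'‖ ^ 2 *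
      ENNReal.ofReal (jb k k' ^ (2 * (s : ℝ)))) ≤ ENNReal.ofReal c ^ 2 := by
    have h3 : ENNReal.ofReal K₁ * (ENNReal.ofReal ‖blk M k k'‖ ^ 2 *
      ENNReal.ofReal (jb k k' ^ (2 * (s : ℝ)))) ≤ decayNorm K₁ s M ^ 2 := by
      unfold decayNorm
      have e : ∀ x : ℝ≥0∞, (x ^ (1 / 2 : ℝ)) ^ 2 = x := fun x => by
        rw [← ENNReal.rpow_natCast, ← ENNReal.rpow_mul]; norm_num
      rw [e]
      gcongr
      refine le_trans ?_ (ENNReal.le_tsum (site k - site k'))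
      have h1' := pow_le_pow_left' h1 2
      exact mul_le_mul' h1' le_rfl
    exact h3.trans (pow_le_pow_left' h 2)
  have hj := jb_pos k k'
  have h4 : K₁ * (‖blk M k k'‖ ^ 2 * (jb k k' ^ s) ^ 2) ≤ c ^ 2 := by
    rw [← ENNReal.ofReal_pow (norm_nonneg _), ← ENNReal.ofReal_mul (by positivity),
      ← ENNReal.ofReal_mul hK.le, ← ENNReal.ofReal_pow hc,
      ENNReal.ofReal_le_ofReal_iff (by positivity)] at h2
    have e : jb k k' ^ (2 * (s : ℝ)) = (jb k k' ^ s) ^ 2 := by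
      rw [← pow_mul, mul_comm s 2, ← Real.rpow_natCast]; norm_num
    rwa [e] at h2
  rw [le_div_iff₀ (Real.sqrt_pos.2 hK)]
  apply abs_le_of_sq_le_sq' _ hc |>.2
  rw [mul_pow, mul_pow, Real.sq_sqrt hK.le]
  linarith

/-- A square matrix that is bounded below is injective, hence invertible, and the lower bound is
exactly a norm bound for the inverse. -/
theorem invBound_iff {n : Type} [Fintype n] [DecidableEq n] {A : Matrix n n ℂ} {b : ℝ} (hb : 0 ≤ b) :
    InvBound A b ↔ ∀ x : EuclideanSpace ℂ n, ‖x‖ ≤ b * ‖Matrix.toEuclideanLin A x‖ := by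
  have hmul : ∀ (P Q : Matrix n n ℂ) (x : EuclideanSpace ℂ n),
      Matrix.toEuclideanLin P (Matrix.toEuclideanLin Q x) = Matrix.toEuclideanLin (P * Q) x := by
    intro P Q x
    simp [Matrix.toEuclideanLin, Matrix.toLpLin_apply, Matrix.mulVec_mulVec]
  have hone : ∀ x : EuclideanSpace ℂ n, Matrix.toEuclideanLin (1 : Matrix n n ℂ) x = x := by
    intro x
    simp [Matrix.toEuclideanLin]
  constructor
  · rintro ⟨R, -, h2, h3⟩ x
    have e : R * A = 1 := by rw [h2]; congr!
    calc ‖x‖ = ‖Matrix.toEuclideanLin R (Matrix.toEuclideanLin A x)‖ := by rw [hmul, e, hone]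
      _ ≤ opNorm R * ‖Matrix.toEuclideanLin A x‖ := norm_toEuclideanLin_le _ _
      _ ≤ _ := by gcongr
  · intro h
    have hinj : Function.Injective A.mulVec := by
      intro x y hxy
      have h1 := h (WithLp.toLp 2 (x - y))
      have h2 : Matrix.toEuclideanLin A (WithLp.toLp 2 (x - y)) = 0 := by
        simp only [Matrix.toEuclideanLin, Matrix.toLpLin_apply,
          Matrix.mulVec_sub]
        rw [hxy, sub_self]; rfl
      rw [h2, norm_zero, mul_zero] at h1
      have h3 : WithLp.toLp 2 (x - y) = 0 := norm_le_zero_iff.1 h1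
      exact sub_eq_zero.1 (congrArg WithLp.ofLp h3)
    have hu := Matrix.mulVec_injective_iff_isUnit.1 hinj
    have hu' := (Matrix.isUnit_iff_isUnit_det A).1 hu
    have e1 := Matrix.mul_nonsing_inv A hu'
    have e2 := Matrix.nonsing_inv_mul A hu'
    refine ⟨A⁻¹, by rw [e1]; congr!, by rw [e2]; congr!, ?_⟩
    have : opNorm A⁻¹ = ‖LinearMap.toContinuousLinearMap (Matrix.toEuclideanLin A⁻¹)‖ := by
      unfold opNorm; congr!
    rw [this]
    refine ContinuousLinearMap.opNorm_le_bound _ hb fun x => ?_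
    have h1 := h (Matrix.toEuclideanLin A⁻¹ x)
    rwa [hmul, e1, hone] at h1

/-- The components of `u` with indices in a box, as a vector. -/
def vec (N : ℕ) (i : Site K) (u : Seq K) : EuclideanSpace ℂ (Σ k : box N i, Fin (dim k.1)) :=
  WithLp.toLp 2 fun x => u x.1.1 x.2

theorem sum_box_eq {β : Type*} [AddCommMonoid β] (N : ℕ) (i : Site K) (f : Idx K → β) :
    ∑ k : box N i, f k.1 = ∑ k ∈ bx N i, f k :=
  (Finset.sum_subtype (bx N i) (fun x => by simp [bx]) f).symm

theorem norm_vec (N : ℕ) (i : Site K) (u : Seq K) : ‖vec N i u‖ = l2 (bx N i) u := by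
  rw [EuclideanSpace.norm_eq, l2, Fintype.sum_sigma, ← sum_box_eq]
  congr 1
  refine Finset.sum_congr rfl fun k _ => ?_
  rw [EuclideanSpace.norm_sq_eq]
  rfl

theorem exists_vec_eq (N : ℕ) (i : Site K) (x : EuclideanSpace ℂ (Σ k : box N i, Fin (dim k.1))) :
    ∃ u, SuppIn (bx N i) u ∧ vec N i u = x := by
  classical
  refine ⟨fun k => if hk : k ∈ box N i then WithLp.toLp 2 fun c => x ⟨⟨k, hk⟩, c⟩ else 0, ?_, ?_⟩
  · intro k hk
    have : k ∉ box N i := fun h => hk (by simpa [bx] using h)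
    simp [this]
  · ext ⟨⟨k, hk⟩, c⟩
    simp [vec]

open Classical in
theorem toEuclideanLin_trunc (m : Idx K → ℂ) (ε : ℝ) (J : BlockMatrix K) (N : ℕ) (i : Site K)
    (u : Seq K) :
    Matrix.toEuclideanLin (trunc (diagMatrix m + (ε : ℂ) • J) N i) (vec N i u) =
      vec N i (app m (fun k k' => (ε : ℂ) • blk J k k') (bx N i) u) := by
  ext ⟨⟨k, hk⟩, c⟩
  have hkb : k ∈ bx N i := by simpa [bx] using hk
  simp only [Matrix.toEuclideanLin, Matrix.toLpLin_apply, Matrix.mulVec,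
    dotProduct, Fintype.sum_sigma, vec, app_apply, trunc, Matrix.of_apply]
  rw [sum_box_eq N i fun k' => ∑ c', (diagMatrix m + (ε : ℂ) • J) k k' c c' * u k' c']
  have h1 : ∀ k', ∑ c', (diagMatrix m + (ε : ℂ) • J) k k' c c' * u k' c' =
      (∑ c', diagMatrix m k k' c c' * u k' c') + ε * blk J k k' (u k') c := by
    intro k'
    rw [blk_apply, Finset.mul_sum, ← Finset.sum_add_distrib]
    refine Finset.sum_congr rfl fun c' _ => ?_
    simp only [Pi.add_apply, Pi.smul_apply, Matrix.add_apply, Matrix.smul_apply, smul_eq_mul]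
    ring
  rw [Finset.sum_congr rfl fun k' _ => h1 k', Finset.sum_add_distrib]
  have h2 : ∑ k' ∈ bx N i, ∑ c', diagMatrix m k k' c c' * u k' c' = m k * u k c := by
    rw [Finset.sum_eq_single_of_mem k hkb, Finset.sum_eq_single_of_mem c (Finset.mem_univ _)]
    · simp [diagMatrix]
    · intro c' _ hc
      have : ¬ ((c : ℕ) = (c' : ℕ)) := fun h => hc (Fin.ext h.symm)
      simp [diagMatrix, this]
    · intro k' _ hk'
      refine Finset.sum_eq_zero fun c' _ => ?_
      have : ¬ (k = k') := fun h => hk' h.symm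
      simp [diagMatrix, this]
  rw [h2]
  simp [Finset.sum_apply]

/-- The bridge from the matrix language of the parameter sets to the coercivity estimates used in
the analysis. -/
theorem invBound_trunc_iff {m : Idx K → ℂ} {ε : ℝ} {J : BlockMatrix K} {N : ℕ} {i : Site K} {b : ℝ}
    (hb : 0 ≤ b) : InvBound (trunc (diagMatrix m + (ε : ℂ) • J) N i) b ↔
      Coer m (fun k k' => (ε : ℂ) • blk J k k') (bx N i) b := by
  classical
  rw [invBound_iff hb]
  constructor
  · intro h u _
    have := h (vec N i u)
    rwa [toEuclideanLin_trunc, norm_vec, norm_vec] at this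
  · intro h x
    obtain ⟨u, hu, rfl⟩ := exists_vec_eq N i x
    rw [toEuclideanLin_trunc, norm_vec, norm_vec]
    exact h u hu

theorem l2_le_card_mul {E : Finset (Idx K)} {T : Ker K} {t : ℝ} (ht : ∀ k k', ‖T k k'‖ ≤ t)
    (u : Seq K) : l2 E (fun k => ∑ k' ∈ E, T k k' (u k')) ≤ E.card ^ 2 * t * l2 E u := by
  refine (l2_le_sum _ _).trans ?_
  rw [sq, mul_assoc, mul_assoc]
  refine sum_le_card_mul fun k hk => (norm_sum_le _ _).trans (sum_le_card_mul fun k' hk' => ?_)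
  exact ((T k k').le_opNorm _).trans
    (mul_le_mul (ht _ _) (norm_le_l2 hk' u) (norm_nonneg _) ((norm_nonneg _).trans (ht k k')))

/-- The difference of the kernels has ℓ² norm at most `card² t`; the passage from `b / 2` to `b`
pays for it. This is where the factor `1/2` in the parameter sets is spent. -/
theorem Coer.perturb {m : Idx K → ℂ} {T T' : Ker K} {E : Finset (Idx K)} {b t : ℝ} (hb : 0 ≤ b)
    (h : Coer m T E (b / 2)) (ht : ∀ k k', ‖T k k' - T' k k'‖ ≤ t)
    (hs : b * (E.card ^ 2 * t) ≤ 1) : Coer m T' E b := by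
  intro u hu
  have h1 := h u hu
  have h2 : app m T E u = app m T' E u + fun k => ∑ k' ∈ E, (T k k' - T' k k') (u k') := by
    funext k
    simp only [Pi.add_apply, app_apply, sub_apply, Finset.sum_sub_distrib]
    abel
  have h3 := l2_add_le E (app m T' E u) (fun k => ∑ k' ∈ E, (T k k' - T' k k') (u k'))
  rw [← h2] at h3
  have h4 := l2_le_card_mul (E := E) (T := fun k k' => T k k' - T' k k') ht u
  have h5 := l2_nonneg E u
  have h6 : b * (E.card ^ 2 * t * l2 E u) ≤ l2 E u := by
    calc b * (E.card ^ 2 * t * l2 E u) = b * (E.card ^ 2 * t) * l2 E u := by ring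
      _ ≤ 1 * l2 E u := by gcongr
      _ = _ := one_mul _
  have h7 : l2 E u ≤ b / 2 * (l2 E (app m T' E u) + E.card ^ 2 * t * l2 E u) :=
    h1.trans (by gcongr; linarith)
  linarith

/-! ### The multiscale step -/

/-- A maximum argument for a column with source at `k₀`: each kind of site returns at most half the
weighted maximum plus its own error, so the maximum is at most twice the sum of the three errors.
The weight `g` is at least `1` and can be dropped at the end. The smallness conditions `hs1`, `hs2`,
`hs3` do not involve `s`. -/
theorem colDec_of_goodSites {m : Idx K → ℂ} {T : Ker K} {E : Finset (Idx K)} {Bad : Set (Idx K)}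
    {s p sd : ℕ} {N G t t' b b' z cF X Cσ : ℝ} (hN : 1 ≤ N) (hb : 0 ≤ b) (hb' : 0 ≤ b') (hz : 0 ≤ z)
    (hcF : 0 ≤ cF) (hpsd : p ≤ sd) (hX : 1 ≤ X) (hG : (1 + N ^ 2) ^ p ≤ G) (hC : Coer m T E b')
    (hsite : ∀ k ∈ E, k ∉ Bad → GoodSite m T E N b z cF sd k) (hBE : ∀ o ∈ Bad, o ∈ E)
    (hcl : ∀ k ∈ Bad, ∃ Om ⊆ Bad, k ∈ Om ∧
      (∀ o ∈ Om, ∀ k' : Idx K, 4 * ‖site k' - site o‖ ≤ N ^ 2 → jb k k' ≤ X) ∧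
      ∀ o ∈ Om, ∀ o' ∈ Bad, o' ∉ Om → N ^ 2 < ‖site o' - site o‖)
    (hσ : ∀ k, ∑ k' ∈ E, (jb k k' ^ (2 * rd K))⁻¹ ≤ Cσ) (ht0 : 0 ≤ t) (ht'0 : 0 ≤ t')
    (ht1 : TB T (p + 2 * rd K) t) (ht2 : TB T sd t) (ht' : TB T (s + p) t')
    (hs1 : (9 + 3 * cq p) * (t * Cσ) ≤ 1 / 2)
    (hs2 : (9 + 3 * cq p) * (E.card * (cF * (2 ^ sd * (z * t + b * t)))) ≤ 1 / 2 * N ^ (sd - p))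
    (hs3 : 3 * b' * E.card ^ 2 * t * 8 ^ p ≤ 1 / 2 * N ^ (2 * p)) :
    ColDec m T E s (2 * ((G + cq s * (3 + cq p) * G * (E.card * t') * b') +
      (b * (3 * N) ^ s * G + cq s * (3 + cq p) * G *
        (E.card * (cF * (2 ^ (s + p) * (b * (3 * N) ^ (s + p) * t + b * t')))) * b') +
      (b' * X ^ s + b' * E.card ^ 2 * (cq s * (2 * X) ^ s * t' * b')))) := by
  intro k₀ hk₀ u hu h0
  set H := ‖app m T E u k₀‖ with hHdef
  have hH0 : 0 ≤ H := norm_nonneg _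
  have cs := cq_pos s
  have cp := cq_pos p
  have hG0 : 0 ≤ G := le_trans (by positivity) hG
  have hl2 : l2 E (app m T E u) ≤ H := (l2_le_sum _ _).trans (le_of_eq
    (Finset.sum_eq_single_of_mem k₀ hk₀ fun k hk hne => by rw [h0 k hk hne, norm_zero]))
  have hA : ∀ k ∈ E, ‖u k‖ ≤ b' * H := fun k hk =>
    (norm_le_l2 hk u).trans ((hC u hu).trans (mul_le_mul_of_nonneg_left hl2 hb'))
  have hA0 : 0 ≤ b' * H := mul_nonneg hb' hH0
  let g : Idx K → ℝ := fun k => gam Bad N k ^ p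
  have hg1 : ∀ k, 1 ≤ g k := fun k => one_le_pow₀ (one_le_gam Bad N k)
  have hgG : ∀ k, g k ≤ G := fun k => (pow_le_pow_left₀
    (zero_le_one.trans (one_le_gam Bad N k)) (gam_le Bad N k) p).trans hG
  have hg : ∀ k k', g k ≤ 3 * g k' + cq p * jb k k' ^ p := fun k k' =>
    pow_add_le_of_quasi p (zero_le_one.trans (one_le_gam Bad N k))
      (zero_le_one.trans (one_le_gam Bad N k')) (jb_pos _ _).le (gam_le_add Bad N k k')
  set B1 := G * H + cq s * (3 + cq p) * G * (E.card * t') * (b' * H) with hB1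
  set B2 := b * (3 * N) ^ s * G * H + cq s * (3 + cq p) * G *
        (E.card * (cF * (2 ^ (s + p) * (b * (3 * N) ^ (s + p) * t + b * t')))) * (b' * H) with hB2
  set B3 := b' * X ^ s * H + b' * E.card ^ 2 * (cq s * (2 * X) ^ s * t' * (b' * H)) with hB3
  have hB1' : 0 ≤ B1 := by positivity
  have hB2' : 0 ≤ B2 := by positivity
  have hB3' : 0 ≤ B3 := by positivity
  have key := le_of_half E (fun k => ‖u k‖ * jb k k₀ ^ s * g k) (B := B1 + B2 + B3)
    (fun k => mul_nonneg (mul_nonneg (norm_nonneg _) (pow_pos (jb_pos _ _) s).le)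
      (zero_le_one.trans (hg1 k))) ?_
  · intro k hk
    have h1 := key k hk
    have h2 : ‖u k‖ * jb k k₀ ^ s ≤ ‖u k‖ * jb k k₀ ^ s * g k :=
      le_mul_of_one_le_right (mul_nonneg (norm_nonneg _) (pow_pos (jb_pos _ _) s).le) (hg1 k)
    refine h2.trans (h1.trans (le_of_eq ?_))
    rw [hB1, hB2, hB3]; ring
  · intro M hM0 hM k hk
    by_cases hkB : k ∈ Bad
    · obtain ⟨Om, hOm, hkO, hdiam, hsep⟩ := hcl k hkB
      have := weighted_le_of_bad (M := M) hN hb' hC hOm hBE hkO hX hdiam hsep h0 hHdef.symm.le hM hM0 hA hA0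
        (ht2.mono hpsd) ht0 (ht'.mono (Nat.le_add_right s p)) ht'0 hs3
      exact this.trans (by linarith)
    · rcases hsite k hk hkB with hreg | ⟨F, hF, hkF, hfar, hd, hCF, hcol, hc⟩
      · have := weighted_le_of_regular (M := M) hk hreg hg1 hgG (hg k) h0 hHdef.symm.le hM hM0 hA hA0
          (hσ k) ht1 ht0 ht' hs1
        exact this.trans (by linarith)
      · have := weighted_le_of_box (M := M) hN hF hkF hfar hd hCF hcol hc hb hz hpsd hg1 hgG (hg k) h0
          hHdef.symm.le hM hM0 hA hA0 ht2 ht0 ht' ht'0 hs2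
        exact this.trans (by linarith)

/-- Estimate of the columns of the inverse when all the diagonal entries are bounded below and the
off-diagonal part is small. -/
theorem colDec_of_diagonal {m : Idx K → ℂ} {T : Ker K} {E : Finset (Idx K)} {s : ℕ} {μ b t t' : ℝ}
    (hμ : 0 < μ) (hm : ∀ k ∈ E, 0 < dim k → μ ≤ ‖m k‖) (hb : 0 ≤ b) (hC : Coer m T E b)
    (ht : TB T 0 t) (ht' : TB T s t') (ht0 : 0 ≤ t) (ht'0 : 0 ≤ t')
    (hs : μ⁻¹ * (3 * (E.card * t)) ≤ 1 / 2) :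
    ColDec m T E s (2 * (μ⁻¹ + μ⁻¹ * (cq s * (E.card * t') * b))) := by
  intro k₀ hk₀ u hu h0
  set H := ‖app m T E u k₀‖ with hHdef
  have hH0 : 0 ≤ H := norm_nonneg _
  have cs := cq_pos s
  have hμ' := inv_pos.2 hμ
  have hl2 : l2 E (app m T E u) ≤ H := (l2_le_sum _ _).trans (le_of_eq
    (Finset.sum_eq_single_of_mem k₀ hk₀ fun k hk hne => by rw [h0 k hk hne, norm_zero]))
  have hA : ∀ k ∈ E, ‖u k‖ ≤ b * H := fun k hk =>
    (norm_le_l2 hk u).trans ((hC u hu).trans (mul_le_mul_of_nonneg_left hl2 hb))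
  have hj : ∀ (k k' : Idx K) (n : ℕ), 0 < jb k k' ^ n := fun k k' n => pow_pos (jb_pos _ _) n
  have key := le_of_half E (fun k => ‖u k‖ * jb k k₀ ^ s)
    (B := μ⁻¹ * H + μ⁻¹ * (cq s * (E.card * t') * (b * H)))
    (fun k => mul_nonneg (norm_nonneg _) (hj _ _ _).le) ?_
  · intro k hk
    exact (key k hk).trans (le_of_eq (by ring))
  · intro M hM0 hM k hk
    -- With multiplicity zero there is no lower bound on the diagonal entry, but the component of
    -- `u` vanishes.
    by_cases hd : 0 < dim k
    swap
    · have : u k = 0 := by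
        ext c
        exact absurd c.pos hd
      rw [this, norm_zero, zero_mul]
      positivity
    have h1 := norm_le_of_regular (T := T) (E := E) hμ (hm k hk hd) u
    have h2 : ‖app m T E u k‖ * jb k k₀ ^ s ≤ H := by
      by_cases hkk : k = k₀
      · subst hkk
        rw [jb_self, one_pow, mul_one]
      · rw [h0 k hk hkk, norm_zero, zero_mul]; exact hH0
    have h3 : (∑ k' ∈ E, ‖T k k'‖ * ‖u k'‖) * jb k k₀ ^ s ≤
        3 * (E.card * t) * M + cq s * (E.card * t') * (b * H) := by
      have e : ∀ k' ∈ E, ‖T k k'‖ * ‖u k'‖ * jb k k₀ ^ s ≤ 3 * t * M + cq s * t' * (b * H) := by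
        intro k' hk'
        have q : jb k k₀ ^ s ≤ 3 * jb k' k₀ ^ s + cq s * jb k k' ^ s := jb_pow_quasi s k k' k₀
        have h4 := hM k' hk'
        have h5 := hA k' hk'
        have h6 := ht' k k'
        have h7 := ht.norm_le k k'
        have h8 := hj k' k₀ s
        calc ‖T k k'‖ * ‖u k'‖ * jb k k₀ ^ s
            ≤ ‖T k k'‖ * ‖u k'‖ * (3 * jb k' k₀ ^ s + cq s * jb k k' ^ s) := by gcongr
          _ = 3 * ‖T k k'‖ * (‖u k'‖ * jb k' k₀ ^ s) + cq s * (‖T k k'‖ * jb k k' ^ s) * ‖u k'‖ := by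
              ring
          _ ≤ 3 * t * M + cq s * t' * (b * H) := by gcongr
      rw [Finset.sum_mul]
      exact (sum_le_card_mul e).trans (le_of_eq (by ring))
    have h9 : μ⁻¹ * (3 * (E.card * t)) * M ≤ 1 / 2 * M := by gcongr
    calc ‖u k‖ * jb k k₀ ^ s
        ≤ μ⁻¹ * (‖app m T E u k‖ + ∑ k' ∈ E, ‖T k k'‖ * ‖u k'‖) * jb k k₀ ^ s :=
          mul_le_mul_of_nonneg_right h1 (hj _ _ _).le
      _ = μ⁻¹ * (‖app m T E u k‖ * jb k k₀ ^ s + (∑ k' ∈ E, ‖T k k'‖ * ‖u k'‖) * jb k k₀ ^ s) := by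
          ring
      _ ≤ μ⁻¹ * (H + (3 * (E.card * t) * M + cq s * (E.card * t') * (b * H))) := by gcongr
      _ ≤ _ := by linarith

/-- Test coercivity on a unit vector at `k`: its image is at most `‖m k‖` plus a contribution of
size `card · t` from `T`. For small `T`, an ℓ² bound on the inverse therefore bounds every diagonal
entry of the box from below. -/
theorem le_norm_diag_of_coer {m : Idx K → ℂ} {T : Ker K} {E : Finset (Idx K)} {b t : ℝ} (hb : 0 < b)
    (hC : Coer m T E b) (ht : TB T 0 t) (hs : b * (E.card * t) ≤ 1 / 2) {k : Idx K} (hk : k ∈ E)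
    (hd : 0 < dim k) : 1 / (2 * b) ≤ ‖m k‖ := by
  classical
  let x : EuclideanSpace ℂ (Fin (dim k)) := EuclideanSpace.single ⟨0, hd⟩ 1
  have hx : ‖x‖ = 1 := by simp [x]
  let u : Seq K := Pi.single k x
  have hu : SuppIn E u := fun k' hk' => Pi.single_eq_of_ne (fun h => hk' (by rw [h]; exact hk)) _
  have huk : u k = x := Pi.single_eq_same _ _
  have h1 := (norm_le_l2 hk u).trans ((hC u hu).trans (mul_le_mul_of_nonneg_left (l2_le_sum _ _) hb.le))
  rw [huk, hx] at h1
  have h2 : ∀ k' ∈ E, ‖app m T E u k'‖ ≤ (if k' = k then ‖m k‖ else 0) + t := by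
    intro k' _
    rw [app_apply]
    refine (norm_add_le _ _).trans (add_le_add ?_ ?_)
    · split_ifs with h
      · subst h; rw [norm_smul, huk, hx, mul_one]
      · rw [show u k' = 0 from Pi.single_eq_of_ne h _, smul_zero, norm_zero]
    · rw [Finset.sum_eq_single_of_mem k hk fun b _ hb => by
        rw [show u b = 0 from Pi.single_eq_of_ne hb _, map_zero], huk]
      refine ((T k' k).le_opNorm x).trans ?_
      rw [hx, mul_one]
      exact ht.norm_le _ _
  have h3 : ∑ k' ∈ E, ‖app m T E u k'‖ ≤ ‖m k‖ + E.card * t := by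
    refine (Finset.sum_le_sum h2).trans (le_of_eq ?_)
    rw [Finset.sum_add_distrib, Finset.sum_ite_eq', if_pos hk, Finset.sum_const, nsmul_eq_mul]
  have h4 : 1 ≤ b * (‖m k‖ + E.card * t) := h1.trans (by gcongr)
  rw [div_le_iff₀ (by positivity)]
  linarith

/-! ### Clusters of singular sites -/

theorem idxDist_le {k k' : Idx K} {x : ℝ} (hx : 1 ≤ x) (h : ‖site k - site k'‖ ≤ x) :
    idxDist k k' ≤ x := by
  unfold idxDist
  split_ifs
  · exact hx
  · exact h

/-- `Om` is the connected component of `k` in the graph that joins sites at distance at most `Γ`. A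
path in this graph is a `Γ`-chain, so it has at most `Λ` steps, which bounds the distance to `k`;
sites of different components are not adjacent. -/
theorem exists_cluster {Sig : Set (Idx K)} {Γ Λ : ℝ} (hΓ : 1 ≤ Γ)
    (hch : ∀ (ℓ : ℕ) (k : Fin (ℓ + 1) → Idx K), (∀ q, k q ∈ Sig) → IsChainOfLength Γ ℓ k →
      (ℓ : ℝ) ≤ Λ) {k : Idx K} (hk : k ∈ Sig) :
    ∃ Om ⊆ Sig, k ∈ Om ∧ (∀ o ∈ Om, ‖site k - site o‖ ≤ Γ * Λ) ∧
      ∀ o ∈ Om, ∀ o' ∈ Sig, o' ∉ Om → Γ < ‖site o' - site o‖ := by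
  classical
  let G : SimpleGraph Sig :=
    { Adj := fun x y => x ≠ y ∧ ‖site x.1 - site y.1‖ ≤ Γ
      symm := ⟨fun x y h => ⟨h.1.symm, by rw [norm_sub_rev]; exact h.2⟩⟩
      loopless := ⟨fun x h => h.1 rfl⟩ }
  have hlen : ∀ {x y : Sig} (p : G.Walk x y), ‖site x.1 - site y.1‖ ≤ Γ * p.length := by
    intro x y p
    induction p with
    | nil => simp
    | cons h p ih =>
      rename_i a b c
      have h1 := h.2
      have h2 := norm_sub_le_norm_sub_add_norm_sub (site a.1) (site b.1) (site c.1)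
      rw [SimpleGraph.Walk.length_cons]
      push_cast
      linarith
  refine ⟨{o | ∃ ho : o ∈ Sig, G.Reachable ⟨k, hk⟩ ⟨o, ho⟩}, fun o ho => ho.1,
    ⟨hk, SimpleGraph.Reachable.refl _⟩, ?_, ?_⟩
  · rintro o ⟨ho, ⟨w⟩⟩
    -- Replacing the walk by a path supplies the distinctness that a chain requires.
    obtain ⟨p, hp⟩ : ∃ p : G.Walk ⟨k, hk⟩ ⟨o, ho⟩, p.IsPath := ⟨w.toPath.1, w.toPath.2⟩
    refine (hlen p).trans (mul_le_mul_of_nonneg_left ?_ (by linarith))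
    refine hch p.length (fun q => (p.getVert q).1) (fun q => (p.getVert q).2) ⟨?_, ?_⟩
    · intro q q' h
      have h' : p.getVert q = p.getVert q' := Subtype.ext h
      exact Fin.ext (hp.getVert_injOn (Nat.lt_succ_iff.1 q.2) (Nat.lt_succ_iff.1 q'.2) h')
    · intro q
      apply idxDist_le hΓ
      have := p.adj_getVert_succ q.2
      rw [norm_sub_rev]
      exact this.2
  · rintro o ⟨ho, hr⟩ o' ho' hno
    by_contra hle
    push Not at hle
    apply hno
    refine ⟨ho', hr.trans (SimpleGraph.Adj.reachable ⟨?_, ?_⟩)⟩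
    · rintro h
      apply hno
      have : o = o' := congrArg Subtype.val h
      exact this ▸ ⟨ho, hr⟩
    · rw [norm_sub_rev]; exact hle

/-! ### Boxes inside a large box -/

/-- The coordinatewise projection of `x` to the cube of radius `R` around `x₀`. -/
def clamp {n : ℕ} (R : ℕ) (x₀ x : Fin n → ℤ) : Fin n → ℤ := fun p =>
  max (x₀ p - R) (min (x p) (x₀ p + R))

theorem norm_sub_le_iff {n : ℕ} {x y : Fin n → ℤ} {N : ℕ} :
    ‖x - y‖ ≤ N ↔ ∀ p, -(N : ℤ) ≤ x p - y p ∧ x p - y p ≤ N := by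
  rw [pi_norm_le_iff_of_nonneg (Nat.cast_nonneg N)]
  refine forall_congr' fun p => ?_
  rw [Int.norm_eq_abs, abs_le]
  norm_cast

theorem norm_clamp_sub_le {n : ℕ} (R : ℕ) (x₀ x : Fin n → ℤ) : ‖clamp R x₀ x - x₀‖ ≤ R := by
  rw [norm_sub_le_iff]
  intro p
  simp only [clamp]
  omega

theorem norm_sub_clamp_le {n : ℕ} {R N : ℕ} {x₀ x : Fin n → ℤ} (h : ‖x - x₀‖ ≤ (R + N : ℕ)) :
    ‖x - clamp R x₀ x‖ ≤ N := by
  rw [norm_sub_le_iff] at h ⊢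
  intro p
  have := h p
  simp only [clamp]
  omega

/-- Look at a coordinate in which `y` leaves the small cube. If the centre was not moved there, it
coincides with `x`. If it was moved, the small cube reaches the face of the large one on the side of
`x`, so `y` leaves on the opposite side, even farther from `x`. -/
theorem lt_norm_sub_of_clamp {n : ℕ} {R N : ℕ} {x₀ x y : Fin n → ℤ}
    (hx : ‖x - x₀‖ ≤ (R + N : ℕ)) (hy : ‖y - x₀‖ ≤ (R + N : ℕ)) (h : ¬ ‖y - clamp R x₀ x‖ ≤ N) :
    ¬ ‖x - y‖ ≤ N := by
  rw [norm_sub_le_iff] at hx hy h ⊢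
  push Not at h ⊢
  obtain ⟨p, hp⟩ := h
  refine ⟨p, ?_⟩
  have := hx p
  have := hy p
  simp only [clamp] at hp
  omega

/-- As `j₀` belongs to the cube, the clamped vector lies coordinatewise between `j₀` and `j`. This
is the use of the product structure: the boxes attached to sites are centred in `Λ₊`. -/
theorem clamp_mem {R : ℕ} {x j₀ j : Fin K.r → ℤ} (h₀ : j₀ ∈ K.Lam) (hx : ‖j₀ - x‖ ≤ R)
    (h : j ∈ K.Lam) : clamp R x j ∈ K.Lam := by
  rw [norm_sub_le_iff] at hx
  refine K.product_structure j₀ h₀ j h _ fun p => ?_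
  have := hx p
  simp only [clamp]
  omega

/-- The centre of the box of radius `N` attached to `k` in the box of radius `R + N` around `i`. -/
def ctr (R : ℕ) (i : Site K) (k : Idx K) : Site K := (clamp R i.1 k.1, clamp R i.2 k.2.1.1)

/-- The site underlying a pair `(l, j)` with `j ∈ Λ₊`. -/
def toSite (i : (Fin K.d → ℤ) × K.Lam) : Site K := (i.1, i.2.1)

theorem norm_site_le_iff {x : Site K} {N : ℝ} : ‖x‖ ≤ N ↔ ‖x.1‖ ≤ N ∧ ‖x.2‖ ≤ N := by
  rw [Prod.norm_def, max_le_iff]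

theorem mem_bx_iff {N : ℕ} {i : Site K} {k : Idx K} :
    k ∈ bx N i ↔ ‖k.1 - i.1‖ ≤ N ∧ ‖k.2.1.1 - i.2‖ ≤ N := by
  rw [mem_bx, norm_site_le_iff]; rfl

theorem bx_ctr_subset (R N : ℕ) (i : Site K) (k : Idx K) :
    bx N (ctr R i k) ⊆ bx (R + N) i := by
  intro k' hk'
  rw [mem_bx_iff] at hk' ⊢
  have h1 := norm_clamp_sub_le R i.1 k.1
  have h2 := norm_clamp_sub_le R i.2 k.2.1.1
  have e1 := norm_sub_le_norm_sub_add_norm_sub k'.1 (clamp R i.1 k.1) i.1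
  have e2 := norm_sub_le_norm_sub_add_norm_sub k'.2.1.1 (clamp R i.2 k.2.1.1) i.2
  have h3 := hk'.1
  have h4 := hk'.2
  simp only [ctr] at h3 h4
  push_cast
  constructor <;> linarith

theorem mem_bx_ctr {R N : ℕ} {i : Site K} {k : Idx K}
    (hk : k ∈ bx (R + N) i) : k ∈ bx N (ctr R i k) := by
  rw [mem_bx_iff] at hk ⊢
  exact ⟨norm_sub_clamp_le hk.1, norm_sub_clamp_le hk.2⟩

theorem le_jb_of_not_mem_bx_ctr {R N : ℕ} {i : Site K} {k k' : Idx K}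
    (hk : k ∈ bx (R + N) i) (hk' : k' ∈ bx (R + N) i)
    (h : k' ∉ bx N (ctr R i k)) : (N : ℝ) ≤ jb k k' := by
  rw [mem_bx_iff] at hk hk' h
  have hle : ¬ ‖site k - site k'‖ ≤ N := by
    rw [norm_site_le_iff]
    by_cases h1 : ‖k'.1 - (ctr R i k).1‖ ≤ N
    · exact fun h2 => lt_norm_sub_of_clamp hk.2 hk'.2 (fun h3 => h ⟨h1, h3⟩) h2.2
    · exact fun h2 => lt_norm_sub_of_clamp hk.1 hk'.1 h1 h2.1
  exact (not_le.1 hle).le.trans (norm_le_jb k k')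

/-! ### Translation in time -/

/-- Translation of indices in time. -/
def shiftIdx (l : Fin K.d → ℤ) (k : Idx K) : Idx K := (k.1 + l, k.2)

theorem shiftIdx_injective (l : Fin K.d → ℤ) : Function.Injective (shiftIdx (K := K) l) := by
  rintro ⟨x, y⟩ ⟨x', y'⟩ h
  simpa [shiftIdx] using h

theorem bx_shift (N : ℕ) (l : Fin K.d → ℤ) (j : K.Lam) :
    bx N (toSite (l, j)) = (bx N (toSite (0, j))).map ⟨shiftIdx l, shiftIdx_injective l⟩ := by
  ext k
  simp only [Finset.mem_map, Function.Embedding.coeFn_mk]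
  constructor
  · intro h
    refine ⟨shiftIdx (-l) k, ?_, by simp [shiftIdx]⟩
    rw [mem_bx_iff] at h ⊢
    simpa [shiftIdx, toSite, ← sub_eq_add_neg] using h
  · rintro ⟨k', h, rfl⟩
    rw [mem_bx_iff] at h ⊢
    simpa [shiftIdx, toSite] using h

/-- A kernel is Töplitz in time. -/
def ToepKer (T : Ker K) : Prop := ∀ (l : Fin K.d → ℤ) (k k' : Idx K),
  T (shiftIdx l k) (shiftIdx l k') = T k k'

/-- A translation in time leaves `T` unchanged and adds `λ ω̄ · l` to the angle. Whether the box at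
`(l, j)` is bad thus becomes a question about one angle and the box at `(0, j)`. -/
theorem coer_shift {om : Fin K.d → ℝ} {DD : K.Lam → K.A → ℝ → ℂ} {lam θ : ℝ} {T : Ker K}
    (hT : ToepKer T) {N : ℕ} {l : Fin K.d → ℤ} {j : K.Lam} {b : ℝ}
    (h : Coer (Dtheta om DD lam (θ + lam * ∑ p, om p * l p)) T (bx N (toSite (0, j))) b) :
    Coer (Dtheta om DD lam θ) T (bx N (toSite (l, j))) b := by
  intro u hu
  have hbx := bx_shift N l j
  let v : Seq K := fun k => u (shiftIdx l k)
  have hv : SuppIn (bx N (toSite (0, j))) v := by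
    intro k hk
    apply hu
    rw [hbx]
    intro h
    obtain ⟨k', hk', he⟩ := Finset.mem_map.1 h
    exact hk (shiftIdx_injective l he ▸ hk')
  have h1 := h v hv
  have h2 : ∀ k, app (Dtheta om DD lam (θ + lam * ∑ p, om p * l p)) T (bx N (toSite (0, j))) v k =
      app (Dtheta om DD lam θ) T (bx N (toSite (l, j))) u (shiftIdx l k) := by
    intro k
    rw [app_apply, app_apply, hbx, Finset.sum_map]
    have e1 : Dtheta om DD lam (θ + lam * ∑ p, om p * l p) k =
        Dtheta om DD lam θ (shiftIdx l k) := by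
      simp only [Dtheta, shiftIdx, Pi.add_apply]
      congr 1
      push_cast
      simp only [mul_add, Finset.sum_add_distrib]
      ring
    rw [e1]
    congr 1
    refine Finset.sum_congr rfl fun k' _ => ?_
    have := hT l k k'
    exact congrArg (fun S => S (v k')) this.symm
  have h3 : l2 (bx N (toSite (0, j))) v = l2 (bx N (toSite (l, j))) u := by
    rw [l2, l2, hbx, Finset.sum_map]; rfl
  have h4 : l2 (bx N (toSite (0, j)))
      (app (Dtheta om DD lam (θ + lam * ∑ p, om p * l p)) T (bx N (toSite (0, j))) v) =
      l2 (bx N (toSite (l, j))) (app (Dtheta om DD lam θ) T (bx N (toSite (l, j))) u) := by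
    generalize app (Dtheta om DD lam θ) T (bx N (toSite (l, j))) u = w at h2 ⊢
    rw [l2, l2, hbx, Finset.sum_map]
    congr 1
    refine Finset.sum_congr rfl fun k _ => ?_
    rw [h2]; rfl
  rwa [h3, h4] at h1

/-! ### Counting bad sites -/

theorem abs_sub_le_of_ordConnected {J : Set ℝ} (hJ : J.OrdConnected) {δ : ℝ} (hδ : 0 ≤ δ)
    (hv : MeasureTheory.volume J ≤ ENNReal.ofReal δ) {x y : ℝ} (hx : x ∈ J) (hy : y ∈ J) :
    |x - y| ≤ δ := by
  have key : ∀ a ∈ J, ∀ b ∈ J, a ≤ b → b - a ≤ δ := by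
    intro a ha b hb hab
    have h1 := (MeasureTheory.measure_mono (hJ.out ha hb)).trans hv
    rw [Real.volume_Icc] at h1
    exact (ENNReal.ofReal_le_ofReal_iff hδ).1 h1
  rcases le_total x y with h | h
  · rw [abs_sub_comm, abs_of_nonneg (by linarith)]; exact key x hx y hy h
  · rw [abs_of_nonneg (by linarith)]; exact key y hy x hx h

/-- The angles attached to the centres lie in few intervals of length at most `δ`, while distinct
time components of centres give angles more than `δ` apart, so an interval determines the time
component of the centre. A site of the section is then known from its interval, its offset in time
from the centre and its element of `𝔄`. -/
theorem ncard_section_le {om : Fin K.d → ℝ} {lam θ δ M : ℝ} (hδ : 0 ≤ δ) {R N : ℕ}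
    {i : Site K} {j : K.Lam} {S : Set (Idx K)}
    (hSj : ∀ k ∈ S, k.2.1 = j) (hSE : ∀ k ∈ S, k ∈ bx (R + N) i) {B : Set ℝ}
    (hB : CoveredBy B M δ) (hSB : ∀ k ∈ S, θ + lam * ∑ p, om p * (ctr R i k).1 p ∈ B)
    (hdio : ∀ l : Fin K.d → ℤ, l ≠ 0 → ‖l‖ ≤ 2 * R → δ < |lam * ∑ p, om p * l p|) :
    S.Finite ∧ ((S.ncard : ℕ) : ℝ) ≤ M * ((2 * N + 1) ^ K.d * Fintype.card K.A) := by
  classical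
  have hfin : S.Finite := (bx (R + N) i).finite_toSet.subset hSE
  refine ⟨hfin, ?_⟩
  obtain ⟨n, hn, J, hJ, hBJ⟩ := hB
  rcases S.eq_empty_or_nonempty with rfl | hne
  · have hM : 0 ≤ M := (Nat.cast_nonneg n).trans hn
    simp only [Set.ncard_empty, Nat.cast_zero]
    positivity
  have h1 : ∀ k ∈ S, ∃ q : Fin n, θ + lam * ∑ p, om p * (ctr R i k).1 p ∈ J q := fun k hk =>
    Set.mem_iUnion.1 (hBJ (hSB k hk))
  have : Nonempty (Fin n) := ⟨(h1 _ hne.some_mem).choose⟩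
  choose! q hq using h1
  let off : Idx K → (Fin K.d → ℤ) := fun k => k.1 - (ctr R i k).1
  let P : Finset (Fin n × (Fin K.d → ℤ) × K.A) :=
    Finset.univ ×ˢ (Fintype.piFinset fun _ => Finset.Icc (-(N : ℤ)) N) ×ˢ Finset.univ
  have hcard : P.card = n * ((2 * N + 1) ^ K.d * Fintype.card K.A) := by
    have h2 : ((N : ℤ) + 1 - -N).toNat = 2 * N + 1 := by omega
    simp only [P, Finset.card_product, Fintype.card_piFinset, Int.card_Icc, h2, Finset.prod_const,
      Finset.card_univ, Fintype.card_fin]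
  have hle : S.ncard ≤ P.card := by
    rw [Set.ncard_eq_toFinset_card S hfin]
    refine Finset.card_le_card_of_injOn (fun k => (q k, off k, k.2.2)) ?_ ?_
    · intro k hk
      have hk' : k ∈ S := by simpa using hk
      have h3 := (mem_bx_iff.1 (mem_bx_ctr (hSE k hk'))).1
      rw [norm_sub_le_iff] at h3
      simp only [P, Finset.coe_product, Set.mem_prod, Finset.mem_coe, Fintype.mem_piFinset,
        Finset.mem_Icc, Finset.mem_univ, and_true, true_and]
      exact h3
    · intro k hk k' hk' he
      have hk1 : k ∈ S := by simpa using hk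
      have hk2 : k' ∈ S := by simpa using hk'
      simp only [Prod.mk.injEq] at he
      obtain ⟨e1, e2, e3⟩ := he
      have h4 := abs_sub_le_of_ordConnected (hJ (q k)).1 hδ (hJ (q k)).2 (hq k hk1)
        (e1 ▸ hq k' hk2)
      have h5 : (ctr R i k).1 = (ctr R i k').1 := by
        by_contra hne
        have h6 := hdio ((ctr R i k).1 - (ctr R i k').1) (sub_ne_zero.2 hne) (by
          have a1 := norm_clamp_sub_le R i.1 k.1
          have a2 := norm_clamp_sub_le R i.1 k'.1
          have a3 := norm_sub_le (clamp R i.1 k.1 - i.1) (clamp R i.1 k'.1 - i.1)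
          rw [sub_sub_sub_cancel_right] at a3
          simp only [ctr]
          linarith)
        have h7 : lam * ∑ p, om p * (((ctr R i k).1 - (ctr R i k').1) p : ℤ) =
            (θ + lam * ∑ p, om p * (ctr R i k).1 p) - (θ + lam * ∑ p, om p * (ctr R i k').1 p) := by
          simp only [Pi.sub_apply, Int.cast_sub, mul_sub, Finset.sum_sub_distrib]
          ring
        rw [h7] at h6
        linarith
      have h8 : k.1 = k'.1 := by
        have e2' : k.1 - (ctr R i k).1 = k'.1 - (ctr R i k').1 := e2
        rw [h5] at e2'
        exact sub_left_injective e2'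
      exact Prod.ext h8 (Prod.ext ((hSj k hk1).trans (hSj k' hk2).symm) e3)
  calc ((S.ncard : ℕ) : ℝ) ≤ (P.card : ℕ) := by exact_mod_cast hle
    _ = n * ((2 * N + 1) ^ K.d * Fintype.card K.A) := by rw [hcard]; push_cast; ring
    _ ≤ _ := by gcongr

/-! ### The multiscale induction -/

variable (K) in
/-- The exponents of the multiscale analysis and the relations between them. -/
structure Expo (ee e : ℝ) where
  kap : ℕ
  C : ℕ
  kk : ℕ
  χ : ℕ
  τ : ℕ
  p : ℕ
  e₀ : ℕ
  ζ : ℕ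
  hkap : ee + K.d + 1 ≤ kap
  hC : 2 + (2 + kap) * ⌈e⌉₊ ≤ C
  hχ : χ = 2 ^ kk
  hχC : 16 * C ≤ χ
  hτ : χ * K.d + 2 ≤ τ
  hp : χ * τ + 2 * χ * (rd K + 1) + 1 ≤ p
  he₀ : 3 * p + 2 * χ * (rd K + 1) + (rd K + 1) + τ + 2 * χ * τ ≤ e₀
  hζ : 2 * (e₀ + χ * (rd K + 1) + (rd K + 1) + 3) ≤ ζ

/-- Each relation bounds one exponent in terms of earlier ones, so they can be chosen in order.
Taking `kk = 16 C` works because `n ≤ 2 ^ n`. -/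
theorem nonempty_expo (ee e : ℝ) : Nonempty (Expo K ee e) := by
  obtain ⟨kap, hkap⟩ := exists_nat_ge (ee + K.d + 1)
  exact ⟨⟨kap, 2 + (2 + kap) * ⌈e⌉₊, 16 * (2 + (2 + kap) * ⌈e⌉₊), _, _, _, _, _, hkap, le_rfl, rfl,
    Nat.lt_two_pow_self.le, le_rfl, le_rfl, le_rfl, le_rfl⟩⟩

/-- One extra power of `N` absorbs the constant. -/
theorem card_bx_le_pow {N : ℕ} (hN : Fintype.card K.A * 3 ^ rd K + 1 ≤ N) (i : Site K) :
    ((bx N i).card : ℝ) ≤ (N : ℝ) ^ (rd K + 1) := by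
  have h1 := card_bx_le N i
  have h2 : Fintype.card K.A * (2 * N + 1) ^ rd K ≤ N ^ (rd K + 1) := by
    calc Fintype.card K.A * (2 * N + 1) ^ rd K ≤ Fintype.card K.A * (3 * N) ^ rd K := by
          gcongr; omega
      _ = (Fintype.card K.A * 3 ^ rd K) * N ^ rd K := by rw [mul_pow]; ring
      _ ≤ N * N ^ rd K := by gcongr; omega
      _ = _ := by ring
  exact_mod_cast h1.trans h2

theorem rpow_le_pow_ceil {x : ℝ} (hx : 1 ≤ x) (e : ℝ) : x ^ e ≤ x ^ ⌈e⌉₊ := by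
  rw [← Real.rpow_natCast]
  exact Real.rpow_le_rpow_of_exponent_le hx (Nat.le_ceil e)

/-- The constant in the multiscale step. -/
def msConst (s p : ℕ) : ℝ :=
  2 * (2 ^ p + cq s * (3 + cq p) * 2 ^ p + 3 ^ s * 2 ^ p +
    cq s * (3 + cq p) * 2 ^ p * (2 ^ (s + p) * 3 ^ (s + p)) + 2 ^ s + cq s * 4 ^ s)

theorem msConst_pos (s p : ℕ) : 0 < msConst s p := by
  have := cq_pos s
  have := cq_pos p
  unfold msConst; positivity

/-- Bookkeeping for the six terms produced by `colDec_of_goodSites`. The exponent `e₀` collects the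
powers of `N` that do not involve `s`; the worst dependence on `s` is the power `N ^ (C s)` of the
diameter of the clusters. -/
theorem ms_bound {ee e : ℝ} (X : Expo K ee e) (s : ℕ) {N t t' c cF : ℝ} (hN : 1 ≤ N) (ht : t ≤ 1)
    (ht0 : 0 ≤ t) (ht' : 0 ≤ t') (hc0 : 0 ≤ c) (hc : c ≤ N ^ (X.χ * (rd K + 1)))
    (hcF0 : 0 ≤ cF) (hcF : cF ≤ N ^ (rd K + 1)) :
    2 * (((2 * N ^ 2) ^ X.p + cq s * (3 + cq X.p) * (2 * N ^ 2) ^ X.p * (c * t') * (N ^ X.χ) ^ X.τ) +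
      (N ^ X.τ * (3 * N) ^ s * (2 * N ^ 2) ^ X.p + cq s * (3 + cq X.p) * (2 * N ^ 2) ^ X.p *
        (c * (cF * (2 ^ (s + X.p) * (N ^ X.τ * (3 * N) ^ (s + X.p) * t + N ^ X.τ * t')))) *
          (N ^ X.χ) ^ X.τ) +
      ((N ^ X.χ) ^ X.τ * (2 * N ^ X.C) ^ s + (N ^ X.χ) ^ X.τ * c ^ 2 *
        (cq s * (2 * (2 * N ^ X.C)) ^ s * t' * (N ^ X.χ) ^ X.τ))) ≤
      msConst s X.p * (1 + t') * N ^ (X.e₀ + X.C * s) := by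
  have cs := cq_pos s
  have cp := cq_pos X.p
  have hC1 : 1 ≤ X.C := by have := X.hC; omega
  have hsC : s ≤ X.C * s := Nat.le_mul_of_pos_left s hC1
  have he := X.he₀
  set D := rd K + 1
  set χ := X.χ
  set τ := X.τ
  set p := X.p
  have hpow : ∀ {a b : ℕ}, a ≤ b → N ^ a ≤ N ^ b := fun h => pow_le_pow_right₀ hN h
  set Y := N ^ (X.e₀ + X.C * s) with hY
  have hY0 : 0 ≤ Y := by positivity
  have hYt : Y ≤ (1 + t') * Y := le_mul_of_one_le_left hY0 (by linarith)
  have hYt' : t' * Y ≤ (1 + t') * Y := by gcongr; linarith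
  have e1 : (2 * N ^ 2) ^ p = 2 ^ p * N ^ (2 * p) := by rw [mul_pow, pow_mul]
  have t1 : (2 * N ^ 2) ^ p ≤ 2 ^ p * ((1 + t') * Y) := by
    rw [e1]
    have : N ^ (2 * p) ≤ Y := hpow (by omega)
    gcongr
    exact this.trans hYt
  have t2 : cq s * (3 + cq p) * (2 * N ^ 2) ^ p * (c * t') * (N ^ χ) ^ τ ≤
      cq s * (3 + cq p) * 2 ^ p * ((1 + t') * Y) := by
    have : N ^ (2 * p) * N ^ (χ * D) * N ^ (χ * τ) ≤ Y := by
      rw [← pow_add, ← pow_add]; apply hpow; nlinarith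
    calc cq s * (3 + cq p) * (2 * N ^ 2) ^ p * (c * t') * (N ^ χ) ^ τ
        ≤ cq s * (3 + cq p) * (2 * N ^ 2) ^ p * (N ^ (χ * D) * t') * (N ^ χ) ^ τ := by gcongr
      _ = cq s * (3 + cq p) * 2 ^ p * (t' * (N ^ (2 * p) * N ^ (χ * D) * N ^ (χ * τ))) := by
          rw [e1, ← pow_mul]; ring
      _ ≤ cq s * (3 + cq p) * 2 ^ p * (t' * Y) := by gcongr
      _ ≤ _ := by gcongr
  have t3 : N ^ τ * (3 * N) ^ s * (2 * N ^ 2) ^ p ≤ 3 ^ s * 2 ^ p * ((1 + t') * Y) := by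
    have : N ^ τ * N ^ s * N ^ (2 * p) ≤ Y := by
      rw [← pow_add, ← pow_add]; apply hpow; omega
    calc N ^ τ * (3 * N) ^ s * (2 * N ^ 2) ^ p = 3 ^ s * 2 ^ p * (N ^ τ * N ^ s * N ^ (2 * p)) := by
          rw [e1, mul_pow]; ring
      _ ≤ 3 ^ s * 2 ^ p * Y := by gcongr
      _ ≤ _ := by gcongr
  have t4 : cq s * (3 + cq p) * (2 * N ^ 2) ^ p *
        (c * (cF * (2 ^ (s + p) * (N ^ τ * (3 * N) ^ (s + p) * t + N ^ τ * t')))) * (N ^ χ) ^ τ ≤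
      cq s * (3 + cq p) * 2 ^ p * (2 ^ (s + p) * 3 ^ (s + p)) * ((1 + t') * Y) := by
    have h1 : N ^ τ * (3 * N) ^ (s + p) * t + N ^ τ * t' ≤
        3 ^ (s + p) * (N ^ τ * N ^ (s + p)) * (1 + t') := by
      have h3 : N ^ τ * (3 * N) ^ (s + p) * t ≤ 3 ^ (s + p) * (N ^ τ * N ^ (s + p)) * 1 := by
        rw [mul_pow]
        calc N ^ τ * (3 ^ (s + p) * N ^ (s + p)) * t ≤ N ^ τ * (3 ^ (s + p) * N ^ (s + p)) * 1 := by
              gcongr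
          _ = _ := by ring
      have h4 : N ^ τ ≤ 3 ^ (s + p) * (N ^ τ * N ^ (s + p)) := by
        have h5 : (1 : ℝ) ≤ 3 ^ (s + p) := one_le_pow₀ (by norm_num)
        have h6 : (1 : ℝ) ≤ N ^ (s + p) := one_le_pow₀ hN
        calc N ^ τ = 1 * (N ^ τ * 1) := by ring
          _ ≤ _ := by gcongr
      have h7 : N ^ τ * t' ≤ 3 ^ (s + p) * (N ^ τ * N ^ (s + p)) * t' := by gcongr
      linarith
    have h2 : N ^ (2 * p) * N ^ (χ * D) * N ^ D * (N ^ τ * N ^ (s + p)) * N ^ (χ * τ) ≤ Y := by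
      simp only [← pow_add]; apply hpow; nlinarith
    calc cq s * (3 + cq p) * (2 * N ^ 2) ^ p *
        (c * (cF * (2 ^ (s + p) * (N ^ τ * (3 * N) ^ (s + p) * t + N ^ τ * t')))) * (N ^ χ) ^ τ
        ≤ cq s * (3 + cq p) * (2 * N ^ 2) ^ p *
        (N ^ (χ * D) * (N ^ D * (2 ^ (s + p) * (3 ^ (s + p) * (N ^ τ * N ^ (s + p)) * (1 + t')))))
          * (N ^ χ) ^ τ := by gcongr
      _ = cq s * (3 + cq p) * 2 ^ p * (2 ^ (s + p) * 3 ^ (s + p)) * ((1 + t') *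
          (N ^ (2 * p) * N ^ (χ * D) * N ^ D * (N ^ τ * N ^ (s + p)) * N ^ (χ * τ))) := by
          rw [e1, ← pow_mul N χ τ]; ring
      _ ≤ _ := by gcongr
  have t5 : (N ^ χ) ^ τ * (2 * N ^ X.C) ^ s ≤ 2 ^ s * ((1 + t') * Y) := by
    have : N ^ (χ * τ) * N ^ (X.C * s) ≤ Y := by
      rw [← pow_add]; apply hpow; nlinarith
    calc (N ^ χ) ^ τ * (2 * N ^ X.C) ^ s = 2 ^ s * (N ^ (χ * τ) * N ^ (X.C * s)) := by
          rw [mul_pow, ← pow_mul, ← pow_mul]; ring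
      _ ≤ 2 ^ s * Y := by gcongr
      _ ≤ _ := by gcongr
  have t6 : (N ^ χ) ^ τ * c ^ 2 * (cq s * (2 * (2 * N ^ X.C)) ^ s * t' * (N ^ χ) ^ τ) ≤
      cq s * 4 ^ s * ((1 + t') * Y) := by
    have : N ^ (χ * τ) * (N ^ (χ * D)) ^ 2 * N ^ (X.C * s) * N ^ (χ * τ) ≤ Y := by
      rw [← pow_mul]; simp only [← pow_add]; apply hpow; nlinarith
    calc (N ^ χ) ^ τ * c ^ 2 * (cq s * (2 * (2 * N ^ X.C)) ^ s * t' * (N ^ χ) ^ τ)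
        ≤ (N ^ χ) ^ τ * (N ^ (χ * D)) ^ 2 * (cq s * (2 * (2 * N ^ X.C)) ^ s * t' * (N ^ χ) ^ τ) := by
          gcongr
      _ = cq s * 4 ^ s * (t' * (N ^ (χ * τ) * (N ^ (χ * D)) ^ 2 * N ^ (X.C * s) * N ^ (χ * τ))) := by
          rw [show 2 * (2 * N ^ X.C) = 4 * N ^ X.C by ring, mul_pow 4, ← pow_mul N χ τ,
            ← pow_mul N X.C s]
          ring
      _ ≤ cq s * 4 ^ s * (t' * Y) := by gcongr
      _ ≤ _ := by gcongr
  have hms : msConst s p * (1 + t') * Y = 2 * ((2 ^ p * ((1 + t') * Y) +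
      cq s * (3 + cq p) * 2 ^ p * ((1 + t') * Y)) + (3 ^ s * 2 ^ p * ((1 + t') * Y) +
      cq s * (3 + cq p) * 2 ^ p * (2 ^ (s + p) * 3 ^ (s + p)) * ((1 + t') * Y)) +
      (2 ^ s * ((1 + t') * Y) + cq s * 4 ^ s * ((1 + t') * Y))) := by
    unfold msConst; ring
  rw [hms]
  linarith

/-- Bad sites are the singular sites whose box of radius `N` is not coercive; there are at most `N ^
kap` of them over each `j`, so clusters have diameter of order `N ^ C`. The exponent `p` is such
that `N ^ (2 p)` beats the ℓ² bound `N ^ (χ τ)` on the large box, and the decay `2 ζ` of the small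
boxes beats their constant `N ^ ζ`. The thresholds `Nmin` and `t₀` are fixed before `s`, and `t'` is
arbitrary. -/
theorem multiscale_step {ee e : ℝ} (X : Expo K ee e) :
    ∃ (Nmin : ℕ) (t₀ : ℝ), 0 < t₀ ∧ ∀ (N : ℕ), Nmin ≤ N →
      ∀ (om : Fin K.d → ℝ) (DD : K.Lam → K.A → ℝ → ℂ) (lam : ℝ) (T : Ker K) (t : ℝ),
      ToepKer T → 0 ≤ t → t ≤ t₀ → TB T (X.p + 2 * rd K) t → TB T (2 * X.ζ) t →
      (∀ (θ : ℝ) (Sig : Set (Idx K)), IsSingularSet (Dtheta om DD lam θ) ((N : ℝ) ^ X.kap) Sig →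
        ∀ (ℓ : ℕ) (k : Fin (ℓ + 1) → Idx K), (∀ q, k q ∈ Sig) → IsChainOfLength ((N : ℝ) ^ 2) ℓ k →
          (ℓ : ℝ) ≤ ((N : ℝ) ^ 2 * (N : ℝ) ^ X.kap) ^ e) →
      (∀ l : Fin K.d → ℤ, l ≠ 0 → ‖l‖ ≤ 2 * (N : ℝ) ^ X.χ →
        ((N : ℝ) ^ X.τ)⁻¹ < |lam * ∑ p, om p * l p|) →
      (∀ j₀ : K.Lam, CoveredBy
        {θ | ¬ Coer (Dtheta om DD lam θ) T (bx N (toSite (0, j₀))) ((N : ℝ) ^ X.τ)}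
        ((N : ℝ) ^ ee) ((N : ℝ) ^ X.τ)⁻¹) →
      (∀ i θ, Coer (Dtheta om DD lam θ) T (bx N (toSite i)) ((N : ℝ) ^ X.τ) →
        ColDec (Dtheta om DD lam θ) T (bx N (toSite i)) (2 * X.ζ) ((N : ℝ) ^ X.ζ)) →
      ∀ (i : Site K), (∃ j₀ ∈ K.Lam, ‖j₀ - i.2‖ ≤ N) → ∀ θ,
        Coer (Dtheta om DD lam θ) T (bx (N ^ X.χ) i) (((N : ℝ) ^ X.χ) ^ X.τ) →
        ∀ (s : ℕ) (t' : ℝ), 0 ≤ t' → TB T (s + X.p) t' →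
          ColDec (Dtheta om DD lam θ) T (bx (N ^ X.χ) i) s
            (msConst s X.p * (1 + t') * (N : ℝ) ^ (X.e₀ + X.C * s)) := by
  obtain ⟨Cσ, hCσ1, hCσ⟩ := exists_sum_jb_le (K := K)
  have cp := cq_pos X.p
  obtain ⟨n1, hn1⟩ := exists_nat_ge (4 * ((9 + 3 * cq X.p) * 2 ^ (2 * X.ζ)))
  obtain ⟨n2, hn2⟩ := exists_nat_ge ((6 : ℝ) * 8 ^ X.p)
  refine ⟨max (max n1 n2) (Fintype.card K.A * 3 ^ rd K + 2),
    min 1 (1 / (2 * ((9 + 3 * cq X.p) * Cσ))), lt_min one_pos (by positivity), ?_⟩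
  intro N hN om DD lam T t hT ht0 ht htp htsd hsep hdio hbad hind i hi θ hC s t' ht'0 ht'
  have hN1 : n1 ≤ N := (le_max_left _ _).trans ((le_max_left _ _).trans hN)
  have hN2 : n2 ≤ N := (le_max_right _ _).trans ((le_max_left _ _).trans hN)
  have hNA : Fintype.card K.A * 3 ^ rd K + 2 ≤ N := (le_max_right _ _).trans hN
  have hNn : (2 : ℝ) ≤ N := by
    have : 2 ≤ N := by omega
    exact_mod_cast this
  have hNr : (1 : ℝ) ≤ N := by linarith
  have hn1N : 4 * ((9 + 3 * cq X.p) * 2 ^ (2 * X.ζ)) ≤ (N : ℝ) := hn1.trans (by exact_mod_cast hN1)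
  have hn2N : (6 : ℝ) * 8 ^ X.p ≤ (N : ℝ) := hn2.trans (by exact_mod_cast hN2)
  have ht1 : t ≤ 1 := ht.trans (min_le_left _ _)
  have htσ : (9 + 3 * cq X.p) * (t * Cσ) ≤ 1 / 2 := by
    have := ht.trans (min_le_right _ _)
    rw [le_div_iff₀ (by positivity)] at this
    linarith
  have hχ1 : 1 ≤ X.χ := by rw [X.hχ]; exact Nat.one_le_two_pow
  have hNχ : N ≤ N ^ X.χ := Nat.le_self_pow (by omega) N
  -- Centres are clamped to the cube of radius `R`, so that the small boxes stay inside the large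
  -- one.
  obtain ⟨R, hR⟩ : ∃ R, N ^ X.χ = R + N := ⟨N ^ X.χ - N, by omega⟩
  have hcl : ∀ j : K.Lam, clamp R i.2 j.1 ∈ K.Lam := by
    obtain ⟨j₀, h₀, hj⟩ := hi
    have h1 : N * N ≤ N ^ X.χ := by
      rw [← pow_two]
      exact Nat.pow_le_pow_right (by omega) (by have := X.hC; have := X.hχC; omega)
    have h2 : 2 * N ≤ N * N := Nat.mul_le_mul_right _ (by omega)
    exact fun j => clamp_mem h₀ (hj.trans (by exact_mod_cast (by omega : N ≤ R))) j.2
  have hpow : ∀ {a b : ℕ}, a ≤ b → (N : ℝ) ^ a ≤ (N : ℝ) ^ b := fun h => pow_le_pow_right₀ hNr h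
  set D := rd K + 1 with hD
  have hcardF : ∀ i', ((bx N i').card : ℝ) ≤ (N : ℝ) ^ D := fun i' => card_bx_le_pow (by omega) i'
  have hcardE : ((bx (N ^ X.χ) i).card : ℝ) ≤ (N : ℝ) ^ (X.χ * D) := by
    have := card_bx_le_pow (K := K) (N := N ^ X.χ) (by omega) i
    rwa [Nat.cast_pow, ← pow_mul] at this
  set E := bx (N ^ X.χ) i with hE
  set m := Dtheta om DD lam θ with hm
  have hEmem : ∀ {k}, k ∈ E → k ∈ bx (R + N) i := fun h => by rwa [hE, hR] at h
  let Bad : Set (Idx K) :=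
    {k | k ∈ E ∧ ‖m k‖ < 1 ∧ ¬ Coer m T (bx N (ctr R i k)) ((N : ℝ) ^ X.τ)}
  have hsing : IsSingularSet m ((N : ℝ) ^ X.kap) Bad := by
    refine ⟨fun k hk => hk.2.1, fun j => ?_⟩
    have h1 := ncard_section_le (om := om) (lam := lam) (θ := θ) (δ := ((N : ℝ) ^ X.τ)⁻¹)
      (M := (N : ℝ) ^ ee) (by positivity) (R := R) (N := N) (i := i) (j := j)
      (S := {k ∈ Bad | k.2.1 = j}) (fun k hk => hk.2) (fun k hk => hEmem hk.1.1)
      (hbad ⟨clamp R i.2 j.1, hcl j⟩) ?_ ?_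
    · refine ⟨h1.1, h1.2.trans ?_⟩
      have h2 : ((2 * (N : ℝ) + 1) ^ K.d * Fintype.card K.A) ≤ (N : ℝ) ^ (K.d + 1) := by
        have h3 : (Fintype.card K.A : ℝ) * 3 ^ K.d ≤ N := by
          have : Fintype.card K.A * 3 ^ K.d ≤ N := by
            have h4 : Fintype.card K.A * 3 ^ K.d ≤ Fintype.card K.A * 3 ^ rd K :=
              Nat.mul_le_mul_left _ (Nat.pow_le_pow_right (by norm_num) (Nat.le_add_right _ _))
            omega
          exact_mod_cast this
        calc (2 * (N : ℝ) + 1) ^ K.d * Fintype.card K.A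
            ≤ (3 * (N : ℝ)) ^ K.d * Fintype.card K.A := by gcongr; linarith
          _ = Fintype.card K.A * 3 ^ K.d * (N : ℝ) ^ K.d := by rw [mul_pow]; ring
          _ ≤ N * (N : ℝ) ^ K.d := by gcongr
          _ = _ := by ring
      calc (N : ℝ) ^ ee * ((2 * (N : ℝ) + 1) ^ K.d * Fintype.card K.A)
          ≤ (N : ℝ) ^ ee * (N : ℝ) ^ (K.d + 1) := by gcongr
        _ = (N : ℝ) ^ (ee + (K.d + 1 : ℕ)) := by
            rw [Real.rpow_add (by linarith), Real.rpow_natCast]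
        _ ≤ (N : ℝ) ^ (X.kap : ℝ) := by
            apply Real.rpow_le_rpow_of_exponent_le hNr
            have := X.hkap
            push_cast; linarith
        _ = _ := Real.rpow_natCast _ _
    · rintro k ⟨hk, rfl⟩
      exact fun h => hk.2.2 (coer_shift (j := ⟨clamp R i.2 k.2.1.1, hcl k.2.1⟩) hT h)
    · intro l hl hln
      refine hdio l hl (hln.trans ?_)
      have : (R : ℝ) ≤ (N : ℝ) ^ X.χ := by
        have : R ≤ N ^ X.χ := by omega
        exact_mod_cast this
      linarith
  set Λ := ((N : ℝ) ^ 2 * (N : ℝ) ^ X.kap) ^ e with hΛ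
  have hΓΛ : (N : ℝ) ^ 2 * Λ ≤ (N : ℝ) ^ X.C := by
    have h1 : Λ ≤ (N : ℝ) ^ ((2 + X.kap) * ⌈e⌉₊) := by
      rw [pow_mul, pow_add]
      exact rpow_le_pow_ceil (by rw [← pow_add]; exact one_le_pow₀ hNr) e
    calc (N : ℝ) ^ 2 * Λ ≤ (N : ℝ) ^ 2 * (N : ℝ) ^ ((2 + X.kap) * ⌈e⌉₊) := by gcongr
      _ = (N : ℝ) ^ (2 + (2 + X.kap) * ⌈e⌉₊) := (pow_add _ _ _).symm
      _ ≤ _ := hpow X.hC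
  have hN2 : (1 : ℝ) ≤ (N : ℝ) ^ 2 := one_le_pow₀ hNr
  have hN4 : (4 : ℝ) ≤ (N : ℝ) ^ 2 := by nlinarith
  have hNC : (N : ℝ) ^ 2 ≤ (N : ℝ) ^ X.C := hpow (by have := X.hC; omega)
  have hζ := X.hζ
  have he₀ := X.he₀
  have hp := X.hp
  have hχD : 2 * X.χ * D = 2 * (X.χ * D) := mul_assoc _ _ _
  have hχτ : 2 * X.χ * X.τ = 2 * (X.χ * X.τ) := mul_assoc _ _ _
  rw [← hD] at hζ he₀ hp
  have hτζ : X.τ ≤ X.ζ := by omega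
  have step := colDec_of_goodSites (m := m) (T := T) (E := E) (Bad := Bad) (s := s) (p := X.p)
    (sd := 2 * X.ζ) (N := N) (G := (2 * (N : ℝ) ^ 2) ^ X.p) (t := t) (t' := t')
    (b := (N : ℝ) ^ X.τ) (b' := ((N : ℝ) ^ X.χ) ^ X.τ) (z := (N : ℝ) ^ X.ζ) (cF := (N : ℝ) ^ D)
    (X := 2 * (N : ℝ) ^ X.C) (Cσ := Cσ) hNr (by positivity) (by positivity) (by positivity)
    (by positivity) (by omega) (by linarith) (pow_le_pow_left₀ (by positivity) (by linarith) _)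
    hC ?_ (fun o ho => ho.1) ?_ (fun k => hCσ k E) ht0 ht'0 htp htsd ht' htσ ?_ ?_
  · exact step.mono (ms_bound X s hNr ht1 ht0 ht'0 (Nat.cast_nonneg _) hcardE (by positivity) le_rfl)
  · intro k hk hkB
    by_cases hreg : 1 ≤ ‖m k‖
    · exact Or.inl hreg
    · right
      have hCk : Coer m T (bx N (ctr R i k)) ((N : ℝ) ^ X.τ) := by
        by_contra h
        exact hkB ⟨hk, not_le.1 hreg, h⟩
      have hsub := bx_ctr_subset R N i k
      rw [← hR] at hsub
      refine ⟨_, hsub, mem_bx_ctr (hEmem hk), fun k' hk' hn =>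
        le_jb_of_not_mem_bx_ctr (hEmem hk) (hEmem hk') hn, fun k' hk' => ?_, hCk,
        hind (_, ⟨_, hcl k.2.1⟩) _ hCk,
        hcardF _⟩
      have := jb_le_of_mem_bx (mem_bx_ctr (hEmem hk)) hk'
      linarith
  · intro k hk
    obtain ⟨Om, h1, h2, h3, h4⟩ := exists_cluster hN2 (fun ℓ k hkq hch => hsep θ Bad hsing ℓ k hkq hch)
      hk
    refine ⟨Om, h1, h2, fun o ho k' hk' => ?_, h4⟩
    have h5 := h3 o ho
    have h6 := norm_sub_le_norm_sub_add_norm_sub (site k) (site o) (site k')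
    rw [norm_sub_rev (site o) (site k')] at h6
    have h7 := jb_le_one_add k k'
    linarith
  · have hz : (N : ℝ) ^ X.ζ * t + (N : ℝ) ^ X.τ * t ≤ 2 * (N : ℝ) ^ X.ζ := by
      have h1 : (N : ℝ) ^ X.τ ≤ (N : ℝ) ^ X.ζ := hpow hτζ
      have h2 : (N : ℝ) ^ X.ζ * t ≤ (N : ℝ) ^ X.ζ * 1 := by gcongr
      have h3 : (N : ℝ) ^ X.τ * t ≤ (N : ℝ) ^ X.ζ * 1 := by gcongr
      linarith
    calc (9 + 3 * cq X.p) * (E.card * ((N : ℝ) ^ D * (2 ^ (2 * X.ζ) *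
          ((N : ℝ) ^ X.ζ * t + (N : ℝ) ^ X.τ * t))))
        ≤ (9 + 3 * cq X.p) * ((N : ℝ) ^ (X.χ * D) * ((N : ℝ) ^ D * (2 ^ (2 * X.ζ) *
          (2 * (N : ℝ) ^ X.ζ)))) := by gcongr
      _ = 1 / 2 * (4 * ((9 + 3 * cq X.p) * 2 ^ (2 * X.ζ))) * (N : ℝ) ^ (X.χ * D + D + X.ζ) := by
          rw [pow_add, pow_add]; ring
      _ ≤ 1 / 2 * N * (N : ℝ) ^ (X.χ * D + D + X.ζ) := by gcongr
      _ = 1 / 2 * (N : ℝ) ^ (X.χ * D + D + X.ζ + 1) := by ring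
      _ ≤ _ := by
          have : (N : ℝ) ^ (X.χ * D + D + X.ζ + 1) ≤ (N : ℝ) ^ (2 * X.ζ - X.p) := hpow (by omega)
          gcongr
  · calc 3 * ((N : ℝ) ^ X.χ) ^ X.τ * (E.card : ℝ) ^ 2 * t * 8 ^ X.p
        ≤ 3 * ((N : ℝ) ^ X.χ) ^ X.τ * ((N : ℝ) ^ (X.χ * D)) ^ 2 * 1 * 8 ^ X.p := by gcongr
      _ = 1 / 2 * (6 * 8 ^ X.p) * (N : ℝ) ^ (X.χ * X.τ + 2 * X.χ * D) := by
          rw [← pow_mul, ← pow_mul, pow_add]; ring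
      _ ≤ 1 / 2 * N * (N : ℝ) ^ (X.χ * X.τ + 2 * X.χ * D) := by gcongr
      _ = 1 / 2 * (N : ℝ) ^ (X.χ * X.τ + 2 * X.χ * D + 1) := by ring
      _ ≤ _ := by
          have : (N : ℝ) ^ (X.χ * X.τ + 2 * X.χ * D + 1) ≤ (N : ℝ) ^ (2 * X.p) := hpow (by omega)
          gcongr

/-- The constant in the multiscale estimate. -/
def decConst (s p : ℕ) : ℝ := msConst s p + 4 + 4 * cq s

theorem four_le_decConst (s p : ℕ) : 4 ≤ decConst s p := by
  have := msConst_pos s p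
  have := cq_pos s
  unfold decConst
  linarith

/-- The start of the induction: coercivity and the smallness of `T` bound all diagonal entries below
by `1 / (2 N ^ τ)`, and then the operator is a small perturbation of its diagonal. -/
theorem colDec_initial {m : Idx K → ℂ} {T : Ker K} {N τ : ℕ} {i : Site K} {t : ℝ}
    (hN : Fintype.card K.A * 3 ^ rd K + 1 ≤ N) (hC : Coer m T (bx N i) ((N : ℝ) ^ τ))
    (ht0 : 0 ≤ t) (ht : TB T 0 t) (hs : 12 * (N : ℝ) ^ (τ + (rd K + 1)) * t ≤ 1) (s p : ℕ) {t' : ℝ}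
    (ht'0 : 0 ≤ t') (ht' : TB T s t') :
    ColDec m T (bx N i) s (decConst s p * (1 + t') * (N : ℝ) ^ (2 * τ + (rd K + 1))) := by
  have hN1 : (1 : ℝ) ≤ N := by exact_mod_cast (by omega : 1 ≤ N)
  have hcard := card_bx_le_pow hN i
  have hb : 0 < (N : ℝ) ^ τ := by positivity
  have h1 : (N : ℝ) ^ τ * ((bx N i).card * t) ≤ (N : ℝ) ^ (τ + (rd K + 1)) * t := by
    rw [pow_add, mul_assoc]; gcongr
  have hμ : ∀ k ∈ bx N i, 0 < dim k → 1 / (2 * (N : ℝ) ^ τ) ≤ ‖m k‖ := fun k hk hd =>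
    le_norm_diag_of_coer hb hC ht (by linarith) hk hd
  refine (colDec_of_diagonal (by positivity) hμ hb.le hC ht ht' ht0 ht'0 ?_).mono ?_
  · rw [one_div, inv_inv]
    linarith
  · rw [one_div, inv_inv]
    have h2 := msConst_pos s p
    have h3 := cq_pos s
    have e1 : (N : ℝ) ^ τ ≤ (N : ℝ) ^ (2 * τ + (rd K + 1)) := pow_le_pow_right₀ hN1 (by omega)
    have e2 : (N : ℝ) ^ τ * (bx N i).card * (N : ℝ) ^ τ ≤ (N : ℝ) ^ (2 * τ + (rd K + 1)) := by
      calc (N : ℝ) ^ τ * (bx N i).card * (N : ℝ) ^ τ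
          ≤ (N : ℝ) ^ τ * (N : ℝ) ^ (rd K + 1) * (N : ℝ) ^ τ := by gcongr
        _ = _ := by ring
    set Y := (N : ℝ) ^ (2 * τ + (rd K + 1))
    calc 2 * (2 * (N : ℝ) ^ τ + 2 * (N : ℝ) ^ τ * (cq s * ((bx N i).card * t') * (N : ℝ) ^ τ))
        = 4 * (N : ℝ) ^ τ + 4 * cq s * t' * ((N : ℝ) ^ τ * (bx N i).card * (N : ℝ) ^ τ) := by ring
      _ ≤ 4 * Y + 4 * cq s * t' * Y := by gcongr
      _ ≤ decConst s p * (1 + t') * Y := by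
          have hY : 0 ≤ Y := by positivity
          have : decConst s p * (1 + t') * Y = 4 * Y + 4 * cq s * t' * Y +
            (msConst s p * (1 + t') + 4 * t' + 4 * cq s) * Y := by unfold decConst; ring
          rw [this]
          exact le_add_of_nonneg_right (by positivity)

/-- Off-diagonal decay, at all scales `N₀^(2^n)`, of the inverses of truncations that are bounded in
`L²`. -/
theorem multiscale {ee e : ℝ} (X : Expo K ee e) :
    ∃ (Nmin : ℕ), ∀ (N₀ : ℕ), Nmin ≤ N₀ →
      ∀ (om : Fin K.d → ℝ) (DD : K.Lam → K.A → ℝ → ℂ) (lam : ℝ) (T : Ker K) (t : ℝ),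
      ToepKer T → 0 ≤ t → (N₀ : ℝ) ^ (X.χ * (X.τ + (rd K + 1)) + 1) * t ≤ 1 →
      TB T (2 * X.ζ + X.p + 2 * rd K) t →
      (∀ n : ℕ, ∀ (θ : ℝ) (Sig : Set (Idx K)),
        IsSingularSet (Dtheta om DD lam θ) (((N₀ ^ 2 ^ n : ℕ) : ℝ) ^ X.kap) Sig →
        ∀ (ℓ : ℕ) (k : Fin (ℓ + 1) → Idx K), (∀ q, k q ∈ Sig) →
          IsChainOfLength (((N₀ ^ 2 ^ n : ℕ) : ℝ) ^ 2) ℓ k →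
          (ℓ : ℝ) ≤ (((N₀ ^ 2 ^ n : ℕ) : ℝ) ^ 2 * ((N₀ ^ 2 ^ n : ℕ) : ℝ) ^ X.kap) ^ e) →
      (∀ n : ℕ, ∀ l : Fin K.d → ℤ, l ≠ 0 → ‖l‖ ≤ 2 * ((N₀ ^ 2 ^ n : ℕ) : ℝ) ^ X.χ →
        (((N₀ ^ 2 ^ n : ℕ) : ℝ) ^ X.τ)⁻¹ < |lam * ∑ p, om p * l p|) →
      ∀ n : ℕ, (∀ m < n, ∀ j₀ : K.Lam, CoveredBy
        {θ | ¬ Coer (Dtheta om DD lam θ) T (bx (N₀ ^ 2 ^ m) (toSite (0, j₀)))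
          (((N₀ ^ 2 ^ m : ℕ) : ℝ) ^ X.τ)}
        (((N₀ ^ 2 ^ m : ℕ) : ℝ) ^ ee) (((N₀ ^ 2 ^ m : ℕ) : ℝ) ^ X.τ)⁻¹) →
      ∀ (i : Site K), (∃ j₀ ∈ K.Lam, ‖j₀ - i.2‖ ≤ N₀) → ∀ θ,
        Coer (Dtheta om DD lam θ) T (bx (N₀ ^ 2 ^ n) i) (((N₀ ^ 2 ^ n : ℕ) : ℝ) ^ X.τ) →
        ∀ (s q : ℕ) (t' : ℝ), X.C * s ≤ X.χ * q → 0 ≤ t' → TB T (s + X.p) t' →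
          ColDec (Dtheta om DD lam θ) T (bx (N₀ ^ 2 ^ n) i) s
            (decConst s X.p * (1 + t') * ((N₀ ^ 2 ^ n : ℕ) : ℝ) ^ (X.e₀ + q)) := by
  obtain ⟨Nst, t₀, ht₀, step⟩ := multiscale_step X
  obtain ⟨n1, hn1⟩ := exists_nat_ge (2 * decConst (2 * X.ζ) X.p)
  obtain ⟨n2, hn2⟩ := exists_nat_ge (1 / t₀)
  refine ⟨max (max Nst n1) (max n2 (Fintype.card K.A * 3 ^ rd K + 12)), ?_⟩
  intro N₀ hN om DD lam T t hT ht0 hts htb hsep hdio n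
  have hNst : Nst ≤ N₀ := (le_max_left _ _).trans ((le_max_left _ _).trans hN)
  have hN1 : n1 ≤ N₀ := (le_max_right _ _).trans ((le_max_left _ _).trans hN)
  have hN2 : n2 ≤ N₀ := (le_max_left _ _).trans ((le_max_right _ _).trans hN)
  have hNA : Fintype.card K.A * 3 ^ rd K + 12 ≤ N₀ :=
    (le_max_right _ _).trans ((le_max_right _ _).trans hN)
  have hr1 : (1 : ℝ) ≤ N₀ := by exact_mod_cast (by omega : 1 ≤ N₀)
  have hr12 : (12 : ℝ) ≤ N₀ := by exact_mod_cast (by omega : 12 ≤ N₀)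
  have hge : ∀ n, N₀ ≤ N₀ ^ 2 ^ n := fun n => Nat.le_self_pow (by positivity) N₀
  have ht1 : (N₀ : ℝ) * t ≤ 1 := by
    refine le_trans ?_ hts
    gcongr
    exact le_self_pow₀ hr1 (by omega)
  have htt₀ : t ≤ t₀ := by
    have h1 : 1 / t₀ ≤ N₀ := hn2.trans (by exact_mod_cast hN2)
    rw [div_le_iff₀ ht₀] at h1
    have h2 : (N₀ : ℝ) * t ≤ N₀ * t₀ := by linarith
    exact le_of_mul_le_mul_left h2 (by linarith)
  have htle1 : t ≤ 1 := by nlinarith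
  have hζ := X.hζ
  have he₀ := X.he₀
  have hχ1 : 1 ≤ X.χ := by rw [X.hχ]; exact Nat.one_le_two_pow
  induction n using Nat.strong_induction_on with
  | _ n ih =>
  intro hcov i hi θ hC s q t' hsq ht'0 ht'
  -- For `n < kk` the scale is at most `N₀ ^ χ`, and `T` is small with respect to the needed power
  -- of it. From `kk` on, the scale is the `χ`-th power of an earlier one, because `χ = 2 ^ kk`.
  by_cases hn : n < X.kk
  · have hle : N₀ ^ 2 ^ n ≤ N₀ ^ X.χ :=
      Nat.pow_le_pow_right (by omega) (by rw [X.hχ]; exact Nat.pow_le_pow_right (by norm_num) hn.le)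
    have hgen := hge n
    have := colDec_initial (p := X.p) (s := s) (by omega) hC ht0 (htb.mono (Nat.zero_le _)) ?_ ht'0
      (ht'.mono (Nat.le_add_right _ _))
    · refine this.mono ?_
      have h4 := four_le_decConst s X.p
      refine mul_le_mul_of_nonneg_left (pow_le_pow_right₀ ?_ ?_) (by positivity)
      · exact_mod_cast (by omega : 1 ≤ N₀ ^ 2 ^ n)
      · have h5 : X.τ ≤ X.χ * X.τ := Nat.le_mul_of_pos_left _ hχ1
        have h6 : 2 * X.χ * X.τ = 2 * (X.χ * X.τ) := mul_assoc _ _ _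
        omega
    · have h1 : ((N₀ ^ 2 ^ n : ℕ) : ℝ) ≤ (N₀ : ℝ) ^ X.χ := by exact_mod_cast hle
      calc 12 * ((N₀ ^ 2 ^ n : ℕ) : ℝ) ^ (X.τ + (rd K + 1)) * t
          ≤ N₀ * ((N₀ : ℝ) ^ X.χ) ^ (X.τ + (rd K + 1)) * t := by gcongr
        _ = (N₀ : ℝ) ^ (X.χ * (X.τ + (rd K + 1)) + 1) * t := by rw [← pow_mul]; ring
        _ ≤ 1 := hts
  · obtain ⟨m, rfl⟩ : ∃ m, n = m + X.kk := ⟨n - X.kk, by omega⟩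
    have hNm : N₀ ^ 2 ^ (m + X.kk) = (N₀ ^ 2 ^ m) ^ X.χ := by rw [X.hχ, ← pow_mul, ← pow_add]
    have hgem := hge m
    set N := N₀ ^ 2 ^ m with hNdef
    have hNr : (1 : ℝ) ≤ N := by exact_mod_cast (by omega : 1 ≤ N)
    have hN₀N : (N₀ : ℝ) ≤ N := by exact_mod_cast hgem
    have hkk : X.kk ≠ 0 := by
      intro h0
      have h1 := X.hχ
      rw [h0, pow_zero] at h1
      have := X.hC
      have := X.hχC
      omega
    -- At order `2 ζ` the induction hypothesis has to give the constant `N ^ ζ`. As `16 C ≤ χ`, the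
    -- decay costs only about `ζ / 8`, and `ζ` is more than twice `e₀`, so there is room.
    have hind : ∀ i θ, Coer (Dtheta om DD lam θ) T (bx N (toSite i)) ((N : ℝ) ^ X.τ) →
        ColDec (Dtheta om DD lam θ) T (bx N (toSite i)) (2 * X.ζ) ((N : ℝ) ^ X.ζ) := by
      intro i θ hCi
      have hq : X.C * (2 * X.ζ) ≤ X.χ * ((X.ζ + 7) / 8) := by
        have h1 : X.ζ ≤ 8 * ((X.ζ + 7) / 8) := by omega
        calc X.C * (2 * X.ζ) ≤ X.C * (2 * (8 * ((X.ζ + 7) / 8))) := by gcongr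
          _ = 16 * X.C * ((X.ζ + 7) / 8) := by ring
          _ ≤ _ := by gcongr; exact X.hχC
      have h2 := ih m (by omega) (fun m' hm' => hcov m' (by omega)) (toSite i)
        ⟨i.2, i.2.2, by simp [toSite]⟩ θ hCi (2 * X.ζ) ((X.ζ + 7) / 8) t hq ht0 (htb.mono (by omega))
      refine h2.mono ?_
      have h3 : 2 * decConst (2 * X.ζ) X.p ≤ N := hn1.trans ((Nat.cast_le.2 hN1).trans hN₀N)
      have h4 := four_le_decConst (2 * X.ζ) X.p
      calc decConst (2 * X.ζ) X.p * (1 + t) * (N : ℝ) ^ (X.e₀ + (X.ζ + 7) / 8)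
          ≤ decConst (2 * X.ζ) X.p * (1 + 1) * (N : ℝ) ^ (X.e₀ + (X.ζ + 7) / 8) := by gcongr
        _ ≤ N * (N : ℝ) ^ (X.e₀ + (X.ζ + 7) / 8) := by gcongr; linarith
        _ = (N : ℝ) ^ (X.e₀ + (X.ζ + 7) / 8 + 1) := by ring
        _ ≤ _ := pow_le_pow_right₀ hNr (by omega)
    rw [hNm] at hC ⊢
    rw [Nat.cast_pow] at hC ⊢
    have h1 := step N (hNst.trans hgem) om DD lam T t hT ht0 htt₀ (htb.mono (by omega))
      (htb.mono (by omega)) (hsep m) (hdio m) (hcov m (by omega)) hind i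
      (hi.imp fun j hj => ⟨hj.1, hj.2.trans hN₀N⟩) θ hC s t' ht'0 ht'
    refine h1.mono ?_
    have h4 : msConst s X.p ≤ decConst s X.p := by
      have := cq_pos s
      unfold decConst; linarith
    have h5 := msConst_pos s X.p
    refine mul_le_mul (by gcongr) ?_ (by positivity)
      (mul_nonneg (h5.le.trans h4) (by linarith))
    rw [← pow_mul]
    refine pow_le_pow_right₀ hNr ?_
    rw [mul_add]
    have : X.e₀ ≤ X.χ * X.e₀ := Nat.le_mul_of_pos_left _ hχ1
    omega

/-! ### A Newton iteration depending on a parameter -/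

/-- The data of an equation `D(λ) v + G(v) = 0` in a space `W`, with the bounds that are needed for a
Newton iteration with respect to the norm `‖l ·‖`. -/
structure NewtonEnv (V X : Type*) [NormedAddCommGroup V] [NormedSpace ℝ V] [NormedAddCommGroup X]
    [NormedSpace ℝ X] where
  W : Submodule ℝ V
  l : V →L[ℝ] X
  I : Set ℝ
  D : ℝ → V →L[ℝ] V
  D' : ℝ → V →L[ℝ] V
  G : V → V
  G' : V → V →L[ℝ] V
  N : ℝ
  a : ℕ
  one_le : 1 ≤ N
  ordConnected : I.OrdConnected
  norm_le : ∀ x ∈ W, ‖x‖ ≤ ‖l x‖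
  D_mem : ∀ lam x, D lam x ∈ W
  D'_mem : ∀ lam x, D' lam x ∈ W
  G_mem : ∀ v, G v ∈ W
  G'_mem : ∀ v x, G' v x ∈ W
  hasDeriv_D : ∀ lam ∈ I, HasDerivWithinAt D (D' lam) I lam
  continuousOn_D' : ContinuousOn D' I
  hasFDeriv_G : ∀ v, ‖v‖ < 1 → HasFDerivAt G (G' v) v
  continuousOn_G' : ContinuousOn G' (Metric.ball 0 1)
  D_le : ∀ lam ∈ I, ∀ x ∈ W, ‖l (D lam x)‖ ≤ N ^ a * ‖l x‖
  D'_le : ∀ lam ∈ I, ∀ x ∈ W, ‖l (D' lam x)‖ ≤ N ^ a * ‖l x‖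
  G'_le : ∀ v ∈ W, ‖l v‖ < 1 → ∀ x ∈ W, ‖l (G' v x)‖ ≤ N ^ a * ‖l x‖
  G'_lip : ∀ v ∈ W, ‖l v‖ < 1 → ∀ w ∈ W, ‖l w‖ < 1 → ∀ x ∈ W,
    ‖l (G' v x - G' w x)‖ ≤ N * ‖l (v - w)‖ * ‖l x‖

namespace NewtonEnv

variable {V X : Type*} [NormedAddCommGroup V] [NormedSpace ℝ V] [NormedAddCommGroup X]
  [NormedSpace ℝ X] (E : NewtonEnv V X)

/-- `v` is a `C¹` path in `W` with derivative `v'`. -/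
structure IsPath (v v' : ℝ → V) : Prop where
  mem : ∀ lam ∈ E.I, v lam ∈ E.W
  mem' : ∀ lam ∈ E.I, v' lam ∈ E.W
  hasDeriv : ∀ lam ∈ E.I, HasDerivWithinAt v (v' lam) E.I lam
  cont : ContinuousOn v' E.I

/-- The linearised operator. -/
def L (lam : ℝ) (v : V) : V →L[ℝ] V := E.D lam + E.G' v

/-- The residual. -/
def res (v : ℝ → V) (lam : ℝ) : V := E.D lam (v lam) + E.G (v lam)

/-- The derivative of the residual along a path. -/
def res' (v v' : ℝ → V) (lam : ℝ) : V :=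
  E.D' lam (v lam) + E.L lam (v lam) (v' lam)

/-- One step of the Newton iteration. -/
def step (Q : ℝ → V →L[ℝ] V) (v : ℝ → V) (lam : ℝ) : V := v lam - Q lam (E.res v lam)

/-- The derivative of one step of the Newton iteration. -/
def step' (Q Q' : ℝ → V →L[ℝ] V) (v v' : ℝ → V) (lam : ℝ) : V :=
  v' lam - (Q' lam (E.res v lam) + Q lam (E.res' v v' lam))

/-- An approximate right inverse that depends on the parameter. -/
structure IsPrecond (Q Q' : ℝ → V →L[ℝ] V) (B B' : ℝ) : Prop where
  mem : ∀ lam x, Q lam x ∈ E.W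
  mem' : ∀ lam x, Q' lam x ∈ E.W
  hasDeriv : ∀ lam ∈ E.I, HasDerivWithinAt Q (Q' lam) E.I lam
  cont : ContinuousOn Q' E.I
  le : ∀ lam ∈ E.I, ∀ x ∈ E.W, ‖E.l (Q lam x)‖ ≤ B * ‖E.l x‖
  le' : ∀ lam ∈ E.I, ∀ x ∈ E.W, ‖E.l (Q' lam x)‖ ≤ B' * ‖E.l x‖

variable {E} {v v' : ℝ → V} {Q Q' : ℝ → V →L[ℝ] V} {B B' : ℝ}

theorem L_mem (lam : ℝ) (v x : V) : E.L lam v x ∈ E.W :=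
  E.W.add_mem (E.D_mem _ _) (E.G'_mem _ _)

theorem res_mem (v : ℝ → V) (lam : ℝ) : E.res v lam ∈ E.W := E.W.add_mem (E.D_mem _ _) (E.G_mem _)

theorem res'_mem (v v' : ℝ → V) (lam : ℝ) : E.res' v v' lam ∈ E.W :=
  E.W.add_mem (E.D'_mem _ _) (L_mem _ _ _)

theorem norm_lt (hv : E.IsPath v v') {lam : ℝ} (hl : lam ∈ E.I) (h : ‖E.l (v lam)‖ < 1) :
    ‖v lam‖ < 1 := (E.norm_le _ (hv.mem lam hl)).trans_lt h

theorem IsPath.continuousOn (hv : E.IsPath v v') : ContinuousOn v E.I :=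
  fun lam hl => (hv.hasDeriv lam hl).continuousWithinAt

theorem hasDeriv_res (hv : E.IsPath v v') (h1 : ∀ lam ∈ E.I, ‖E.l (v lam)‖ < 1) {lam : ℝ}
    (hl : lam ∈ E.I) : HasDerivWithinAt (E.res v) (E.res' v v' lam) E.I lam := by
  have hd := (E.hasDeriv_D lam hl).clm_apply (hv.hasDeriv lam hl)
  have hg := (E.hasFDeriv_G _ (norm_lt hv hl (h1 lam hl))).comp_hasDerivWithinAt lam
    (hv.hasDeriv lam hl)
  refine (hd.add hg).congr_deriv ?_
  simp only [res', L, add_apply]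
  abel

theorem continuousOn_res' (hv : E.IsPath v v') (h1 : ∀ lam ∈ E.I, ‖E.l (v lam)‖ < 1) :
    ContinuousOn (E.res' v v') E.I := by
  have hD : ContinuousOn E.D E.I := fun lam hl => (E.hasDeriv_D lam hl).continuousWithinAt
  have hG : ContinuousOn (fun lam => E.G' (v lam)) E.I :=
    E.continuousOn_G'.comp hv.continuousOn fun lam hl => by
      simpa using norm_lt hv hl (h1 lam hl)
  exact (E.continuousOn_D'.clm_apply hv.continuousOn).add ((hD.add hG).clm_apply hv.cont)

theorem isPath_step (hv : E.IsPath v v') (h1 : ∀ lam ∈ E.I, ‖E.l (v lam)‖ < 1)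
    (hQ : E.IsPrecond Q Q' B B') : E.IsPath (E.step Q v) (E.step' Q Q' v v') where
  mem lam hl := E.W.sub_mem (hv.mem lam hl) (hQ.mem _ _)
  mem' lam hl := E.W.sub_mem (hv.mem' lam hl) (E.W.add_mem (hQ.mem' _ _) (hQ.mem _ _))
  hasDeriv lam hl := (hv.hasDeriv lam hl).sub
    ((hQ.hasDeriv lam hl).clm_apply (hasDeriv_res hv h1 hl))
  cont := by
    have h2 : ContinuousOn Q E.I := fun lam hl => (hQ.hasDeriv lam hl).continuousWithinAt
    have h3 : ContinuousOn (E.res v) E.I := fun lam hl => (hasDeriv_res hv h1 hl).continuousWithinAt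
    exact hv.cont.sub ((hQ.cont.clm_apply h3).add (h2.clm_apply (continuousOn_res' hv h1)))

theorem norm_step_sub_le (hQ : E.IsPrecond Q Q' B B') {lam : ℝ} (hl : lam ∈ E.I) :
    ‖E.l (E.step Q v lam - v lam)‖ ≤ B * ‖E.l (E.res v lam)‖ := by
  rw [step, sub_sub_cancel_left, map_neg, norm_neg]
  exact hQ.le lam hl _ (res_mem _ _)

theorem norm_step'_sub_le (hQ : E.IsPrecond Q Q' B B') {lam : ℝ} (hl : lam ∈ E.I) :
    ‖E.l (E.step' Q Q' v v' lam - v' lam)‖ ≤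
      B' * ‖E.l (E.res v lam)‖ + B * ‖E.l (E.res' v v' lam)‖ := by
  rw [step', sub_sub_cancel_left, map_neg, norm_neg, map_add]
  exact (norm_add_le _ _).trans
    (add_le_add (hQ.le' lam hl _ (res_mem _ _)) (hQ.le lam hl _ (res'_mem _ _ _)))

theorem norm_L_le {lam : ℝ} (hl : lam ∈ E.I) {v x : V} (hv : v ∈ E.W) (hv1 : ‖E.l v‖ < 1)
    (hx : x ∈ E.W) : ‖E.l (E.L lam v x)‖ ≤ 2 * E.N ^ E.a * ‖E.l x‖ := by
  rw [L, add_apply, map_add]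
  have := norm_add_le (E.l (E.D lam x)) (E.l (E.G' v x))
  have := E.D_le lam hl x hx
  have := E.G'_le v hv hv1 x hx
  linarith

/-- The mean value inequality for `t ↦ G (v + t h) - t G' v h`, whose derivative is controlled by
the Lipschitz bound for `G'`. -/
theorem norm_taylor_le {v h : V} (hv : v ∈ E.W) (hh : h ∈ E.W) (h1 : ‖E.l v‖ < 1)
    (h2 : ‖E.l (v + h)‖ < 1) :
    ‖E.l (E.G (v + h) - E.G v - E.G' v h)‖ ≤ E.N * ‖E.l h‖ ^ 2 := by
  have hseg : ∀ t ∈ Set.Icc (0 : ℝ) 1, ‖E.l (v + t • h)‖ < 1 := by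
    intro t ht
    have he : v + t • h = (1 - t) • v + t • (v + h) := by
      rw [smul_add, sub_smul, one_smul]; abel
    have h3 : E.l (v + t • h) ∈ Metric.ball (0 : X) 1 := by
      rw [he, map_add, map_smul, map_smul]
      exact convex_ball (0 : X) 1 (by simpa using h1) (by simpa using h2) (by linarith [ht.2]) ht.1
        (by ring)
    simpa using h3
  have hmem : ∀ t : ℝ, v + t • h ∈ E.W := fun t => E.W.add_mem hv (E.W.smul_mem _ hh)
  have hd : ∀ t ∈ Set.Icc (0 : ℝ) 1, HasDerivWithinAt
      (fun t : ℝ => E.l (E.G (v + t • h) - t • E.G' v h))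
      (E.l (E.G' (v + t • h) h - E.G' v h)) (Set.Icc 0 1) t := by
    intro t ht
    have h4 : HasDerivAt (fun t : ℝ => v + t • h) h t := by
      simpa using ((hasDerivAt_id t).smul_const h).const_add v
    have h5 := (E.hasFDeriv_G _ ((E.norm_le _ (hmem t)).trans_lt (hseg t ht))).comp_hasDerivAt t h4
    have h6 : HasDerivAt (fun t : ℝ => t • E.G' v h) (E.G' v h) t := by
      simpa using (hasDerivAt_id t).smul_const (E.G' v h)
    exact (E.l.hasFDerivAt.comp_hasDerivAt t (h5.sub h6)).hasDerivWithinAt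
  have := (convex_Icc (0 : ℝ) 1).norm_image_sub_le_of_norm_hasDerivWithin_le
    (C := E.N * ‖E.l h‖ ^ 2) hd (fun t ht => ?_)
    (Set.left_mem_Icc.2 zero_le_one) (Set.right_mem_Icc.2 zero_le_one)
  · simpa [← map_sub, sub_right_comm] using this
  · have h7 := E.G'_lip _ (hmem t) (hseg t ht) v hv h1 h hh
    rw [add_sub_cancel_left, map_smul, norm_smul, Real.norm_of_nonneg ht.1] at h7
    have hN := E.one_le
    calc _ ≤ E.N * (t * ‖E.l h‖) * ‖E.l h‖ := h7
      _ ≤ E.N * (1 * ‖E.l h‖) * ‖E.l h‖ := by gcongr; exact ht.2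
      _ = _ := by ring

/-- The new residual is the error of the approximate inverse on the old residual, plus a Taylor
remainder. -/
theorem norm_res_step_le (hv : E.IsPath v v') (hQ : E.IsPrecond Q Q' B B') {lam η : ℝ}
    (hl : lam ∈ E.I) (h1 : ‖E.l (v lam)‖ < 1) (h2 : ‖E.l (E.step Q v lam)‖ < 1)
    (hη : ∀ x ∈ E.W, ‖E.l (x - E.L lam (v lam) (Q lam x))‖ ≤ η * ‖E.l x‖) :
    ‖E.l (E.res (E.step Q v) lam)‖ ≤
      η * ‖E.l (E.res v lam)‖ + E.N * (B * ‖E.l (E.res v lam)‖) ^ 2 := by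
  set r := E.res v lam with hr
  obtain ⟨h, hh⟩ : ∃ h, h = -Q lam r := ⟨_, rfl⟩
  have hmem : h ∈ E.W := hh ▸ E.W.neg_mem (hQ.mem _ _)
  have hs : E.step Q v lam = v lam + h := by rw [step, ← hr, hh, sub_eq_add_neg]
  have he : E.res (E.step Q v) lam = (r - E.L lam (v lam) (Q lam r)) +
      (E.G (v lam + h) - E.G (v lam) - E.G' (v lam) h) := by
    have : r = E.D lam (v lam) + E.G (v lam) := hr
    have hQh : Q lam r = -h := by rw [hh, neg_neg]
    rw [res, hs, map_add, hQh, L, add_apply, map_neg, map_neg, this]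
    abel
  rw [hs] at h2
  have h3 := norm_taylor_le (hv.mem lam hl) hmem h1 h2
  have h4 : ‖E.l h‖ ≤ B * ‖E.l r‖ := by
    rw [hh, map_neg, norm_neg]; exact hQ.le lam hl r (res_mem _ _)
  have hN := E.one_le
  rw [he, map_add]
  refine (norm_add_le _ _).trans (add_le_add (hη r (res_mem _ _)) (h3.trans ?_))
  gcongr

/-- Differentiate the identity for the new residual. Besides the error of the approximate inverse on
`res'`, every term is proportional to `res`; one of them carries the bound `B'` for the derivative
of the approximate inverse, which will be large. -/
theorem norm_res'_step_le (hv : E.IsPath v v') (hB : 0 ≤ B)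
    (hQ : E.IsPrecond Q Q' B B') {lam η : ℝ}
    (hl : lam ∈ E.I) (h1 : ‖E.l (v lam)‖ < 1) (h2 : ‖E.l (E.step Q v lam)‖ < 1)
    (hη : ∀ x ∈ E.W, ‖E.l (x - E.L lam (v lam) (Q lam x))‖ ≤ η * ‖E.l x‖) :
    ‖E.l (E.res' (E.step Q v) (E.step' Q Q' v v') lam)‖ ≤
      η * ‖E.l (E.res' v v' lam)‖ + (E.N ^ E.a * B + E.N * B * (‖E.l (v' lam)‖ +
        B * ‖E.l (E.res' v v' lam)‖) + 2 * E.N ^ E.a * B') * ‖E.l (E.res v lam)‖ := by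
  set r := E.res v lam with hr
  set r' := E.res' v v' lam with hr'
  set w := E.step Q v lam with hw
  have hwW : w ∈ E.W := E.W.sub_mem (hv.mem lam hl) (hQ.mem _ _)
  have hN := E.one_le
  have hsub : ‖E.l (w - v lam)‖ ≤ B * ‖E.l r‖ := norm_step_sub_le hQ hl
  set y := v' lam - Q lam r' with hy
  have hyW : y ∈ E.W := E.W.sub_mem (hv.mem' lam hl) (hQ.mem _ _)
  have he : E.res' (E.step Q v) (E.step' Q Q' v v') lam =
      (r' - E.L lam (v lam) (Q lam r')) + E.D' lam (w - v lam) +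
        (E.G' w y - E.G' (v lam) y) - E.L lam w (Q' lam r) := by
    have e1 : E.step' Q Q' v v' lam = y - Q' lam r := by
      rw [step', ← hr, ← hr', hy]; abel
    have e2 : r' = E.D' lam (v lam) + E.L lam (v lam) (v' lam) := hr'
    have e3 : E.L lam w y - E.L lam (v lam) y = E.G' w y - E.G' (v lam) y := by
      simp only [L, add_apply]; abel
    have e4 : E.L lam (v lam) y = E.L lam (v lam) (v' lam) - E.L lam (v lam) (Q lam r') := map_sub _ _ _
    have e5 : E.D' lam (w - v lam) = E.D' lam w - E.D' lam (v lam) := map_sub _ _ _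
    have e6 : E.L lam w (y - Q' lam r) = E.L lam w y - E.L lam w (Q' lam r) := map_sub _ _ _
    have e7 : E.L lam (v lam) (Q lam r') = E.L lam (v lam) (v' lam) - E.L lam (v lam) y := by
      rw [e4, sub_sub_cancel]
    rw [res', e1, ← hw, ← e3, e7, e6, e5]
    nth_rw 1 [e2]
    abel
  have b1 := hη r' (res'_mem _ _ _)
  have b2 := E.D'_le lam hl _ (E.W.sub_mem hwW (hv.mem lam hl))
  have b3 := E.G'_lip w hwW h2 (v lam) (hv.mem lam hl) h1 y hyW
  have b4 := norm_L_le hl hwW h2 (hQ.mem' lam r)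
  have b5 := hQ.le' lam hl r (res_mem _ _)
  have b6 : ‖E.l y‖ ≤ ‖E.l (v' lam)‖ + B * ‖E.l r'‖ := by
    rw [hy, map_sub]
    exact (norm_sub_le _ _).trans (by gcongr; exact hQ.le lam hl r' (res'_mem _ _ _))
  have hNa : 0 ≤ E.N ^ E.a := by positivity
  have c2 : ‖E.l (E.D' lam (w - v lam))‖ ≤ E.N ^ E.a * (B * ‖E.l r‖) := b2.trans (by gcongr)
  have c3 : ‖E.l (E.G' w y - E.G' (v lam) y)‖ ≤
      E.N * (B * ‖E.l r‖) * (‖E.l (v' lam)‖ + B * ‖E.l r'‖) := b3.trans (by gcongr)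
  have c4 : ‖E.l (E.L lam w (Q' lam r))‖ ≤ 2 * E.N ^ E.a * (B' * ‖E.l r‖) := b4.trans (by gcongr)
  rw [he, map_sub, map_add, map_add]
  refine (norm_sub_le _ _).trans ?_
  have d1 := norm_add_le (E.l (r' - E.L lam (v lam) (Q lam r')) + E.l (E.D' lam (w - v lam)))
    (E.l (E.G' w y - E.G' (v lam) y))
  have d2 := norm_add_le (E.l (r' - E.L lam (v lam) (Q lam r'))) (E.l (E.D' lam (w - v lam)))
  linarith

end NewtonEnv

/-! ### Smooth interpolation on a grid -/

theorem exists_deriv_smoothTransition_le :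
    ∃ C : ℝ, 0 ≤ C ∧ ∀ x, |deriv Real.smoothTransition x| ≤ C := by
  have hc : Continuous (deriv Real.smoothTransition) :=
    (Real.smoothTransition.contDiff (n := 1)).continuous_deriv le_rfl
  obtain ⟨C, hC⟩ := (isCompact_Icc (a := (0 : ℝ)) (b := 1)).exists_bound_of_continuousOn
    hc.continuousOn
  refine ⟨max C 0, le_max_right _ _, fun x => ?_⟩
  by_cases h0 : 0 ≤ x
  · by_cases h1 : x ≤ 1
    · exact (hC x ⟨h0, h1⟩).trans (le_max_left _ _)
    · have : Real.smoothTransition =ᶠ[nhds x] fun _ => 1 := by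
        filter_upwards [lt_mem_nhds (not_le.1 h1)] with y hy
        exact Real.smoothTransition.one_of_one_le hy.le
      rw [this.deriv_eq]; simp
  · have : Real.smoothTransition =ᶠ[nhds x] fun _ => 0 := by
      filter_upwards [gt_mem_nhds (not_le.1 h0)] with y hy
      exact Real.smoothTransition.zero_of_nonpos (le_of_lt hy)
    rw [this.deriv_eq]; simp

section Interp

variable {E : Type*} [NormedAddCommGroup E] [NormedSpace ℝ E]

/-- Smooth interpolation of a function on the integers. -/
def interp (c : ℤ → E) (x : ℝ) : E :=
  c ⌊x⌋ + Real.smoothTransition (x - ⌊x⌋) • (c (⌊x⌋ + 1) - c ⌊x⌋)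

/-- The derivative of the smooth interpolation. -/
def interp' (c : ℤ → E) (x : ℝ) : E :=
  deriv Real.smoothTransition (x - ⌊x⌋) • (c (⌊x⌋ + 1) - c ⌊x⌋)

/-- One formula valid on both sides of the integer `n`, from which the smoothness at `n` can be read
off. -/
theorem interp_eq (c : ℤ → E) (n : ℤ) {x : ℝ} (h1 : n - 1 < x) (h2 : x < n + 1) :
    interp c x = c (n - 1) + Real.smoothTransition (x - (n - 1)) • (c n - c (n - 1)) +
      Real.smoothTransition (x - n) • (c (n + 1) - c n) := by
  by_cases h : x < n
  · have hf : ⌊x⌋ = n - 1 := by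
      rw [Int.floor_eq_iff]; push_cast; constructor <;> linarith
    rw [interp, hf, Real.smoothTransition.zero_of_nonpos (x := x - n) (by linarith)]
    simp
  · push Not at h
    have hf : ⌊x⌋ = n := by
      rw [Int.floor_eq_iff]; constructor <;> linarith
    rw [interp, hf, Real.smoothTransition.one_of_one_le (x := x - (n - 1)) (by linarith)]
    simp

/-- The pieces fit at integers because the transition function has an extremum, hence a vanishing
derivative, at `0` and at `1`. -/
theorem hasDerivAt_interp (c : ℤ → E) (x : ℝ) : HasDerivAt (interp c) (interp' c x) x := by
  have hdiff : Differentiable ℝ Real.smoothTransition :=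
    (Real.smoothTransition.contDiff (n := 1)).differentiable one_ne_zero
  have h0 : ∀ y ≤ (0 : ℝ), deriv Real.smoothTransition y = 0 := by
    intro y hy
    rcases hy.lt_or_eq with hy | rfl
    · have : Real.smoothTransition =ᶠ[nhds y] fun _ => 0 := by
        filter_upwards [gt_mem_nhds hy] with z hz
        exact Real.smoothTransition.zero_of_nonpos (le_of_lt hz)
      rw [this.deriv_eq]; simp
    · apply IsLocalMin.deriv_eq_zero
      exact Filter.Eventually.of_forall fun z => by
        rw [Real.smoothTransition.zero]; exact Real.smoothTransition.nonneg z
  have h1 : deriv Real.smoothTransition 1 = 0 := by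
    apply IsLocalMax.deriv_eq_zero
    exact Filter.Eventually.of_forall fun z => by
      rw [Real.smoothTransition.one]; exact Real.smoothTransition.le_one z
  set n := ⌊x⌋
  have hn1 : (n : ℝ) ≤ x := Int.floor_le x
  have hn2 : x < n + 1 := Int.lt_floor_add_one x
  have hev : interp c =ᶠ[nhds x] fun x =>
      c (n - 1) + Real.smoothTransition (x - (n - 1)) • (c n - c (n - 1)) +
        Real.smoothTransition (x - n) • (c (n + 1) - c n) := by
    filter_upwards [Ioo_mem_nhds (a := (n : ℝ) - 1) (b := n + 1) (by linarith) hn2] with y hy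
    exact interp_eq c n hy.1 hy.2
  have ha : ∀ z : ℝ, HasDerivAt (fun x => Real.smoothTransition (x - z))
      (deriv Real.smoothTransition (x - z)) x := fun z => by
    simpa [Function.comp_def] using
      (hdiff (x - z)).hasDerivAt.comp x ((hasDerivAt_id x).sub_const z)
  have hd := (((ha (n - 1)).smul_const (c n - c (n - 1))).const_add (c (n - 1))).add
    ((ha n).smul_const (c (n + 1) - c n))
  refine (hd.congr_of_eventuallyEq hev).congr_deriv ?_
  have hz : deriv Real.smoothTransition (x - (n - 1)) = 0 := by
    rcases hn1.lt_or_eq with h | h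
    · have : Real.smoothTransition =ᶠ[nhds (x - (n - 1))] fun _ => 1 := by
        filter_upwards [lt_mem_nhds (show 1 < x - (n - 1) by linarith)] with y hy
        exact Real.smoothTransition.one_of_one_le hy.le
      rw [this.deriv_eq]; simp
    · rw [← h, sub_sub_cancel]; exact h1
  rw [hz, zero_smul, zero_add]
  rfl

theorem continuous_interp' (c : ℤ → E) : Continuous (interp' c) := by
  have hC : ContDiff ℝ 1 (interp c) := by
    rw [contDiff_iff_contDiffAt]
    intro x
    set n := ⌊x⌋
    have hn1 : (n : ℝ) ≤ x := Int.floor_le x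
    have hn2 : x < n + 1 := Int.lt_floor_add_one x
    have hev : interp c =ᶠ[nhds x] fun x =>
        c (n - 1) + Real.smoothTransition (x - (n - 1)) • (c n - c (n - 1)) +
          Real.smoothTransition (x - n) • (c (n + 1) - c n) := by
      filter_upwards [Ioo_mem_nhds (a := (n : ℝ) - 1) (b := n + 1) (by linarith) hn2] with y hy
      exact interp_eq c n hy.1 hy.2
    refine ContDiffAt.congr_of_eventuallyEq ?_ hev
    have hs := Real.smoothTransition.contDiff (n := 1)
    have ha : ∀ z : ℝ, ContDiff ℝ 1 (fun x : ℝ => Real.smoothTransition (x - z)) := fun z =>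
      hs.comp (contDiff_id.sub contDiff_const)
    exact ((contDiff_const.add ((ha _).smul contDiff_const)).add
      ((ha _).smul contDiff_const)).contDiffAt
  have : interp' c = deriv (interp c) := funext fun x => (hasDerivAt_interp c x).deriv.symm
  rw [this]
  exact hC.continuous_deriv le_rfl

end Interp

namespace NewtonEnv

/-! ### One scale of the Nash–Moser scheme -/

variable {V X : Type*} [NormedAddCommGroup V] [NormedSpace ℝ V] [NormedAddCommGroup X]
  [NormedSpace ℝ X] {E : NewtonEnv V X}

open Classical in
/-- The inverses used at the points of a grid of mesh `ρ`: those at nearby points of `A`, and zero if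
there is no such point. -/
def gridInv (A : Set ℝ) (ρ : ℝ) (Qc : ℝ → V →L[ℝ] V) (n : ℤ) : V →L[ℝ] V :=
  if h : ∃ lam₀ ∈ A, |lam₀ - ρ * n| ≤ 2 * ρ then Qc h.choose else 0

theorem gridInv_cases (A : Set ℝ) (ρ : ℝ) (Qc : ℝ → V →L[ℝ] V) (n : ℤ) :
    (∃ lam₀ ∈ A, |lam₀ - ρ * n| ≤ 2 * ρ ∧ gridInv A ρ Qc n = Qc lam₀) ∨
      ((∀ lam₀ ∈ A, ¬ |lam₀ - ρ * n| ≤ 2 * ρ) ∧ gridInv A ρ Qc n = 0) := by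
  by_cases h : ∃ lam₀ ∈ A, |lam₀ - ρ * n| ≤ 2 * ρ
  · exact Or.inl ⟨h.choose, h.choose_spec.1, h.choose_spec.2, by rw [gridInv, dif_pos h]⟩
  · right
    refine ⟨fun x hx hn => h ⟨x, hx, hn⟩, by rw [gridInv, dif_neg h]⟩

/-- The smooth interpolation of the inverses at the grid points. -/
def gridQ (A : Set ℝ) (ρ : ℝ) (Qc : ℝ → V →L[ℝ] V) (lam : ℝ) : V →L[ℝ] V :=
  interp (gridInv A ρ Qc) (ρ⁻¹ * lam)

/-- The derivative of the interpolation. -/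
def gridQ' (A : Set ℝ) (ρ : ℝ) (Qc : ℝ → V →L[ℝ] V) (lam : ℝ) : V →L[ℝ] V :=
  ρ⁻¹ • interp' (gridInv A ρ Qc) (ρ⁻¹ * lam)

variable {A : Set ℝ} {ρ : ℝ} {Qc : ℝ → V →L[ℝ] V}

theorem hasDerivAt_gridQ (lam : ℝ) : HasDerivAt (gridQ A ρ Qc) (gridQ' A ρ Qc lam) lam := by
  have h := (hasDerivAt_interp (gridInv A ρ Qc) (ρ⁻¹ * lam)).scomp lam
    ((hasDerivAt_id lam).const_mul ρ⁻¹)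
  rw [mul_one] at h
  exact h

theorem continuous_gridQ' : Continuous (gridQ' A ρ Qc) :=
  ((continuous_interp' _).comp (continuous_const.mul continuous_id)).const_smul ρ⁻¹

theorem abs_sub_floor_le (hρ : 0 < ρ) (lam : ℝ) :
    |lam - ρ * ⌊ρ⁻¹ * lam⌋| ≤ ρ ∧ |lam - ρ * (⌊ρ⁻¹ * lam⌋ + 1 : ℤ)| ≤ ρ := by
  have h1 := Int.floor_le (ρ⁻¹ * lam)
  have h2 := Int.lt_floor_add_one (ρ⁻¹ * lam)
  have h3 : ρ * (ρ⁻¹ * lam) = lam := by field_simp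
  have h4 := mul_le_mul_of_nonneg_left h1 hρ.le
  have h5 := mul_le_mul_of_nonneg_left h2.le hρ.le
  push_cast
  rw [abs_le, abs_le]
  refine ⟨⟨?_, ?_⟩, ?_, ?_⟩ <;> nlinarith

theorem gridQ_mem {W : Submodule ℝ V} (hQc : ∀ lam ∈ A, ∀ x, Qc lam x ∈ W) (lam : ℝ) (x : V) :
    gridQ A ρ Qc lam x ∈ W ∧ gridQ' A ρ Qc lam x ∈ W := by
  have h : ∀ n, gridInv A ρ Qc n x ∈ W := by
    intro n
    rcases gridInv_cases A ρ Qc n with ⟨l, hl, -, he⟩ | ⟨-, he⟩ <;> rw [he]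
    · exact hQc l hl x
    · exact W.zero_mem
  constructor
  · exact W.add_mem (h _) (W.smul_mem _ (W.sub_mem (h _) (h _)))
  · exact W.smul_mem _ (W.smul_mem _ (W.sub_mem (h _) (h _)))

/-- The interpolation is a convex combination of two samples, so it inherits every seminorm bound
that holds on `A`, for low and high norms alike. -/
theorem gridQ_seminorm_le (q : Seminorm ℝ V) {x : V} {c : ℝ} (hc : 0 ≤ c)
    (h : ∀ lam ∈ A, q (Qc lam x) ≤ c) (lam : ℝ) : q (gridQ A ρ Qc lam x) ≤ c := by
  have h : ∀ n, q (gridInv A ρ Qc n x) ≤ c := by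
    intro n
    rcases gridInv_cases A ρ Qc n with ⟨l, hl, -, he⟩ | ⟨-, he⟩ <;> rw [he]
    · exact h l hl
    · simpa using hc
  rw [gridQ, interp]
  set n := ⌊ρ⁻¹ * lam⌋
  set t := Real.smoothTransition (ρ⁻¹ * lam - n)
  have ht0 : 0 ≤ t := Real.smoothTransition.nonneg _
  have ht1 : t ≤ 1 := Real.smoothTransition.le_one _
  have he : (gridInv A ρ Qc n + t • (gridInv A ρ Qc (n + 1) - gridInv A ρ Qc n)) x =
      (1 - t) • gridInv A ρ Qc n x + t • gridInv A ρ Qc (n + 1) x := by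
    simp only [add_apply, smul_apply, sub_apply]
    rw [smul_sub, sub_smul, one_smul]; abel
  rw [he]
  refine (map_add_le_add q _ _).trans ?_
  rw [map_smul_eq_mul, map_smul_eq_mul, Real.norm_of_nonneg ht0,
    Real.norm_of_nonneg (by linarith : 0 ≤ 1 - t)]
  have h1 : (1 - t) * q (gridInv A ρ Qc n x) ≤ (1 - t) * c :=
    mul_le_mul_of_nonneg_left (h n) (by linarith)
  have h2 : t * q (gridInv A ρ Qc (n + 1) x) ≤ t * c := mul_le_mul_of_nonneg_left (h _) ht0
  linarith

theorem gridQ'_seminorm_le (hρ : 0 < ρ) {C : ℝ}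
    (hC : ∀ x, |deriv Real.smoothTransition x| ≤ C) (q : Seminorm ℝ V) {x : V} {c : ℝ} (hc : 0 ≤ c)
    (h : ∀ lam ∈ A, q (Qc lam x) ≤ c) (lam : ℝ) :
    q (gridQ' A ρ Qc lam x) ≤ 2 * C * ρ⁻¹ * c := by
  have h : ∀ n, q (gridInv A ρ Qc n x) ≤ c := by
    intro n
    rcases gridInv_cases A ρ Qc n with ⟨l, hl, -, he⟩ | ⟨-, he⟩ <;> rw [he]
    · exact h l hl
    · simpa using hc
  rw [gridQ', interp']
  set n := ⌊ρ⁻¹ * lam⌋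
  have he : (ρ⁻¹ • deriv Real.smoothTransition (ρ⁻¹ * lam - n) •
      (gridInv A ρ Qc (n + 1) - gridInv A ρ Qc n)) x =
      ρ⁻¹ • deriv Real.smoothTransition (ρ⁻¹ * lam - n) •
        (gridInv A ρ Qc (n + 1) x - gridInv A ρ Qc n x) := rfl
  rw [he, map_smul_eq_mul, map_smul_eq_mul, Real.norm_of_nonneg (inv_pos.2 hρ).le, Real.norm_eq_abs]
  have h1 := map_sub_le_add q (gridInv A ρ Qc (n + 1) x) (gridInv A ρ Qc n x)
  have h2 := h n
  have h3 := h (n + 1)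
  have hC0 : 0 ≤ C := (abs_nonneg _).trans (hC 0)
  calc ρ⁻¹ * (|deriv Real.smoothTransition (ρ⁻¹ * lam - n)| *
        q (gridInv A ρ Qc (n + 1) x - gridInv A ρ Qc n x))
      ≤ ρ⁻¹ * (C * (2 * c)) := by
        have := hC (ρ⁻¹ * lam - n)
        have := inv_pos.2 hρ
        gcongr
        linarith
    _ = _ := by ring

/-- If neither adjacent grid point has a point of `A` within `2 ρ`, both samples have the default
value zero, and the iteration leaves the path unchanged there. -/
theorem gridQ_eq_zero_or (hρ : 0 < ρ) (lam : ℝ) :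
    (∃ lam₀ ∈ A, |lam - lam₀| ≤ 3 * ρ) ∨ (gridQ A ρ Qc lam = 0 ∧ gridQ' A ρ Qc lam = 0) := by
  obtain ⟨h1, h2⟩ := abs_sub_floor_le hρ lam
  set n := ⌊ρ⁻¹ * lam⌋ with hn
  have key : ∀ m : ℤ, |lam - ρ * m| ≤ ρ → (∃ lam₀ ∈ A, |lam - lam₀| ≤ 3 * ρ) ∨
      gridInv A ρ Qc m = 0 := by
    intro m hm
    rcases gridInv_cases A ρ Qc m with ⟨l, hl, hd, -⟩ | ⟨-, he⟩
    · left
      refine ⟨l, hl, ?_⟩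
      have := abs_sub_le lam (ρ * m) l
      rw [abs_sub_comm (ρ * m) l] at this
      linarith
    · exact Or.inr he
  rcases key n h1 with h | h
  · exact Or.inl h
  rcases key (n + 1) h2 with h' | h'
  · exact Or.inl h'
  right
  rw [gridQ, gridQ', interp, interp', ← hn, h, h']
  simp

/-- Within `ρ` of `A`, both adjacent grid points have a point of `A` within `2 ρ`, so both samples
are true inverses at nearby parameters. -/
theorem gridQ_near (hρ : 0 < ρ) {lam lam₀ : ℝ} (h₀ : lam₀ ∈ A) (hd : |lam - lam₀| ≤ ρ) :
    ∃ l₁ ∈ A, ∃ l₂ ∈ A, ∃ t ∈ Set.Icc (0 : ℝ) 1, |lam - l₁| ≤ 3 * ρ ∧ |lam - l₂| ≤ 3 * ρ ∧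
      gridQ A ρ Qc lam = (1 - t) • Qc l₁ + t • Qc l₂ := by
  obtain ⟨h1, h2⟩ := abs_sub_floor_le hρ lam
  set n := ⌊ρ⁻¹ * lam⌋ with hn
  have key : ∀ m : ℤ, |lam - ρ * m| ≤ ρ →
      ∃ l ∈ A, |lam - l| ≤ 3 * ρ ∧ gridInv A ρ Qc m = Qc l := by
    intro m hm
    rcases gridInv_cases A ρ Qc m with ⟨l, hl, hd, he⟩ | ⟨hno, -⟩
    · refine ⟨l, hl, ?_, he⟩
      have := abs_sub_le lam (ρ * m) l
      rw [abs_sub_comm (ρ * m) l] at this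
      linarith
    · refine absurd ?_ (hno lam₀ h₀)
      have := abs_sub_le lam₀ lam (ρ * m)
      rw [abs_sub_comm lam₀ lam] at this
      linarith
  obtain ⟨l₁, hl₁, hd₁, he₁⟩ := key n h1
  obtain ⟨l₂, hl₂, hd₂, he₂⟩ := key (n + 1) h2
  refine ⟨l₁, hl₁, l₂, hl₂, _, ⟨Real.smoothTransition.nonneg (ρ⁻¹ * lam - n),
    Real.smoothTransition.le_one (ρ⁻¹ * lam - n)⟩, hd₁, hd₂, ?_⟩
  rw [gridQ, interp, ← hn, he₁, he₂]
  rw [smul_sub, sub_smul, one_smul]; abel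

variable (E) in
/-- The low norm as a seminorm. -/
def low : Seminorm ℝ V := (normSeminorm ℝ X).comp (E.l : V →ₗ[ℝ] X)

theorem isPrecond_gridQ (hρ : 0 < ρ) {C : ℝ}
    (hC : ∀ x, |deriv Real.smoothTransition x| ≤ C) {B : ℝ} (hB : 0 ≤ B)
    (hQm : ∀ lam ∈ A, ∀ x, Qc lam x ∈ E.W)
    (hQ : ∀ lam ∈ A, ∀ x ∈ E.W, ‖E.l (Qc lam x)‖ ≤ B * ‖E.l x‖) :
    E.IsPrecond (gridQ A ρ Qc) (gridQ' A ρ Qc) B (2 * C * ρ⁻¹ * B) := by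
  have h1 : ∀ lam, HasDerivWithinAt (gridQ A ρ Qc) (gridQ' A ρ Qc lam) E.I lam := fun lam =>
    (hasDerivAt_gridQ (A := A) (ρ := ρ) (Qc := Qc) lam).hasDerivWithinAt
  have h2 : ContinuousOn (gridQ' A ρ Qc) E.I := Continuous.continuousOn continuous_gridQ'
  have h3 : ∀ lam, ∀ x ∈ E.W, ‖E.l (gridQ A ρ Qc lam x)‖ ≤ B * ‖E.l x‖ := by
    intro lam x hx
    have h0 : ∀ l ∈ A, E.low (Qc l x) ≤ B * ‖E.l x‖ := fun l hl => hQ l hl x hx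
    exact gridQ_seminorm_le E.low (by positivity) h0 lam
  have h4 : ∀ lam, ∀ x ∈ E.W, ‖E.l (gridQ' A ρ Qc lam x)‖ ≤ 2 * C * ρ⁻¹ * B * ‖E.l x‖ := by
    intro lam x hx
    have h0 : ∀ l ∈ A, E.low (Qc l x) ≤ B * ‖E.l x‖ := fun l hl => hQ l hl x hx
    rw [mul_assoc (2 * C * ρ⁻¹)]
    exact gridQ'_seminorm_le hρ hC E.low (by positivity) h0 lam
  exact ⟨fun lam x => (gridQ_mem hQm lam x).1, fun lam x => (gridQ_mem hQm lam x).2,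
    fun lam _ => h1 lam, h2, fun lam _ => h3 lam, fun lam _ => h4 lam⟩

/-- The error of the interpolated inverses close to `A`. -/
theorem gridQ_error (hρ : 0 < ρ) {B : ℝ} {u u' v : ℝ → V} (hu : E.IsPath u u')
    (hA : A ⊆ E.I) (hu1 : ∀ lam ∈ E.I, ‖E.l (u lam)‖ < 1) (hu' : ∀ lam ∈ E.I, ‖E.l (u' lam)‖ ≤ 1)
    (hQm : ∀ lam ∈ A, ∀ x, Qc lam x ∈ E.W)
    (hQ : ∀ lam ∈ A, ∀ x ∈ E.W, ‖E.l (Qc lam x)‖ ≤ B * ‖E.l x‖)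
    (hinv : ∀ lam ∈ A, ∀ x ∈ E.W, E.L lam (u lam) (Qc lam x) = x) {lam lam₀ δ : ℝ} (hl : lam ∈ E.I)
    (h₀ : lam₀ ∈ A) (hd : |lam - lam₀| ≤ ρ) (hvW : v lam ∈ E.W) (hv1 : ‖E.l (v lam)‖ < 1)
    (hv : ‖E.l (v lam - u lam)‖ ≤ δ) {x : V} (hx : x ∈ E.W) :
    ‖E.l (x - E.L lam (v lam) (gridQ A ρ Qc lam x))‖ ≤
      (E.N ^ E.a * (3 * ρ) + E.N * (3 * ρ + δ)) * B * ‖E.l x‖ := by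
  obtain ⟨l₁, hl₁, l₂, hl₂, t, ht, hd₁, hd₂, he⟩ := gridQ_near (Qc := Qc) hρ h₀ hd
  have hN := E.one_le
  have hconv : Convex ℝ E.I := E.ordConnected.convex
  have key : ∀ l ∈ A, |lam - l| ≤ 3 * ρ → ‖E.l (x - E.L lam (v lam) (Qc l x))‖ ≤
      (E.N ^ E.a * (3 * ρ) + E.N * (3 * ρ + δ)) * B * ‖E.l x‖ := by
    intro l hlA hdl
    set y := Qc l x with hy
    have hyW : y ∈ E.W := hQm l hlA x
    have hyl : ‖E.l y‖ ≤ B * ‖E.l x‖ := hQ l hlA x hx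
    have hlI := hA hlA
    have hD : ‖E.l (E.D l y - E.D lam y)‖ ≤ E.N ^ E.a * ‖E.l y‖ * (3 * ρ) := by
      have hder : ∀ z ∈ E.I, HasDerivWithinAt (fun z => E.l (E.D z y)) (E.l (E.D' z y)) E.I z := by
        intro z hz
        have h1 := (E.hasDeriv_D z hz).clm_apply (hasDerivWithinAt_const z E.I y)
        have h2 := E.l.hasFDerivAt.comp_hasDerivWithinAt z h1
        simpa [Function.comp_def] using h2
      have := hconv.norm_image_sub_le_of_norm_hasDerivWithin_le hder
        (fun z hz => E.D'_le z hz y hyW) hl hlI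
      rw [← map_sub, Real.norm_eq_abs, abs_sub_comm] at this
      exact this.trans (by gcongr)
    have hul : ‖E.l (u l - u lam)‖ ≤ 3 * ρ := by
      have hder : ∀ z ∈ E.I, HasDerivWithinAt (fun z => E.l (u z)) (E.l (u' z)) E.I z := by
        intro z hz
        exact E.l.hasFDerivAt.comp_hasDerivWithinAt z (hu.hasDeriv z hz)
      have := hconv.norm_image_sub_le_of_norm_hasDerivWithin_le hder hu' hl hlI
      rw [← map_sub, Real.norm_eq_abs, abs_sub_comm, one_mul] at this
      exact this.trans hdl
    have hG := E.G'_lip (u l) (hu.mem l hlI) (hu1 l hlI) (v lam) hvW hv1 y hyW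
    have huv : ‖E.l (u l - v lam)‖ ≤ 3 * ρ + δ := by
      have : u l - v lam = (u l - u lam) - (v lam - u lam) := by abel
      rw [this, map_sub]
      exact (norm_sub_le _ _).trans (add_le_add hul hv)
    -- As `y` solves the exact equation at `l`, the error is only the variation of the operator
    -- between `(l, u l)` and `(lam, v lam)`.
    have e : x - E.L lam (v lam) y = (E.D l y - E.D lam y) + (E.G' (u l) y - E.G' (v lam) y) := by
      have h3 := hinv l hlA x hx
      rw [← hy] at h3
      conv_lhs => rw [← h3]
      simp only [L, add_apply]
      abel
    rw [e, map_add]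
    have hδ : 0 ≤ δ := (norm_nonneg _).trans hv
    calc _ ≤ E.N ^ E.a * ‖E.l y‖ * (3 * ρ) + E.N * (3 * ρ + δ) * ‖E.l y‖ :=
          (norm_add_le _ _).trans (add_le_add hD (hG.trans (by gcongr)))
      _ = (E.N ^ E.a * (3 * ρ) + E.N * (3 * ρ + δ)) * ‖E.l y‖ := by ring
      _ ≤ (E.N ^ E.a * (3 * ρ) + E.N * (3 * ρ + δ)) * (B * ‖E.l x‖) := by gcongr
      _ = _ := by ring
  have e : x - E.L lam (v lam) (gridQ A ρ Qc lam x) =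
      (1 - t) • (x - E.L lam (v lam) (Qc l₁ x)) + t • (x - E.L lam (v lam) (Qc l₂ x)) := by
    rw [he]
    simp only [add_apply, smul_apply, map_add, map_smul]
    module
  rw [e, map_add, map_smul, map_smul]
  refine (norm_add_le _ _).trans ?_
  rw [norm_smul, norm_smul, Real.norm_of_nonneg ht.1,
    Real.norm_of_nonneg (by linarith [ht.2] : 0 ≤ 1 - t)]
  have h1 := mul_le_mul_of_nonneg_left (key l₁ hl₁ hd₁) (by linarith [ht.2] : 0 ≤ 1 - t)
  have h2 := mul_le_mul_of_nonneg_left (key l₂ hl₂ hd₂) ht.1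
  linarith

end NewtonEnv

/-! ### Residuals and high norms under the interpolated Newton step -/

namespace NewtonEnv

variable {V X : Type*} [NormedAddCommGroup V] [NormedSpace ℝ V] [NormedAddCommGroup X]
  [NormedSpace ℝ X] {E : NewtonEnv V X}

variable (E) in
/-- The tame estimates in a high norm. -/
structure HighNorm (p : Seminorm ℝ V) : Prop where
  D_le : ∀ lam ∈ E.I, ∀ x ∈ E.W, p (E.D lam x) ≤ E.N ^ E.a * p x
  D'_le : ∀ lam ∈ E.I, ∀ x ∈ E.W, p (E.D' lam x) ≤ E.N ^ E.a * p x
  G_le : ∀ v ∈ E.W, ‖E.l v‖ < 1 → p (E.G v) ≤ E.N ^ E.a * (1 + p v)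
  G'_le : ∀ v ∈ E.W, ‖E.l v‖ < 1 → ∀ x ∈ E.W, p (E.G' v x) ≤ E.N ^ E.a * (p v * ‖E.l x‖ + p x)

variable {v v' : ℝ → V} {Q Q' : ℝ → V →L[ℝ] V} {b g : ℕ}

/-- The Newton estimates with all constants expressed as powers of `N`; the exponent `3 g` in the
bound for `Q'` is the price of a grid of mesh `N ^ (-3 g)`. The error `η` is left free, to be used
both near `A` and on the larger neighbourhood. -/
theorem residual_step_le (hv : E.IsPath v v') (ha : E.a ≤ b) (hN : 16 ≤ E.N)
    (hQ : E.IsPrecond Q Q' (E.N ^ b) (E.N ^ (b + 3 * g + 1))) {lam η x x' : ℝ} (hl : lam ∈ E.I)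
    (h1 : ‖E.l (v lam)‖ < 1) (h2 : ‖E.l (E.step Q v lam)‖ < 1) (h3 : ‖E.l (v' lam)‖ ≤ 2)
    (hη0 : 0 ≤ η) (hη : ∀ x ∈ E.W, ‖E.l (x - E.L lam (v lam) (Q lam x))‖ ≤ η * ‖E.l x‖)
    (hx : ‖E.l (E.res v lam)‖ ≤ x) (hx' : ‖E.l (E.res' v v' lam)‖ ≤ x') (hx'1 : x' ≤ 1) :
    ‖E.l (E.res (E.step Q v) lam)‖ ≤ η * x + E.N ^ (2 * b + 1) * x ^ 2 ∧
    ‖E.l (E.res' (E.step Q v) (E.step' Q Q' v v') lam)‖ ≤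
      η * x' + E.N ^ (2 * b + 3 * g + 2) * x := by
  have hN1 := E.one_le
  have hx0 : 0 ≤ x := (norm_nonneg _).trans hx
  constructor
  · refine (norm_res_step_le hv hQ hl h1 h2 hη).trans ?_
    calc η * ‖E.l (E.res v lam)‖ + E.N * (E.N ^ b * ‖E.l (E.res v lam)‖) ^ 2
        ≤ η * x + E.N * (E.N ^ b * x) ^ 2 := by gcongr
      _ = _ := by ring
  · refine (norm_res'_step_le hv (by positivity) hQ hl h1 h2 hη).trans ?_
    have hab : E.N ^ E.a ≤ E.N ^ b := pow_le_pow_right₀ hN1 ha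
    have e1 : E.N ^ (2 * b) ≤ E.N ^ (2 * b + 3 * g + 1) := pow_le_pow_right₀ hN1 (by omega)
    have e2 : E.N ^ (b + 1) ≤ E.N ^ (2 * b + 3 * g + 1) := pow_le_pow_right₀ hN1 (by omega)
    have e3 : E.N ^ (2 * b + 1) ≤ E.N ^ (2 * b + 3 * g + 1) := pow_le_pow_right₀ hN1 (by omega)
    have hc : E.N ^ E.a * E.N ^ b + E.N * E.N ^ b * (‖E.l (v' lam)‖ +
        E.N ^ b * ‖E.l (E.res' v v' lam)‖) + 2 * E.N ^ E.a * E.N ^ (b + 3 * g + 1) ≤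
        E.N ^ (2 * b + 3 * g + 2) := by
      calc _ ≤ E.N ^ b * E.N ^ b + E.N * E.N ^ b * (2 + E.N ^ b * 1) +
            2 * E.N ^ b * E.N ^ (b + 3 * g + 1) := by gcongr; exact hx'.trans hx'1
        _ = E.N ^ (2 * b) + 2 * E.N ^ (b + 1) + E.N ^ (2 * b + 1) +
            2 * E.N ^ (2 * b + 3 * g + 1) := by ring
        _ ≤ 16 * E.N ^ (2 * b + 3 * g + 1) := by
            have : 0 ≤ E.N ^ (2 * b + 3 * g + 1) := by positivity
            linarith
        _ ≤ E.N * E.N ^ (2 * b + 3 * g + 1) := by gcongr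
        _ = _ := by ring
    gcongr

/-- No smallness is available in a high norm. Tame estimates are affine in it while the low norms
stay bounded, so one step multiplies it by at most a power of `N`. -/
theorem high_step_le {p : Seminorm ℝ V} (hp : E.HighNorm p) (hv : E.IsPath v v') (ha : E.a ≤ b)
    (hN : 16 ≤ E.N) {σ : ℕ} {lam Y : ℝ}
    (hl : lam ∈ E.I) (h1 : ‖E.l (v lam)‖ < 1) (h3 : ‖E.l (v' lam)‖ ≤ 2)
    (hx : ‖E.l (E.res v lam)‖ ≤ 1) (hx' : ‖E.l (E.res' v v' lam)‖ ≤ 1)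
    (hY : p (v lam) ≤ Y) (hY' : p (v' lam) ≤ Y)
    (hq : ∀ x ∈ E.W, ‖E.l x‖ ≤ 1 → p (Q lam x) ≤ E.N ^ (b + σ) * (1 + Y + p x) ∧
      p (Q' lam x) ≤ E.N ^ (b + σ + 3 * g + 1) * (1 + Y + p x)) :
    1 + p (E.step Q v lam) ≤ E.N ^ (2 * b + σ + 3 * g + 2) * (1 + Y) ∧
    1 + p (E.step' Q Q' v v' lam) ≤ E.N ^ (2 * b + σ + 3 * g + 2) * (1 + Y) := by
  have hN1 := E.one_le
  have hY0 : 0 ≤ Y := (apply_nonneg p _).trans hY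
  have hab : E.N ^ E.a ≤ E.N ^ b := pow_le_pow_right₀ hN1 ha
  have hb1 : 1 ≤ E.N ^ b := one_le_pow₀ hN1
  have r1 : p (E.res v lam) ≤ 2 * E.N ^ b * (1 + Y) := by
    have e1 := hp.D_le lam hl _ (hv.mem lam hl)
    have e2 := hp.G_le _ (hv.mem lam hl) h1
    calc p (E.res v lam) ≤ p (E.D lam (v lam)) + p (E.G (v lam)) := map_add_le_add p _ _
      _ ≤ E.N ^ b * Y + E.N ^ b * (1 + Y) := by
          refine add_le_add (e1.trans ?_) (e2.trans ?_) <;> gcongr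
      _ ≤ _ := by nlinarith
  have r2 : p (E.res' v v' lam) ≤ 5 * E.N ^ b * (1 + Y) := by
    have e1 := hp.D'_le lam hl _ (hv.mem lam hl)
    have e2 := hp.D_le lam hl _ (hv.mem' lam hl)
    have e3 := hp.G'_le _ (hv.mem lam hl) h1 _ (hv.mem' lam hl)
    calc p (E.res' v v' lam) ≤ p (E.D' lam (v lam)) +
          (p (E.D lam (v' lam)) + p (E.G' (v lam) (v' lam))) :=
          (map_add_le_add p _ _).trans (by gcongr; exact map_add_le_add p _ _)
      _ ≤ E.N ^ b * Y + (E.N ^ b * Y + E.N ^ b * (Y * 2 + Y)) := by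
          refine add_le_add (e1.trans ?_) (add_le_add (e2.trans ?_) (e3.trans ?_)) <;> gcongr
      _ ≤ _ := by nlinarith
  have q1 := hq _ (res_mem v lam) hx
  have q2 := hq _ (res'_mem v v' lam) hx'
  have k1 : 1 + Y + p (E.res v lam) ≤ 3 * E.N ^ b * (1 + Y) := by nlinarith
  have k2 : 1 + Y + p (E.res' v v' lam) ≤ 6 * E.N ^ b * (1 + Y) := by nlinarith
  set M := E.N ^ (2 * b + σ + 3 * g + 1) with hM
  have m1 : 1 ≤ M := one_le_pow₀ hN1
  have m2 : E.N ^ (b + σ) * E.N ^ b ≤ M := by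
    rw [← pow_add]; exact pow_le_pow_right₀ hN1 (by omega)
  have m3 : E.N ^ (b + σ + 3 * g + 1) * E.N ^ b = M := by rw [← pow_add, hM]; congr 1; ring
  have m4 : 16 * M ≤ E.N ^ (2 * b + σ + 3 * g + 2) := by
    calc 16 * M ≤ E.N * M := by gcongr
      _ = _ := by rw [hM]; ring
  have c1 : p (Q lam (E.res v lam)) ≤ 3 * M * (1 + Y) := by
    calc _ ≤ E.N ^ (b + σ) * (3 * E.N ^ b * (1 + Y)) := q1.1.trans (by gcongr)
      _ = 3 * (E.N ^ (b + σ) * E.N ^ b) * (1 + Y) := by ring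
      _ ≤ _ := by gcongr
  have c2 : p (Q' lam (E.res v lam)) ≤ 3 * M * (1 + Y) := by
    calc _ ≤ E.N ^ (b + σ + 3 * g + 1) * (3 * E.N ^ b * (1 + Y)) := q1.2.trans (by gcongr)
      _ = 3 * (E.N ^ (b + σ + 3 * g + 1) * E.N ^ b) * (1 + Y) := by ring
      _ = _ := by rw [m3]
  have c3 : p (Q lam (E.res' v v' lam)) ≤ 6 * M * (1 + Y) := by
    calc _ ≤ E.N ^ (b + σ) * (6 * E.N ^ b * (1 + Y)) := q2.1.trans (by gcongr)
      _ = 6 * (E.N ^ (b + σ) * E.N ^ b) * (1 + Y) := by ring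
      _ ≤ _ := by gcongr
  have d1 := map_sub_le_add p (v lam) (Q lam (E.res v lam))
  have d2 := map_sub_le_add p (v' lam) (Q' lam (E.res v lam) + Q lam (E.res' v v' lam))
  have d3 := map_add_le_add p (Q' lam (E.res v lam)) (Q lam (E.res' v v' lam))
  have f1 : 16 * M * (1 + Y) ≤ E.N ^ (2 * b + σ + 3 * g + 2) * (1 + Y) := by gcongr
  have f2 : 1 + Y ≤ M * (1 + Y) := le_mul_of_one_le_left (by linarith) m1
  rw [step, step']
  constructor <;> nlinarith

theorem step_eq_self {lam : ℝ} (h : Q lam = 0) : E.step Q v lam = v lam := by simp [step, h]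

theorem step'_eq_self {lam : ℝ} (h : Q lam = 0) (h' : Q' lam = 0) :
    E.step' Q Q' v v' lam = v' lam := by simp [step', h, h']

/-- Between distance `ρ` and `3 ρ` from `A` the interpolated operator need not approximate an
inverse. A power bound for the error is enough there, because the residual is already small. -/
theorem trivial_error (hQ : ∀ x ∈ E.W, ‖E.l (Q lam x)‖ ≤ E.N ^ b * ‖E.l x‖) (ha : E.a ≤ b)
    (hN : 16 ≤ E.N) (hm : ∀ x, Q lam x ∈ E.W) (hl : lam ∈ E.I) {v x : V} (hv : v ∈ E.W)
    (hv1 : ‖E.l v‖ < 1) (hx : x ∈ E.W) :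
    ‖E.l (x - E.L lam v (Q lam x))‖ ≤ E.N ^ (2 * b + 1) * ‖E.l x‖ := by
  have hN1 := E.one_le
  have h1 := norm_L_le hl hv hv1 (hm x)
  have h2 := hQ x hx
  rw [map_sub]
  refine (norm_sub_le _ _).trans ?_
  have hab : E.N ^ E.a ≤ E.N ^ b := pow_le_pow_right₀ hN1 ha
  have hb1 : 1 ≤ E.N ^ (2 * b) := one_le_pow₀ hN1
  calc ‖E.l x‖ + ‖E.l (E.L lam v (Q lam x))‖
      ≤ 1 * ‖E.l x‖ + 2 * E.N ^ b * (E.N ^ b * ‖E.l x‖) := by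
        rw [one_mul]; gcongr; exact h1.trans (by gcongr)
    _ ≤ E.N ^ (2 * b) * ‖E.l x‖ + 2 * E.N ^ b * (E.N ^ b * ‖E.l x‖) := by gcongr
    _ = 3 * E.N ^ (2 * b) * ‖E.l x‖ := by ring
    _ ≤ E.N * E.N ^ (2 * b) * ‖E.l x‖ := by gcongr; linarith
    _ = _ := by ring

/-- One scale of the Nash–Moser scheme: two Newton iterations with the interpolated inverses. -/
theorem exists_scale_step {C : ℝ} (hC : ∀ x, |deriv Real.smoothTransition x| ≤ C) (ha : E.a ≤ b)
    (hg : 3 * b + 10 ≤ g) (hN : 16 ≤ E.N) (hNC : 2 * C ≤ E.N) {u u' : ℝ → V} (hu : E.IsPath u u')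
    {A : Set ℝ} (hA : A ⊆ E.I) (hu1 : ∀ lam ∈ E.I, ‖E.l (u lam)‖ ≤ 1 / 2)
    (hu' : ∀ lam ∈ E.I, ‖E.l (u' lam)‖ ≤ 1 / 2) {Qc : ℝ → V →L[ℝ] V}
    (hQm : ∀ lam ∈ A, ∀ x, Qc lam x ∈ E.W)
    (hQ : ∀ lam ∈ A, ∀ x ∈ E.W, ‖E.l (Qc lam x)‖ ≤ E.N ^ b * ‖E.l x‖)
    (hinv : ∀ lam ∈ A, ∀ x ∈ E.W, E.L lam (u lam) (Qc lam x) = x)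
    (hres : ∀ lam ∈ E.I, ∀ lam₀ ∈ A, |lam - lam₀| ≤ 3 * E.N ^ (-(3 * g : ℤ)) →
      ‖E.l (E.res u lam)‖ ≤ E.N ^ (-(4 * g : ℤ)) ∧ ‖E.l (E.res' u u' lam)‖ ≤ E.N ^ (-(g : ℤ))) :
    ∃ v v' : ℝ → V, E.IsPath v v' ∧
      (∀ lam ∈ E.I, ‖E.l (v lam - u lam)‖ ≤ E.N ^ (3 * b + 3 - 4 * g : ℤ) ∧
        ‖E.l (v' lam - u' lam)‖ ≤ E.N ^ (3 * b + 5 - g : ℤ)) ∧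
      (∀ lam ∈ E.I, ∀ lam₀ ∈ A, |lam - lam₀| ≤ E.N ^ (-(3 * g : ℤ)) →
        ‖E.l (E.res v lam)‖ ≤ E.N ^ (4 * b + 6 - 10 * g : ℤ) ∧
        ‖E.l (E.res' v v' lam)‖ ≤ E.N ^ (4 * b + 6 - 4 * g : ℤ)) ∧
      ∀ (p : Seminorm ℝ V) (σ : ℕ) (Z : ℝ), E.HighNorm p →
        (∀ lam ∈ A, ∀ x ∈ E.W, p (Qc lam x) ≤ E.N ^ (b + σ) * ((1 + p (u lam)) * ‖E.l x‖ + p x)) →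
        (∀ lam ∈ E.I, p (u lam) ≤ Z ∧ p (u' lam) ≤ Z) →
        ∀ lam ∈ E.I, 1 + p (v lam) ≤ E.N ^ (2 * (2 * b + σ + 3 * g + 2)) * (1 + Z) ∧
          1 + p (v' lam) ≤ E.N ^ (2 * (2 * b + σ + 3 * g + 2)) * (1 + Z) := by
  have hN1 := E.one_le
  have hN0 : 0 < E.N := by linarith
  have hzp : ∀ {m n : ℤ}, m ≤ n → E.N ^ m ≤ E.N ^ n := fun h => zpow_le_zpow_right₀ hN1 h
  have hz1 : ∀ {m : ℤ}, m ≤ 0 → E.N ^ m ≤ 1 := fun h => by simpa using hzp h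
  have hzpos : ∀ m : ℤ, 0 < E.N ^ m := fun m => zpow_pos hN0 m
  have hsum : ∀ {m n : ℤ} {c : ℝ}, c ≤ 16 → m + 1 ≤ n → c * E.N ^ m ≤ E.N ^ n := by
    intro m n c hc h
    calc c * E.N ^ m ≤ E.N * E.N ^ m := by
          have := hzpos m
          gcongr; linarith
      _ = E.N ^ (m + 1) := by rw [zpow_add_one₀ hN0.ne']; ring
      _ ≤ _ := hzp h
  have hmul : ∀ m n : ℤ, E.N ^ m * E.N ^ n = E.N ^ (m + n) := fun m n =>
    (zpow_add₀ hN0.ne' m n).symm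
  have hnat : ∀ m : ℕ, E.N ^ m = E.N ^ (m : ℤ) := fun m => (zpow_natCast _ _).symm
  -- The mesh is fine enough for an error of order `N ^ (2 b + 2 - 3 g)` within `ρ` of `A`. It is
  -- coarse enough that the derivative of the interpolation, of order `N ^ (b + 3 g + 1)`, times the
  -- residual `N ^ (-4 g)` is still small.
  set ρ := E.N ^ (-(3 * g : ℤ)) with hρ
  have hρ0 : 0 < ρ := hzpos _
  set Q := gridQ A ρ Qc with hQdef
  set Q' := gridQ' A ρ Qc with hQ'def
  have hB' : 2 * C * ρ⁻¹ * E.N ^ b ≤ E.N ^ (b + 3 * g + 1) := by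
    rw [hρ, ← zpow_neg, neg_neg]
    calc 2 * C * E.N ^ (3 * g : ℤ) * E.N ^ b ≤ E.N * E.N ^ (3 * g : ℤ) * E.N ^ b := by gcongr
      _ = _ := by
          rw [show (3 * g : ℤ) = ((3 * g : ℕ) : ℤ) by push_cast; ring, zpow_natCast]; ring
  have hprec : E.IsPrecond Q Q' (E.N ^ b) (E.N ^ (b + 3 * g + 1)) := by
    have h := isPrecond_gridQ (E := E) hρ0 hC (by positivity) hQm hQ
    exact ⟨h.mem, h.mem', h.hasDeriv, h.cont, h.le, fun lam hl x hx =>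
      (h.le' lam hl x hx).trans (by gcongr)⟩
  have hu1' : ∀ lam ∈ E.I, ‖E.l (u lam)‖ < 1 := fun lam hl => (hu1 lam hl).trans_lt (by norm_num)
  have hu'1 : ∀ lam ∈ E.I, ‖E.l (u' lam)‖ ≤ 1 := fun lam hl => (hu' lam hl).trans (by norm_num)
  have hcase := gridQ_eq_zero_or (V := V) (A := A) (Qc := Qc) hρ0
  set v₁ := E.step Q u with hv₁
  set v₁' := E.step' Q Q' u u' with hv₁'
  have hp₁ : E.IsPath v₁ v₁' := isPath_step hu hu1' hprec
  -- the first increment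
  have inc₁ : ∀ lam ∈ E.I, ‖E.l (v₁ lam - u lam)‖ ≤ E.N ^ (b - 4 * g : ℤ) ∧
      ‖E.l (v₁' lam - u' lam)‖ ≤ E.N ^ (b + 2 - g : ℤ) := by
    intro lam hl
    rcases hcase lam with ⟨lam₀, h₀, hd⟩ | ⟨hz, hz'⟩
    · obtain ⟨r, r'⟩ := hres lam hl lam₀ h₀ hd
      constructor
      · refine (norm_step_sub_le hprec hl).trans ?_
        calc _ ≤ E.N ^ b * E.N ^ (-(4 * g : ℤ)) := by gcongr
          _ = _ := by rw [hnat, hmul]; congr 1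
      · refine (norm_step'_sub_le hprec hl).trans ?_
        calc _ ≤ E.N ^ (b + 3 * g + 1) * E.N ^ (-(4 * g : ℤ)) + E.N ^ b * E.N ^ (-(g : ℤ)) := by
              gcongr
          _ ≤ E.N ^ (b + 1 - g : ℤ) + E.N ^ (b + 1 - g : ℤ) := by
              rw [hnat, hnat, hmul, hmul]
              exact add_le_add (hzp (by omega)) (hzp (by omega))
          _ = 2 * E.N ^ (b + 1 - g : ℤ) := by ring
          _ ≤ _ := hsum (by norm_num) (by omega)
    · rw [hv₁, hv₁', step_eq_self hz, step'_eq_self hz hz', sub_self, sub_self, map_zero, norm_zero]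
      exact ⟨(hzpos _).le, (hzpos _).le⟩
  have low_of : ∀ {w u₀ : V} {x : ℝ}, ‖E.l u₀‖ ≤ x → ∀ {m : ℤ}, ‖E.l (w - u₀)‖ ≤ E.N ^ m → m ≤ -1 →
      ‖E.l w‖ ≤ x + 1 / 16 := by
    intro w u₀ x h1 m h2 hm
    have h3 : E.N ^ m ≤ 1 / 16 := by
      refine (hzp hm).trans ?_
      rw [zpow_neg_one, ← one_div]
      gcongr
    have h4 : w = u₀ + (w - u₀) := by abel
    rw [h4, map_add]
    exact (norm_add_le _ _).trans (add_le_add h1 (h2.trans h3))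
  have l₁ : ∀ lam ∈ E.I, ‖E.l (v₁ lam)‖ < 1 := fun lam hl =>
    (low_of (hu1 lam hl) (inc₁ lam hl).1 (by omega)).trans_lt (by norm_num)
  have l₁' : ∀ lam ∈ E.I, ‖E.l (v₁' lam)‖ ≤ 1 := fun lam hl =>
    (low_of (hu' lam hl) (inc₁ lam hl).2 (by omega)).trans (by norm_num)
  have triv : ∀ lam ∈ E.I, ∀ w ∈ E.W, ‖E.l w‖ < 1 → ∀ x ∈ E.W,
      ‖E.l (x - E.L lam w (Q lam x))‖ ≤ E.N ^ (2 * b + 1) * ‖E.l x‖ := fun lam hl w hw hw1 x hx =>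
    trivial_error (lam := lam) (hprec.le lam hl) ha hN (hprec.mem lam) hl hw hw1 hx
  -- the residual after the first iteration
  have res₁ : ∀ lam ∈ E.I, ∀ lam₀ ∈ A, |lam - lam₀| ≤ 3 * ρ →
      ‖E.l (E.res v₁ lam)‖ ≤ E.N ^ (2 * b + 2 - 4 * g : ℤ) ∧
      ‖E.l (E.res' v₁ v₁' lam)‖ ≤ E.N ^ (2 * b + 3 - g : ℤ) := by
    intro lam hl lam₀ h₀ hd
    obtain ⟨r, r'⟩ := hres lam hl lam₀ h₀ hd
    obtain ⟨k, k'⟩ := residual_step_le (g := g) hu ha hN hprec hl (hu1' lam hl) (l₁ lam hl)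
      ((hu'1 lam hl).trans one_le_two) (by positivity) (triv lam hl _ (hu.mem lam hl) (hu1' lam hl))
      r r' (hz1 (by omega))
    constructor
    · refine k.trans ?_
      calc _ = E.N ^ (2 * b + 1 - 4 * g : ℤ) + E.N ^ (2 * b + 1 - 8 * g : ℤ) := by
            rw [hnat, sq, hmul, hmul, hmul]; push_cast; congr 2 <;> ring
        _ ≤ E.N ^ (2 * b + 1 - 4 * g : ℤ) + E.N ^ (2 * b + 1 - 4 * g : ℤ) :=
            add_le_add (hzp (by omega)) (hzp (by omega))
        _ = 2 * E.N ^ (2 * b + 1 - 4 * g : ℤ) := by ring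
        _ ≤ _ := hsum (by norm_num) (by omega)
    · refine k'.trans ?_
      calc _ = E.N ^ (2 * b + 1 - g : ℤ) + E.N ^ (2 * b + 2 - g : ℤ) := by
            rw [hnat, hnat, hmul, hmul]; push_cast; congr 2; ring
        _ ≤ E.N ^ (2 * b + 2 - g : ℤ) + E.N ^ (2 * b + 2 - g : ℤ) :=
            add_le_add (hzp (by omega)) (hzp (by omega))
        _ = 2 * E.N ^ (2 * b + 2 - g : ℤ) := by ring
        _ ≤ _ := hsum (by norm_num) (by omega)
  have err : ∀ w : ℝ → V, ∀ lam ∈ E.I, ∀ lam₀ ∈ A, |lam - lam₀| ≤ ρ → w lam ∈ E.W →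
      ‖E.l (w lam)‖ < 1 → ‖E.l (w lam - u lam)‖ ≤ E.N ^ (b - 4 * g : ℤ) → ∀ x ∈ E.W,
      ‖E.l (x - E.L lam (w lam) (Q lam x))‖ ≤ E.N ^ (2 * b + 2 - 3 * g : ℤ) * ‖E.l x‖ := by
    intro w lam hl lam₀ h₀ hd hw hw1 hwu x hx
    refine (gridQ_error (v := w) hρ0 hu hA hu1' hu'1 hQm hQ hinv hl h₀ hd hw hw1 hwu hx).trans ?_
    gcongr
    have h1 : E.N ^ (b - 4 * g : ℤ) ≤ ρ := hzp (by omega)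
    have hab : E.N ^ E.a ≤ E.N ^ b := pow_le_pow_right₀ hN1 ha
    have h2 : E.N ≤ E.N ^ (b + 1) := le_self_pow₀ hN1 (by omega)
    have h3 : E.N ^ b ≤ E.N ^ (b + 1) := pow_le_pow_right₀ hN1 (by omega)
    calc (E.N ^ E.a * (3 * ρ) + E.N * (3 * ρ + E.N ^ (b - 4 * g : ℤ))) * E.N ^ b
        ≤ (E.N ^ (b + 1) * (3 * ρ) + E.N ^ (b + 1) * (3 * ρ + ρ)) * E.N ^ b := by
          have h4 := mul_le_mul_of_nonneg_right (hab.trans h3) (by positivity : 0 ≤ 3 * ρ)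
          gcongr
      _ = 7 * (E.N ^ (2 * b + 1) * ρ) := by ring
      _ = 7 * E.N ^ (2 * b + 1 - 3 * g : ℤ) := by rw [hnat, hρ, hmul]; push_cast; congr 2
      _ ≤ _ := hsum (by norm_num) (by omega)
  -- The same operators are used again. The first step improves the residual but not its derivative,
  -- which is fed by the old residual times `N ^ (3 g)`; it becomes small once the improved residual
  -- enters.
  set v₂ := E.step Q v₁ with hv₂
  set v₂' := E.step' Q Q' v₁ v₁' with hv₂'
  have hp₂ : E.IsPath v₂ v₂' := isPath_step hp₁ l₁ hprec
  have inc₂ : ∀ lam ∈ E.I, ‖E.l (v₂ lam - v₁ lam)‖ ≤ E.N ^ (3 * b + 2 - 4 * g : ℤ) ∧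
      ‖E.l (v₂' lam - v₁' lam)‖ ≤ E.N ^ (3 * b + 4 - g : ℤ) := by
    intro lam hl
    rcases hcase lam with ⟨lam₀, h₀, hd⟩ | ⟨hz, hz'⟩
    · obtain ⟨r, r'⟩ := res₁ lam hl lam₀ h₀ hd
      constructor
      · refine (norm_step_sub_le hprec hl).trans ?_
        calc _ ≤ E.N ^ b * E.N ^ (2 * b + 2 - 4 * g : ℤ) := by gcongr
          _ = _ := by rw [hnat, hmul]; congr 1; ring
      · refine (norm_step'_sub_le hprec hl).trans ?_
        calc _ ≤ E.N ^ (b + 3 * g + 1) * E.N ^ (2 * b + 2 - 4 * g : ℤ) +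
              E.N ^ b * E.N ^ (2 * b + 3 - g : ℤ) := by
              gcongr
          _ = E.N ^ (3 * b + 3 - g : ℤ) + E.N ^ (3 * b + 3 - g : ℤ) := by
              rw [hnat, hnat, hmul, hmul]
              push_cast; congr 2 <;> ring
          _ = 2 * E.N ^ (3 * b + 3 - g : ℤ) := by ring
          _ ≤ _ := hsum (by norm_num) (by omega)
    · rw [hv₂, hv₂', step_eq_self hz, step'_eq_self hz hz', sub_self, sub_self, map_zero, norm_zero]
      exact ⟨(hzpos _).le, (hzpos _).le⟩
  have inc : ∀ lam ∈ E.I, ‖E.l (v₂ lam - u lam)‖ ≤ E.N ^ (3 * b + 3 - 4 * g : ℤ) ∧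
      ‖E.l (v₂' lam - u' lam)‖ ≤ E.N ^ (3 * b + 5 - g : ℤ) := by
    intro lam hl
    have hsplit : ∀ {x y z : V} {m n k : ℤ}, ‖E.l (x - y)‖ ≤ E.N ^ m → ‖E.l (y - z)‖ ≤ E.N ^ n →
        m + 1 ≤ k → n ≤ m → ‖E.l (x - z)‖ ≤ E.N ^ k := by
      intro x y z m n k h1 h2 h3 h4
      have h5 : x - z = (x - y) + (y - z) := by abel
      rw [h5, map_add]
      calc _ ≤ E.N ^ m + E.N ^ m := (norm_add_le _ _).trans (add_le_add h1 (h2.trans (hzp h4)))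
        _ = 2 * E.N ^ m := by ring
        _ ≤ _ := hsum (by norm_num) h3
    exact ⟨hsplit (inc₂ lam hl).1 (inc₁ lam hl).1 (by omega) (by omega),
      hsplit (inc₂ lam hl).2 (inc₁ lam hl).2 (by omega) (by omega)⟩
  have l₂ : ∀ lam ∈ E.I, ‖E.l (v₂ lam)‖ < 1 := fun lam hl =>
    (low_of (hu1 lam hl) (inc lam hl).1 (by omega)).trans_lt (by norm_num)
  refine ⟨v₂, v₂', hp₂, inc, ?_, ?_⟩
  · intro lam hl lam₀ h₀ hd
    have hd3 : |lam - lam₀| ≤ 3 * ρ := by linarith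
    obtain ⟨r, r'⟩ := hres lam hl lam₀ h₀ hd3
    -- Up to multiples of `b`, the exponents of the residual go from `-4 g` to `-7 g` to `-10 g`,
    -- those of its derivative from `-g` to `-g` to `-4 g`. The next scale requires a little more
    -- than `-8 g` and `-2 g`.
    obtain ⟨k, k'⟩ := residual_step_le (g := g) hu ha hN hprec hl (hu1' lam hl) (l₁ lam hl)
      ((hu'1 lam hl).trans one_le_two) (hzpos _).le
      (err u lam hl lam₀ h₀ hd (hu.mem lam hl) (hu1' lam hl) (by simpa using (hzpos _).le))
      r r' (hz1 (by omega))
    have k₁ : ‖E.l (E.res v₁ lam)‖ ≤ E.N ^ (2 * b + 3 - 7 * g : ℤ) := by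
      refine k.trans ?_
      calc _ = E.N ^ (2 * b + 2 - 7 * g : ℤ) + E.N ^ (2 * b + 1 - 8 * g : ℤ) := by
            rw [hnat, sq, hmul, hmul, hmul]; push_cast; congr 2 <;> ring
        _ ≤ E.N ^ (2 * b + 2 - 7 * g : ℤ) + E.N ^ (2 * b + 2 - 7 * g : ℤ) :=
            add_le_add (hzp (by omega)) (hzp (by omega))
        _ = 2 * E.N ^ (2 * b + 2 - 7 * g : ℤ) := by ring
        _ ≤ _ := hsum (by norm_num) (by omega)
    have k₁' : ‖E.l (E.res' v₁ v₁' lam)‖ ≤ E.N ^ (2 * b + 3 - g : ℤ) := by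
      refine k'.trans ?_
      calc _ = E.N ^ (2 * b + 2 - 4 * g : ℤ) + E.N ^ (2 * b + 2 - g : ℤ) := by
            rw [hnat, hmul, hmul]; push_cast; congr 2 <;> ring
        _ ≤ E.N ^ (2 * b + 2 - g : ℤ) + E.N ^ (2 * b + 2 - g : ℤ) :=
            add_le_add (hzp (by omega)) (hzp (by omega))
        _ = 2 * E.N ^ (2 * b + 2 - g : ℤ) := by ring
        _ ≤ _ := hsum (by norm_num) (by omega)
    obtain ⟨j, j'⟩ := residual_step_le (g := g) hp₁ ha hN hprec hl (l₁ lam hl) (l₂ lam hl)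
      ((l₁' lam hl).trans one_le_two) (hzpos _).le
      (err v₁ lam hl lam₀ h₀ hd (hp₁.mem lam hl) (l₁ lam hl) (inc₁ lam hl).1)
      k₁ k₁' (hz1 (by omega))
    constructor
    · refine j.trans ?_
      calc _ = E.N ^ (4 * b + 5 - 10 * g : ℤ) + E.N ^ (6 * b + 7 - 14 * g : ℤ) := by
            rw [hnat, sq, hmul, hmul, hmul]; push_cast; congr 2 <;> ring
        _ ≤ E.N ^ (4 * b + 5 - 10 * g : ℤ) + E.N ^ (4 * b + 5 - 10 * g : ℤ) :=
            add_le_add (hzp (by omega)) (hzp (by omega))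
        _ = 2 * E.N ^ (4 * b + 5 - 10 * g : ℤ) := by ring
        _ ≤ _ := hsum (by norm_num) (by omega)
    · refine j'.trans ?_
      calc _ = E.N ^ (4 * b + 5 - 4 * g : ℤ) + E.N ^ (4 * b + 5 - 4 * g : ℤ) := by
            rw [hnat, hmul, hmul]; push_cast; congr 2 <;> ring
        _ = 2 * E.N ^ (4 * b + 5 - 4 * g : ℤ) := by ring
        _ ≤ _ := hsum (by norm_num) (by omega)
  · intro p σ Z hp hpQ hZ lam hl
    obtain ⟨hZ1, hZ2⟩ := hZ lam hl
    have hZ0 : 0 ≤ Z := (apply_nonneg p _).trans hZ1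
    set c := 2 * b + σ + 3 * g + 2 with hc
    have hNc : 1 ≤ E.N ^ c := one_le_pow₀ hN1
    have hq : ∀ Y, Z ≤ Y → ∀ x ∈ E.W, ‖E.l x‖ ≤ 1 → p (Q lam x) ≤ E.N ^ (b + σ) * (1 + Y + p x) ∧
        p (Q' lam x) ≤ E.N ^ (b + σ + 3 * g + 1) * (1 + Y + p x) := by
      intro Y hY x hx hx1
      have hpx := apply_nonneg p x
      have hA' : ∀ l ∈ A, p (Qc l x) ≤ E.N ^ (b + σ) * (1 + Y + p x) := by
        intro l hlA
        refine (hpQ l hlA x hx).trans ?_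
        have h1 := (hZ l (hA hlA)).1
        have h2 := apply_nonneg p (u l)
        have h3 : (1 + p (u l)) * ‖E.l x‖ ≤ (1 + p (u l)) * 1 := by gcongr
        gcongr
        linarith
      have hc0 : 0 ≤ E.N ^ (b + σ) * (1 + Y + p x) := by
        have : 0 ≤ Y := hZ0.trans hY
        positivity
      refine ⟨gridQ_seminorm_le p hc0 hA' lam, (gridQ'_seminorm_le hρ0 hC p hc0 hA' lam).trans ?_⟩
      have h4 : 2 * C * ρ⁻¹ ≤ E.N ^ (3 * g + 1) := by
        rw [hρ, ← zpow_neg, neg_neg]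
        calc 2 * C * E.N ^ (3 * g : ℤ) ≤ E.N * E.N ^ (3 * g : ℤ) := by gcongr
          _ = _ := by
              rw [show (3 * g : ℤ) = ((3 * g : ℕ) : ℤ) by push_cast; ring, zpow_natCast]; ring
      calc _ ≤ E.N ^ (3 * g + 1) * (E.N ^ (b + σ) * (1 + Y + p x)) := by gcongr
        _ = _ := by ring
    have hpow2 : E.N ^ (2 * c) * (1 + Z) = E.N ^ c * (E.N ^ c * (1 + Z)) := by
      rw [two_mul, pow_add]; ring
    rcases hcase lam with ⟨lam₀, h₀, hd⟩ | ⟨hz, hz'⟩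
    · obtain ⟨r, r'⟩ := hres lam hl lam₀ h₀ hd
      obtain ⟨s, s'⟩ := high_step_le (g := g) hp hu ha hN hl (hu1' lam hl)
        ((hu'1 lam hl).trans one_le_two) (r.trans (hz1 (by omega))) (r'.trans (hz1 (by omega)))
        hZ1 hZ2 (hq Z le_rfl)
      obtain ⟨r₁, r₁'⟩ := res₁ lam hl lam₀ h₀ hd
      have hY1 : 1 + Z ≤ E.N ^ c * (1 + Z) := le_mul_of_one_le_left (by linarith) hNc
      obtain ⟨w, w'⟩ := high_step_le (g := g) (Y := E.N ^ c * (1 + Z) - 1) hp hp₁ ha hN hl (l₁ lam hl)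
        ((l₁' lam hl).trans one_le_two) (r₁.trans (hz1 (by omega))) (r₁'.trans (hz1 (by omega)))
        (by linarith) (by linarith) (hq _ (by linarith))
      rw [add_sub_cancel] at w w'
      rw [hpow2]
      exact ⟨w, w'⟩
    · rw [hv₂, hv₂', step_eq_self hz, step'_eq_self hz hz', hv₁, hv₁', step_eq_self hz,
        step'_eq_self hz hz']
      have : 1 + Z ≤ E.N ^ (2 * c) * (1 + Z) := le_mul_of_one_le_left (by linarith)
        (one_le_pow₀ hN1)
      constructor <;> linarith

end NewtonEnv

/-! ### Truncations in the scale of sequence spaces -/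

theorem memHs_of_suppIn (s : ℝ) {E : Finset (Idx K)} {u : Seq K} (h : SuppIn E u) : MemHs s u := by
  refine summable_of_ne_finset_zero (s := E) fun k hk => ?_
  rw [h k hk]; simp

theorem weighted_term_nonneg (s : ℝ) (u : Seq K) (k : Idx K) : 0 ≤ bracket k ^ (2 * s) * ‖u k‖ ^ 2 := by
  have := bracket_pos k
  positivity

theorem snorm_nonneg (s : ℝ) (u : Seq K) : 0 ≤ snorm s u := Real.sqrt_nonneg _

theorem snorm_sq (s : ℝ) (u : Seq K) :
    snorm s u ^ 2 = ∑' k, bracket k ^ (2 * s) * ‖u k‖ ^ 2 :=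
  Real.sq_sqrt (tsum_nonneg fun k => weighted_term_nonneg s u k)

theorem snorm_sq_of_suppIn (s : ℝ) {E : Finset (Idx K)} {u : Seq K} (h : SuppIn E u) :
    snorm s u ^ 2 = ∑ k ∈ E, bracket k ^ (2 * s) * ‖u k‖ ^ 2 := by
  rw [snorm_sq, tsum_eq_sum fun k hk => by rw [h k hk]; simp]

theorem sum_le_snorm_sq {s : ℝ} {u : Seq K} (h : MemHs s u) (E : Finset (Idx K)) :
    ∑ k ∈ E, bracket k ^ (2 * s) * ‖u k‖ ^ 2 ≤ snorm s u ^ 2 := by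
  rw [snorm_sq]
  exact Summable.sum_le_tsum E (fun k _ => weighted_term_nonneg s u k) h

theorem bracket_sq (s : ℝ) (u : Seq K) (k : Idx K) :
    bracket k ^ (2 * s) * ‖u k‖ ^ 2 = (bracket k ^ s * ‖u k‖) ^ 2 := by
  rw [mul_pow, mul_comm 2 s, Real.rpow_mul (bracket_pos k).le]
  norm_num

theorem bracket_mul_le_snorm {s : ℝ} {u : Seq K} (h : MemHs s u) (k : Idx K) :
    bracket k ^ s * ‖u k‖ ≤ snorm s u := by
  have h1 := sum_le_snorm_sq h {k}
  rw [Finset.sum_singleton, bracket_sq] at h1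
  exact le_of_sq_le_sq h1 (snorm_nonneg s u)

theorem snorm_le_of_sq_le {s : ℝ} {u : Seq K} {c : ℝ} (hc : 0 ≤ c) (h : snorm s u ^ 2 ≤ c ^ 2) :
    snorm s u ≤ c := le_of_sq_le_sq h hc

theorem snorm_le_sum (s : ℝ) {E : Finset (Idx K)} {u : Seq K} (h : SuppIn E u) :
    snorm s u ≤ ∑ k ∈ E, bracket k ^ s * ‖u k‖ := by
  have hnn : ∀ k, 0 ≤ bracket k ^ s * ‖u k‖ := fun k => by
    have := bracket_pos k
    positivity
  refine snorm_le_of_sq_le (Finset.sum_nonneg fun k _ => hnn k) ?_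
  rw [snorm_sq_of_suppIn s h]
  simp only [bracket_sq]
  exact Finset.sum_sq_le_sq_sum_of_nonneg fun k _ => hnn k

theorem snorm_le_mul {s s' c : ℝ} (hc : 0 ≤ c) {E : Finset (Idx K)} {u w : Seq K} (hu : SuppIn E u)
    (hw : SuppIn E w) (h : ∀ k ∈ E, bracket k ^ s * ‖u k‖ ≤ c * (bracket k ^ s' * ‖w k‖)) :
    snorm s u ≤ c * snorm s' w := by
  refine snorm_le_of_sq_le (mul_nonneg hc (snorm_nonneg _ _)) ?_
  rw [mul_pow, snorm_sq_of_suppIn s hu, snorm_sq_of_suppIn s' hw, Finset.mul_sum]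
  refine Finset.sum_le_sum fun k hk => ?_
  rw [bracket_sq, bracket_sq, ← mul_pow]
  have := bracket_pos k
  exact pow_le_pow_left₀ (by positivity) (h k hk) 2

namespace Hs

variable {s₀ : ℝ}

theorem val_zero : (0 : Hs K s₀).val = 0 := rfl

theorem val_sub (u v : Hs K s₀) : (u - v).val = u.val - v.val := rfl

theorem val_real_smul (c : ℝ) (u : Hs K s₀) : (c • u).val = c • u.val := by
  have h1 : (c • u) = (c : ℂ) • u := (Complex.coe_smul c u).symm
  rw [h1, val_smul]
  exact Complex.coe_smul c u.val

theorem val_sum {ι : Type*} (E : Finset ι) (f : ι → Hs K s₀) (k : Idx K) :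
    (∑ i ∈ E, f i).val k = ∑ i ∈ E, (f i).val k := by
  classical
  induction E using Finset.induction_on with
  | empty => simp [val_zero]
  | insert i E hi ih => rw [Finset.sum_insert hi, Finset.sum_insert hi, val_add, Pi.add_apply, ih]

end Hs

variable {s₀ : ℝ}

/-- Restriction to a finite set of indices, as an operator from `H^{s₀}` to `H^s`. -/
def proj (E : Finset (Idx K)) (s : ℝ) : Hs K s₀ →L[ℝ] Hs K s :=
  LinearMap.mkContinuous
    { toFun := fun x => Hs.mk (restr E x.val) (memHs_of_suppIn s (restr_suppIn E x.val))
      map_add' := fun x y => Hs.val_injective (funext fun k => by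
        change restr E (x.val + y.val) k = restr E x.val k + restr E y.val k
        unfold restr
        split_ifs <;> simp)
      map_smul' := fun c x => Hs.val_injective (funext fun k => by
        rw [RingHom.id_apply, Hs.val_real_smul]
        change restr E (c • x).val k = c • restr E x.val k
        rw [Hs.val_real_smul]
        unfold restr
        split_ifs <;> simp) }
    (∑ k ∈ E, bracket k ^ s * bracket k ^ (-s₀)) (fun x => by
      rw [Hs.norm_eq, Hs.norm_eq, Finset.sum_mul]
      refine (snorm_le_sum s (restr_suppIn E x.val)).trans (Finset.sum_le_sum fun k hk => ?_)
      have hb := bracket_pos k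
      have h1 := bracket_mul_le_snorm x.val_mem k
      have h2 : restr E x.val k = x.val k := restr_apply hk _
      change bracket k ^ s * ‖restr E x.val k‖ ≤ _
      rw [h2, mul_assoc]
      gcongr
      calc ‖x.val k‖ = bracket k ^ (-s₀) * (bracket k ^ s₀ * ‖x.val k‖) := by
            rw [← mul_assoc, ← Real.rpow_add hb]; simp
        _ ≤ _ := by gcongr)

theorem proj_val (E : Finset (Idx K)) (s : ℝ) (x : Hs K s₀) : (proj E s x).val = restr E x.val := rfl

theorem norm_proj (E : Finset (Idx K)) (s : ℝ) (x : Hs K s₀) :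
    ‖proj E s x‖ = snorm s (restr E x.val) := Hs.norm_eq _

theorem restr_of_suppIn {E : Finset (Idx K)} {u : Seq K} (h : SuppIn E u) : restr E u = u := by
  funext k
  by_cases hk : k ∈ E
  · exact restr_apply hk u
  · rw [restr_suppIn E u k hk, h k hk]

theorem norm_restr_le (E : Finset (Idx K)) (u : Seq K) (k : Idx K) : ‖restr E u k‖ ≤ ‖u k‖ := by
  by_cases hk : k ∈ E
  · rw [restr_apply hk]
  · rw [restr_suppIn E u k hk, norm_zero]; exact norm_nonneg _

variable (K s₀) in
/-- The subspace of families supported in the box of radius `N` around the origin. -/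
def WN (N : ℕ) : Submodule ℝ (Hs K s₀) where
  carrier := {x | SuppIn (bx N 0) x.val}
  zero_mem' := fun _ _ => rfl
  add_mem' := fun {x y} hx hy k hk => by
    rw [Hs.val_add, Pi.add_apply, hx k hk, hy k hk, add_zero]
  smul_mem' := fun c x hx k hk => by
    rw [Hs.val_real_smul, Pi.smul_apply, hx k hk, smul_zero]

theorem WN_mono {N M : ℕ} (h : N ≤ M) : WN K s₀ N ≤ WN K s₀ M := fun _ hx k hk =>
  hx k fun h' => hk (bx_subset h 0 h')

/-- The norm in `H^s` of the truncation to the box of radius `N`. -/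
def ns (N : ℕ) (s : ℝ) (x : Hs K s₀) : ℝ := ‖(proj (bx N 0) s x : Hs K s)‖

theorem ns_nonneg (N : ℕ) (s : ℝ) (x : Hs K s₀) : 0 ≤ ns N s x := norm_nonneg _

theorem ns_eq (N : ℕ) (s : ℝ) (x : Hs K s₀) : ns N s x = snorm s (restr (bx N 0) x.val) :=
  norm_proj _ _ _

theorem ns_add_le (N : ℕ) (s : ℝ) (x y : Hs K s₀) : ns N s (x + y) ≤ ns N s x + ns N s y := by
  unfold ns; rw [map_add]; exact norm_add_le _ _

theorem ns_smul (N : ℕ) (s c : ℝ) (x : Hs K s₀) : ns N s (c • x) = |c| * ns N s x := by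
  unfold ns; rw [map_smul, norm_smul, Real.norm_eq_abs]

theorem ns_le_snorm {N : ℕ} {s : ℝ} {x : Hs K s₀} (h : MemHs s x.val) : ns N s x ≤ snorm s x.val := by
  rw [ns_eq]
  refine snorm_le_of_sq_le (snorm_nonneg _ _) ?_
  rw [snorm_sq_of_suppIn s (restr_suppIn _ _)]
  refine le_trans (le_of_eq ?_) (sum_le_snorm_sq h (bx N 0))
  exact Finset.sum_congr rfl fun k hk => by rw [restr_apply hk]

theorem ns_eq_snorm {N : ℕ} {s : ℝ} {x : Hs K s₀} (h : x ∈ WN K s₀ N) :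
    ns N s x = snorm s x.val := by
  rw [ns_eq, restr_of_suppIn h]

theorem ns_eq_ns {N M : ℕ} (h : N ≤ M) {s : ℝ} {x : Hs K s₀} (hx : x ∈ WN K s₀ N) :
    ns M s x = ns N s x := by
  rw [ns_eq_snorm hx, ns_eq_snorm (WN_mono h hx)]

theorem ns_mono {N : ℕ} {s s' : ℝ} (h : s ≤ s') (x : Hs K s₀) : ns N s x ≤ ns N s' x := by
  rw [ns_eq, ns_eq, ← one_mul (snorm s' _)]
  refine snorm_le_mul zero_le_one (restr_suppIn _ _) (restr_suppIn _ _) fun k _ => ?_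
  rw [one_mul]
  gcongr
  exact one_le_bracket k

theorem norm_eq_ns {N : ℕ} {x : Hs K s₀} (h : x ∈ WN K s₀ N) : ‖x‖ = ns N s₀ x := by
  rw [ns_eq_snorm h, Hs.norm_eq]

theorem ns_le_norm (N : ℕ) (x : Hs K s₀) : ns N s₀ x ≤ ‖x‖ := by
  rw [Hs.norm_eq]; exact ns_le_snorm x.val_mem

theorem norm_le_ns {N : ℕ} {s : ℝ} (hs : s₀ ≤ s) {x : Hs K s₀} (h : x ∈ WN K s₀ N) :
    ‖x‖ ≤ ns N s x := by
  rw [norm_eq_ns h]; exact ns_mono hs x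

theorem norm_val_le_ns {N : ℕ} {s : ℝ} (hs : 0 ≤ s) (x : Hs K s₀) {k : Idx K} (hk : k ∈ bx N 0) :
    ‖x.val k‖ ≤ ns N s x := by
  rw [ns_eq]
  have h1 := bracket_mul_le_snorm (memHs_of_suppIn s (restr_suppIn (bx N 0) x.val)) k
  rw [restr_apply hk] at h1
  have h2 : 1 ≤ bracket k ^ s := Real.one_le_rpow (one_le_bracket k) hs
  nlinarith [norm_nonneg (x.val k)]

/-- A constant comparing the weights with the distance to the origin. -/
structure IsBracketConst (K : IndexData) (C : ℝ) : Prop where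
  one_le : 1 ≤ C
  upper : ∀ (N : ℕ), 1 ≤ N → ∀ k ∈ bx (K := K) N 0, bracket k ≤ C * N
  lower : ∀ (N : ℕ), ∀ k : Idx K, k ∉ bx N 0 → (N : ℝ) ≤ C * bracket k

variable (K) in
theorem exists_isBracketConst : ∃ C, IsBracketConst K C := by
  obtain ⟨C, hC1, hC⟩ := exists_bracket_bounds (K := K)
  refine ⟨C, hC1, fun N hN k hk => ?_, fun N k hk => ?_⟩
  · have h1 := (hC k).1
    rw [mem_bx_zero] at hk
    have hN' : (1 : ℝ) ≤ N := by exact_mod_cast hN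
    exact h1.trans (by gcongr; exact max_le hN' hk)
  · rw [mem_bx_zero, not_le] at hk
    exact hk.le.trans ((le_max_right _ _).trans (hC k).2)

/-- Bernstein inequality: inside the box the weights are at most `C N`. -/
theorem ns_growth {C : ℝ} (hC : IsBracketConst K C) {N : ℕ} (hN : 1 ≤ N) {s s' : ℝ} (h : s ≤ s')
    (x : Hs K s₀) : ns N s' x ≤ (C * N) ^ (s' - s) * ns N s x := by
  have hC1 := hC.one_le
  rw [ns_eq, ns_eq]
  refine snorm_le_mul (by positivity) (restr_suppIn _ _) (restr_suppIn _ _) fun k hk => ?_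
  have hb := bracket_pos k
  rw [← mul_assoc]
  gcongr
  calc bracket k ^ s' = bracket k ^ (s' - s) * bracket k ^ s := by
        rw [← Real.rpow_add hb, sub_add_cancel]
    _ ≤ _ := by
        gcongr
        exact hC.upper N hN k hk

/-- Outside the box the weights are at least `N / C`, so a truncation gains powers of `N` from
regularity. -/
theorem ns_smoothing {C : ℝ} (hC : IsBracketConst K C) {N M : ℕ} (hN : 1 ≤ N) {s s' : ℝ}
    (h : s ≤ s') (x : Hs K s₀) :
    ns M s (x - proj (bx N 0) s₀ x) ≤ (C / N) ^ (s' - s) * ns M s' x := by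
  have hC1 := hC.one_le
  have hN' : (1 : ℝ) ≤ N := by exact_mod_cast hN
  rw [ns_eq, ns_eq]
  refine snorm_le_mul (by positivity) (restr_suppIn _ _) (restr_suppIn _ _) fun k hk => ?_
  have hb := bracket_pos k
  rw [restr_apply hk, restr_apply hk, Hs.val_sub, proj_val, Pi.sub_apply]
  by_cases hkN : k ∈ bx N 0
  · rw [restr_apply hkN, sub_self, norm_zero, mul_zero]
    positivity
  · rw [restr_suppIn _ _ k hkN, sub_zero, ← mul_assoc]
    gcongr
    have h1 := hC.lower N k hkN
    calc bracket k ^ s = 1 * bracket k ^ s := (one_mul _).symm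
      _ ≤ (C / N * bracket k) ^ (s' - s) * bracket k ^ s := by
          gcongr
          refine Real.one_le_rpow ?_ (by linarith)
          rw [div_mul_eq_mul_div, le_div_iff₀ (by linarith)]
          linarith
      _ = (C / N) ^ (s' - s) * (bracket k ^ (s' - s) * bracket k ^ s) := by
          rw [Real.mul_rpow (by positivity) hb.le, mul_assoc]
      _ = _ := by rw [← Real.rpow_add hb, sub_add_cancel]

theorem proj_mem_WN (N : ℕ) (x : Hs K s₀) : proj (bx N 0) s₀ x ∈ WN K s₀ N := restr_suppIn _ _

theorem proj_eq_self {N : ℕ} {x : Hs K s₀} (h : x ∈ WN K s₀ N) : proj (bx N 0) s₀ x = x :=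
  Hs.val_injective (restr_of_suppIn h)

theorem ns_proj_le {N M : ℕ} {s : ℝ} (x : Hs K s₀) : ns M s (proj (bx N 0) s₀ x) ≤ ns M s x := by
  rw [ns_eq, ns_eq, ← one_mul (snorm s (restr _ x.val))]
  refine snorm_le_mul zero_le_one (restr_suppIn _ _) (restr_suppIn _ _) fun k hk => ?_
  rw [one_mul, restr_apply hk, restr_apply hk, proj_val]
  have := bracket_pos k
  gcongr
  exact norm_restr_le _ _ _

/-! ### Diagonal operators -/

/-- The truncation of a diagonal operator. -/
def dop (N : ℕ) (m : Idx K → ℂ) : Hs K s₀ →L[ℝ] Hs K s₀ :=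
  ∑ k ∈ bx N 0, m k • proj {k} s₀

theorem dop_val (N : ℕ) (m : Idx K → ℂ) (x : Hs K s₀) (k : Idx K) (hk : k ∈ bx N 0) :
    (dop N m x).val k = m k • x.val k := by
  rw [dop, sum_apply, Hs.val_sum, Finset.sum_eq_single k]
  · change (m k • (proj {k} s₀ x)).val k = _
    rw [Hs.val_smul, Pi.smul_apply, proj_val, restr_apply (Finset.mem_singleton_self k)]
  · intro k' _ hne
    change (m k' • (proj {k'} s₀ x)).val k = _
    rw [Hs.val_smul, Pi.smul_apply, proj_val, restr_suppIn _ _ k (by simpa using hne.symm), smul_zero]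
  · exact fun h => absurd hk h

theorem dop_mem (N : ℕ) (m : Idx K → ℂ) (x : Hs K s₀) : dop N m x ∈ WN K s₀ N := by
  intro k hk
  rw [dop, sum_apply, Hs.val_sum]
  refine Finset.sum_eq_zero fun k' hk' => ?_
  change (m k' • (proj {k'} s₀ x)).val k = _
  rw [Hs.val_smul, Pi.smul_apply, proj_val, restr_suppIn, smul_zero]
  rintro h
  exact hk (Finset.mem_singleton.1 h ▸ hk')

theorem ns_dop_le {N M : ℕ} {m : Idx K → ℂ} {c : ℝ} (hc : 0 ≤ c)
    (h : ∀ k ∈ bx N 0, 0 < dim k → ‖m k‖ ≤ c) (s : ℝ) (x : Hs K s₀) :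
    ns M s (dop N m x) ≤ c * ns M s x := by
  rw [ns_eq, ns_eq]
  refine snorm_le_mul hc (restr_suppIn _ _) (restr_suppIn _ _) fun k hk => ?_
  rw [restr_apply hk, restr_apply hk]
  have hb := bracket_pos k
  by_cases hkN : k ∈ bx N 0
  · rw [dop_val N m x k hkN, norm_smul]
    by_cases hd : 0 < dim k
    · calc bracket k ^ s * (‖m k‖ * ‖x.val k‖) ≤ bracket k ^ s * (c * ‖x.val k‖) := by
            gcongr; exact h k hkN hd
        _ = _ := by ring
    · have : IsEmpty (Fin (dim k)) := by
        rw [Nat.not_lt, Nat.le_zero] at hd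
        rw [hd]; infer_instance
      have : x.val k = 0 := Subsingleton.elim _ _
      rw [this]; simp
  · rw [dop_mem N m x k hkN]
    simp only [norm_zero, mul_zero]
    positivity

theorem hasDerivWithinAt_dop {N : ℕ} {I : Set ℝ} {D : Idx K → ℝ → ℂ} {D' : Idx K → ℂ} {lam : ℝ}
    (h : ∀ k, HasDerivWithinAt (D k) (D' k) I lam) :
    HasDerivWithinAt (fun lam => (dop N fun k => D k lam : Hs K s₀ →L[ℝ] Hs K s₀)) (dop N D')
      I lam := by
  unfold dop
  refine HasDerivWithinAt.fun_sum fun k _ => ?_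
  exact (h k).smul_const (proj {k} s₀ : Hs K s₀ →L[ℝ] Hs K s₀)

theorem continuousOn_dop {N : ℕ} {I : Set ℝ} {D : Idx K → ℝ → ℂ} (h : ∀ k, ContinuousOn (D k) I) :
    ContinuousOn (fun lam => (dop N fun k => D k lam : Hs K s₀ →L[ℝ] Hs K s₀)) I := by
  unfold dop
  exact continuousOn_finsetSum _ fun k _ => (h k).smul continuousOn_const

/-! ### The nonlinear problem -/

variable (K) in
/-- The data of the nonlinear problem and the standing assumptions on it. -/
structure Problem (s₀ ν ν₀ K₁ : ℝ) where
  I : Set ℝ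
  D : Idx K → ℝ → ℂ
  f : Hs K s₀ → Hs K s₀
  om : Fin K.d → ℝ
  DD : K.Lam → K.A → ℝ → ℂ
  S' : EReal
  s₀_nonneg : 0 ≤ s₀
  ν_nonneg : 0 ≤ ν
  ν₀_pos : 0 < ν₀
  K₁_pos : 0 < K₁
  ordConnected : I.OrdConnected
  interior_nonempty : (interior I).Nonempty
  half_le : I ⊆ Set.Ici (1 / 2)
  contDiff_D : ∀ k, ContDiffOn ℝ 1 (D k) I
  bound_D : DiagBound ν I (fun lam k => D k lam)
  bound_D' : DiagBound ν I (fun lam k => derivWithin (D k) I lam)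
  contDiff_f : ContDiffOn ℝ 2 f (Metric.ball 0 1)
  complexLinear : ∀ u : Hs K s₀, ‖u‖ < 1 → ∀ (c : ℂ) (h : Hs K s₀),
    fderiv ℝ f u (c • h) = c • fderiv ℝ f u h
  tame : TameUpTo K₁ s₀ ν₀ f S'
  diophantine : Diophantine om
  covariance : ∀ lam ∈ I, ∀ k, D k lam = Dtheta om DD lam 0 k
  toeplitz : ∀ u : Hs K s₀, ‖u‖ < 1 → ToeplitzInTime (jacobian f u)

namespace Problem

variable {s₀ ν ν₀ K₁ : ℝ} (P : Problem K s₀ ν ν₀ K₁)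

theorem hasFDerivAt_f {v : Hs K s₀} (hv : ‖v‖ < 1) : HasFDerivAt P.f (fderiv ℝ P.f v) v := by
  have h1 : Metric.ball (0 : Hs K s₀) 1 ∈ nhds v := Metric.isOpen_ball.mem_nhds (by simpa using hv)
  exact ((P.contDiff_f.contDiffAt h1).differentiableAt (by norm_num)).hasFDerivAt

theorem contDiffOn_fderiv : ContDiffOn ℝ 1 (fderiv ℝ P.f) (Metric.ball 0 1) :=
  P.contDiff_f.fderiv_of_isOpen Metric.isOpen_ball (by norm_num)

theorem hasFDerivAt_fderiv {v : Hs K s₀} (hv : ‖v‖ < 1) :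
    HasFDerivAt (fderiv ℝ P.f) (fderiv ℝ (fderiv ℝ P.f) v) v := by
  have h1 : Metric.ball (0 : Hs K s₀) 1 ∈ nhds v := Metric.isOpen_ball.mem_nhds (by simpa using hv)
  exact ((P.contDiffOn_fderiv.contDiffAt h1).differentiableAt (by norm_num)).hasFDerivAt

/-- Tame bounds for the nonlinearity at regularity `s`, with constant `C`, on finitely supported
families. -/
structure TameConst (s C : ℝ) : Prop where
  one_le : 1 ≤ C
  deriv_le : ∀ M N : ℕ, ∀ v ∈ WN K s₀ N, ‖v‖ < 1 → ∀ h ∈ WN K s₀ N,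
    ns M s (fderiv ℝ P.f v h) ≤ C * (ns N s v * ‖h‖ + ns N s h)
  le : ∀ M N : ℕ, ∀ v ∈ WN K s₀ N, ‖v‖ < 1 → ns M s (P.f v) ≤ C * (1 + ns N s v)
  lip : ∀ M N : ℕ, ∀ v ∈ WN K s₀ N, ns N s v < 1 → ∀ w ∈ WN K s₀ N, ns N s w < 1 →
    ∀ h ∈ WN K s₀ N,
    ns M s (fderiv ℝ P.f v h - fderiv ℝ P.f w h) ≤ C * ns N s (v - w) * ns N s h

theorem TameConst.mono {P : Problem K s₀ ν ν₀ K₁} {s C C' : ℝ} (h : P.TameConst s C) (hC : C ≤ C') :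
    P.TameConst s C' where
  one_le := h.one_le.trans hC
  deriv_le M N v hv hv1 w hw := (h.deriv_le M N v hv hv1 w hw).trans
    (mul_le_mul_of_nonneg_right hC
      (add_nonneg (mul_nonneg (ns_nonneg _ _ _) (norm_nonneg _)) (ns_nonneg _ _ _)))
  le M N v hv hv1 := (h.le M N v hv hv1).trans
    (mul_le_mul_of_nonneg_right hC (add_nonneg zero_le_one (ns_nonneg _ _ _)))
  lip M N v hv hv1 w hw hw1 x hx := (h.lip M N v hv hv1 w hw hw1 x hx).trans
    (mul_le_mul_of_nonneg_right (mul_le_mul_of_nonneg_right hC (ns_nonneg _ _ _))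
      (ns_nonneg _ _ _))

/-- The path is differentiable only in `H^{s₀}`, but its projection to a box is differentiable in
every `H^s`; the mean value inequality is applied to that. -/
theorem ns_sub_le_of_hasDerivAt {M : ℕ} {s c : ℝ} {γ γ' : ℝ → Hs K s₀}
    (hd : ∀ t ∈ Set.Icc (0 : ℝ) 1, HasDerivAt γ (γ' t) t)
    (hc : ∀ t ∈ Set.Icc (0 : ℝ) 1, ns M s (γ' t) ≤ c) : ns M s (γ 1 - γ 0) ≤ c := by
  have hder : ∀ t ∈ Set.Icc (0 : ℝ) 1, HasDerivWithinAt
      (fun t : ℝ => (proj (bx M 0) s (γ t) : Hs K s)) (proj (bx M 0) s (γ' t)) (Set.Icc 0 1) t :=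
    fun t ht => ((proj (bx M 0) s).hasFDerivAt.comp_hasDerivAt t (hd t ht)).hasDerivWithinAt
  have h := (convex_Icc (0 : ℝ) 1).norm_image_sub_le_of_norm_hasDerivWithin_le hder hc
    (Set.left_mem_Icc.2 zero_le_one) (Set.right_mem_Icc.2 zero_le_one)
  rw [sub_zero, norm_one, mul_one, ← map_sub] at h
  exact h

theorem norm_segment_lt {v w : Hs K s₀} (hv : ‖v‖ < 1) (hw : ‖w‖ < 1) {t : ℝ}
    (ht : t ∈ Set.Icc (0 : ℝ) 1) : ‖w + t • (v - w)‖ < 1 := by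
  have he : w + t • (v - w) = (1 - t) • w + t • v := by module
  have := convex_ball (0 : Hs K s₀) 1 (by simpa using hw : w ∈ _) (by simpa using hv : v ∈ _)
    (by linarith [ht.2] : 0 ≤ 1 - t) ht.1 (by ring)
  rw [he]
  simpa using this

theorem ns_segment_le {N : ℕ} {s : ℝ} {v w : Hs K s₀} (hv : ns N s v ≤ 1) (hw : ns N s w ≤ 1)
    {t : ℝ} (ht : t ∈ Set.Icc (0 : ℝ) 1) : ns N s (w + t • (v - w)) ≤ 1 := by
  have he : w + t • (v - w) = (1 - t) • w + t • v := by module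
  rw [he]
  refine (ns_add_le _ _ _ _).trans ?_
  rw [ns_smul, ns_smul, abs_of_nonneg ht.1, abs_of_nonneg (by linarith [ht.2] : 0 ≤ 1 - t)]
  have h1 := mul_le_mul_of_nonneg_left hw (by linarith [ht.2] : 0 ≤ 1 - t)
  have h2 := mul_le_mul_of_nonneg_left hv ht.1
  linarith

theorem exists_deriv_le {s : ℝ} (hs : s₀ ≤ s) (hsS : (s : EReal) < P.S') :
    ∃ C, 0 ≤ C ∧ ∀ M N : ℕ, ∀ v ∈ WN K s₀ N, ‖v‖ < 1 → ∀ h ∈ WN K s₀ N,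
      ns M s (fderiv ℝ P.f v h) ≤ C * (ns N s v * ‖h‖ + ns N s h) := by
  obtain ⟨C, hC⟩ := P.tame.f1 s hs hsS
  refine ⟨max C 0, le_max_right _ _, fun M N v hv hv1 h hh => ?_⟩
  obtain ⟨k1, k2⟩ := hC v h hv1 (memHs_of_suppIn s hv) (memHs_of_suppIn s hh)
  rw [← ns_eq_snorm hv, ← ns_eq_snorm hh] at k2
  have := ns_nonneg N s v
  have := ns_nonneg N s h
  exact (ns_le_snorm k1).trans (k2.trans (by gcongr; exact le_max_left _ _))

/-- The first tame estimate is integrated along the segment from `0` to `v`, starting from `f 0`. -/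
theorem exists_value_le {s : ℝ} (hs : s₀ ≤ s) (hsS : (s : EReal) < P.S') :
    ∃ C, 0 ≤ C ∧ ∀ M N : ℕ, ∀ v ∈ WN K s₀ N, ‖v‖ < 1 → ns M s (P.f v) ≤ C * (1 + ns N s v) := by
  obtain ⟨C₁, hC₁, h₁⟩ := P.exists_deriv_le hs hsS
  have h₀ := P.tame.zero_mem s hs hsS
  have hs0 := snorm_nonneg s (P.f 0).val
  refine ⟨2 * C₁ + snorm s (P.f 0).val, by positivity, fun M N v hv hv1 => ?_⟩
  have hseg : ∀ t ∈ Set.Icc (0 : ℝ) 1, ‖t • v‖ < 1 := fun t ht => by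
    rw [norm_smul, Real.norm_of_nonneg ht.1]
    calc t * ‖v‖ ≤ 1 * ‖v‖ := by gcongr; exact ht.2
      _ < 1 := by rwa [one_mul]
  have n0 := ns_nonneg N s v
  have hmv := ns_sub_le_of_hasDerivAt (M := M) (s := s) (c := 2 * C₁ * ns N s v)
    (γ := fun t : ℝ => P.f (t • v)) (γ' := fun t => fderiv ℝ P.f (t • v) v)
    (fun t ht => (P.hasFDerivAt_f (hseg t ht)).comp_hasDerivAt t
      (by simpa using (hasDerivAt_id t).smul_const v))
    (fun t ht => by
      refine (h₁ M N (t • v) ((WN K s₀ N).smul_mem t hv) (hseg t ht) v hv).trans ?_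
      rw [ns_smul, abs_of_nonneg ht.1]
      calc _ ≤ C₁ * (1 * ns N s v * 1 + ns N s v) := by gcongr; exact ht.2
        _ = _ := by ring)
  simp only [one_smul, zero_smul] at hmv
  have h6 : ns M s (P.f 0) ≤ snorm s (P.f 0).val := ns_le_snorm h₀
  have h7 := ns_add_le M s (P.f v - P.f 0) (P.f 0)
  rw [sub_add_cancel] at h7
  nlinarith

/-- The second tame estimate is integrated along the segment from `w` to `v`. The whole segment is
bounded by `1` in the norm of order `s`, so the estimate becomes bilinear. -/
theorem exists_lip_le {s : ℝ} (hs : s₀ ≤ s) (hsS : (s : EReal) < P.S') :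
    ∃ C, 0 ≤ C ∧ ∀ M N : ℕ, ∀ v ∈ WN K s₀ N, ns N s v < 1 → ∀ w ∈ WN K s₀ N, ns N s w < 1 →
      ∀ h ∈ WN K s₀ N,
      ns M s (fderiv ℝ P.f v h - fderiv ℝ P.f w h) ≤ C * ns N s (v - w) * ns N s h := by
  obtain ⟨C, hC⟩ := P.tame.f2 s hs hsS
  refine ⟨3 * max C 0, by positivity, fun M N v hv hv1 w hw hw1 h hh => ?_⟩
  have hvn : ‖v‖ < 1 := (norm_le_ns hs hv).trans_lt hv1
  have hwn : ‖w‖ < 1 := (norm_le_ns hs hw).trans_lt hw1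
  have hsub : v - w ∈ WN K s₀ N := (WN K s₀ N).sub_mem hv hw
  have hmem : ∀ t : ℝ, w + t • (v - w) ∈ WN K s₀ N := fun t =>
    (WN K s₀ N).add_mem hw ((WN K s₀ N).smul_mem t hsub)
  have hmv := ns_sub_le_of_hasDerivAt (M := M) (s := s)
    (c := 3 * max C 0 * ns N s (v - w) * ns N s h)
    (γ := fun t : ℝ => fderiv ℝ P.f (w + t • (v - w)) h)
    (γ' := fun t => fderiv ℝ (fderiv ℝ P.f) (w + t • (v - w)) (v - w) h)
    (fun t ht => by
      have h4 : HasDerivAt (fun t : ℝ => w + t • (v - w)) (v - w) t := by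
        simpa using ((hasDerivAt_id t).smul_const (v - w)).const_add w
      have h5 := (P.hasFDerivAt_fderiv (norm_segment_lt hvn hwn ht)).comp_hasDerivAt t h4
      have h6 := h5.clm_apply (hasDerivAt_const t h)
      rw [map_zero, add_zero] at h6
      exact h6)
    (fun t ht => by
      obtain ⟨k1, k2⟩ := hC _ (v - w) h (norm_segment_lt hvn hwn ht) (memHs_of_suppIn s (hmem t))
        (memHs_of_suppIn s hsub) (memHs_of_suppIn s hh)
      rw [← ns_eq_snorm hsub, ← ns_eq_snorm hh, ← ns_eq_snorm (hmem t)] at k2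
      have n1 := norm_le_ns hs hsub
      have n2 := norm_le_ns hs hh
      have n3 := ns_segment_le hv1.le hw1.le ht
      have n4 := ns_nonneg N s (v - w)
      have n5 := ns_nonneg N s h
      have n6 := ns_nonneg N s (w + t • (v - w))
      refine ((ns_le_snorm (N := M) k1).trans k2).trans ?_
      generalize ns N s (v - w) = a at n1 n4 ⊢
      generalize ns N s h = b at n2 n5 ⊢
      generalize ns N s (w + t • (v - w)) = c at n3 n6 ⊢
      calc C * (c * ‖v - w‖ * ‖h‖ + a * ‖h‖ + ‖v - w‖ * b)
          ≤ max C 0 * (1 * a * b + a * b + a * b) := by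
            gcongr
            exact le_max_left _ _
        _ = _ := by ring)
  simp only [one_smul, zero_smul, add_zero, add_sub_cancel] at hmv
  exact hmv

theorem exists_tameConst {s : ℝ} (hs : s₀ ≤ s) (hsS : (s : EReal) < P.S') :
    ∃ C, P.TameConst s C := by
  obtain ⟨C₁, hC₁, h₁⟩ := P.exists_deriv_le hs hsS
  obtain ⟨C₂, hC₂, h₂⟩ := P.exists_value_le hs hsS
  obtain ⟨C₃, hC₃, h₃⟩ := P.exists_lip_le hs hsS
  refine ⟨1 + C₁ + C₂ + C₃, by linarith, fun M N v hv hv1 h hh => ?_, fun M N v hv hv1 => ?_,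
    fun M N v hv hv1 w hw hw1 h hh => ?_⟩
  · refine (h₁ M N v hv hv1 h hh).trans ?_
    have := ns_nonneg N s v
    have := ns_nonneg N s h
    gcongr; linarith
  · refine (h₂ M N v hv hv1).trans ?_
    have := ns_nonneg N s v
    gcongr; linarith
  · refine (h₃ M N v hv hv1 w hw hw1 h hh).trans ?_
    exact mul_le_mul_of_nonneg_right (mul_le_mul_of_nonneg_right (by linarith) (ns_nonneg _ _ _))
      (ns_nonneg _ _ _)

/-! ### The matrix of the differential -/

theorem blk_sub (M M' : BlockMatrix K) (k k' : Idx K) : blk (M - M') k k' = blk M k k' - blk M' k k' := by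
  ext x c
  simp only [blk_apply, sub_apply, PiLp.sub_apply, Pi.sub_apply, Matrix.sub_apply, sub_mul,
    Finset.sum_sub_distrib]

/-- Bounds for the matrix of the differential with decay exponent `σ`, with constant `C`. -/
structure DecayConst (σ : ℕ) (C : ℝ) : Prop where
  one_le : 1 ≤ C
  decay : ∀ u : Hs K s₀, ‖u‖ < 1 → MemHs (σ + ν₀) u.val →
    TB (blk (jacobian P.f u)) σ (C * (1 + snorm (σ + ν₀) u.val))
  lip : ∀ u v : Hs K s₀, ‖u‖ < 1 → ‖v‖ < 1 → MemHs (σ + ν₀) u.val → MemHs (σ + ν₀) v.val →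
    ∀ k k', ‖blk (jacobian P.f u) k k' - blk (jacobian P.f v) k k'‖ ≤
      C * (snorm (σ + ν₀) (u - v).val +
        (snorm (σ + ν₀) u.val + snorm (σ + ν₀) v.val) * ‖u - v‖)

theorem exists_decayConst {σ : ℕ} (hs : s₀ < σ) (hsS : ((σ + ν₀ : ℝ) : EReal) < P.S') :
    ∃ C, P.DecayConst σ C := by
  obtain ⟨C₁, h₁⟩ := P.tame.decay (σ + ν₀) (by linarith) hsS
  obtain ⟨C₂, h₂⟩ := P.tame.lipschitz (σ + ν₀) (by linarith) hsS
  have hK := P.K₁_pos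
  have hsK : 0 < Real.sqrt K₁ := Real.sqrt_pos.2 hK
  set C := max 1 (max (|C₁| / Real.sqrt K₁) (|C₂| / Real.sqrt K₁)) with hC
  have c1 : |C₁| / Real.sqrt K₁ ≤ C := (le_max_left _ _).trans (le_max_right _ _)
  have c2 : |C₂| / Real.sqrt K₁ ≤ C := (le_max_right _ _).trans (le_max_right _ _)
  refine ⟨C, le_max_left _ _, fun u hu hm k k' => ?_, fun u v hu hv hmu hmv k k' => ?_⟩
  · have h := h₁ u hu hm
    rw [add_sub_cancel_right] at h
    have hn := snorm_nonneg (σ + ν₀) u.val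
    have h' := h.trans (ENNReal.ofReal_le_ofReal
      (mul_le_mul_of_nonneg_right (le_abs_self C₁) (by linarith)))
    refine (norm_blk_mul_jb_le hK (by positivity) h' k k').trans ?_
    rw [mul_div_right_comm]
    gcongr
  · have h := h₂ u v hu hv hmu hmv
    rw [add_sub_cancel_right] at h
    have hn := snorm_nonneg (σ + ν₀) u.val
    have hn' := snorm_nonneg (σ + ν₀) v.val
    have hn2 := snorm_nonneg (σ + ν₀) (u - v).val
    have h' := h.trans (ENNReal.ofReal_le_ofReal
      (mul_le_mul_of_nonneg_right (le_abs_self C₂) (by positivity)))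
    have h3 := norm_blk_mul_jb_le hK (by positivity) h' k k'
    rw [blk_sub] at h3
    have h4 : ‖blk (jacobian P.f u) k k' - blk (jacobian P.f v) k k'‖ ≤
        ‖blk (jacobian P.f u) k k' - blk (jacobian P.f v) k k'‖ * jb k k' ^ σ :=
      le_mul_of_one_le_right (norm_nonneg _) (one_le_pow₀ (one_le_jb k k'))
    refine h4.trans (h3.trans ?_)
    rw [mul_div_right_comm]
    gcongr

theorem eq_sum_single {E : Finset (Idx K)} {h : Hs K s₀} (hh : SuppIn E h.val) :
    h = ∑ k ∈ E, ∑ c, (h.val k c) • Hs.single s₀ k (EuclideanSpace.single c 1) := by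
  classical
  apply Hs.val_injective
  funext k
  rw [Hs.val_sum]
  have hs : ∀ k' c, ((h.val k' c) • Hs.single s₀ k' (EuclideanSpace.single c 1)).val =
      (Pi.single k' ((h.val k' c) • EuclideanSpace.single c (1 : ℂ)) : Seq K) := by
    intro k' c
    rw [Hs.val_smul]
    change h.val k' c • (Pi.single k' (EuclideanSpace.single c 1) : Seq K) = _
    funext j
    by_cases hj : j = k'
    · subst hj; simp
    · simp [Pi.single_eq_of_ne hj]
  simp only [Hs.val_sum, hs]
  by_cases hk : k ∈ E
  · rw [Finset.sum_eq_single k]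
    · simp only [Pi.single_eq_same]
      ext c
      simp [Finset.sum_apply, Pi.single_apply]
    · intro k' _ hne
      exact Finset.sum_eq_zero fun c _ => Pi.single_eq_of_ne hne.symm _
    · exact fun h => absurd hk h
  · rw [hh k hk]
    refine (Finset.sum_eq_zero fun k' hk' => Finset.sum_eq_zero fun c _ => ?_).symm
    exact Pi.single_eq_of_ne (fun he : k = k' => hk (he ▸ hk')) _

/-- On finitely supported families the complex linear differential is determined by its values on
unit vectors, which are the columns of `jacobian`. -/
theorem fderiv_apply_eq {v : Hs K s₀} (hv : ‖v‖ < 1) {N : ℕ} {h : Hs K s₀} (hh : h ∈ WN K s₀ N)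
    (k : Idx K) : (fderiv ℝ P.f v h).val k =
      ∑ k' ∈ bx N 0, blk (jacobian P.f v) k k' (h.val k') := by
  have h1 : fderiv ℝ P.f v h = ∑ k' ∈ bx N 0, ∑ c,
      (h.val k' c) • fderiv ℝ P.f v (Hs.single s₀ k' (EuclideanSpace.single c 1)) := by
    conv_lhs => rw [eq_sum_single hh]
    simp only [map_sum, P.complexLinear v hv]
  rw [h1, Hs.val_sum]
  refine Finset.sum_congr rfl fun k' _ => ?_
  rw [Hs.val_sum]
  ext x
  rw [blk_apply]
  simp only [Hs.val_smul, WithLp.ofLp_sum, Finset.sum_apply, jacobian, Matrix.of_apply]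
  refine Finset.sum_congr rfl fun c _ => ?_
  rw [mul_comm]; rfl

theorem toepKer {v : Hs K s₀} (hv : ‖v‖ < 1) (ε : ℝ) :
    ToepKer fun k k' => (ε : ℂ) • blk (jacobian P.f v) k k' := by
  intro l k k'
  have h := P.toeplitz v hv l k.1 k'.1 k.2.1 k'.2.1 k.2.2 k'.2.2
  have h2 : blk (jacobian P.f v) (shiftIdx l k) (shiftIdx l k') = blk (jacobian P.f v) k k' :=
    congrArg (fun M => LinearMap.toContinuousLinearMap (Matrix.toEuclideanLin M)) h
  exact congrArg (fun S => (ε : ℂ) • S) h2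

/-! ### Bounds for the diagonal part -/

/-- The bound of order `0` is tested on a unit vector at `k`, which exists only if the multiplicity
is positive. -/
theorem exists_diag_le {ν : ℝ} {I : Set ℝ} {m : ℝ → Idx K → ℂ} (h : DiagBound ν I m) :
    ∃ C : ℝ, 1 ≤ C ∧ ∀ lam ∈ I, ∀ k, 0 < dim k → ‖m lam k‖ ≤ C * bracket k ^ ν := by
  classical
  obtain ⟨C, hC⟩ := h 0 le_rfl
  refine ⟨max 1 C, le_max_left _ _, fun lam hl k hd => ?_⟩
  have hb := bracket_pos k
  let x : EuclideanSpace ℂ (Fin (dim k)) := EuclideanSpace.single ⟨0, hd⟩ 1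
  let u : Seq K := Pi.single k x
  have hu : SuppIn {k} u := fun k' hk' => Pi.single_eq_of_ne (by simpa using hk') _
  have hx : ‖x‖ = 1 := by simp [x]
  have huk : u k = x := Pi.single_eq_same (M := fun k : Idx K => EuclideanSpace ℂ (Fin (dim k))) k x
  obtain ⟨h1, h2⟩ := hC lam hl u (memHs_of_suppIn _ hu)
  have h3 := bracket_mul_le_snorm h1 k
  have h4 := snorm_le_sum (0 + ν) hu
  rw [Finset.sum_singleton, huk, hx, mul_one, zero_add] at h4
  have h5 : diagAct (m lam) u k = m lam k • x := by rw [diagAct, huk]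
  rw [h5, norm_smul, hx, mul_one, Real.rpow_zero, one_mul] at h3
  rw [zero_add] at h2
  calc ‖m lam k‖ ≤ C * snorm ν u := h3.trans h2
    _ ≤ max 1 C * snorm ν u := by
        have := snorm_nonneg ν u
        gcongr; exact le_max_right _ _
    _ ≤ _ := by gcongr

end Problem

/-! ### The truncated equation as a Newton scheme -/

namespace Problem

variable {s₀ ν ν₀ K₁ : ℝ} (P : Problem K s₀ ν ν₀ K₁)

/-- The conditions on `N` and `ε` under which the truncated equation fits the Newton scheme. -/
structure ScaleOK (sl C : ℝ) (a N : ℕ) (ε : ℝ) : Prop where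
  le_sl : s₀ ≤ sl
  tame : P.TameConst sl C
  one_le_a : 1 ≤ a
  one_le : 1 ≤ N
  ε_nonneg : 0 ≤ ε
  ε_le : ε ≤ 1
  two_mul_le : 2 * C ≤ N
  D_le : ∀ lam ∈ P.I, ∀ k ∈ bx N 0, 0 < dim k → ‖P.D k lam‖ ≤ (N : ℝ) ^ a
  D'_le : ∀ lam ∈ P.I, ∀ k ∈ bx N 0, 0 < dim k → ‖derivWithin (P.D k) P.I lam‖ ≤ (N : ℝ) ^ a

theorem ns_smul_proj_le {N M : ℕ} {s ε : ℝ} (hε : 0 ≤ ε) (x : Hs K s₀) :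
    ns M s (ε • proj (bx N 0) s₀ x) ≤ ε * ns M s x := by
  rw [ns_smul, abs_of_nonneg hε]
  exact mul_le_mul_of_nonneg_left (ns_proj_le x) hε

theorem uniqueDiffOn : UniqueDiffOn ℝ P.I :=
  uniqueDiffOn_convex P.ordConnected.convex P.interior_nonempty

variable {P}

/-- The truncated equation as an instance of the Newton scheme. -/
def env {sl C : ℝ} {a N : ℕ} {ε : ℝ} (h : P.ScaleOK sl C a N ε) :
    NewtonEnv (Hs K s₀) (Hs K sl) where
  W := WN K s₀ N
  l := proj (bx N 0) sl
  I := P.I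
  D lam := dop N fun k => P.D k lam
  D' lam := dop N fun k => derivWithin (P.D k) P.I lam
  G v := ε • proj (bx N 0) s₀ (P.f v)
  G' v := ε • (proj (bx N 0) s₀).comp (fderiv ℝ P.f v)
  N := N
  a := a
  one_le := by exact_mod_cast h.one_le
  ordConnected := P.ordConnected
  norm_le x hx := norm_le_ns h.le_sl hx
  D_mem lam x := dop_mem _ _ _
  D'_mem lam x := dop_mem _ _ _
  G_mem v := (WN K s₀ N).smul_mem _ (proj_mem_WN _ _)
  G'_mem v x := (WN K s₀ N).smul_mem _ (proj_mem_WN _ _)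
  hasDeriv_D lam hl := hasDerivWithinAt_dop fun k =>
    ((P.contDiff_D k).differentiableOn one_ne_zero lam hl).hasDerivWithinAt
  continuousOn_D' := continuousOn_dop fun k =>
    (P.contDiff_D k).continuousOn_derivWithin P.uniqueDiffOn le_rfl
  hasFDeriv_G v hv := (((proj (bx N 0) s₀).hasFDerivAt).comp v (P.hasFDerivAt_f hv)).const_smul ε
  continuousOn_G' :=
    (continuousOn_const.clm_comp P.contDiffOn_fderiv.continuousOn).const_smul ε
  D_le lam hl x _ := ns_dop_le (by positivity) (h.D_le lam hl) _ _
  D'_le lam hl x _ := ns_dop_le (by positivity) (h.D'_le lam hl) _ _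
  G'_le v hv hv1 x hx := by
    have hN1 : (1 : ℝ) ≤ N := by exact_mod_cast h.one_le
    have h1 : ns N sl v < 1 := hv1
    have h2 := h.tame.deriv_le N N v hv ((norm_le_ns h.le_sl hv).trans_lt h1) x hx
    have h3 := norm_le_ns h.le_sl hx
    have h4 := h.tame.one_le
    have h5 := h.two_mul_le
    have h6 := ns_smul_proj_le (N := N) (M := N) (s := sl) h.ε_nonneg (fderiv ℝ P.f v x)
    have h7 : (N : ℝ) ≤ (N : ℝ) ^ a := le_self_pow₀ hN1 (by have := h.one_le_a; omega)
    have h8 := ns_nonneg N sl x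
    have h9 := ns_nonneg N sl v
    refine h6.trans ?_
    have h10 := ns_nonneg N sl (fderiv ℝ P.f v x)
    change _ ≤ (N : ℝ) ^ a * ns N sl x
    have h11 := h.ε_le
    calc ε * ns N sl (fderiv ℝ P.f v x) ≤ 1 * (C * (ns N sl v * ‖x‖ + ns N sl x)) :=
          mul_le_mul h11 h2 h10 zero_le_one
      _ ≤ 1 * (C * (1 * ns N sl x + ns N sl x)) := by
          generalize ns N sl x = y at *
          generalize ns N sl v = z at *
          gcongr
      _ = 2 * C * ns N sl x := by ring
      _ ≤ (N : ℝ) ^ a * ns N sl x := mul_le_mul_of_nonneg_right (h5.trans h7) h8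
  G'_lip v hv hv1 w hw hw1 x hx := by
    have h2 := h.tame.lip N N v hv hv1 w hw hw1 x hx
    have h4 := h.tame.one_le
    have h5 := h.two_mul_le
    have h6 := ns_smul_proj_le (N := N) (M := N) (s := sl) h.ε_nonneg
      (fderiv ℝ P.f v x - fderiv ℝ P.f w x)
    have h8 := ns_nonneg N sl x
    have h9 := ns_nonneg N sl (v - w)
    have h10 := ns_nonneg N sl (fderiv ℝ P.f v x - fderiv ℝ P.f w x)
    rw [map_sub, smul_sub] at h6
    refine h6.trans ?_
    change _ ≤ N * ns N sl (v - w) * ns N sl x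
    calc _ ≤ 1 * (C * ns N sl (v - w) * ns N sl x) := mul_le_mul h.ε_le h2 h10 zero_le_one
      _ = C * (ns N sl (v - w) * ns N sl x) := by ring
      _ ≤ N * (ns N sl (v - w) * ns N sl x) :=
          mul_le_mul_of_nonneg_right (by linarith) (mul_nonneg h9 h8)
      _ = _ := by ring

/-- The truncated norm of `H^s` as a seminorm. -/
def nsn (N : ℕ) (s : ℝ) : Seminorm ℝ (Hs K s₀) :=
  (normSeminorm ℝ (Hs K s)).comp ((proj (bx N 0) s : Hs K s₀ →L[ℝ] Hs K s) : Hs K s₀ →ₗ[ℝ] Hs K s)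

theorem nsn_apply (N : ℕ) (s : ℝ) (x : Hs K s₀) : nsn N s x = ns N s x := rfl

theorem highNorm {sl C : ℝ} {a N : ℕ} {ε : ℝ} (h : P.ScaleOK sl C a N ε) {s C' : ℝ}
    (hC' : P.TameConst s C') (hN : C' ≤ N) : (env h).HighNorm (nsn N s) := by
  have hN1 : (1 : ℝ) ≤ N := by exact_mod_cast h.one_le
  have h7 : (N : ℝ) ≤ (N : ℝ) ^ a := le_self_pow₀ hN1 (by have := h.one_le_a; omega)
  have h4 := hC'.one_le
  refine ⟨fun lam hl x _ => ns_dop_le (by positivity) (h.D_le lam hl) _ _,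
    fun lam hl x _ => ns_dop_le (by positivity) (h.D'_le lam hl) _ _, fun v hv hv1 => ?_,
    fun v hv hv1 x hx => ?_⟩
  · have h1 : ns N sl v < 1 := hv1
    have h2 := hC'.le N N v hv ((norm_le_ns h.le_sl hv).trans_lt h1)
    have h6 := ns_smul_proj_le (N := N) (M := N) (s := s) h.ε_nonneg (P.f v)
    refine h6.trans ?_
    have h9 := ns_nonneg N s v
    change _ ≤ (N : ℝ) ^ a * (1 + ns N s v)
    calc ε * ns N s (P.f v) ≤ 1 * (C' * (1 + ns N s v)) :=
          mul_le_mul h.ε_le h2 (ns_nonneg _ _ _) zero_le_one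
      _ ≤ _ := by
          rw [one_mul]
          exact mul_le_mul_of_nonneg_right (hN.trans h7) (by linarith)
  · have h1 : ns N sl v < 1 := hv1
    have h2 := hC'.deriv_le N N v hv ((norm_le_ns h.le_sl hv).trans_lt h1) x hx
    have h6 := ns_smul_proj_le (N := N) (M := N) (s := s) h.ε_nonneg (fderiv ℝ P.f v x)
    refine h6.trans ?_
    have h3 : ‖x‖ ≤ ns N sl x := norm_le_ns h.le_sl hx
    have h8 := ns_nonneg N s x
    have h9 := ns_nonneg N s v
    have h10 := ns_nonneg N sl x
    change _ ≤ (N : ℝ) ^ a * (ns N s v * ns N sl x + ns N s x)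
    calc ε * ns N s (fderiv ℝ P.f v x) ≤ 1 * (C' * (ns N s v * ‖x‖ + ns N s x)) :=
          mul_le_mul h.ε_le h2 (ns_nonneg _ _ _) zero_le_one
      _ ≤ (N : ℝ) ^ a * (ns N s v * ns N sl x + ns N s x) := by
          rw [one_mul]
          generalize ns N s v = y at *
          generalize ns N sl x = z at *
          refine mul_le_mul (hN.trans h7) ?_ (by positivity) (by positivity)
          exact add_le_add_left (mul_le_mul_of_nonneg_left h3 h9) _

/-- The exponent that controls the diagonal part. -/
def diagExp (ν : ℝ) : ℕ := ⌈ν⌉₊ + 1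

-- The diagonal entries grow at most like `N ^ ν` on the box; the extra power in `diagExp` absorbs
-- the constants, once `N` is large.
variable (P) in
theorem exists_scaleOK : ∃ N₁ : ℕ, ∀ (sl C : ℝ) (N : ℕ) (ε : ℝ), s₀ ≤ sl → P.TameConst sl C →
    N₁ ≤ N → 2 * C ≤ N → 0 ≤ ε → ε ≤ 1 → P.ScaleOK sl C (diagExp ν) N ε := by
  obtain ⟨C₁, hC₁, h₁⟩ := exists_diag_le P.bound_D
  obtain ⟨C₂, hC₂, h₂⟩ := exists_diag_le P.bound_D'
  obtain ⟨B, hB⟩ := exists_isBracketConst K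
  have hB1 := hB.one_le
  obtain ⟨N₁, hN₁⟩ := exists_nat_ge (max C₁ C₂ * B ^ ν)
  refine ⟨N₁ + 1, fun sl C N ε hs hC hN hCN h0 h1 => ?_⟩
  have hN1 : 1 ≤ N := by omega
  have hNr : (1 : ℝ) ≤ N := by exact_mod_cast hN1
  have hν := P.ν_nonneg
  have key : ∀ C' ≤ max C₁ C₂, 1 ≤ C' → ∀ k ∈ bx (K := K) N 0,
      C' * bracket k ^ ν ≤ (N : ℝ) ^ diagExp ν := by
    intro C' hC' hC'1 k hk
    have hb := bracket_pos k
    calc C' * bracket k ^ ν ≤ max C₁ C₂ * (B * N) ^ ν := by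
          gcongr
          exact hB.upper N hN1 k hk
      _ = (max C₁ C₂ * B ^ ν) * (N : ℝ) ^ ν := by
          rw [Real.mul_rpow (by positivity) (by positivity)]; ring
      _ ≤ N * (N : ℝ) ^ ⌈ν⌉₊ := by
          gcongr
          · exact hN₁.trans (by exact_mod_cast (by omega : N₁ ≤ N))
          · exact rpow_le_pow_ceil hNr ν
      _ = _ := by rw [diagExp, pow_succ, mul_comm]
  exact
    { le_sl := hs, tame := hC, one_le_a := by unfold diagExp; omega, one_le := hN1, ε_nonneg := h0,
      ε_le := h1, two_mul_le := hCN
      D_le := fun lam hl k hk hd => (h₁ lam hl k hd).trans (key _ (le_max_left _ _) hC₁ k hk)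
      D'_le := fun lam hl k hk hd => (h₂ lam hl k hd).trans (key _ (le_max_right _ _) hC₂ k hk) }

end Problem

/-! ### Tame bounds for the inverse of the truncated linearised operator -/

theorem exists_bracket_pow_le :
    ∃ A : ℝ, 1 ≤ A ∧ ∀ (s : ℕ) (k k' : Idx K),
      bracket k ^ s ≤ A ^ s * (bracket k' ^ s + jb k k' ^ s) := by
  obtain ⟨C, hC1, hC⟩ := exists_bracket_bounds (K := K)
  refine ⟨2 * C ^ 2, by nlinarith, fun s k k' => ?_⟩
  have hb := bracket_pos k
  have hb' := bracket_pos k'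
  have hj := jb_pos k k'
  have h1 := (hC k).1
  have h2 := (hC k').2
  have h3 : max 1 ‖site k‖ ≤ max 1 ‖site k'‖ + jb k k' := by
    refine max_le ((le_max_left _ _).trans (le_add_of_nonneg_right hj.le)) ?_
    have := norm_le_jb k k'
    have h4 := norm_add_le (site k - site k') (site k')
    rw [sub_add_cancel] at h4
    linarith [le_max_right 1 ‖site k'‖]
  have hM : 0 < max (bracket k') (jb k k') := lt_max_of_lt_left hb'
  have h5 : bracket k ≤ 2 * C ^ 2 * max (bracket k') (jb k k') := by
    have e1 := le_max_left (bracket k') (jb k k')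
    have e2 := le_max_right (bracket k') (jb k k')
    calc bracket k ≤ C * (max 1 ‖site k'‖ + jb k k') := h1.trans (by gcongr)
      _ ≤ C * (C * max (bracket k') (jb k k') + C * max (bracket k') (jb k k')) := by
          gcongr
          · exact h2.trans (by gcongr)
          · exact e2.trans (le_mul_of_one_le_left hM.le hC1)
      _ = _ := by ring
  calc bracket k ^ s ≤ (2 * C ^ 2 * max (bracket k') (jb k k')) ^ s := by gcongr
    _ = (2 * C ^ 2) ^ s * max (bracket k') (jb k k') ^ s := mul_pow _ _ _
    _ ≤ _ := by
        gcongr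
        rcases max_choice (bracket k') (jb k k') with h | h <;> rw [h]
        · exact le_add_of_nonneg_right (by positivity)
        · exact le_add_of_nonneg_left (by positivity)

/-- The weight at `k` is split between the weight at the source index `k₁` and the distance from `k`
to `k₁`. The first part falls on the source and uses the ℓ² bound `b` of the column; the second is
absorbed by the decay of the column. -/
theorem snorm_le_of_colDec {A : ℝ} (hA1 : 1 ≤ A) {s : ℕ}
    (hA : ∀ k k' : Idx K, bracket k ^ s ≤ A ^ s * (bracket k' ^ s + jb k k' ^ s))
    {m : Idx K → ℂ} {T : Ker K} {E : Finset (Idx K)} {b z : ℝ} (hb : 0 ≤ b) (hz : 0 ≤ z)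
    (hC : Coer m T E b) (hZ : ColDec m T E s z) {u x : Seq K} (hu : SuppIn E u) (hx : SuppIn E x)
    (hux : ∀ k ∈ E, app m T E u k = x k) :
    snorm s u ≤ E.card ^ 2 * A ^ s * (b * snorm s x + z * snorm 0 x) := by
  have hcol := fun (k : Idx K) (hk : k ∈ E) => norm_le_sum_of_columns (Z := fun k k₀ => min b (z * (jb k k₀ ^ s)⁻¹)) hC
    (fun k₀ hk₀ u hu h0 k hk => by
      have hj := jb_pos k k₀
      rw [min_mul_of_nonneg _ _ (norm_nonneg _)]
      refine le_min ?_ ?_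
      · refine (norm_le_l2 hk u).trans ((hC u hu).trans (mul_le_mul_of_nonneg_left ?_ hb))
        rw [l2, Finset.sum_eq_single k₀ (fun k hk hne => by rw [h0 k hk hne]; simp)
          (fun h => absurd hk₀ h), Real.sqrt_sq (norm_nonneg _)]
      · have := hZ k₀ hk₀ u hu h0 k hk
        rw [mul_right_comm, ← div_eq_mul_inv, le_div_iff₀ (by positivity)]
        exact this)
    hu hk
  have hS0 := snorm_nonneg s x
  have hS0' := snorm_nonneg 0 x
  have h1 : ∀ k ∈ E, bracket k ^ (s : ℝ) * ‖u k‖ ≤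
      E.card * (A ^ s * (b * snorm s x + z * snorm 0 x)) := by
    intro k hk
    have hbk := bracket_pos k
    rw [Real.rpow_natCast]
    calc bracket k ^ s * ‖u k‖
        ≤ bracket k ^ s * ∑ k₁ ∈ E, min b (z * (jb k k₁ ^ s)⁻¹) * ‖app m T E u k₁‖ := by
          gcongr; exact hcol k hk
      _ ≤ _ := by
          rw [Finset.mul_sum]
          refine sum_le_card_mul fun k₁ hk₁ => ?_
          rw [hux k₁ hk₁]
          have hj := jb_pos k k₁
          have hbk1 := bracket_pos k₁
          have e1 := bracket_mul_le_snorm (memHs_of_suppIn s hx) k₁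
          have e2 := bracket_mul_le_snorm (memHs_of_suppIn 0 hx) k₁
          rw [Real.rpow_natCast] at e1
          rw [Real.rpow_zero, one_mul] at e2
          have hmin : 0 ≤ min b (z * (jb k k₁ ^ s)⁻¹) := le_min hb (by positivity)
          calc bracket k ^ s * (min b (z * (jb k k₁ ^ s)⁻¹) * ‖x k₁‖)
              ≤ (A ^ s * (bracket k₁ ^ s + jb k k₁ ^ s)) *
                  (min b (z * (jb k k₁ ^ s)⁻¹) * ‖x k₁‖) := by gcongr; exact hA k k₁
            _ = A ^ s * (bracket k₁ ^ s * min b (z * (jb k k₁ ^ s)⁻¹) * ‖x k₁‖ +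
                  jb k k₁ ^ s * min b (z * (jb k k₁ ^ s)⁻¹) * ‖x k₁‖) := by ring
            _ ≤ A ^ s * (bracket k₁ ^ s * b * ‖x k₁‖ +
                  jb k k₁ ^ s * (z * (jb k k₁ ^ s)⁻¹) * ‖x k₁‖) := by
                gcongr
                · exact min_le_left _ _
                · exact min_le_right _ _
            _ = A ^ s * (b * (bracket k₁ ^ s * ‖x k₁‖) + z * ‖x k₁‖) := by
                field_simp
            _ ≤ _ := by gcongr
  calc snorm s u ≤ ∑ k ∈ E, bracket k ^ (s : ℝ) * ‖u k‖ := snorm_le_sum s hu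
    _ ≤ E.card * (E.card * (A ^ s * (b * snorm s x + z * snorm 0 x))) := sum_le_card_mul h1
    _ = _ := by ring

namespace Problem

variable {s₀ ν ν₀ K₁ : ℝ} (P : Problem K s₀ ν ν₀ K₁)

/-- The kernel of the perturbation `ε df(v)`. -/
def tker (ε : ℝ) (v : Hs K s₀) : Ker K := fun k k' => (ε : ℂ) • blk (jacobian P.f v) k k'

variable {P} in
theorem DecayConst.tker_bound {σ : ℕ} {C : ℝ} (h : P.DecayConst σ C) {ε : ℝ} (hε : 0 ≤ ε)
    {v : Hs K s₀} (hv : ‖v‖ < 1) (hm : MemHs (σ + ν₀) v.val) :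
    TB (P.tker ε v) σ (ε * (C * (1 + snorm (σ + ν₀) v.val))) := by
  intro k k'
  have := h.decay v hv hm k k'
  rw [tker, norm_smul, Complex.norm_real, Real.norm_of_nonneg hε, mul_assoc]
  gcongr

/-- `Q` inverts the truncated linearised operator at `v`. -/
structure IsInv (N : ℕ) (ε lam : ℝ) (v : Hs K s₀) (Q : Hs K s₀ →L[ℝ] Hs K s₀) : Prop where
  mem : ∀ x, Q x ∈ WN K s₀ N
  app_eq : ∀ x, ∀ k ∈ bx N 0, app (Dtheta P.om P.DD lam 0) (P.tker ε v) (bx N 0) (Q x).val k =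
    x.val k

variable {P}

theorem IsInv.eq {N : ℕ} {ε lam : ℝ} (hl : lam ∈ P.I) {v : Hs K s₀} (hv : ‖v‖ < 1)
    {Q : Hs K s₀ →L[ℝ] Hs K s₀} (h : P.IsInv N ε lam v Q) {x : Hs K s₀} (hx : x ∈ WN K s₀ N) :
    dop N (fun k => P.D k lam) (Q x) + ε • proj (bx N 0) s₀ (fderiv ℝ P.f v (Q x)) = x := by
  apply Hs.val_injective
  funext k
  by_cases hk : k ∈ bx N 0
  · rw [← h.app_eq x k hk, Hs.val_add, Pi.add_apply, dop_val _ _ _ _ hk, Hs.val_real_smul,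
      Pi.smul_apply, proj_val, restr_apply hk, fderiv_apply_eq P hv (h.mem x), app_apply,
      P.covariance lam hl, Finset.smul_sum]
    rfl
  · rw [hx k hk]
    exact ((WN K s₀ N).add_mem (dop_mem _ _ _) ((WN K s₀ N).smul_mem _ (proj_mem_WN _ _))) k hk

/-- Uniqueness of solutions makes the chosen solution operator linear; it is bounded because only
finitely many components enter. -/
theorem exists_isInv {N : ℕ} {ε lam : ℝ} {v : Hs K s₀} {b : ℝ}
    (hC : Coer (Dtheta P.om P.DD lam 0) (P.tker ε v) (bx N 0) b) :
    ∃ Q : Hs K s₀ →L[ℝ] Hs K s₀, P.IsInv N ε lam v Q := by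
  have hs₀ := P.s₀_nonneg
  choose q hq1 hq2 using fun h : Seq K => exists_app_eq hC h
  have hadd : ∀ x y, q (x + y) = q x + q y := fun x y => by
    refine sub_eq_zero.1 (hC.eq_zero ((hq1 _).sub fun k hk => by
      rw [Pi.add_apply, hq1 x k hk, hq1 y k hk, add_zero]) fun k hk => ?_)
    rw [map_sub, map_add, Pi.sub_apply, Pi.add_apply, hq2 _ k hk, hq2 _ k hk, hq2 _ k hk,
      Pi.add_apply, sub_self]
  have hsmul : ∀ (c : ℝ) x, q (c • x) = c • q x := fun c x => by
    have hc : ∀ y : Seq K, c • y = (c : ℂ) • y := fun y => (Complex.coe_smul c y).symm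
    rw [hc, hc]
    refine sub_eq_zero.1 (hC.eq_zero ((hq1 _).sub ?_) fun k hk => ?_)
    · intro k hk; rw [Pi.smul_apply, hq1 x k hk, smul_zero]
    · rw [map_sub, map_smul, Pi.sub_apply, Pi.smul_apply, hq2 _ k hk, hq2 _ k hk, Pi.smul_apply,
        sub_self]
  have hrel : ∀ x : Seq K, ∀ k ∈ bx (K := K) N 0, ‖q x k‖ ≤ |b| * l2 (bx N 0) x := fun x k hk => by
    refine (norm_le_l2 hk _).trans ((hC _ (hq1 x)).trans ?_)
    rw [l2_congr (hq2 x)]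
    exact mul_le_mul_of_nonneg_right (le_abs_self b) (l2_nonneg _ _)
  let Q₀ : Hs K s₀ →ₗ[ℝ] Hs K s₀ :=
    { toFun := fun x => Hs.mk (q x.val) (memHs_of_suppIn s₀ (hq1 _))
      map_add' := fun x y => Hs.val_injective (hadd x.val y.val)
      map_smul' := fun c x => Hs.val_injective (by
        change q (c • x).val = _
        rw [Hs.val_real_smul, hsmul]
        exact (Hs.val_real_smul c (Hs.mk (q x.val) (memHs_of_suppIn s₀ (hq1 _)))).symm) }
  refine ⟨Q₀.mkContinuous (∑ k ∈ bx (K := K) N 0, bracket k ^ s₀ * (|b| * (bx (K := K) N 0).card))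
    fun x => ?_, fun x => hq1 _, fun x k hk => hq2 _ k hk⟩
  rw [Hs.norm_eq]
  refine (snorm_le_sum s₀ (hq1 x.val)).trans ?_
  rw [Finset.sum_mul]
  refine Finset.sum_le_sum fun k hk => ?_
  have hbk := bracket_pos k
  rw [mul_assoc, mul_assoc]
  have h1 : l2 (bx N 0) x.val ≤ (bx (K := K) N 0).card * ‖x‖ :=
    (l2_le_sum _ _).trans (sum_le_card_mul fun k hk =>
      (norm_val_le_ns hs₀ x hk).trans (ns_le_norm N x))
  gcongr
  exact (hrel _ k hk).trans (by gcongr)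

variable (P) in
/-- The truncated linearised operator at `v` has an inverse that is bounded by a power of `N` and
has tame off-diagonal decay. -/
structure Good {ee e : ℝ} (X : Expo K ee e) (N : ℕ) (ε lam : ℝ) (v : Hs K s₀) : Prop where
  coer : Coer (Dtheta P.om P.DD lam 0) (P.tker ε v) (bx N 0) ((N : ℝ) ^ X.τ)
  colDec : ∀ (s q : ℕ) (t : ℝ), X.C * s ≤ X.χ * q → 0 ≤ t → TB (P.tker ε v) (s + X.p) t →
    ColDec (Dtheta P.om P.DD lam 0) (P.tker ε v) (bx N 0) s
      (decConst s X.p * (1 + t) * (N : ℝ) ^ (X.e₀ + q))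

/-- The basic exponent of the bounds for the inverse. -/
def invExp {ee e : ℝ} (X : Expo K ee e) (ν₀ : ℝ) : ℕ :=
  2 * (rd K + 1) + X.τ + X.e₀ + X.p + ⌈ν₀⌉₊ + 1

variable (P) in
/-- The bounds at regularity `16 σ` hold at all scales `N ≥ M`. -/
structure Level {ee e : ℝ} (X : Expo K ee e) (σ M : ℕ) : Prop where
  tame : P.TameConst (16 * σ : ℕ) M
  inv : ∀ N : ℕ, M ≤ N → ∀ (ε lam : ℝ) (v : Hs K s₀), 0 ≤ ε → ε ≤ 1 → v ∈ WN K s₀ N → ‖v‖ < 1 →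
    P.Good X N ε lam v → ∀ Q, P.IsInv N ε lam v Q → ∀ x ∈ WN K s₀ N,
      ns N (16 * σ : ℕ) (Q x) ≤ (N : ℝ) ^ (invExp X ν₀ + σ) *
        ((1 + ns N (16 * σ : ℕ) v) * ns N 0 x + ns N (16 * σ : ℕ) x)

/-- At order `s = 16 σ` the condition `C s ≤ χ q` holds with `q = σ`, since `16 C ≤ χ`; so the
inverse loses only `N ^ σ` beyond a fixed power. The decay of `T` of order `s + p` involves the norm
of `v` of order `s + p + ν₀`; `ns_growth` brings it back to order `s` at the cost of a fixed power
of `N`. -/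
theorem exists_level {ee e : ℝ} (X : Expo K ee e) {σ : ℕ} (hσ : s₀ ≤ (16 * σ : ℕ))
    (hp : s₀ < (16 * σ + X.p : ℕ)) (hS : (((16 * σ + X.p : ℕ) + ν₀ : ℝ) : EReal) < P.S') :
    ∃ M, P.Level X σ M := by
  have hν₀ := P.ν₀_pos
  obtain ⟨C₁, hC₁⟩ := P.exists_tameConst hσ (lt_of_le_of_lt (by
    rw [EReal.coe_le_coe_iff]; push_cast; have := Nat.cast_nonneg (α := ℝ) X.p; linarith) hS)
  obtain ⟨C₂, hC₂⟩ := P.exists_decayConst hp hS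
  have hC2 := hC₂.one_le
  obtain ⟨A, hA1, hA⟩ := exists_bracket_pow_le (K := K)
  obtain ⟨B, hB⟩ := exists_isBracketConst K
  have hB1 := hB.one_le
  set s := 16 * σ with hs
  set G : ℝ := A ^ s * (decConst s X.p * (2 * C₂ * B ^ ((X.p : ℝ) + ν₀))) with hG
  obtain ⟨M, hM⟩ := exists_nat_ge (max (max C₁ G) (Fintype.card K.A * 3 ^ rd K + 1 : ℕ))
  have hM1 : C₁ ≤ M := (le_max_left _ _).trans ((le_max_left _ _).trans hM)
  have hM2 : G ≤ M := (le_max_right _ _).trans ((le_max_left _ _).trans hM)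
  have hM3 : Fintype.card K.A * 3 ^ rd K + 1 ≤ M := by exact_mod_cast (le_max_right _ _).trans hM
  refine ⟨M, hC₁.mono hM1, fun N hN ε lam v hε hε1 hvm hv hgood Q hQ x hx => ?_⟩
  have hN0 : 1 ≤ N := by omega
  have hN1 : (1 : ℝ) ≤ N := by exact_mod_cast hN0
  have hNM : (M : ℝ) ≤ N := by exact_mod_cast hN
  have hcard := card_bx_le_pow (hM3.trans hN) (0 : Site K)
  have hd := four_le_decConst s X.p
  set t := ε * (C₂ * (1 + snorm ((s + X.p : ℕ) + ν₀) v.val)) with ht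
  have hsn := snorm_nonneg ((s + X.p : ℕ) + ν₀) v.val
  have ht0 : 0 ≤ t := by positivity
  have hTB := hC₂.tker_bound hε hv (memHs_of_suppIn _ hvm)
  have hcd := hgood.colDec s σ t (by
    have := X.hχC
    calc X.C * s = (16 * X.C) * σ := by rw [hs]; ring
      _ ≤ _ := by gcongr) ht0 hTB
  have hy0 := ns_nonneg N s v
  have ht1 : 1 + t ≤ 2 * C₂ * B ^ ((X.p : ℝ) + ν₀) * (N : ℝ) ^ (X.p + ⌈ν₀⌉₊) * (1 + ns N s v) := by
    have h1 := ns_growth hB hN0 (s := (s : ℝ)) (s' := (s + X.p : ℕ) + ν₀) (by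
      push_cast; have := Nat.cast_nonneg (α := ℝ) X.p; linarith) v
    rw [ns_eq_snorm hvm] at h1
    have e : ((s + X.p : ℕ) : ℝ) + ν₀ - s = X.p + ν₀ := by push_cast; ring
    rw [e, Real.mul_rpow (by positivity) (by positivity)] at h1
    have h2 : (N : ℝ) ^ ((X.p : ℝ) + ν₀) ≤ (N : ℝ) ^ (X.p + ⌈ν₀⌉₊) := by
      rw [← Real.rpow_natCast]
      refine Real.rpow_le_rpow_of_exponent_le hN1 ?_
      push_cast
      have := Nat.le_ceil ν₀
      linarith
    have h3 : 1 ≤ B ^ ((X.p : ℝ) + ν₀) := Real.one_le_rpow hB1 (by positivity)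
    have h4 : (1 : ℝ) ≤ (N : ℝ) ^ (X.p + ⌈ν₀⌉₊) := one_le_pow₀ hN1
    set F := B ^ ((X.p : ℝ) + ν₀) * (N : ℝ) ^ (X.p + ⌈ν₀⌉₊) with hF
    have h5 : 1 ≤ F := one_le_mul_of_one_le_of_one_le h3 h4
    have h6 : snorm ((s + X.p : ℕ) + ν₀) v.val ≤ F * ns N s v := h1.trans (by rw [hF]; gcongr)
    have h7 : t ≤ 1 * (C₂ * (F + F * ns N s v)) := by rw [ht]; gcongr
    have h8 : 1 ≤ C₂ * (F + F * ns N s v) :=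
      one_le_mul_of_one_le_of_one_le hC2 (by nlinarith)
    calc 1 + t ≤ 2 * (C₂ * (F + F * ns N s v)) := by linarith
      _ = _ := by rw [hF]; ring
  have hx0 := ns_nonneg N 0 x
  have hxs := ns_nonneg N s x
  have key := snorm_le_of_colDec hA1 (hA s) (by positivity) (by positivity) hgood.coer hcd
    (hQ.mem x) hx (hQ.app_eq x)
  rw [← ns_eq_snorm (hQ.mem x), ← ns_eq_snorm hx, ← ns_eq_snorm hx] at key
  refine key.trans ?_
  generalize ns N s v = y at *
  generalize ns N 0 x = x₀ at *
  generalize ns N s x = x₁ at *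
  set H := 2 * C₂ * B ^ ((X.p : ℝ) + ν₀) with hH
  have hH1 : 1 ≤ H := by
    rw [hH]
    exact one_le_mul_of_one_le_of_one_le (by linarith) (Real.one_le_rpow hB1 (by positivity))
  have e1 : (N : ℝ) ^ X.τ * x₁ ≤ decConst s X.p * H * (N : ℝ) ^ (X.τ + X.e₀ + X.p + ⌈ν₀⌉₊ + σ) * x₁ := by
    refine mul_le_mul_of_nonneg_right ?_ hxs
    refine (pow_le_pow_right₀ hN1 (by omega : X.τ ≤ X.τ + X.e₀ + X.p + ⌈ν₀⌉₊ + σ)).trans ?_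
    exact le_mul_of_one_le_left (by positivity)
      (one_le_mul_of_one_le_of_one_le (by linarith) hH1)
  have e2 : decConst s X.p * (1 + t) * (N : ℝ) ^ (X.e₀ + σ) * x₀ ≤
      decConst s X.p * H * (N : ℝ) ^ (X.τ + X.e₀ + X.p + ⌈ν₀⌉₊ + σ) * ((1 + y) * x₀) := by
    calc _ ≤ decConst s X.p * (H * (N : ℝ) ^ (X.p + ⌈ν₀⌉₊) * (1 + y)) * (N : ℝ) ^ (X.e₀ + σ) * x₀ := by
          gcongr
      _ = decConst s X.p * H * (N : ℝ) ^ (X.p + ⌈ν₀⌉₊ + (X.e₀ + σ)) * ((1 + y) * x₀) := by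
          rw [pow_add (N : ℝ) (X.p + ⌈ν₀⌉₊)]; ring
      _ ≤ _ := by
          refine mul_le_mul_of_nonneg_right ?_ (by positivity)
          refine mul_le_mul_of_nonneg_left (pow_le_pow_right₀ hN1 (by omega)) (by positivity)
  calc ((bx (K := K) N 0).card : ℝ) ^ 2 * A ^ s * ((N : ℝ) ^ X.τ * x₁ +
        decConst s X.p * (1 + t) * (N : ℝ) ^ (X.e₀ + σ) * x₀)
      ≤ ((N : ℝ) ^ (rd K + 1)) ^ 2 * A ^ s * (decConst s X.p * H *
          (N : ℝ) ^ (X.τ + X.e₀ + X.p + ⌈ν₀⌉₊ + σ) * x₁ + decConst s X.p * H *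
          (N : ℝ) ^ (X.τ + X.e₀ + X.p + ⌈ν₀⌉₊ + σ) * ((1 + y) * x₀)) := by gcongr
    _ = G * (((N : ℝ) ^ (rd K + 1)) ^ 2 * (N : ℝ) ^ (X.τ + X.e₀ + X.p + ⌈ν₀⌉₊ + σ) *
          ((1 + y) * x₀ + x₁)) := by rw [hG]; ring
    _ ≤ N * (((N : ℝ) ^ (rd K + 1)) ^ 2 * (N : ℝ) ^ (X.τ + X.e₀ + X.p + ⌈ν₀⌉₊ + σ) *
          ((1 + y) * x₀ + x₁)) := by gcongr; exact hM2.trans hNM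
    _ = _ := by
        rw [show invExp X ν₀ + σ = 1 + (rd K + 1) * 2 + (X.τ + X.e₀ + X.p + ⌈ν₀⌉₊ + σ) by
          unfold invExp; ring, pow_add (N : ℝ) (1 + _), pow_add (N : ℝ) 1, pow_one, pow_mul]
        ring

end Problem

/-! ### Transfer of good parameters from the limit to the approximations -/

theorem memHs_mono {s s' : ℝ} (h : s ≤ s') {u : Seq K} (hu : MemHs s' u) : MemHs s u := by
  refine Summable.of_nonneg_of_le (fun k => weighted_term_nonneg s u k) (fun k => ?_) hu
  gcongr
  exact one_le_bracket k

theorem snorm_mono {s s' : ℝ} (h : s ≤ s') {u : Seq K} (hu : MemHs s' u) :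
    snorm s u ≤ snorm s' u := by
  refine Real.sqrt_le_sqrt (Summable.tsum_le_tsum (fun k => ?_) (memHs_mono h hu) hu)
  gcongr
  exact one_le_bracket k

theorem natCast_pow_rpow_natCast (N τ : ℕ) : (N : ℝ) ^ (τ : ℝ) = (N : ℝ) ^ τ := Real.rpow_natCast _ _

theorem exists_dio {d : ℕ} {om : Fin d → ℝ} (h : Diophantine om) {χ τ : ℕ} (hτ : χ * d + 2 ≤ τ) :
    ∃ J : ℕ, ∀ N : ℕ, J ≤ N → ∀ lam : ℝ, 1 / 2 ≤ lam → ∀ l : Fin d → ℤ, l ≠ 0 →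
      ‖l‖ ≤ 2 * (N : ℝ) ^ χ → ((N : ℝ) ^ τ)⁻¹ < |lam * ∑ p, om p * l p| := by
  obtain ⟨γ, hγ, h⟩ := h
  obtain ⟨J, hJ⟩ := exists_nat_gt (2 ^ d / γ)
  refine ⟨J + 1, fun N hN lam hlam l hl hlN => ?_⟩
  have hN1 : (1 : ℝ) ≤ N := by exact_mod_cast (by omega : 1 ≤ N)
  have hJN : 2 ^ d / γ < N := hJ.trans_le (by exact_mod_cast (by omega : J ≤ N))
  have h1 := h l hl
  have hl0 : 0 < ‖l‖ := norm_pos_iff.2 hl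
  rw [Real.rpow_neg hl0.le, Real.rpow_natCast] at h1
  rw [abs_mul, abs_of_nonneg (by linarith : 0 ≤ lam)]
  have h2 : γ * (‖l‖ ^ d)⁻¹ ≤ lam * |∑ p, om p * l p| := by
    calc γ * (‖l‖ ^ d)⁻¹ = 1 / 2 * (2 * γ * (‖l‖ ^ d)⁻¹) := by ring
      _ ≤ lam * |∑ p, om p * l p| := by gcongr
  refine lt_of_lt_of_le ?_ h2
  have h3 : ‖l‖ ^ d ≤ 2 ^ d * (N : ℝ) ^ (χ * d) := by
    calc ‖l‖ ^ d ≤ (2 * (N : ℝ) ^ χ) ^ d := by gcongr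
      _ = _ := by rw [mul_pow, pow_mul]
  rw [← div_eq_mul_inv, lt_div_iff₀ (by positivity), inv_mul_lt_iff₀ (by positivity)]
  rw [div_lt_iff₀ hγ] at hJN
  calc ‖l‖ ^ d ≤ 2 ^ d * (N : ℝ) ^ (χ * d) := h3
    _ < N * γ * (N : ℝ) ^ (χ * d) := by gcongr
    _ = (N : ℝ) ^ (χ * d + 1) * γ := by rw [pow_succ]; ring
    _ ≤ (N : ℝ) ^ τ * γ := by
        refine mul_le_mul_of_nonneg_right (pow_le_pow_right₀ hN1 (by omega)) hγ.le

/-- The truncation `L_N` is centred at the origin, which need not belong to `Λ₊`; it is enough that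
some point of `Λ₊` is within `N` of it, unless there are no indices at all. -/
theorem exists_near_lam : ∃ J : ℕ, ∀ N : ℕ, J ≤ N →
    (∃ j₀ ∈ K.Lam, ‖j₀‖ ≤ N) ∨ IsEmpty (Idx K) := by
  by_cases h : K.Lam.Nonempty
  · obtain ⟨j, hj⟩ := h
    obtain ⟨J, hJ⟩ := exists_nat_ge ‖j‖
    exact ⟨J, fun N hN => .inl ⟨j, hj, hJ.trans (by exact_mod_cast hN)⟩⟩
  · exact ⟨0, fun N _ => .inr ⟨fun k => h ⟨_, k.2.1.2⟩⟩⟩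

namespace Problem

variable {s₀ ν ν₀ K₁ : ℝ} {P : Problem K s₀ ν ν₀ K₁} {ee e : ℝ}

/-- The decay exponent of the perturbation that the multiscale analysis uses. -/
def decayExp (X : Expo K ee e) : ℕ := 2 * X.ζ + X.p + 2 * rd K

/-- The exponent of closeness that allows to transfer bounds on inverses. -/
def closeExp (X : Expo K ee e) : ℕ := X.τ + 2 * (rd K + 1) + 1

/-- The exponent of smallness of the perturbation. -/
def smallExp (X : Expo K ee e) : ℕ := X.χ * (X.τ + (rd K + 1)) + 2

theorem le_pow_two_pow (N₀ n : ℕ) : N₀ ≤ N₀ ^ 2 ^ n :=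
  Nat.le_self_pow (by positivity) _

/-- The parameter sets speak about `w`, in the application the limit, whereas the inverse is needed
at the approximation `v`. As `w - v` is smaller than the inverse of `N ^ closeExp`, the two
linearised operators differ by so little that bounds `N ^ τ / 2` for `w` become bounds `N ^ τ` for
`v`, at the scale `n` and at all earlier ones; `multiscale` then applies to `v`. -/
theorem exists_good_of_cantor (X : Expo K ee e) (hee : 0 ≤ ee) (hσ : s₀ < decayExp X) {C : ℝ}
    (hC : P.DecayConst (decayExp X) C) : ∃ J : ℕ, ∀ N₀ : ℕ, J ≤ N₀ → ∀ ε lam : ℝ, 0 ≤ ε → ε ≤ 1 →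
      ε * (N₀ : ℝ) ^ smallExp X ≤ 1 → lam ∈ P.I → ∀ Itilde : ℕ → Set ℝ,
      SeparatedChains P.om P.DD e Itilde → lam ∈ Itilde N₀ → ∀ (n : ℕ) (w v : Hs K s₀),
      ‖w‖ < 1 → MemHs (decayExp X + ν₀) w.val → snorm (decayExp X + ν₀) w.val ≤ 1 →
      ‖v‖ < 1 → MemHs (decayExp X + ν₀) v.val → snorm (decayExp X + ν₀) v.val ≤ 1 →
      snorm (decayExp X + ν₀) (w - v).val ≤ (((N₀ ^ 2 ^ n : ℕ) : ℝ) ^ closeExp X)⁻¹ →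
      (∀ m ≤ n, InGoodEig P.om P.DD P.f ee X.τ ε lam w (N₀ ^ 2 ^ m)) →
      InGoodL2 P.om P.DD P.f X.τ ε lam w (N₀ ^ 2 ^ n) → P.Good X (N₀ ^ 2 ^ n) ε lam v := by
  have hC1 := hC.one_le
  have hν₀ := P.ν₀_pos
  obtain ⟨J₁, h₁⟩ := multiscale X
  obtain ⟨J₂, h₂⟩ := exists_dio P.diophantine X.hτ
  obtain ⟨J₃, h₃⟩ := exists_near_lam (K := K)
  obtain ⟨J₄, h₄⟩ := exists_nat_ge (3 * C)
  refine ⟨J₁ + J₂ + J₃ + J₄ + (Fintype.card K.A * 3 ^ rd K + 1) + 2, ?_⟩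
  intro N₀ hN₀ ε lam hε hε1 hsm hl Itilde hsep hit n w v hw hmw hsw hv hmv hsv hd heig hL2
  have hN2 : 2 ≤ N₀ := by omega
  have hN₀r : (2 : ℝ) ≤ N₀ := by exact_mod_cast hN2
  have hCN : 3 * C ≤ N₀ := h₄.trans (by exact_mod_cast (by omega : J₄ ≤ N₀))
  have hge : ∀ m, N₀ ≤ N₀ ^ 2 ^ m := le_pow_two_pow N₀
  have hscale : ∀ m, (2 : ℝ) ≤ ((N₀ ^ 2 ^ m : ℕ) : ℝ) := fun m =>
    hN₀r.trans (by exact_mod_cast hge m)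
  set δ := (((N₀ ^ 2 ^ n : ℕ) : ℝ) ^ closeExp X)⁻¹ with hδ
  have hδ0 : 0 ≤ δ := by positivity
  have hwv : ‖w - v‖ ≤ δ := by
    rw [Hs.norm_eq]
    have hm : MemHs (decayExp X + ν₀) (w - v).val := by
      rw [Hs.val_sub]; exact (hsSubmodule K _).sub_mem hmw hmv
    exact (snorm_mono (by linarith) hm).trans hd
  have hdiff : ∀ k k', ‖P.tker ε w k k' - P.tker ε v k k'‖ ≤ 3 * C * δ := by
    intro k k'
    have hsub : P.tker ε w k k' - P.tker ε v k k' =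
        (ε : ℂ) • (blk (jacobian P.f w) k k' - blk (jacobian P.f v) k k') := (smul_sub _ _ _).symm
    rw [hsub, norm_smul, Complex.norm_real, Real.norm_of_nonneg hε]
    have h := hC.lip w v hw hv hmw hmv k k'
    have n1 := snorm_nonneg (decayExp X + ν₀) w.val
    have n2 := snorm_nonneg (decayExp X + ν₀) v.val
    calc ε * ‖blk (jacobian P.f w) k k' - blk (jacobian P.f v) k k'‖
        ≤ 1 * (C * (δ + (1 + 1) * δ)) := by
          refine mul_le_mul hε1 (h.trans ?_) (norm_nonneg _) zero_le_one
          gcongr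
      _ = _ := by ring
  have hpert : ∀ m ≤ n, ∀ θ i, Coer (Dtheta P.om P.DD lam θ) (P.tker ε w) (bx (N₀ ^ 2 ^ m) i)
      (((N₀ ^ 2 ^ m : ℕ) : ℝ) ^ X.τ / 2) → Coer (Dtheta P.om P.DD lam θ) (P.tker ε v)
        (bx (N₀ ^ 2 ^ m) i) (((N₀ ^ 2 ^ m : ℕ) : ℝ) ^ X.τ) := by
    intro m hm θ i h
    refine Coer.perturb (by positivity) h hdiff ?_
    have hmn : (((N₀ ^ 2 ^ m : ℕ) : ℝ)) ≤ ((N₀ ^ 2 ^ n : ℕ) : ℝ) := by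
      exact_mod_cast Nat.pow_le_pow_right (by omega) (Nat.pow_le_pow_right (by omega) hm)
    have hcard := card_bx_le_pow (K := K) (N := N₀ ^ 2 ^ m) ((by omega :
      Fintype.card K.A * 3 ^ rd K + 1 ≤ N₀).trans (hge m)) i
    have hCn : 3 * C ≤ ((N₀ ^ 2 ^ n : ℕ) : ℝ) := hCN.trans (by exact_mod_cast hge n)
    have hs2 := hscale m
    have hs2n := hscale n
    rw [hδ]
    generalize ((N₀ ^ 2 ^ n : ℕ) : ℝ) = y at *
    generalize ((N₀ ^ 2 ^ m : ℕ) : ℝ) = x at *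
    calc x ^ X.τ * (((bx (N₀ ^ 2 ^ m) i).card : ℝ) ^ 2 * (3 * C * (y ^ closeExp X)⁻¹))
        ≤ y ^ X.τ * ((y ^ (rd K + 1)) ^ 2 * (y * (y ^ closeExp X)⁻¹)) := by
          gcongr
          exact hcard.trans (by gcongr)
      _ = y ^ closeExp X * (y ^ closeExp X)⁻¹ := by unfold closeExp; ring
      _ = 1 := mul_inv_cancel₀ (by positivity)
  have hcoer : Coer (Dtheta P.om P.DD lam 0) (P.tker ε v) (bx (N₀ ^ 2 ^ n) 0)
      (((N₀ ^ 2 ^ n : ℕ) : ℝ) ^ X.τ) := by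
    refine hpert n le_rfl 0 0 ?_
    have h := (invBound_trunc_iff (by positivity)).1 hL2
    rwa [natCast_pow_rpow_natCast] at h
  rcases h₃ N₀ (by omega) with ⟨j₀, hj₀, hjN⟩ | hemp
  swap
  · exact ⟨hcoer, fun _ _ _ _ _ _ k => (hemp.false k).elim⟩
  refine ⟨hcoer, h₁ N₀ (by omega) P.om P.DD lam (P.tker ε v) (ε * (C * 2)) (P.toepKer hv ε)
    (by positivity) ?_ ?_ ?_ ?_ n ?_ 0 ⟨j₀, hj₀, by simpa using hjN⟩ 0 hcoer⟩
  · calc (N₀ : ℝ) ^ (X.χ * (X.τ + (rd K + 1)) + 1) * (ε * (C * 2))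
        ≤ (N₀ : ℝ) ^ (X.χ * (X.τ + (rd K + 1)) + 1) * (ε * N₀) := by gcongr; linarith
      _ = ε * (N₀ : ℝ) ^ smallExp X := by unfold smallExp; ring
      _ ≤ 1 := hsm
  · intro k k'
    refine (hC.tker_bound hε hv hmv k k').trans ?_
    gcongr
    linarith
  · intro m θ Sig hSig ℓ k hk hch
    have h2 := hscale m
    -- The separation hypothesis is used with `K = N ^ kap` and `Γ = N²`, where `N` is the current
    -- scale.
    refine hsep N₀ hN2 lam hit θ _ _ ?_ ?_ ?_ Sig hSig ℓ k hk hch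
    · exact one_lt_pow₀ (by linarith) (by
        have h1 := X.hkap
        intro h0
        rw [h0, Nat.cast_zero] at h1
        have := Nat.cast_nonneg (α := ℝ) K.d
        linarith)
    · nlinarith
    · have h3 : (N₀ : ℝ) ≤ ((N₀ ^ 2 ^ m : ℕ) : ℝ) := by exact_mod_cast hge m
      have h4 : (1 : ℝ) ≤ ((N₀ ^ 2 ^ m : ℕ) : ℝ) ^ X.kap := one_le_pow₀ (by linarith)
      generalize ((N₀ ^ 2 ^ m : ℕ) : ℝ) = x at *
      generalize x ^ X.kap = y at *
      nlinarith
  · intro m l hl0 hln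
    exact h₂ (N₀ ^ 2 ^ m) ((by omega : J₂ ≤ N₀).trans (hge m)) lam (P.half_le hl) l hl0 hln
  · intro m hm j
    obtain ⟨c, hc, J, hJ, hcov⟩ := heig m hm.le j
    refine ⟨c, hc, J, fun q => ⟨(hJ q).1, ?_⟩, fun θ hθ => hcov fun hinv => hθ ?_⟩
    · have := (hJ q).2
      rwa [Real.rpow_neg (Nat.cast_nonneg _), natCast_pow_rpow_natCast] at this
    · have h := (invBound_trunc_iff (by positivity)).1 hinv
      rw [natCast_pow_rpow_natCast] at h
      exact hpert m hm.le θ _ h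

end Problem

/-! ### Change of scale and the Newton step for the truncated equation -/

theorem dop_eq_of_mem {s₀ : ℝ} {N M : ℕ} (h : N ≤ M) (m : Idx K → ℂ) {x : Hs K s₀} (hx : x ∈ WN K s₀ N) :
    dop M m x = dop N m x := by
  apply Hs.val_injective
  funext k
  by_cases hk : k ∈ bx N 0
  · rw [dop_val _ _ _ _ hk, dop_val _ _ _ _ (bx_subset h 0 hk)]
  · rw [dop_mem N m x k hk]
    by_cases hk' : k ∈ bx M 0
    · rw [dop_val _ _ _ _ hk', hx k hk, smul_zero]
    · exact dop_mem M m x k hk'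

theorem ns_proj_sub_proj_le {s₀ B : ℝ} (hB : IsBracketConst K B) {N M : ℕ} (hN : 1 ≤ N) (h : N ≤ M)
    {s : ℝ} (D : ℕ) (x : Hs K s₀) :
    ns M s (proj (bx M 0) s₀ x - proj (bx N 0) s₀ x) ≤ (B / N) ^ D * ns M (s + D) x := by
  have h1 : proj (bx M 0) s₀ x - proj (bx N 0) s₀ x =
      proj (bx M 0) s₀ (x - proj (bx N 0) s₀ x) := by
    rw [map_sub, proj_eq_self (WN_mono h (proj_mem_WN N x))]
  have h2 := ns_smoothing hB (M := M) hN (le_add_of_nonneg_right (Nat.cast_nonneg D) : s ≤ s + D) x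
  rw [add_sub_cancel_left, Real.rpow_natCast] at h2
  rw [h1]
  exact (ns_proj_le _).trans h2

namespace Problem

variable {s₀ ν ν₀ K₁ : ℝ} {P : Problem K s₀ ν ν₀ K₁} {ee e : ℝ}

/-- The residual of a path supported in the box of radius `N` with respect to a larger box. -/
theorem residual_le_of_scale_change {B : ℝ} (hB : IsBracketConst K B) {sl C C' ε : ℝ} {a N M D : ℕ}
    (hN : P.ScaleOK sl C a N ε) (hM : P.ScaleOK sl C a M ε) (hNM : N ≤ M)
    (hC' : P.TameConst (sl + D) C') {v v' : ℝ → Hs K s₀} {lam : ℝ} (hv : v lam ∈ WN K s₀ N)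
    (hv' : v' lam ∈ WN K s₀ N) (h1 : ns N sl (v lam) ≤ 1 / 2) (h1' : ns N sl (v' lam) ≤ 1 / 2)
    {Z : ℝ} (hZ : 1 + ns N (sl + D) (v lam) ≤ Z) (hZ' : 1 + ns N (sl + D) (v' lam) ≤ Z) :
    ‖(env hM).l ((env hM).res v lam)‖ ≤
      ‖(env hN).l ((env hN).res v lam)‖ + (B / N) ^ D * (2 * C' * Z) ∧
    ‖(env hM).l ((env hM).res' v v' lam)‖ ≤
      ‖(env hN).l ((env hN).res' v v' lam)‖ + (B / N) ^ D * (2 * C' * Z) := by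
  have hB1 := hB.one_le
  have hC1 := hC'.one_le
  have hvn : ‖v lam‖ < 1 := by linarith [norm_le_ns hN.le_sl hv]
  have hvn' : ‖v' lam‖ ≤ 1 := by linarith [norm_le_ns hN.le_sl hv']
  have hf : ns M (sl + D) (P.f (v lam)) ≤ 2 * C' * Z := by
    have h := hC'.le M N (v lam) hv hvn
    have h0 := ns_nonneg N (sl + D) (v lam)
    calc _ ≤ C' * (1 + ns N (sl + D) (v lam)) := h
      _ ≤ C' * Z := by gcongr
      _ ≤ 2 * C' * Z := by nlinarith
  have hf' : ns M (sl + D) (fderiv ℝ P.f (v lam) (v' lam)) ≤ 2 * C' * Z := by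
    have h := hC'.deriv_le M N (v lam) hv hvn (v' lam) hv'
    have h0 := ns_nonneg N (sl + D) (v lam)
    have h0' := ns_nonneg N (sl + D) (v' lam)
    calc _ ≤ C' * (ns N (sl + D) (v lam) * ‖v' lam‖ + ns N (sl + D) (v' lam)) := h
      _ ≤ C' * (ns N (sl + D) (v lam) * 1 + ns N (sl + D) (v' lam)) := by
          have := mul_le_mul_of_nonneg_left hvn' h0
          exact mul_le_mul_of_nonneg_left (by linarith) (by linarith)
      _ ≤ C' * (Z + Z) := mul_le_mul_of_nonneg_left (by linarith) (by linarith)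
      _ = _ := by ring
  have key : ∀ (x y z : Hs K s₀), x ∈ WN K s₀ N → ns M (sl + D) y ≤ 2 * C' * Z →
      z = x + ε • (proj (bx M 0) s₀ y - proj (bx N 0) s₀ y) →
      ns M sl z ≤ ns N sl x + (B / N) ^ D * (2 * C' * Z) := by
    rintro x y z hx hy rfl
    refine (ns_add_le _ _ _ _).trans ?_
    rw [ns_eq_ns hNM hx, ns_smul, abs_of_nonneg hN.ε_nonneg]
    have h := ns_proj_sub_proj_le hB hN.one_le hNM (s := sl) D y
    have h0 := ns_nonneg M sl (proj (bx M 0) s₀ y - proj (bx N 0) s₀ y)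
    have h2 : (B / N) ^ D * ns M (sl + D) y ≤ (B / N) ^ D * (2 * C' * Z) := by gcongr
    have h3 := mul_le_mul_of_nonneg_right hN.ε_le h0
    linarith
  constructor
  · refine key _ (P.f (v lam)) _ (NewtonEnv.res_mem (E := env hN) v lam) hf ?_
    change dop M _ (v lam) + ε • proj (bx M 0) s₀ (P.f (v lam)) =
      dop N _ (v lam) + ε • proj (bx N 0) s₀ (P.f (v lam)) + _
    rw [dop_eq_of_mem hNM _ hv]
    module
  · refine key _ (fderiv ℝ P.f (v lam) (v' lam)) _
      (NewtonEnv.res'_mem (E := env hN) v v' lam) hf' ?_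
    change dop M _ (v lam) + (dop M _ (v' lam) +
        ε • proj (bx M 0) s₀ (fderiv ℝ P.f (v lam) (v' lam))) =
      dop N _ (v lam) + (dop N _ (v' lam) +
        ε • proj (bx N 0) s₀ (fderiv ℝ P.f (v lam) (v' lam))) + _
    rw [dop_eq_of_mem hNM _ hv, dop_eq_of_mem hNM _ hv']
    module

/-- The basic exponent of the Newton scheme. -/
def baseExp (X : Expo K ee e) (ν ν₀ : ℝ) (σL : ℕ) : ℕ :=
  invExp X ν₀ + σL + 1 + diagExp ν + closeExp X

/-- In the low norm `v` is bounded by `1/2`, so the tame estimate for the inverse becomes a linear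
bound. -/
theorem Level.low_le {X : Expo K ee e} {σL c : ℕ} (hL : P.Level X σL c) {N : ℕ} (hc : c ≤ N)
    (h3 : 3 ≤ N) {ε lam : ℝ} {v : Hs K s₀} (hε : 0 ≤ ε) (hε1 : ε ≤ 1) (hv : v ∈ WN K s₀ N)
    (hv1 : ‖v‖ < 1) (hvl : ns N (16 * σL : ℕ) v ≤ 1 / 2) (hg : P.Good X N ε lam v)
    {Q : Hs K s₀ →L[ℝ] Hs K s₀} (hQ : P.IsInv N ε lam v Q) {x : Hs K s₀} (hx : x ∈ WN K s₀ N) :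
    ns N (16 * σL : ℕ) (Q x) ≤ (N : ℝ) ^ baseExp X ν ν₀ σL * ns N (16 * σL : ℕ) x := by
  have h3' : (3 : ℝ) ≤ N := by exact_mod_cast h3
  have h := hL.inv N hc ε lam v hε hε1 hv hv1 hg Q hQ x hx
  have h0 : ns N 0 x ≤ ns N (16 * σL : ℕ) x := ns_mono (by positivity) x
  have h00 := ns_nonneg N 0 x
  generalize ns N 0 x = x₀ at *
  generalize ns N (16 * σL : ℕ) x = x₁ at *
  have hv0 := ns_nonneg N (16 * σL : ℕ) v
  generalize ns N (16 * σL : ℕ) v = y at *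
  calc _ ≤ (N : ℝ) ^ (invExp X ν₀ + σL) * ((1 + y) * x₀ + x₁) := h
    _ ≤ (N : ℝ) ^ (invExp X ν₀ + σL) * (N * x₁) := by
        gcongr
        nlinarith
    _ = (N : ℝ) ^ (invExp X ν₀ + σL + 1) * x₁ := by rw [pow_succ]; ring
    _ ≤ _ := by
        refine mul_le_mul_of_nonneg_right ?_ (by linarith)
        exact pow_le_pow_right₀ (by linarith) (by unfold baseExp; omega)

open NewtonEnv in
/-- One scale of the Nash–Moser iteration. -/
theorem exists_newton_scale {X : Expo K ee e} {σL c g : ℕ} (hL : P.Level X σL c) {N : ℕ} (hc : c ≤ N)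
    {C ε : ℝ} (hN : P.ScaleOK (16 * σL : ℕ) C (diagExp ν) N ε)
    {C₀ : ℝ} (hC₀ : ∀ x, |deriv Real.smoothTransition x| ≤ C₀) (h16 : 16 ≤ N) (hNC : 2 * C₀ ≤ N)
    (hg : 3 * baseExp X ν ν₀ σL + 10 ≤ g) {u u' : ℝ → Hs K s₀} (hu : (env hN).IsPath u u')
    {A : Set ℝ} (hA : A ⊆ P.I) (hgood : ∀ lam ∈ A, P.Good X N ε lam (u lam))
    (hu1 : ∀ lam ∈ P.I, ns N (16 * σL : ℕ) (u lam) ≤ 1 / 2 ∧ ns N (16 * σL : ℕ) (u' lam) ≤ 1 / 2)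
    (hres : ∀ lam ∈ P.I, ∀ lam₀ ∈ A, |lam - lam₀| ≤ 3 * (N : ℝ) ^ (-(3 * g : ℤ)) →
      ‖(env hN).l ((env hN).res u lam)‖ ≤ (N : ℝ) ^ (-(4 * g : ℤ)) ∧
      ‖(env hN).l ((env hN).res' u u' lam)‖ ≤ (N : ℝ) ^ (-(g : ℤ))) :
    ∃ v v' : ℝ → Hs K s₀, (env hN).IsPath v v' ∧
      (∀ lam ∈ P.I,
        ns N (16 * σL : ℕ) (v lam - u lam) ≤ (N : ℝ) ^ (3 * baseExp X ν ν₀ σL + 3 - 4 * g : ℤ) ∧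
        ns N (16 * σL : ℕ) (v' lam - u' lam) ≤ (N : ℝ) ^ (3 * baseExp X ν ν₀ σL + 5 - g : ℤ)) ∧
      (∀ lam ∈ P.I, ∀ lam₀ ∈ A, |lam - lam₀| ≤ (N : ℝ) ^ (-(3 * g : ℤ)) →
        ‖(env hN).l ((env hN).res v lam)‖ ≤ (N : ℝ) ^ (4 * baseExp X ν ν₀ σL + 6 - 10 * g : ℤ) ∧
        ‖(env hN).l ((env hN).res' v v' lam)‖ ≤ (N : ℝ) ^ (4 * baseExp X ν ν₀ σL + 6 - 4 * g : ℤ)) ∧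
      ∀ (σ c' : ℕ) (Z : ℝ), P.Level X σ c' → c' ≤ N →
        (∀ lam ∈ P.I, 1 + ns N (16 * σ : ℕ) (u lam) ≤ Z ∧ 1 + ns N (16 * σ : ℕ) (u' lam) ≤ Z) →
        ∀ lam ∈ P.I,
          1 + ns N (16 * σ : ℕ) (v lam) ≤
            (N : ℝ) ^ (2 * (2 * baseExp X ν ν₀ σL + σ + 3 * g + 2)) * Z ∧
          1 + ns N (16 * σ : ℕ) (v' lam) ≤
            (N : ℝ) ^ (2 * (2 * baseExp X ν ν₀ σL + σ + 3 * g + 2)) * Z := by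
  have hN1 : (1 : ℝ) ≤ N := by exact_mod_cast hN.one_le
  have hmem : ∀ lam ∈ A, u lam ∈ WN K s₀ N := fun lam hl => hu.mem lam (hA hl)
  have hnorm : ∀ lam ∈ A, ‖u lam‖ < 1 := fun lam hl => by
    linarith [norm_le_ns hN.le_sl (hmem lam hl), (hu1 lam (hA hl)).1]
  have hQ : ∀ lam : ℝ, ∃ Q : Hs K s₀ →L[ℝ] Hs K s₀, lam ∈ A → P.IsInv N ε lam (u lam) Q := by
    intro lam
    by_cases hl : lam ∈ A
    · obtain ⟨Q, hQ⟩ := exists_isInv (hgood lam hl).coer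
      exact ⟨Q, fun _ => hQ⟩
    · exact ⟨0, fun h => absurd h hl⟩
  choose Qc hQc using hQ
  obtain ⟨v, v', h1, h2, h3, h4⟩ := exists_scale_step (E := env hN) hC₀
    (b := baseExp X ν ν₀ σL) (g := g) (by change diagExp ν ≤ _; unfold baseExp; omega) hg
    (by change (16 : ℝ) ≤ N; exact_mod_cast h16) hNC hu hA
    (fun lam hl => (hu1 lam hl).1) (fun lam hl => (hu1 lam hl).2) (Qc := Qc)
    (fun lam hl x => (hQc lam hl).mem x)
    (fun lam hl x hx => hL.low_le hc (by omega) hN.ε_nonneg hN.ε_le (hmem lam hl)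
      (hnorm lam hl) (hu1 lam (hA hl)).1 (hgood lam hl) (hQc lam hl) hx)
    (fun lam hl x hx => (hQc lam hl).eq (hA hl) (hnorm lam hl) hx) hres
  refine ⟨v, v', h1, h2, h3, fun σ c' Z hσ hc' hZ lam hl => ?_⟩
  have h5 := h4 (nsn N (16 * σ : ℕ)) σ (Z - 1)
    (highNorm hN hσ.tame (by exact_mod_cast hc')) (fun lam hl x hx => ?_)
    (fun lam hl => ⟨by have := (hZ lam hl).1; rw [nsn_apply]; linarith,
      by have := (hZ lam hl).2; rw [nsn_apply]; linarith⟩) lam hl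
  · rw [add_sub_cancel] at h5
    exact h5
  · have h6 := hσ.inv N hc' ε lam (u lam) hN.ε_nonneg hN.ε_le (hmem lam hl) (hnorm lam hl)
      (hgood lam hl) _ (hQc lam hl) x hx
    have h0 : ns N 0 x ≤ ns N (16 * σL : ℕ) x := ns_mono (by positivity) x
    change ns N (16 * σ : ℕ) (Qc lam x) ≤ (N : ℝ) ^ (baseExp X ν ν₀ σL + σ) *
      ((1 + ns N (16 * σ : ℕ) (u lam)) * ns N (16 * σL : ℕ) x + ns N (16 * σ : ℕ) x)
    refine h6.trans ?_
    have n1 := ns_nonneg N (16 * σ : ℕ) (u lam)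
    have n2 := ns_nonneg N (16 * σ : ℕ) x
    have n3 := ns_nonneg N 0 x
    generalize ns N (16 * σ : ℕ) (u lam) = y at *
    generalize ns N (16 * σ : ℕ) x = z at *
    generalize ns N 0 x = x₀ at *
    generalize ns N (16 * σL : ℕ) x = x₁ at *
    have h7 : invExp X ν₀ ≤ baseExp X ν ν₀ σL := by unfold baseExp; omega
    gcongr

end Problem

/-! ### The induction over the scales -/

theorem two_pow_le_scale {N₀ : ℕ} (h : 4 ≤ N₀) (n : ℕ) : 2 ^ (n + 2) ≤ N₀ ^ 2 ^ n := by
  have h1 : n < 2 ^ n := Nat.lt_two_pow_self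
  calc 2 ^ (n + 2) ≤ 2 ^ (2 * 2 ^ n) := Nat.pow_le_pow_right (by norm_num) (by omega)
    _ = 4 ^ 2 ^ n := by rw [pow_mul]; norm_num
    _ ≤ _ := Nat.pow_le_pow_left h _

theorem scale_succ (N₀ n : ℕ) : N₀ ^ 2 ^ (n + 1) = (N₀ ^ 2 ^ n) ^ 2 := by
  rw [← pow_mul, pow_succ]

theorem two_mul_zpow_le {N : ℝ} (hN : 2 ≤ N) {x y z : ℤ} (hx : x + 1 ≤ z) (hy : y + 1 ≤ z) :
    N ^ x + N ^ y ≤ N ^ z := by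
  have h1 : (1 : ℝ) ≤ N := by linarith
  have h0 : (0 : ℝ) < N := by linarith
  have e1 : N ^ x ≤ N ^ (z - 1) := zpow_le_zpow_right₀ h1 (by omega)
  have e2 : N ^ y ≤ N ^ (z - 1) := zpow_le_zpow_right₀ h1 (by omega)
  have e3 : N ^ z = N * N ^ (z - 1) := by
    rw [← zpow_one_add₀ h0.ne']; congr 1; omega
  have e4 : 0 < N ^ (z - 1) := by positivity
  nlinarith

namespace Problem

variable {s₀ ν ν₀ K₁ : ℝ} {P : Problem K s₀ ν ν₀ K₁} {ee e : ℝ}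

/-- The exponents of smallness of the residuals, at the level of regularity `k`. -/
def resExp (b k : ℕ) : ℕ := 3 * b + 20 + k

/-- The exponents of regularity. -/
def regExp (b σL k : ℕ) : ℕ := 16 * σL + 2 * resExp b k + b + 10

/-- The gain of regularity with respect to the low norm. -/
def gapExp (b σL k : ℕ) : ℕ := 16 * (regExp b σL k - σL)

/-- The exponents of growth of the high norms. -/
def growExp (b σL k : ℕ) : ℕ := 2 * (2 * b + regExp b σL k + 3 * resExp b k + 2) + 1

theorem reg_eq (b σL k : ℕ) :
    ((16 * regExp b σL k : ℕ) : ℝ) = ((16 * σL : ℕ) : ℝ) + (gapExp b σL k : ℕ) := by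
  rw [← Nat.cast_add]
  congr 1
  have : σL ≤ regExp b σL k := by unfold regExp; omega
  unfold gapExp
  omega

variable (P) in
/-- A schedule for the levels of regularity that are active at the scales `N₀ ^ 2 ^ n`. -/
structure Schedule (X : Expo K ee e) (σL N₀ : ℕ) (B : ℝ) where
  q : ℕ → ℕ
  c : ℕ → ℕ
  m : ℕ → ℕ
  M : ℕ → ℝ
  q_zero : q 0 = 0
  q_mono : Monotone q
  q_succ_le : ∀ n, q (n + 1) ≤ q n + 1
  level : ∀ n, P.Level X (regExp (baseExp X ν ν₀ σL) σL (q n)) (c (q n))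
  c_le : ∀ n n', m (q n') ≤ n → c (q n') ≤ N₀ ^ 2 ^ n
  m_le : ∀ n, m (q n) ≤ n
  one_le_M : ∀ k, 1 ≤ M k
  M_ge : ∀ n, m (q n) ≠ 0 →
    1 + (B * (N₀ ^ 2 ^ m (q n) : ℕ)) ^ gapExp (baseExp X ν ν₀ σL) σL (q n) ≤ M (q n)
  M_le : ∀ n, 2 * c (q n) * B ^ gapExp (baseExp X ν ν₀ σL) σL (q n) * M (q n) ≤ (N₀ ^ 2 ^ n : ℕ)

variable (K s₀) in
/-- The state of the iteration: a path, its derivative and a set of parameters. -/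
structure State where
  u : ℝ → Hs K s₀
  u' : ℝ → Hs K s₀
  A : Set ℝ

variable {X : Expo K ee e} {σL N₀ : ℕ} {B C ε : ℝ}

/-- The properties of the state before the step at the scale `N₀ ^ 2 ^ n`. -/
structure Invariant (Sc : P.Schedule X σL N₀ B)
    (hN : ∀ n, P.ScaleOK (16 * σL : ℕ) C (diagExp ν) (N₀ ^ 2 ^ n) ε) (n : ℕ)
    (S : State K s₀) : Prop where
  subset : S.A ⊆ P.I
  path : (env (hN n)).IsPath S.u S.u'
  low : ∀ lam ∈ P.I, ns (N₀ ^ 2 ^ n) (16 * σL : ℕ) (S.u lam) ≤ 1 / 2 - (1 / 2) ^ (n + 1) ∧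
    ns (N₀ ^ 2 ^ n) (16 * σL : ℕ) (S.u' lam) ≤ 1 / 2 - (1 / 2) ^ (n + 1)
  res : ∀ lam ∈ P.I, ∀ lam₀ ∈ S.A,
    |lam - lam₀| ≤ 3 * ((N₀ ^ 2 ^ n : ℕ) : ℝ) ^ (-(3 * resExp (baseExp X ν ν₀ σL) (Sc.q n) : ℕ) : ℤ) →
    ‖(env (hN n)).l ((env (hN n)).res S.u lam)‖ ≤
      ((N₀ ^ 2 ^ n : ℕ) : ℝ) ^ (-(4 * resExp (baseExp X ν ν₀ σL) (Sc.q n) : ℕ) : ℤ) ∧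
    ‖(env (hN n)).l ((env (hN n)).res' S.u S.u' lam)‖ ≤
      ((N₀ ^ 2 ^ n : ℕ) : ℝ) ^ (-(resExp (baseExp X ν ν₀ σL) (Sc.q n)) : ℤ)
  high : ∀ n', Sc.q n ≤ Sc.q n' → Sc.m (Sc.q n') ≤ n → ∀ lam ∈ P.I,
    1 + ns (N₀ ^ 2 ^ n) (16 * regExp (baseExp X ν ν₀ σL) σL (Sc.q n') : ℕ) (S.u lam) ≤
      Sc.M (Sc.q n') * ((N₀ ^ 2 ^ n : ℕ) : ℝ) ^ growExp (baseExp X ν ν₀ σL) σL (Sc.q n') ∧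
    1 + ns (N₀ ^ 2 ^ n) (16 * regExp (baseExp X ν ν₀ σL) σL (Sc.q n') : ℕ) (S.u' lam) ≤
      Sc.M (Sc.q n') * ((N₀ ^ 2 ^ n : ℕ) : ℝ) ^ growExp (baseExp X ν ν₀ σL) σL (Sc.q n')

/-- The relation of two consecutive states. -/
structure Consecutive (Sc : P.Schedule X σL N₀ B) (ε : ℝ) (n : ℕ) (S S' : State K s₀) : Prop where
  set_eq : S'.A = {lam ∈ S.A | P.Good X (N₀ ^ 2 ^ n) ε lam (S.u lam)}
  le : ∀ lam ∈ P.I, ns (N₀ ^ 2 ^ n) (16 * σL : ℕ) (S'.u lam - S.u lam) ≤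
      ((N₀ ^ 2 ^ n : ℕ) : ℝ) ^
        (3 * baseExp X ν ν₀ σL + 3 - 4 * resExp (baseExp X ν ν₀ σL) (Sc.q n) : ℤ)
  le' : ∀ lam ∈ P.I, ns (N₀ ^ 2 ^ n) (16 * σL : ℕ) (S'.u' lam - S.u' lam) ≤
      ((N₀ ^ 2 ^ n : ℕ) : ℝ) ^
        (3 * baseExp X ν ν₀ σL + 5 - resExp (baseExp X ν ν₀ σL) (Sc.q n) : ℤ)
  mem : ∀ lam ∈ P.I, S'.u lam - S.u lam ∈ WN K s₀ (N₀ ^ 2 ^ n)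
  mem' : ∀ lam ∈ P.I, S'.u' lam - S.u' lam ∈ WN K s₀ (N₀ ^ 2 ^ n)

/-- The arithmetic of the change of scale. -/
theorem scale_change_arith {b g g' G D : ℕ} {N B Z c M : ℝ} (hN : 2 ≤ N) (hg' : g' ≤ g + 1)
    (hg : 3 * b + 20 ≤ g) (hD : 2 * G + 8 * g + 10 ≤ D)
    (hM : 2 * c * B ^ D * M ≤ N) (hZ : Z ≤ M * (N ^ 2) ^ G) (hc : 0 ≤ c) (hB : 0 ≤ B)  :
    N ^ (4 * b + 6 - 10 * g : ℤ) + (B / N) ^ D * (2 * c * Z) ≤ (N ^ 2) ^ (-(4 * g' : ℕ) : ℤ) ∧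
    N ^ (4 * b + 6 - 4 * g : ℤ) + (B / N) ^ D * (2 * c * Z) ≤ (N ^ 2) ^ (-(g' : ℕ) : ℤ) := by
  have h0 : 0 < N := by linarith
  have h1 : (B / N) ^ D * (2 * c * Z) ≤ N ^ (1 + 2 * G - D : ℤ) := by
    calc (B / N) ^ D * (2 * c * Z) ≤ (B / N) ^ D * (2 * c * (M * (N ^ 2) ^ G)) := by gcongr
      _ = (2 * c * B ^ D * M) * (N ^ (2 * G) / N ^ D) := by rw [div_pow, pow_mul]; ring
      _ ≤ N * (N ^ (2 * G) / N ^ D) := by gcongr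
      _ = _ := by
          rw [zpow_sub₀ h0.ne', zpow_add₀ h0.ne', zpow_one, zpow_natCast]
          rw [show (2 * G : ℤ) = ((2 * G : ℕ) : ℤ) by push_cast; ring, zpow_natCast]
          ring
  have e : ∀ j : ℤ, (N ^ 2) ^ j = N ^ (2 * j) := fun j => by
    rw [zpow_mul, zpow_ofNat]
  rw [e, e]
  refine ⟨(add_le_add_right h1 _).trans (two_mul_zpow_le hN ?_ ?_),
    (add_le_add_right h1 _).trans (two_mul_zpow_le hN ?_ ?_)⟩ <;> push_cast <;> omega

/-- The inequality that closes the scheme. A level `σ` gains about `16 σ` derivatives and grows with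
exponent about `2 σ`, which counts twice after squaring the scale; the definition of `regExp` makes
`σ` large enough to cover the rest. -/
theorem grow_gap (b σL k : ℕ) :
    2 * growExp b σL k + 8 * resExp b k + 10 ≤ gapExp b σL k := by
  unfold growExp gapExp regExp
  omega

/-- The parameter set shrinks to the parameters that are good at the current scale, and the Newton
steps are made with inverses from there. The residual on the larger box is the residual on the
smaller one plus a truncation error, which the high norm of the current level makes negligible. -/
theorem exists_step (hB : IsBracketConst K B) {c : ℕ} (hL : P.Level X σL c) (hc : c ≤ N₀)
    (hN : ∀ n, P.ScaleOK (16 * σL : ℕ) C (diagExp ν) (N₀ ^ 2 ^ n) ε)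
    {C₀ : ℝ} (hC₀ : ∀ x, |deriv Real.smoothTransition x| ≤ C₀) (h16 : 16 ≤ N₀) (hNC : 2 * C₀ ≤ N₀)
    (Sc : P.Schedule X σL N₀ B) (n : ℕ) (S : State K s₀) (hS : Invariant Sc hN n S) :
    ∃ S', Invariant Sc hN (n + 1) S' ∧ Consecutive Sc ε n S S' := by
  have hB1 := hB.one_le
  have hge := le_pow_two_pow N₀ n
  have hger : (N₀ : ℝ) ≤ ((N₀ ^ 2 ^ n : ℕ) : ℝ) := by exact_mod_cast hge
  have hN16 : (16 : ℝ) ≤ ((N₀ ^ 2 ^ n : ℕ) : ℝ) := le_trans (by exact_mod_cast h16) hger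
  have hle : N₀ ^ 2 ^ n ≤ N₀ ^ 2 ^ (n + 1) :=
    Nat.pow_le_pow_right (by omega) (Nat.pow_le_pow_right (by omega) (by omega))
  have hsq : ((N₀ ^ 2 ^ (n + 1) : ℕ) : ℝ) = ((N₀ ^ 2 ^ n : ℕ) : ℝ) ^ 2 := by
    rw [scale_succ]; push_cast; ring
  have hpow2 : (2 : ℝ) ^ (n + 2) ≤ ((N₀ ^ 2 ^ n : ℕ) : ℝ) := by
    exact_mod_cast two_pow_le_scale (by omega) n
  set b := baseExp X ν ν₀ σL with hb
  set k := Sc.q n with hk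
  have hhalf : ((1 : ℝ) / 2) ^ (n + 1) = 2 * (1 / 2) ^ (n + 2) := by rw [pow_succ _ (n + 1)]; ring
  have hhalf0 : (0 : ℝ) < (1 / 2) ^ (n + 1) := by positivity
  have hu1 : ∀ lam ∈ P.I, ns (N₀ ^ 2 ^ n) (16 * σL : ℕ) (S.u lam) ≤ 1 / 2 ∧
      ns (N₀ ^ 2 ^ n) (16 * σL : ℕ) (S.u' lam) ≤ 1 / 2 := fun lam hl =>
    ⟨by linarith [(hS.low lam hl).1], by linarith [(hS.low lam hl).2]⟩
  obtain ⟨v, v', h1, h2, h3, h4⟩ := exists_newton_scale (g := resExp b k) hL (hc.trans hge) (hN n)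
    hC₀ (h16.trans hge) (hNC.trans hger) (by unfold resExp; omega) hS.path
    (A := {lam ∈ S.A | P.Good X (N₀ ^ 2 ^ n) ε lam (S.u lam)})
    (fun lam hl => hS.subset hl.1) (fun lam hl => hl.2) hu1
    (fun lam hl lam₀ hl₀ hd => by
      have h := hS.res lam hl lam₀ hl₀.1 (by exact_mod_cast hd)
      exact_mod_cast h)
  have hinv : ∀ z : ℤ, z ≤ -1 → ((N₀ ^ 2 ^ n : ℕ) : ℝ) ^ z ≤ (1 / 2) ^ (n + 2) := by
    intro z hz
    calc ((N₀ ^ 2 ^ n : ℕ) : ℝ) ^ z ≤ ((N₀ ^ 2 ^ n : ℕ) : ℝ) ^ (-1 : ℤ) :=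
          zpow_le_zpow_right₀ (by linarith) hz
      _ = (((N₀ ^ 2 ^ n : ℕ) : ℝ))⁻¹ := zpow_neg_one _
      _ ≤ (2 ^ (n + 2))⁻¹ := by gcongr
      _ = _ := by rw [one_div, inv_pow]
  have hlowv : ∀ lam ∈ P.I, ns (N₀ ^ 2 ^ n) (16 * σL : ℕ) (v lam) ≤ 1 / 2 - (1 / 2) ^ (n + 2) ∧
      ns (N₀ ^ 2 ^ n) (16 * σL : ℕ) (v' lam) ≤ 1 / 2 - (1 / 2) ^ (n + 2) := by
    intro lam hl
    have e1 := ns_add_le (N₀ ^ 2 ^ n) (16 * σL : ℕ) (v lam - S.u lam) (S.u lam)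
    have e2 := ns_add_le (N₀ ^ 2 ^ n) (16 * σL : ℕ) (v' lam - S.u' lam) (S.u' lam)
    rw [sub_add_cancel] at e1 e2
    have e3 := (h2 lam hl).1.trans (hinv _ (by unfold resExp; push_cast; omega))
    have e4 := (h2 lam hl).2.trans (hinv _ (by unfold resExp; push_cast; omega))
    have e5 := hS.low lam hl
    constructor <;> linarith [e5.1, e5.2]
  have hvhalf : ∀ lam ∈ P.I, ns (N₀ ^ 2 ^ n) (16 * σL : ℕ) (v lam) ≤ 1 / 2 ∧
      ns (N₀ ^ 2 ^ n) (16 * σL : ℕ) (v' lam) ≤ 1 / 2 := fun lam hl => by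
    have e := hlowv lam hl
    constructor <;> linarith [e.1, e.2]
  -- One scale multiplies a high norm by at most `N ^ growExp`, and `N ^ growExp · N ^ growExp =
  -- (N²) ^ growExp`: the bound keeps its form at the squared scale.
  have hgrow : ∀ n', Sc.q n ≤ Sc.q n' → Sc.m (Sc.q n') ≤ n → ∀ lam ∈ P.I,
      1 + ns (N₀ ^ 2 ^ n) (16 * regExp b σL (Sc.q n') : ℕ) (v lam) ≤
        Sc.M (Sc.q n') * (((N₀ ^ 2 ^ n : ℕ) : ℝ) ^ 2) ^ growExp b σL (Sc.q n') ∧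
      1 + ns (N₀ ^ 2 ^ n) (16 * regExp b σL (Sc.q n') : ℕ) (v' lam) ≤
        Sc.M (Sc.q n') * (((N₀ ^ 2 ^ n : ℕ) : ℝ) ^ 2) ^ growExp b σL (Sc.q n') := by
    intro n' hn' hm lam hl
    have h := h4 _ _ _ (Sc.level n') (Sc.c_le n n' hm) (hS.high n' hn' hm) lam hl
    have hM := Sc.one_le_M (Sc.q n')
    have hle2 : ((N₀ ^ 2 ^ n : ℕ) : ℝ) ^ (2 * (2 * b + regExp b σL (Sc.q n') + 3 * resExp b k + 2)) *
        (Sc.M (Sc.q n') * ((N₀ ^ 2 ^ n : ℕ) : ℝ) ^ growExp b σL (Sc.q n')) ≤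
        Sc.M (Sc.q n') * (((N₀ ^ 2 ^ n : ℕ) : ℝ) ^ 2) ^ growExp b σL (Sc.q n') := by
      have hexp : 2 * (2 * b + regExp b σL (Sc.q n') + 3 * resExp b k + 2) ≤
          growExp b σL (Sc.q n') := by unfold growExp resExp; omega
      have h5 : ((N₀ ^ 2 ^ n : ℕ) : ℝ) ^ (2 * (2 * b + regExp b σL (Sc.q n') + 3 * resExp b k + 2)) ≤
          ((N₀ ^ 2 ^ n : ℕ) : ℝ) ^ growExp b σL (Sc.q n') :=
        pow_le_pow_right₀ (by linarith) hexp
      have h6 : (((N₀ ^ 2 ^ n : ℕ) : ℝ) ^ 2) ^ growExp b σL (Sc.q n') =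
          ((N₀ ^ 2 ^ n : ℕ) : ℝ) ^ growExp b σL (Sc.q n') *
            ((N₀ ^ 2 ^ n : ℕ) : ℝ) ^ growExp b σL (Sc.q n') := by ring
      rw [h6]
      generalize ((N₀ ^ 2 ^ n : ℕ) : ℝ) ^ growExp b σL (Sc.q n') = Y at *
      have hY : 0 ≤ Y := le_trans (by positivity) h5
      calc _ ≤ Y * (Sc.M (Sc.q n') * Y) :=
            mul_le_mul_of_nonneg_right h5 (mul_nonneg (by linarith) hY)
        _ = _ := by ring
    exact ⟨h.1.trans hle2, h.2.trans hle2⟩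
  refine ⟨⟨v, v', _⟩, ⟨fun lam hl => hS.subset hl.1, ?_, ?_, ?_, ?_⟩, ⟨rfl, fun lam hl => (h2 lam hl).1,
    fun lam hl => (h2 lam hl).2, fun lam hl => (WN K s₀ _).sub_mem (h1.mem lam hl) (hS.path.mem lam hl),
    fun lam hl => (WN K s₀ _).sub_mem (h1.mem' lam hl) (hS.path.mem' lam hl)⟩⟩
  · exact ⟨fun lam hl => WN_mono hle (h1.mem lam hl), fun lam hl => WN_mono hle (h1.mem' lam hl),
      h1.hasDeriv, h1.cont⟩
  · intro lam hl
    dsimp only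
    rw [ns_eq_ns hle (h1.mem lam hl), ns_eq_ns hle (h1.mem' lam hl)]
    exact hlowv lam hl
  · intro lam hl lam₀ hl₀ hd
    have hq1 := Sc.q_succ_le n
    have hq2 : Sc.q n ≤ Sc.q (n + 1) := Sc.q_mono (Nat.le_succ n)
    have hgr := hgrow n le_rfl (Sc.m_le n) lam hl
    have hlev := (Sc.level n).tame
    rw [reg_eq] at hlev hgr
    have hsc := residual_le_of_scale_change hB (hN n) (hN (n + 1)) hle hlev
      (h1.mem lam hl) (h1.mem' lam hl) (hvhalf lam hl).1 (hvhalf lam hl).2 hgr.1 hgr.2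
    have har := scale_change_arith (b := b) (g := resExp b k) (g' := resExp b (Sc.q (n + 1)))
      (G := growExp b σL k) (D := gapExp b σL k) (N := ((N₀ ^ 2 ^ n : ℕ) : ℝ)) (B := B)
      (Z := Sc.M k * (((N₀ ^ 2 ^ n : ℕ) : ℝ) ^ 2) ^ growExp b σL k) (c := Sc.c k) (M := Sc.M k)
      (by linarith) (by unfold resExp; omega) (by unfold resExp; omega) (grow_gap b σL k)
      (Sc.M_le n) le_rfl (Nat.cast_nonneg _) (by linarith)
    -- The neighbourhood required at the scale `N²` lies inside the one of radius `N ^ (-3 g)` on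
    -- which both Newton steps were effective.
    have hres := h3 lam hl lam₀ hl₀ (by
      refine hd.trans ?_
      rw [hsq, ← zpow_natCast, ← zpow_mul]
      have e1 : (3 : ℝ) ≤ ((N₀ ^ 2 ^ n : ℕ) : ℝ) ^ (1 : ℤ) := by rw [zpow_one]; linarith
      refine (mul_le_mul_of_nonneg_right e1 (by positivity)).trans ?_
      rw [← zpow_add₀ (by linarith : ((N₀ ^ 2 ^ n : ℕ) : ℝ) ≠ 0)]
      refine zpow_le_zpow_right₀ (by linarith) ?_
      unfold resExp
      push_cast
      omega)
    rw [hsq]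
    exact ⟨hsc.1.trans ((add_le_add_left hres.1 _).trans har.1),
      hsc.2.trans ((add_le_add_left hres.2 _).trans har.2)⟩
  · intro n' hn' hm lam hl
    dsimp only
    rw [ns_eq_ns hle (h1.mem lam hl), ns_eq_ns hle (h1.mem' lam hl), hsq]
    rcases hm.lt_or_eq with hlt | heq
    · exact hgrow n' ((Sc.q_mono (Nat.le_succ n)).trans hn') (by omega) lam hl
    -- A level tracked from this scale on has no earlier bound. Its norms are estimated by
    -- `ns_growth` from the low norm, and its constant was chosen for this purpose.
    · have hMge := Sc.M_ge n' (by omega)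
      have hbig : 1 + (B * ((N₀ ^ 2 ^ n : ℕ) : ℝ)) ^ gapExp b σL (Sc.q n') ≤
          Sc.M (Sc.q n') * (((N₀ ^ 2 ^ n : ℕ) : ℝ) ^ 2) ^ growExp b σL (Sc.q n') := by
        refine le_trans ?_ (hMge.trans (le_mul_of_one_le_right
          (zero_le_one.trans (Sc.one_le_M _)) (one_le_pow₀ (by nlinarith))))
        rw [heq]
        have : ((N₀ ^ 2 ^ n : ℕ) : ℝ) ≤ ((N₀ ^ 2 ^ (n + 1) : ℕ) : ℝ) := by exact_mod_cast hle
        gcongr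
      have hgr : ∀ x : Hs K s₀, ns (N₀ ^ 2 ^ n) (16 * σL : ℕ) x ≤ 1 / 2 →
          ns (N₀ ^ 2 ^ n) (16 * regExp b σL (Sc.q n') : ℕ) x ≤
            (B * ((N₀ ^ 2 ^ n : ℕ) : ℝ)) ^ gapExp b σL (Sc.q n') := by
        intro x hx
        have h := ns_growth hB (hN n).one_le (s := (16 * σL : ℕ))
          (s' := (16 * regExp b σL (Sc.q n') : ℕ)) (by
            rw [reg_eq]; exact le_add_of_nonneg_right (Nat.cast_nonneg _)) x
        rw [reg_eq, add_sub_cancel_left, Real.rpow_natCast] at h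
        rw [reg_eq]
        refine h.trans ?_
        have : 0 ≤ (B * ((N₀ ^ 2 ^ n : ℕ) : ℝ)) ^ gapExp b σL (Sc.q n') := by positivity
        nlinarith
      have e1 := hgr _ (hvhalf lam hl).1
      have e2 := hgr _ (hvhalf lam hl).2
      constructor <;> linarith

end Problem

/-! ### Completeness and limits of `C¹` paths -/

instance (s : ℝ) : CompleteSpace (Hs K s) := by
  have hiso : Isometry (Hs.toLp : Hs K s →ₗ[ℂ] _) :=
    AddMonoidHomClass.isometry_of_norm _ fun u => rfl
  refine (hiso.isUniformInducing.completeSpace_congr fun y => ?_).2 inferInstance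
  have hy : (fun k : Idx K => (bracket k ^ s) • ((bracket k ^ (-s)) • y k)) = fun k => y k := by
    funext k
    rw [smul_smul, ← Real.rpow_add (bracket_pos k), add_neg_cancel, Real.rpow_zero, one_smul]
  refine ⟨Hs.mk (fun k => (bracket k ^ (-s)) • y k) ((memHs_iff s _).2 ?_), Subtype.ext hy⟩
  have := lp.memℓp y
  rw [hy]
  exact this

theorem Hs.tendsto_val {ι : Type*} {F : Filter ι} {s : ℝ} {w : ι → Hs K s} {v : Hs K s}
    (h : Filter.Tendsto w F (nhds v)) (k : Idx K) :
    Filter.Tendsto (fun i => (w i).val k) F (nhds (v.val k)) := by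
  rw [tendsto_iff_norm_sub_tendsto_zero] at h ⊢
  have hb := bracket_pos k
  have hbs : 0 < bracket k ^ s := by positivity
  refine squeeze_zero (fun _ => norm_nonneg _) (fun i => ?_)
    (by simpa using h.const_mul (bracket k ^ s)⁻¹)
  have h1 := bracket_mul_le_snorm (w i - v).val_mem k
  rw [← Hs.norm_eq, Hs.val_sub, Pi.sub_apply] at h1
  rw [inv_mul_eq_div, le_div_iff₀ hbs, mul_comm]
  exact h1

section Limit

variable {V : Type*} [NormedAddCommGroup V] [NormedSpace ℝ V]

theorem tsum_shift_le {a : ℕ → ℝ} (h0 : ∀ n, 0 ≤ a n) (h : ∀ n, a (n + 1) ≤ a n / 2) :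
    Summable a ∧ ∀ n, ∑' i, a (n + i) ≤ 2 * a n := by
  have h1 : ∀ n i, a (n + i) ≤ a n * (1 / 2) ^ i := by
    intro n i
    induction i with
    | zero => simp
    | succ i ih =>
      have := h (n + i)
      rw [pow_succ, ← add_assoc]
      linarith
  have hg : ∀ n, Summable fun i => a n * (1 / 2 : ℝ) ^ i := fun n =>
    (summable_geometric_of_lt_one (by norm_num) (by norm_num)).mul_left _
  have hs : ∀ n, Summable fun i => a (n + i) := fun n =>
    Summable.of_nonneg_of_le (fun i => h0 _) (h1 n) (hg n)
  refine ⟨by simpa using hs 0, fun n => ?_⟩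
  refine ((hs n).tsum_le_tsum (h1 n) (hg n)).trans (le_of_eq ?_)
  rw [tsum_mul_left, tsum_geometric_of_lt_one (by norm_num) (by norm_num)]
  ring

theorem exists_limit {W : Type*} [NormedAddCommGroup W] [CompleteSpace W] {a : ℕ → ℝ} (ha : Summable a) {I : Set ℝ} {w : ℕ → ℝ → W}
    (h : ∀ n, ∀ x ∈ I, ‖w (n + 1) x - w n x‖ ≤ a n) :
    ∃ v : ℝ → W, ∀ x ∈ I, Filter.Tendsto (fun n => w n x) Filter.atTop (nhds (v x)) ∧
      ∀ n, ‖v x - w n x‖ ≤ ∑' i, a (n + i) := by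
  have hd : ∀ x ∈ I, ∀ n, dist (w n x) (w n.succ x) ≤ a n := fun x hx n => by
    rw [dist_comm, dist_eq_norm]; exact h n x hx
  have hex : ∀ x, ∃ y, x ∈ I → Filter.Tendsto (fun n => w n x) Filter.atTop (nhds y) := by
    intro x
    by_cases hx : x ∈ I
    · obtain ⟨y, hy⟩ := cauchySeq_tendsto_of_complete
        (cauchySeq_of_dist_le_of_summable a (hd x hx) ha)
      exact ⟨y, fun _ => hy⟩
    · exact ⟨0, fun hx' => absurd hx' hx⟩
  choose v hv using hex
  refine ⟨v, fun x hx => ⟨hv x hx, fun n => ?_⟩⟩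
  rw [← dist_eq_norm, dist_comm]
  exact dist_le_tsum_of_dist_le_of_tendsto a (hd x hx) ha (hv x hx) n

/-- By the mean value inequality `w m - w n` is Lipschitz with constant `δ m + δ n`. Letting `m`
tend to infinity compares `v` with `w n`, and the derivative of `v` follows from that of `w n` with
an error `δ n`. -/
theorem hasDerivWithinAt_of_limit {I : Set ℝ} (hI : Convex ℝ I) {w w' : ℕ → ℝ → V} {v v' : ℝ → V}
    (hd : ∀ n, ∀ x ∈ I, HasDerivWithinAt (w n) (w' n x) I x)
    (hv : ∀ x ∈ I, Filter.Tendsto (fun n => w n x) Filter.atTop (nhds (v x)))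
    {δ : ℕ → ℝ} (hδ : Filter.Tendsto δ Filter.atTop (nhds 0))
    (hv' : ∀ n, ∀ x ∈ I, ‖v' x - w' n x‖ ≤ δ n) {x : ℝ} (hx : x ∈ I) :
    HasDerivWithinAt v (v' x) I x := by
  have hmv : ∀ n m : ℕ, ∀ y ∈ I, ‖(w m y - w n y) - (w m x - w n x)‖ ≤ (δ m + δ n) * ‖y - x‖ :=
    fun n m y hy => hI.norm_image_sub_le_of_norm_hasDerivWithin_le
      (f := fun y => w m y - w n y) (f' := fun y => w' m y - w' n y)
      (fun z hz => (hd m z hz).sub (hd n z hz)) (fun z hz => by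
        have e : w' m z - w' n z = (v' z - w' n z) - (v' z - w' m z) := by abel
        rw [e]
        exact (norm_sub_le _ _).trans (by linarith [hv' n z hz, hv' m z hz])) hx hy
  have hlim : ∀ n : ℕ, ∀ y ∈ I, ‖(v y - w n y) - (v x - w n x)‖ ≤ δ n * ‖y - x‖ := by
    intro n y hy
    have t1 := (((hv y hy).sub_const (w n y)).sub ((hv x hx).sub_const (w n x))).norm
    have t2 := (hδ.add_const (δ n)).mul_const ‖y - x‖
    rw [zero_add] at t2
    exact le_of_tendsto_of_tendsto' t1 t2 fun m => hmv n m y hy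
  rw [hasDerivWithinAt_iff_isLittleO, Asymptotics.isLittleO_iff]
  intro c hc
  obtain ⟨n, hn⟩ := ((tendsto_order.1 hδ).2 (c / 3) (by positivity)).exists
  have h1 := (Asymptotics.isLittleO_iff.1 (hasDerivWithinAt_iff_isLittleO.1 (hd n x hx)))
    (by positivity : 0 < c / 3)
  filter_upwards [h1, self_mem_nhdsWithin] with y hy hyI
  have e : v y - v x - (y - x) • v' x = ((v y - w n y) - (v x - w n x)) +
      (w n y - w n x - (y - x) • w' n x) - (y - x) • (v' x - w' n x) := by
    rw [smul_sub]; abel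
  rw [e]
  have h2 := hlim n y hyI
  have h3 : ‖(y - x) • (v' x - w' n x)‖ ≤ ‖y - x‖ * δ n := by
    rw [norm_smul]
    exact mul_le_mul_of_nonneg_left (hv' n x hx) (norm_nonneg _)
  have h4 := norm_sub_le ((v y - w n y) - (v x - w n x) + (w n y - w n x - (y - x) • w' n x))
    ((y - x) • (v' x - w' n x))
  have h5 := norm_add_le ((v y - w n y) - (v x - w n x)) (w n y - w n x - (y - x) • w' n x)
  have h6 : δ n * ‖y - x‖ ≤ c / 3 * ‖y - x‖ := by gcongr
  linarith

theorem contDiffOn_of_limit {I : Set ℝ} (hI : Convex ℝ I) (hI' : UniqueDiffOn ℝ I)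
    {w w' : ℕ → ℝ → V} {v v' : ℝ → V}
    (hd : ∀ n, ∀ x ∈ I, HasDerivWithinAt (w n) (w' n x) I x) (hc : ∀ n, ContinuousOn (w' n) I)
    (hv : ∀ x ∈ I, Filter.Tendsto (fun n => w n x) Filter.atTop (nhds (v x)))
    {δ : ℕ → ℝ} (hδ : Filter.Tendsto δ Filter.atTop (nhds 0))
    (hv' : ∀ n, ∀ x ∈ I, ‖v' x - w' n x‖ ≤ δ n) : ContDiffOn ℝ 1 v I := by
  have hder : ∀ x ∈ I, HasDerivWithinAt v (v' x) I x := fun x hx =>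
    hasDerivWithinAt_of_limit hI hd hv hδ hv' hx
  have hcont : ContinuousOn v' I := by
    have hu : TendstoUniformlyOn w' v' Filter.atTop I := by
      rw [Metric.tendstoUniformlyOn_iff]
      intro ε hε
      filter_upwards [(tendsto_order.1 hδ).2 ε hε] with n hn x hx
      rw [dist_eq_norm]
      exact (hv' n x hx).trans_lt hn
    exact hu.continuousOn (Filter.Eventually.frequently (.of_forall hc))
  have h1 : ContDiffOn ℝ (0 + 1) v I := by
    rw [contDiffOn_succ_iff_derivWithin hI']
    refine ⟨fun x hx => (hder x hx).differentiableWithinAt, by simp, contDiffOn_zero.2 ?_⟩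
    exact hcont.congr fun x hx => (hder x hx).derivWithin (hI' x hx)
  simpa using h1

end Limit

/-! ### Schedules of regularity and the start of the iteration -/

/-- A slowly increasing sequence of levels. -/
theorem exists_slow_sequence (h : ℕ → ℕ) (h0 : h 0 = 0) : ∃ q : ℕ → ℕ, q 0 = 0 ∧ Monotone q ∧
    (∀ n, q (n + 1) ≤ q n + 1) ∧ (∀ n, h (q n) ≤ n) ∧ ∀ k, ∃ n₀, ∀ n, n₀ ≤ n → k ≤ q n := by
  -- The level is raised by one as soon as `h` permits it.
  let q : ℕ → ℕ := fun n => Nat.rec 0 (fun n k => if h (k + 1) ≤ n + 1 then k + 1 else k) n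
  have hq : ∀ n, q (n + 1) = if h (q n + 1) ≤ n + 1 then q n + 1 else q n := fun n => rfl
  have hle : ∀ n, q n ≤ q (n + 1) := fun n => by rw [hq]; split_ifs <;> omega
  have hmono : Monotone q := monotone_nat_of_le_succ hle
  refine ⟨q, rfl, hmono, fun n => by rw [hq]; split_ifs <;> omega, fun n => ?_, fun k => ?_⟩
  · induction n with
    | zero => exact h0.le
    | succ n ih =>
      rw [hq]
      split_ifs with hc
      · exact hc
      · omega
  · suffices ∃ n₀, k ≤ q n₀ by
      obtain ⟨n₀, hn₀⟩ := this
      exact ⟨n₀, fun n hn => hn₀.trans (hmono hn)⟩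
    induction k with
    | zero => exact ⟨0, Nat.zero_le _⟩
    | succ k ih =>
      obtain ⟨n₀, hn₀⟩ := ih
      by_contra! hcon
      have he : ∀ n, n₀ ≤ n → q n = k := fun n hn => by
        have := hmono hn
        have := hcon n
        omega
      have h1 := hq (n₀ + h (k + 1))
      have e1 := he (n₀ + h (k + 1)) (by omega)
      have e2 := he (n₀ + h (k + 1) + 1) (by omega)
      rw [e1, e2, if_pos (by omega)] at h1
      omega

theorem exists_iterate {α : Type*} {J : ℕ → α → Prop} {R : ℕ → α → α → Prop} {x₀ : α} (h0 : J 0 x₀)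
    (h : ∀ n x, J n x → ∃ y, J (n + 1) y ∧ R n x y) :
    ∃ f : ℕ → α, f 0 = x₀ ∧ (∀ n, J n (f n)) ∧ ∀ n, R n (f n) (f (n + 1)) := by
  choose! g hg1 hg2 using h
  let f : ℕ → α := fun n => Nat.rec x₀ (fun n x => g n x) n
  have hJ : ∀ n, J n (f n) := fun n => by
    induction n with
    | zero => exact h0
    | succ n ih => exact hg1 n _ ih
  exact ⟨f, rfl, hJ, fun n => hg2 n _ (hJ n)⟩

namespace Problem

variable {s₀ ν ν₀ K₁ : ℝ} {P : Problem K s₀ ν ν₀ K₁} {ee e : ℝ} {X : Expo K ee e} {σL N₀ : ℕ}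
  {B C ε : ℝ}

/-- At the zero path the residual is the truncation of `ε f 0`, which the condition on `ε` makes
small enough; its derivative in the parameter vanishes. -/
theorem invariant_zero (Sc : P.Schedule X σL N₀ B)
    (hN : ∀ n, P.ScaleOK (16 * σL : ℕ) C (diagExp ν) (N₀ ^ 2 ^ n) ε)
    (hε : ε * (N₀ : ℝ) ^ (4 * resExp (baseExp X ν ν₀ σL) 0 + 1) ≤ 1) :
    Invariant Sc hN 0 ⟨0, 0, P.I⟩ := by
  have hN0 := (hN 0).one_le
  have hz : ∀ s, ns (N₀ ^ 2 ^ 0) s (0 : Hs K s₀) = 0 := fun s => by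
    unfold ns; rw [map_zero, norm_zero]
  have hN1 : (1 : ℝ) ≤ ((N₀ ^ 2 ^ 0 : ℕ) : ℝ) := by exact_mod_cast hN0
  refine ⟨subset_rfl, ⟨fun _ _ => (WN K s₀ _).zero_mem, fun _ _ => (WN K s₀ _).zero_mem,
    fun lam _ => hasDerivWithinAt_const lam _ (0 : Hs K s₀), continuousOn_const⟩, ?_, ?_, ?_⟩
  · intro lam _
    simp only [Pi.zero_apply, hz]
    norm_num
  · intro lam _ _ _ _
    constructor
    · have e1 : (env (hN 0)).res 0 lam = ε • proj (bx (N₀ ^ 2 ^ 0) 0) s₀ (P.f 0) := by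
        change dop _ _ (0 : Hs K s₀) + ε • proj (bx (N₀ ^ 2 ^ 0) 0) s₀ (P.f 0) = _
        rw [map_zero, zero_add]
      rw [e1]
      change ns (N₀ ^ 2 ^ 0) (16 * σL : ℕ) _ ≤ _
      have h1 := (hN 0).tame.le (N₀ ^ 2 ^ 0) (N₀ ^ 2 ^ 0) 0 (WN K s₀ _).zero_mem (by simp)
      rw [hz, add_zero, mul_one] at h1
      refine (ns_smul_proj_le (hN 0).ε_nonneg _).trans ?_
      have h2 := (hN 0).two_mul_le
      have h3 := (hN 0).tame.one_le
      rw [Sc.q_zero, zpow_neg, zpow_natCast, ← one_div, le_div_iff₀ (by positivity)]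
      have h4 : ns (N₀ ^ 2 ^ 0) (16 * σL : ℕ) (P.f 0) ≤ ((N₀ ^ 2 ^ 0 : ℕ) : ℝ) := by linarith
      have h5 := (hN 0).ε_nonneg
      rw [pow_zero, pow_one] at *
      calc _ ≤ ε * N₀ * (N₀ : ℝ) ^ (4 * resExp (baseExp X ν ν₀ σL) 0) := by gcongr
        _ = ε * (N₀ : ℝ) ^ (4 * resExp (baseExp X ν ν₀ σL) 0 + 1) := by ring
        _ ≤ 1 := hε
    · have e1 : (env (hN 0)).res' 0 0 lam = 0 := by
        change dop _ _ (0 : Hs K s₀) + (env (hN 0)).L lam _ (0 : Hs K s₀) = 0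
        rw [map_zero, map_zero, add_zero]
      rw [e1, map_zero, norm_zero]
      positivity
  · intro n' _ _ lam _
    simp only [Pi.zero_apply, hz]
    have h1 := Sc.one_le_M (Sc.q n')
    have h2 : (1 : ℝ) ≤ ((N₀ ^ 2 ^ 0 : ℕ) : ℝ) ^ growExp (baseExp X ν ν₀ σL) σL (Sc.q n') :=
      one_le_pow₀ hN1
    have h3 := one_le_mul_of_one_le_of_one_le h1 h2
    exact ⟨by linarith, by linarith⟩

theorem le_scale {N₀ : ℕ} (h : 2 ≤ N₀) (n : ℕ) : n ≤ N₀ ^ 2 ^ n := by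
  have h1 : n < 2 ^ n := Nat.lt_two_pow_self
  have h2 : 2 ^ n < 2 ^ 2 ^ n := Nat.lt_two_pow_self
  have h3 : 2 ^ 2 ^ n ≤ N₀ ^ 2 ^ n := Nat.pow_le_pow_left h _
  omega

/-- The schedule with a single level. -/
def constSchedule {c : ℕ} (h : P.Level X (regExp (baseExp X ν ν₀ σL) σL 0) c) (hc : c ≤ N₀)
    (hM : 2 * c * B ^ gapExp (baseExp X ν ν₀ σL) σL 0 ≤ N₀) : P.Schedule X σL N₀ B where
  q := fun _ => 0
  c := fun _ => c
  m := fun _ => 0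
  M := fun _ => 1
  q_zero := rfl
  q_mono := monotone_const
  q_succ_le := fun _ => by omega
  level := fun _ => h
  c_le := fun n _ _ => hc.trans (le_pow_two_pow N₀ n)
  m_le := fun _ => Nat.zero_le _
  one_le_M := fun _ => le_rfl
  M_ge := fun _ h => absurd rfl h
  M_le := fun n => by
    rw [mul_one]
    exact hM.trans (by exact_mod_cast le_pow_two_pow N₀ n)

/-- Level `k ≥ 1` is tracked from the index `m k = c k` on, where the scale is large enough for its
estimates; `M k` is the Bernstein bound at that scale. It may drive the iteration only once the
scale dominates all its constants, which is the delay `t k`. Level `0` is available at once, by the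
assumptions on `N₀`. -/
theorem exists_schedule_tendsto (hB : 1 ≤ B) {c : ℕ → ℕ}
    (h : ∀ k, P.Level X (regExp (baseExp X ν ν₀ σL) σL k) (c k)) (hN₀ : 2 ≤ N₀) (hc : c 0 ≤ N₀)
    (hM : 2 * c 0 * B ^ gapExp (baseExp X ν ν₀ σL) σL 0 ≤ N₀) :
    ∃ Sc : P.Schedule X σL N₀ B, ∀ k, ∃ n₀, ∀ n, n₀ ≤ n → k ≤ Sc.q n := by
  let m : ℕ → ℕ := fun k => if k = 0 then 0 else c k
  let M : ℕ → ℝ := fun k => if k = 0 then 1 else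
    1 + (B * (N₀ ^ 2 ^ m k : ℕ)) ^ gapExp (baseExp X ν ν₀ σL) σL k
  let t : ℕ → ℕ := fun k => if k = 0 then 0 else
    max (m k) ⌈2 * c k * B ^ gapExp (baseExp X ν ν₀ σL) σL k * M k⌉₊
  obtain ⟨q, h1, h2, h3, h4, h5⟩ := exists_slow_sequence t rfl
  refine ⟨⟨q, c, m, M, h1, h2, h3, fun n => h _, fun n n' hn => ?_, fun n => ?_, fun k => ?_,
    fun n hn => ?_, fun n => ?_⟩, h5⟩
  · by_cases hq : q n' = 0
    · rw [hq]; exact hc.trans (le_pow_two_pow N₀ n)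
    · simp only [m, if_neg hq] at hn
      exact hn.trans (le_scale hN₀ n)
  · by_cases hq : q n = 0
    · simp [m, hq]
    · have := h4 n
      simp only [t, if_neg hq] at this
      exact (le_max_left _ _).trans this
  · by_cases hk : k = 0
    · simp [M, hk]
    · simp only [M, if_neg hk]
      exact le_add_of_nonneg_right (by positivity)
  · by_cases hq : q n = 0
    · simp [m, hq] at hn
    · simp only [M, if_neg hq]; exact le_rfl
  · by_cases hq : q n = 0
    · rw [hq]
      simp only [M, if_true, mul_one]
      exact hM.trans (by exact_mod_cast le_pow_two_pow N₀ n)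
    · have h6 := h4 n
      simp only [t, if_neg hq] at h6
      have h7 := (le_max_right _ _).trans h6
      rw [Nat.ceil_le] at h7
      exact h7.trans (by exact_mod_cast le_scale hN₀ n)

end Problem

/-! ### The limit of the iteration -/

namespace Problem

variable {s₀ ν ν₀ K₁ : ℝ} {P : Problem K s₀ ν ν₀ K₁} {ee e : ℝ} {X : Expo K ee e} {σL N₀ : ℕ}
  {B C ε : ℝ}

/-- A run of the iteration. -/
structure Run (Sc : P.Schedule X σL N₀ B)
    (hN : ∀ n, P.ScaleOK (16 * σL : ℕ) C (diagExp ν) (N₀ ^ 2 ^ n) ε) (F : ℕ → State K s₀) : Prop where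
  zero : F 0 = ⟨0, 0, P.I⟩
  inv : ∀ n, Invariant Sc hN n (F n)
  rel : ∀ n, Consecutive Sc ε n (F n) (F (n + 1))

/-- The paths of a run, in the space of low regularity. -/
def lowPath (σL N₀ : ℕ) (w : ℝ → Hs K s₀) (n : ℕ) (lam : ℝ) : Hs K (16 * σL : ℕ) :=
  proj (bx (N₀ ^ 2 ^ n) 0) (16 * σL : ℕ) (w lam)

theorem lowPath_val {w : ℝ → Hs K s₀} {n : ℕ} {lam : ℝ} (h : w lam ∈ WN K s₀ (N₀ ^ 2 ^ n)) :
    (lowPath σL N₀ w n lam).val = (w lam).val := restr_of_suppIn h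

theorem norm_lowPath_sub {w w' : ℝ → Hs K s₀} {n : ℕ} {lam : ℝ}
    (h : w lam ∈ WN K s₀ (N₀ ^ 2 ^ n)) (h' : w' lam ∈ WN K s₀ (N₀ ^ 2 ^ (n + 1)))
    (hd : w' lam - w lam ∈ WN K s₀ (N₀ ^ 2 ^ n)) :
    ‖lowPath σL N₀ w' (n + 1) lam - lowPath σL N₀ w n lam‖ =
      ns (N₀ ^ 2 ^ n) (16 * σL : ℕ) (w' lam - w lam) := by
  rw [Hs.norm_eq, Hs.val_sub, lowPath_val h, lowPath_val h', ns_eq_snorm hd, Hs.val_sub]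

/-- The geometric sequence that bounds the increments of a run. -/
def incr (N₀ cl n : ℕ) : ℝ := (((N₀ ^ 2 ^ n : ℕ) : ℝ) ^ (cl + 1))⁻¹

theorem incr_nonneg (N₀ cl n : ℕ) : 0 ≤ incr N₀ cl n := by unfold incr; positivity

theorem incr_succ_le (h : 2 ≤ N₀) (cl n : ℕ) : incr N₀ cl (n + 1) ≤ incr N₀ cl n / 2 := by
  have h1 : (2 : ℝ) ≤ ((N₀ ^ 2 ^ n : ℕ) : ℝ) := by exact_mod_cast h.trans (le_pow_two_pow N₀ n)
  unfold incr
  rw [scale_succ, Nat.cast_pow (N₀ ^ 2 ^ n) 2]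
  generalize ((N₀ ^ 2 ^ n : ℕ) : ℝ) = x at *
  rw [div_eq_mul_inv, ← mul_inv]
  refine inv_anti₀ (by positivity) ?_
  have h2 : 2 ≤ x ^ (cl + 1) := h1.trans (le_self_pow₀ (by linarith) (by omega))
  calc x ^ (cl + 1) * 2 ≤ x ^ (cl + 1) * x ^ (cl + 1) := by gcongr
    _ = _ := by ring

theorem two_mul_incr_le (h : 2 ≤ N₀) (cl n : ℕ) :
    2 * incr N₀ cl n ≤ (((N₀ ^ 2 ^ n : ℕ) : ℝ) ^ cl)⁻¹ := by
  have h1 : (2 : ℝ) ≤ ((N₀ ^ 2 ^ n : ℕ) : ℝ) := by exact_mod_cast h.trans (le_pow_two_pow N₀ n)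
  unfold incr
  generalize ((N₀ ^ 2 ^ n : ℕ) : ℝ) = x at *
  have h2 : 0 < x ^ cl := by positivity
  rw [pow_succ, mul_inv, ← mul_assoc, mul_comm 2, mul_assoc]
  refine mul_le_of_le_one_right (by positivity) ?_
  rw [← div_eq_mul_inv, div_le_one (by linarith)]
  exact h1

variable {Sc : P.Schedule X σL N₀ B}
  {hN : ∀ n, P.ScaleOK (16 * σL : ℕ) C (diagExp ν) (N₀ ^ 2 ^ n) ε} {F : ℕ → State K s₀}

/-- `baseExp` contains `closeExp`, so the increments are small enough for the transfer of the
parameter sets. The derivatives only need summable increments. -/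
theorem Run.norm_sub_le (h : Run Sc hN F) (h2 : 2 ≤ N₀) {lam : ℝ} (hl : lam ∈ P.I) (n : ℕ) :
    ‖lowPath σL N₀ (F (n + 1)).u (n + 1) lam - lowPath σL N₀ (F n).u n lam‖ ≤
      incr N₀ (closeExp X) n := by
  rw [norm_lowPath_sub ((h.inv n).path.mem lam hl) ((h.inv (n + 1)).path.mem lam hl)
    ((h.rel n).mem lam hl)]
  refine ((h.rel n).le lam hl).trans ?_
  have h1 : (2 : ℝ) ≤ ((N₀ ^ 2 ^ n : ℕ) : ℝ) := by exact_mod_cast h2.trans (le_pow_two_pow N₀ n)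
  rw [incr, ← zpow_natCast, ← zpow_neg]
  refine zpow_le_zpow_right₀ (by linarith) ?_
  have : closeExp X ≤ baseExp X ν ν₀ σL := by unfold baseExp; omega
  unfold resExp
  push_cast
  omega

theorem Run.norm_sub_le' (h : Run Sc hN F) (h2 : 4 ≤ N₀) {lam : ℝ} (hl : lam ∈ P.I) (n : ℕ) :
    ‖lowPath σL N₀ (F (n + 1)).u' (n + 1) lam - lowPath σL N₀ (F n).u' n lam‖ ≤
      incr N₀ 0 n := by
  rw [norm_lowPath_sub ((h.inv n).path.mem' lam hl) ((h.inv (n + 1)).path.mem' lam hl)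
    ((h.rel n).mem' lam hl)]
  refine ((h.rel n).le' lam hl).trans ?_
  have h1 : (4 : ℝ) ≤ ((N₀ ^ 2 ^ n : ℕ) : ℝ) := by exact_mod_cast h2.trans (le_pow_two_pow N₀ n)
  rw [incr, ← zpow_natCast, ← zpow_neg]
  refine zpow_le_zpow_right₀ (by linarith) ?_
  unfold resExp
  push_cast
  omega

theorem tendsto_incr (h : 2 ≤ N₀) (cl : ℕ) :
    Filter.Tendsto (fun n => 2 * incr N₀ cl n) Filter.atTop (nhds 0) := by
  have := (tsum_shift_le (incr_nonneg N₀ cl) (incr_succ_le h cl)).1.tendsto_atTop_zero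
  simpa using this.const_mul 2

/-- The limit of a run is a `C¹` path. -/
theorem Run.exists_limit (h : Run Sc hN F) (h4 : 4 ≤ N₀) : ∃ v : ℝ → Hs K (16 * σL : ℕ),
    ContDiffOn ℝ 1 v P.I ∧ ∀ lam ∈ P.I,
      Filter.Tendsto (fun n => lowPath σL N₀ (F n).u n lam) Filter.atTop (nhds (v lam)) ∧
      ‖v lam‖ ≤ 1 / 2 ∧ ∀ n, ‖v lam - lowPath σL N₀ (F n).u n lam‖ ≤
        (((N₀ ^ 2 ^ n : ℕ) : ℝ) ^ closeExp X)⁻¹ := by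
  have h2 : 2 ≤ N₀ := by omega
  have s1 := tsum_shift_le (incr_nonneg N₀ (closeExp X)) (incr_succ_le h2 _)
  have s2 := tsum_shift_le (incr_nonneg N₀ 0) (incr_succ_le h2 _)
  obtain ⟨v, hv⟩ := SeqScale.exists_limit s1.1 (I := P.I)
    (w := fun n => lowPath σL N₀ (F n).u n) fun n lam hl => h.norm_sub_le h2 hl n
  obtain ⟨v', hv'⟩ := SeqScale.exists_limit s2.1 (I := P.I)
    (w := fun n => lowPath σL N₀ (F n).u' n) fun n lam hl => h.norm_sub_le' h4 hl n
  refine ⟨v, contDiffOn_of_limit P.ordConnected.convex P.uniqueDiffOn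
    (w := fun n => lowPath σL N₀ (F n).u n) (w' := fun n => lowPath σL N₀ (F n).u' n) (v' := v')
    (fun n lam hl => ?_) (fun n => ?_) (fun lam hl => (hv lam hl).1) (tendsto_incr h2 0)
    (fun n lam hl => ((hv' lam hl).2 n).trans (s2.2 n)), fun lam hl => ⟨(hv lam hl).1, ?_, fun n =>
      ((hv lam hl).2 n).trans ((s1.2 n).trans (two_mul_incr_le h2 _ n))⟩⟩
  · exact (proj (bx (N₀ ^ 2 ^ n) 0) (16 * σL : ℕ)).hasFDerivAt.comp_hasDerivWithinAt lam
      ((h.inv n).path.hasDeriv lam hl)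
  · exact (proj (bx (N₀ ^ 2 ^ n) 0) (16 * σL : ℕ)).continuous.comp_continuousOn (h.inv n).path.cont
  · refine le_of_tendsto' (hv lam hl).1.norm fun n => ?_
    have := ((h.inv n).low lam hl).1
    have h0 : (0 : ℝ) < (1 / 2) ^ (n + 1) := by positivity
    change ns (N₀ ^ 2 ^ n) (16 * σL : ℕ) ((F n).u lam) ≤ 1 / 2
    linarith

theorem tendsto_scale_inv (h : 2 ≤ N₀) :
    Filter.Tendsto (fun n => (((N₀ ^ 2 ^ n : ℕ) : ℝ))⁻¹) Filter.atTop (nhds 0) := by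
  refine tendsto_inv_atTop_zero.comp (Filter.tendsto_atTop_mono (fun n => ?_)
    tendsto_natCast_atTop_atTop)
  exact_mod_cast le_scale h n

/-- The limit of a run solves the equation on the intersection of the parameter sets. -/
theorem Run.eq_zero (h : Run Sc hN F) (h2 : 2 ≤ N₀) {lam : ℝ} (hA : ∀ n, lam ∈ (F n).A)
    {u : Hs K s₀} (hu : ‖u‖ < 1)
    (hlim : Filter.Tendsto (fun n => (F n).u lam) Filter.atTop (nhds u)) :
    Fop P.D P.f ε lam u = 0 := by
  have hl : lam ∈ P.I := (h.inv 0).subset (hA 0)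
  funext k
  have hf : Filter.Tendsto (fun n => P.f ((F n).u lam)) Filter.atTop (nhds (P.f u)) :=
    (P.hasFDerivAt_f hu).continuousAt.tendsto.comp hlim
  have t1 : Filter.Tendsto (fun n => P.D k lam • ((F n).u lam).val k +
      (ε : ℂ) • (P.f ((F n).u lam)).val k) Filter.atTop (nhds (Fop P.D P.f ε lam u k)) :=
    ((Hs.tendsto_val hlim k).const_smul _).add ((Hs.tendsto_val hf k).const_smul _)
  -- Each component is eventually inside the box, where it agrees with a component of the residual
  -- of the truncated equation.
  refine tendsto_nhds_unique t1 (squeeze_zero_norm' ?_ (tendsto_scale_inv h2))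
  obtain ⟨n₀, hn₀⟩ := exists_nat_ge ‖site k‖
  filter_upwards [Filter.eventually_ge_atTop n₀] with n hn
  have hk : k ∈ bx (N₀ ^ 2 ^ n) 0 := by
    rw [mem_bx_zero]
    exact hn₀.trans (by exact_mod_cast hn.trans (le_scale h2 n))
  have hres := ((h.inv n).res lam hl lam (hA n) (by rw [sub_self, abs_zero]; positivity)).1
  have hval : ((env (hN n)).res (F n).u lam).val k =
      P.D k lam • ((F n).u lam).val k + (ε : ℂ) • (P.f ((F n).u lam)).val k := by
    change (dop _ _ ((F n).u lam) + ε • proj (bx (N₀ ^ 2 ^ n) 0) s₀ (P.f ((F n).u lam))).val k = _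
    rw [Hs.val_add, Pi.add_apply, dop_val _ _ _ _ hk, Hs.val_real_smul, Pi.smul_apply, proj_val,
      restr_apply hk]
    exact congrArg _ (Complex.coe_smul ε _).symm
  rw [← hval]
  have h1 : (2 : ℝ) ≤ ((N₀ ^ 2 ^ n : ℕ) : ℝ) := by exact_mod_cast h2.trans (le_pow_two_pow N₀ n)
  refine (norm_val_le_ns (Nat.cast_nonneg (16 * σL)) _ hk).trans (hres.trans ?_)
  rw [← zpow_neg_one]
  refine zpow_le_zpow_right₀ (by linarith) ?_
  unfold resExp
  push_cast
  omega

/-- If the levels tend to infinity, the limit of a run is smooth. -/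
theorem Run.memHs (hB : IsBracketConst K B) (h : Run Sc hN F) (h2 : 2 ≤ N₀)
    (hq : ∀ k, ∃ n₀, ∀ n, n₀ ≤ n → k ≤ Sc.q n) {lam : ℝ} (hl : lam ∈ P.I) {u : Hs K s₀}
    (hlim : Filter.Tendsto (fun n => (F n).u lam) Filter.atTop (nhds u)) (s : ℝ) :
    MemHs s u.val := by
  have hB1 := hB.one_le
  obtain ⟨S, hS⟩ := exists_nat_ge s
  set D := S - 16 * σL with hD
  have hSD : s ≤ (16 * σL : ℕ) + D := by
    refine hS.trans ?_
    have : S ≤ 16 * σL + D := by omega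
    exact_mod_cast this
  obtain ⟨n₀, hn₀⟩ := hq D
  have s1 := tsum_shift_le (incr_nonneg N₀ 0) (incr_succ_le h2 _)
  -- In this space an increment costs at most a constant times `N ^ D` more than in the low norm.
  -- Once the level is at least `D`, the exponent `-4 resExp` of the increments contains `-4 D`, and
  -- the sequence is Cauchy.
  set y : ℕ → Hs K ((16 * σL : ℕ) + D) :=
    fun n => proj (bx (N₀ ^ 2 ^ (n + n₀)) 0) ((16 * σL : ℕ) + D) ((F (n + n₀)).u lam) with hy
  have hyval : ∀ n, (y n).val = ((F (n + n₀)).u lam).val := fun n =>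
    restr_of_suppIn ((h.inv (n + n₀)).path.mem lam hl)
  have hdist : ∀ n, dist (y n) (y n.succ) ≤ B ^ D * incr N₀ 0 (n + n₀) := by
    intro n
    have hmem := (h.rel (n + n₀)).mem lam hl
    have h1 : (2 : ℝ) ≤ ((N₀ ^ 2 ^ (n + n₀) : ℕ) : ℝ) := by
      exact_mod_cast h2.trans (le_pow_two_pow N₀ (n + n₀))
    rw [dist_comm, dist_eq_norm, Hs.norm_eq, Hs.val_sub, hyval, hyval, Nat.succ_eq_add_one,
      show n + 1 + n₀ = n + n₀ + 1 by ring, ← Hs.val_sub, ← ns_eq_snorm hmem]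
    have hg := ns_growth hB (hN (n + n₀)).one_le (s := (16 * σL : ℕ))
      (s' := (16 * σL : ℕ) + D) (le_add_of_nonneg_right (Nat.cast_nonneg _))
      ((F (n + n₀ + 1)).u lam - (F (n + n₀)).u lam)
    rw [add_sub_cancel_left, Real.rpow_natCast, mul_pow] at hg
    refine hg.trans ?_
    rw [mul_assoc]
    refine mul_le_mul_of_nonneg_left ?_ (by positivity)
    refine (mul_le_mul_of_nonneg_left ((h.rel (n + n₀)).le lam hl) (by positivity)).trans ?_
    rw [incr, ← zpow_natCast, ← zpow_natCast, ← zpow_neg, ← zpow_add₀ (by linarith)]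
    refine zpow_le_zpow_right₀ (by linarith) ?_
    have := hn₀ (n + n₀) (by omega)
    unfold resExp
    push_cast
    omega
  obtain ⟨z, hz⟩ := cauchySeq_tendsto_of_complete (cauchySeq_of_dist_le_of_summable _ hdist
    (((summable_nat_add_iff n₀).2 s1.1).mul_left _))
  have hzu : z.val = u.val := by
    funext k
    have t1 := Hs.tendsto_val hz k
    simp only [hyval] at t1
    exact tendsto_nhds_unique t1 ((Hs.tendsto_val hlim k).comp (Filter.tendsto_add_atTop_nat n₀))
  rw [← hzu]
  exact memHs_mono hSD z.val_mem

end Problem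

/-! ### Choice of the exponents and existence of the solution for a given `ε` -/

theorem Hs.val_mk {s : ℝ} (u : Seq K) (hu : MemHs s u) : (Hs.mk u hu).val = u := rfl

/-- The exponent `ζ` is constrained only from below, so it can be increased. -/
theorem exists_expo_with_decay (ee e s : ℝ) : ∃ X : Expo K ee e, s < Problem.decayExp X := by
  obtain ⟨X⟩ := nonempty_expo (K := K) ee e
  refine ⟨{ X with ζ := X.ζ + ⌈s⌉₊ + 1, hζ := X.hζ.trans (by omega) }, ?_⟩
  refine (Nat.le_ceil s).trans_lt ?_
  unfold Problem.decayExp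
  norm_cast
  dsimp only
  omega

namespace Problem

variable {s₀ ν ν₀ K₁ : ℝ} {P : Problem K s₀ ν ν₀ K₁} {ee e : ℝ}

theorem exists_lowLevel (X : Expo K ee e) (s₀ ν ν₀ : ℝ) :
    ∃ σL : ℕ, s₀ + ν₀ + ν + decayExp X + 1 ≤ (16 * σL : ℕ) := by
  obtain ⟨n, hn⟩ := exists_nat_ge (s₀ + ν₀ + ν + decayExp X + 1)
  exact ⟨n, hn.trans (by exact_mod_cast (by omega : n ≤ 16 * n))⟩

/-- The high levels of regularity. -/
def highLevel (X : Expo K ee e) (ν ν₀ : ℝ) (σL k : ℕ) : ℕ := regExp (baseExp X ν ν₀ σL) σL k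

/-- The exponent of smallness of `ε`. -/
def epsExp (X : Expo K ee e) (ν ν₀ : ℝ) (σL : ℕ) : ℕ :=
  smallExp X + (4 * resExp (baseExp X ν ν₀ σL) 0 + 1) +
    16 * highLevel X ν ν₀ σL 0 + X.p

variable (P) in
theorem exists_schedule (X : Expo K ee e) {B : ℝ} (hB : 1 ≤ B) {σL : ℕ}
    (hlow : s₀ + ν₀ + ν + decayExp X + 1 ≤ (16 * σL : ℕ))
    (hS : (((16 * highLevel X ν ν₀ σL 0 + X.p : ℕ) + ν₀ : ℝ) : EReal) < P.S')  :
    ∃ J : ℕ, ∀ N₀, J ≤ N₀ → ∃ Sc : P.Schedule X σL N₀ B,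
      P.S' = ⊤ → ∀ k, ∃ n₀, ∀ n, n₀ ≤ n → k ≤ Sc.q n := by
  have hs : ∀ k, s₀ < (16 * highLevel X ν ν₀ σL k : ℕ) := fun k => by
    have h2 : 16 * σL ≤ 16 * highLevel X ν ν₀ σL k := by
      unfold highLevel regExp; omega
    have h3 : ((16 * σL : ℕ) : ℝ) ≤ (16 * highLevel X ν ν₀ σL k : ℕ) := by
      exact_mod_cast h2
    linarith [P.ν_nonneg, P.ν₀_pos, Nat.cast_nonneg (α := ℝ) (decayExp X)]
  have hs' : ∀ k, s₀ < (16 * highLevel X ν ν₀ σL k + X.p : ℕ) := fun k =>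
    (hs k).trans_le (by exact_mod_cast Nat.le_add_right _ _)
  by_cases htop : P.S' = ⊤
  · have hlev : ∀ k, ∃ c, P.Level X (highLevel X ν ν₀ σL k) c := fun k =>
      exists_level X (hs k).le (hs' k) (htop ▸ EReal.coe_lt_top _)
    choose c hc using hlev
    obtain ⟨J, hJ⟩ := exists_nat_ge (2 * c 0 *
      B ^ gapExp (baseExp X ν ν₀ σL) σL 0)
    refine ⟨J + c 0 + 2, fun N₀ hN => ?_⟩
    obtain ⟨Sc, hSc⟩ := exists_schedule_tendsto hB hc (by omega : 2 ≤ N₀) (by omega)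
      (hJ.trans (by exact_mod_cast (by omega : J ≤ N₀)))
    exact ⟨Sc, fun _ => hSc⟩
  · obtain ⟨c, hc⟩ := exists_level X (hs 0).le (hs' 0) hS
    obtain ⟨J, hJ⟩ := exists_nat_ge ((2 : ℝ) * c *
      B ^ gapExp (baseExp X ν ν₀ σL) σL 0)
    exact ⟨J + c, fun N₀ hN => ⟨constSchedule hc (by omega)
      (hJ.trans (by exact_mod_cast (by omega : J ≤ N₀))), fun h => absurd h htop⟩⟩

/-- The properties of a solution for a given value of `ε`. -/
structure IsSolution (P : Problem K s₀ ν ν₀ K₁) (X : Expo K ee e) (σL : ℕ) (τ₀ : ℝ) (N₀ : ℕ) (ε : ℝ)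
    (u : ℝ → Hs K s₀) : Prop where
  c1 : IsC1Into (16 * σL : ℕ) P.I u
  norm_lt : ∀ lam ∈ P.I, ‖u lam‖ < 1
  eq_zero : ∀ Itilde : ℕ → Set ℝ, SeparatedChains P.om P.DD e Itilde →
    ∀ lam ∈ cantorSet P.om P.DD P.D P.f P.I Itilde ee τ₀ X.τ N₀ ε u, Fop P.D P.f ε lam (u lam) = 0
  smooth : P.S' = ⊤ → ∀ lam ∈ P.I, ∀ s : ℝ, MemHs s (u lam).val

theorem isSolution_zero (P : Problem K s₀ ν ν₀ K₁) (X : Expo K ee e) (σL : ℕ) (τ₀ : ℝ) (N₀ : ℕ) :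
    P.IsSolution X σL τ₀ N₀ 0 0 where
  c1 := ⟨fun _ => 0, contDiffOn_const, fun _ _ => Hs.val_zero.trans Hs.val_zero.symm⟩
  norm_lt _ _ := by simp
  eq_zero _ _ lam _ := by
    funext k
    change P.D k lam • (0 : EuclideanSpace ℂ (Fin (dim k))) + ((0 : ℝ) : ℂ) • (P.f 0).val k = 0
    rw [smul_zero, Complex.ofReal_zero, zero_smul, add_zero]
  smooth _ _ _ s := memHs_of_suppIn (E := ∅) s fun _ _ => rfl

theorem Run.exists_limit_low {X : Expo K ee e} {σL N₀ : ℕ} {B C ε : ℝ} {Sc : P.Schedule X σL N₀ B}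
    {hN : ∀ n, P.ScaleOK (16 * σL : ℕ) C (diagExp ν) (N₀ ^ 2 ^ n) ε} {F : ℕ → State K s₀}
    (h : Run Sc hN F) (hs : s₀ ≤ (16 * σL : ℕ)) (h4 : 4 ≤ N₀) : ∃ u : ℝ → Hs K s₀,
      IsC1Into (16 * σL : ℕ) P.I u ∧ ∀ lam ∈ P.I,
        Filter.Tendsto (fun n => (F n).u lam) Filter.atTop (nhds (u lam)) ∧
        MemHs (16 * σL : ℕ) (u lam).val ∧ snorm (16 * σL : ℕ) (u lam).val ≤ 1 / 2 ∧
        ∀ n, MemHs (16 * σL : ℕ) (u lam - (F n).u lam).val ∧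
          snorm (16 * σL : ℕ) (u lam - (F n).u lam).val ≤
            (((N₀ ^ 2 ^ n : ℕ) : ℝ) ^ closeExp X)⁻¹ := by
  obtain ⟨v, hv1, hv⟩ := h.exists_limit h4
  obtain ⟨u, huv⟩ : ∃ u : ℝ → Hs K s₀, ∀ lam, (u lam).val = (v lam).val :=
    ⟨fun lam => Hs.mk (v lam).val (memHs_mono hs (v lam).val_mem), fun _ => Hs.val_mk _ _⟩
  have hdiff : ∀ lam ∈ P.I, ∀ n, (u lam - (F n).u lam).val =
      (v lam - lowPath σL N₀ (F n).u n lam).val := fun lam hl n => by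
    rw [Hs.val_sub, Hs.val_sub, lowPath_val ((h.inv n).path.mem lam hl), huv]
  have hmem : ∀ lam ∈ P.I, ∀ n, MemHs (16 * σL : ℕ) (u lam - (F n).u lam).val :=
    fun lam hl n => by rw [hdiff lam hl n]; exact Hs.val_mem _
  have hsn : ∀ lam ∈ P.I, ∀ n, snorm (16 * σL : ℕ) (u lam - (F n).u lam).val =
      ‖v lam - lowPath σL N₀ (F n).u n lam‖ := fun lam hl n => by
    rw [hdiff lam hl n, ← Hs.norm_eq]
  refine ⟨u, ⟨v, hv1, fun lam _ => (huv lam).symm⟩, fun lam hl => ⟨?_, ?_, ?_, fun n =>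
    ⟨hmem lam hl n, ?_⟩⟩⟩
  · have h1 := tendsto_iff_norm_sub_tendsto_zero.1 (hv lam hl).1
    rw [tendsto_iff_norm_sub_tendsto_zero]
    refine squeeze_zero (fun _ => norm_nonneg _) (fun n => ?_) h1
    rw [norm_sub_rev, Hs.norm_eq, norm_sub_rev, ← hsn lam hl n]
    exact snorm_mono hs (hmem lam hl n)
  · rw [huv]; exact Hs.val_mem _
  · rw [huv, ← Hs.norm_eq]; exact (hv lam hl).2.1
  · rw [hsn lam hl n]; exact (hv lam hl).2.2 n

theorem exists_isSolution (P : Problem K s₀ ν ν₀ K₁) (X : Expo K ee e) (hee : 0 ≤ ee)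
    (hX : s₀ < decayExp X) {σL : ℕ} (hlow : s₀ + ν₀ + ν + decayExp X + 1 ≤ (16 * σL : ℕ)) (τ₀ : ℝ)
    (hS : (((16 * highLevel X ν ν₀ σL 0 + X.p : ℕ) + ν₀ : ℝ) : EReal) < P.S') :
    ∃ J : ℕ, ∀ N₀, J ≤ N₀ → ∀ ε : ℝ, 0 ≤ ε → ε * (N₀ : ℝ) ^ epsExp X ν ν₀ σL ≤ 1 →
      ∃ u, P.IsSolution X σL τ₀ N₀ ε u := by
  have hν := P.ν_nonneg
  have hν₀ := P.ν₀_pos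
  have hs₀ := P.s₀_nonneg
  have hde := Nat.cast_nonneg (α := ℝ) (decayExp X)
  have hhigh : ((16 * σL : ℕ) : ℝ) ≤ (16 * highLevel X ν ν₀ σL 0 : ℕ) := by
    have : 16 * σL ≤ 16 * highLevel X ν ν₀ σL 0 := by unfold highLevel regExp; omega
    exact_mod_cast this
  have hslow : s₀ ≤ (16 * σL : ℕ) := by linarith
  have hdl : (decayExp X : ℝ) + ν₀ ≤ (16 * σL : ℕ) := by linarith
  have hSL : (((16 * σL + X.p : ℕ) + ν₀ : ℝ) : EReal) < P.S' := by
    refine lt_of_le_of_lt (EReal.coe_le_coe_iff.2 ?_) hS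
    push_cast at hhigh ⊢
    linarith
  have hSd : ((decayExp X + ν₀ : ℝ) : EReal) < P.S' := by
    refine lt_of_le_of_lt (EReal.coe_le_coe_iff.2 ?_) hSL
    have := Nat.cast_nonneg (α := ℝ) X.p
    rw [Nat.cast_add]
    linarith
  obtain ⟨B, hB⟩ := exists_isBracketConst K
  obtain ⟨c, hL⟩ := exists_level (P := P) X hslow
    (lt_of_lt_of_le (by linarith : s₀ < (16 * σL : ℕ)) (by exact_mod_cast Nat.le_add_right _ _)) hSL
  obtain ⟨Cd, hCd⟩ := P.exists_decayConst hX hSd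
  obtain ⟨J₁, hJ₁⟩ := exists_good_of_cantor X hee hX hCd
  obtain ⟨J₂, hJ₂⟩ := P.exists_scaleOK
  obtain ⟨J₃, hJ₃⟩ := P.exists_schedule X hB.one_le hlow hS
  obtain ⟨C₀, -, hC₀⟩ := exists_deriv_smoothTransition_le
  obtain ⟨J₄, hJ₄⟩ := exists_nat_ge (2 * C₀)
  refine ⟨J₁ + J₂ + J₃ + J₄ + 2 * c + 16, fun N₀ hN₀ ε hε hεN => ?_⟩
  have hN1 : (1 : ℝ) ≤ N₀ := by exact_mod_cast (by omega : 1 ≤ N₀)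
  have hεpow : ∀ j, j ≤ epsExp X ν ν₀ σL → ε * (N₀ : ℝ) ^ j ≤ 1 := fun j hj =>
    (mul_le_mul_of_nonneg_left (pow_le_pow_right₀ hN1 hj) hε).trans hεN
  have hε1 : ε ≤ 1 := by simpa using hεpow 0 (Nat.zero_le _)
  have hOK : ∀ n, P.ScaleOK (16 * σL : ℕ) c (diagExp ν) (N₀ ^ 2 ^ n) ε := fun n =>
    hJ₂ _ _ _ ε hslow hL.tame ((by omega : J₂ ≤ N₀).trans (le_pow_two_pow N₀ n))
      (by exact_mod_cast (by omega : 2 * c ≤ N₀).trans (le_pow_two_pow N₀ n)) hε hε1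
  obtain ⟨Sc, hSc⟩ := hJ₃ N₀ (by omega)
  obtain ⟨F, hF0, hF1, hF2⟩ := exists_iterate
    (invariant_zero Sc hOK (hεpow _ (by unfold epsExp; omega)))
    (exists_step hB hL (by omega) hOK hC₀ (by omega)
      (hJ₄.trans (by exact_mod_cast (by omega : J₄ ≤ N₀))) Sc)
  have hrun : Run Sc hOK F := ⟨hF0, hF1, hF2⟩
  obtain ⟨u, hc1, hu⟩ := hrun.exists_limit_low hslow (by omega)
  have hlt : ∀ lam ∈ P.I, ‖u lam‖ < 1 := fun lam hl => by
    rw [Hs.norm_eq]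
    linarith [snorm_mono hslow (hu lam hl).2.1, (hu lam hl).2.2.1]
  refine ⟨u, hc1, hlt, fun Itilde hIt lam hlam => ?_,
    fun htop lam hl s => hrun.memHs hB (by omega) (hSc htop) hl (hu lam hl).1 s⟩
  obtain ⟨hl, hlit, -, hcan⟩ := hlam
  obtain ⟨hlim, hmem, hnorm, hclose⟩ := hu lam hl
  refine hrun.eq_zero (by omega) (fun n => ?_) (hlt lam hl) hlim
  -- A parameter of the Cantor set is never discarded: the conditions at the limit up to scale `n`
  -- make the approximation at that scale good.
  induction n with
  | zero => rw [hF0]; exact hl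
  | succ n ih =>
    rw [(hF2 n).set_eq]
    refine ⟨ih, ?_⟩
    have hw := (hF1 n).path.mem lam hl
    have hwl := ((hF1 n).low lam hl).1
    have h0 : (0 : ℝ) < (1 / 2) ^ (n + 1) := by positivity
    have hwn : ‖(F n).u lam‖ < 1 := by linarith [norm_le_ns hslow hw]
    rw [ns_eq_snorm hw] at hwl
    refine hJ₁ N₀ (by omega) ε lam hε hε1 (hεpow _ (by unfold epsExp; omega)) hl Itilde hIt hlit n
      (u lam) ((F n).u lam) (hlt lam hl) (memHs_mono hdl hmem) ?_ hwn
      (memHs_of_suppIn _ hw) ?_ ?_ (fun m _ => (hcan m).1) (hcan n).2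
    · linarith [snorm_mono hdl hmem]
    · linarith [snorm_mono hdl (memHs_of_suppIn (16 * σL : ℕ) hw)]
    · exact (snorm_mono hdl (hclose n).1).trans (hclose n).2

end Problem

end SeqScale

end

/-! ### Conclusion -/

theorem theorem2p1 (K : SeqScale.IndexData) (s₀ ν ν₀ τ₀ K₁ ee e : ℝ)
    (hs₀ : ((K.d : ℝ) + K.r) / 2 < s₀) (hν : 0 ≤ ν) (hν₀ : 0 < ν₀) (hτ₀ : 0 < τ₀)
    (hK₁ : 4 * ∑' i : SeqScale.Site K, (max 1 ‖i‖) ^ (-2 * s₀) < K₁)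
    (hee : (K.d : ℝ) + K.r + 1 < ee) :
    ∃ τ₁ s₁ S Smin : ℝ, 1 < τ₁ ∧ s₀ + ν₀ < s₁ ∧ s₁ < S ∧ S + ν₀ < Smin ∧
      ∀ (S' : EReal) (_ : (Smin : EReal) ≤ S')
        (I : Set ℝ) (_ : I.OrdConnected) (_ : (interior I).Nonempty) (_ : I ⊆ Set.Ici (1 / 2))
        (D : SeqScale.Idx K → ℝ → ℂ)
        (_ : ∀ k, ContDiffOn ℝ 1 (D k) I)
        (_ : SeqScale.DiagBound ν I (fun lam k => D k lam))
        (_ : SeqScale.DiagBound ν I (fun lam k => derivWithin (D k) I lam))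
        (f : SeqScale.Hs K s₀ → SeqScale.Hs K s₀)
        (_ : ContDiffOn ℝ 2 f (Metric.ball 0 1))
        (_ : ∀ u : SeqScale.Hs K s₀, ‖u‖ < 1 → ∀ (c : ℂ) (h : SeqScale.Hs K s₀),
          fderiv ℝ f u (c • h) = c • fderiv ℝ f u h)
        (_ : SeqScale.TameUpTo K₁ s₀ ν₀ f S')
        (om : Fin K.d → ℝ) (_ : SeqScale.Diophantine om)
        (DD : K.Lam → K.A → ℝ → ℂ)
        (_ : ∀ lam ∈ I, ∀ k : SeqScale.Idx K, D k lam = SeqScale.Dtheta om DD lam 0 k)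
        (_ : ∀ u : SeqScale.Hs K s₀, ‖u‖ < 1 → SeqScale.ToeplitzInTime (SeqScale.jacobian f u))
        (_ : SeqScale.Initialisation om DD I)
        (Itilde : ℕ → Set ℝ) (_ : SeqScale.SeparatedChains om DD e Itilde),
        ∃ Nbar : ℕ, ∃ c : ℝ, 0 < c ∧ ∀ N₀ : ℕ, Nbar ≤ N₀ →
          ∃ u : ℝ → ℝ → SeqScale.Hs K s₀,
            (∀ lam ∈ I, u 0 lam = 0) ∧
            (∀ ε : ℝ, 0 ≤ ε → ε * (N₀ : ℝ) ^ S < c →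
              SeqScale.IsC1Into (s₁ + ν) I (u ε) ∧
              (∀ lam ∈ I, ‖u ε lam‖ < 1) ∧
              ∀ lam ∈ SeqScale.cantorSet om DD D f I Itilde ee τ₀ τ₁ N₀ ε (u ε),
                SeqScale.Fop D f ε lam (u ε lam) = 0) ∧
            (SeqScale.TameUpTo K₁ s₀ ν₀ f ⊤ →
              ∀ ε : ℝ, 0 ≤ ε → ε * (N₀ : ℝ) ^ S < c →
                ∀ lam ∈ I, ∀ s : ℝ, 0 ≤ s → SeqScale.MemHs s (u ε lam).val) := by 
  have hs₀0 : 0 ≤ s₀ := le_trans (by positivity) hs₀.le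
  have hK₁0 : 0 < K₁ := lt_of_le_of_lt (by positivity) hK₁
  have hee0 : 0 ≤ ee := le_trans (by positivity) hee.le
  obtain ⟨X, hX⟩ := SeqScale.exists_expo_with_decay (K := K) ee e s₀
  obtain ⟨σL, hσL⟩ := SeqScale.Problem.exists_lowLevel X s₀ ν ν₀
  have hdec := Nat.cast_nonneg (α := ℝ) (SeqScale.Problem.decayExp X)
  have hτ : 2 ≤ X.τ := le_trans (by omega) X.hτ
  have hSlow : ((16 * σL : ℕ) : ℝ) ≤ SeqScale.Problem.epsExp X ν ν₀ σL := by
    have : 16 * σL ≤ SeqScale.Problem.epsExp X ν ν₀ σL := by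
      unfold SeqScale.Problem.epsExp SeqScale.Problem.highLevel SeqScale.Problem.regExp
      omega
    exact_mod_cast this
  have hShigh : ((16 * SeqScale.Problem.highLevel X ν ν₀ σL 0 + X.p : ℕ) : ℝ) ≤
      SeqScale.Problem.epsExp X ν ν₀ σL := by
    have : 16 * SeqScale.Problem.highLevel X ν ν₀ σL 0 + X.p ≤
        SeqScale.Problem.epsExp X ν ν₀ σL := by
      unfold SeqScale.Problem.epsExp
      omega
    exact_mod_cast this
  -- With this `s₁`, the regularity `s₁ + ν` is the low regularity of the scheme. `epsExp` dominates
  -- the smallness exponents as well as the low and level-zero regularities, so the threshold leaves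
  -- enough room for the estimates.
  refine ⟨X.τ, (16 * σL : ℕ) - ν, SeqScale.Problem.epsExp X ν ν₀ σL + 1,
    SeqScale.Problem.epsExp X ν ν₀ σL + 1 + ν₀ + 1, by exact_mod_cast hτ, by linarith, by linarith,
    by linarith, ?_⟩
  intro S' hS' I hI hI' hI2 D hD hDb hDb' f hf hfc hT om hom DD hcov htoep _ Itilde hIt
  -- If the tame estimates hold at every regularity, the problem is set up with `S' = ⊤` from the
  -- start, so that the same family `u` serves both conclusions.
  obtain ⟨P, rfl, rfl, rfl, rfl, rfl, hPS, hPtop⟩ : ∃ P : SeqScale.Problem K s₀ ν ν₀ K₁,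
      P.I = I ∧ P.D = D ∧ P.f = f ∧ P.om = om ∧ P.DD = DD ∧ S' ≤ P.S' ∧
        (SeqScale.TameUpTo K₁ s₀ ν₀ f ⊤ → P.S' = ⊤) := by
    by_cases htop : SeqScale.TameUpTo K₁ s₀ ν₀ f ⊤
    · exact ⟨⟨I, D, f, om, DD, ⊤, hs₀0, hν, hν₀, hK₁0, hI, hI', hI2, hD, hDb, hDb', hf, hfc, htop,
        hom, hcov, htoep⟩, rfl, rfl, rfl, rfl, rfl, le_top, fun _ => rfl⟩
    · exact ⟨⟨I, D, f, om, DD, S', hs₀0, hν, hν₀, hK₁0, hI, hI', hI2, hD, hDb, hDb', hf, hfc, hT,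
        hom, hcov, htoep⟩, rfl, rfl, rfl, rfl, rfl, le_rfl, fun h => absurd h htop⟩
  obtain ⟨J, hJ⟩ := P.exists_isSolution X hee0 hX hσL τ₀ (by
    refine lt_of_lt_of_le (EReal.coe_lt_coe_iff.2 ?_) (hS'.trans hPS)
    linarith)
  refine ⟨J + 1, 1, one_pos, fun N₀ hN₀ => ?_⟩
  -- The value `ε = 0` is treated apart to have exactly the zero solution there; outside the
  -- admissible range of `ε` the function is zero by default.
  have hsol : ∀ ε : ℝ, ∃ u, (ε = 0 → u = 0) ∧
      (0 ≤ ε → ε * (N₀ : ℝ) ^ (SeqScale.Problem.epsExp X ν ν₀ σL + 1 : ℝ) < 1 →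
        P.IsSolution X σL τ₀ N₀ ε u) := by
    intro ε
    by_cases h0 : ε = 0
    · subst h0
      exact ⟨0, fun _ => rfl, fun _ _ => P.isSolution_zero X σL τ₀ N₀⟩
    by_cases h : 0 ≤ ε ∧ ε * (N₀ : ℝ) ^ (SeqScale.Problem.epsExp X ν ν₀ σL + 1 : ℝ) < 1
    · have hN1 : (1 : ℝ) ≤ N₀ := by exact_mod_cast (by omega : 1 ≤ N₀)
      obtain ⟨u, hu⟩ := hJ N₀ (by omega) ε h.1 (le_trans (mul_le_mul_of_nonneg_left (by
        rw [← Real.rpow_natCast]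
        exact Real.rpow_le_rpow_of_exponent_le hN1 (by linarith)) h.1) h.2.le)
      exact ⟨u, fun h' => absurd h' h0, fun _ _ => hu⟩
    · exact ⟨0, fun _ => rfl, fun h1 h2 => absurd ⟨h1, h2⟩ h⟩
  choose u hu0 hu using hsol
  refine ⟨u, fun lam _ => by rw [hu0 0 rfl, Pi.zero_apply], fun ε hε hεN => ?_,
    fun htop ε hε hεN lam hl s _ => (hu ε hε hεN).smooth (hPtop htop) lam hl s⟩
  have h := hu ε hε hεN
  refine ⟨?_, h.norm_lt, h.eq_zero Itilde hIt⟩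
  rw [sub_add_cancel]
  exact h.c1
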